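/- Let $n\ge 3$, $l>0$, and consider the $n$-dimensional anti-de Sitter metric in static coordinates $x^\mu=(\tau,r,y^A)$, $A=2,\dots,n-1$, $$\bar g=-\Big(1+\frac{r^2}{l^2}\Big)d\tau^2+\Big(1+\frac{r^2}{l^2}\Big)^{-1}dr^2+r^2\sum_A f_A(dy^A)^2,\qquad f_A=\prod_{2\le B<A}\sin^2y^B .$$ The index $a$ runs over all indices other than $r$. Indices are moved with $\bar g$, $\bar D$ is its Levi-Civita connection, and $h=\bar g^{\mu\nu}h_{\mu\nu}$. Vector fields $\xi^\mu$ and symmetric perturbations $h_{\mu\nu}$ are smooth tensor fields near $r=\infty$ (including the poles of the spherical coordinates). Statements $u\to O(r^m)$, $u\to o(r^m)$ mean: as $r\to\infty$, uniformly for $(\tau,y)$ in compact sets, in every static chart (i.e. for every orientation of the polar axes). "With $k$ regular derivatives" means that the $O$-estimate may be differentiated up to $k$ times, each $\partial_r$ lowering the exponent by one and each $\partial_a$ leaving it unchanged. An asymptotic Killing vector is a vector field with $\xi^r\to O(r)$, $\xi^a\to O(1)$ with one regular derivative, and $$L_\xi\bar g_{rr}\to o(r^{-2}),\quad L_\xi\bar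 g_{ar}\to o(r),\quad L_\xi\bar g_{ab}\to o(r^2).$$ For a real number $\Lambda$ put $$\mathcal H^{\mu\nu}_\Lambda=\frac{\sqrt{-\bar g}}{32\pi}\Big(\frac{2\Lambda}{n-2}(2h^{\mu\nu}-\bar g^{\mu\nu}h)+\bar D^\mu\bar D^\nu h+\bar D^\lambda\bar D_\lambda h^{\mu\nu}-2\bar D_\lambda\bar D^{(\mu}h^{\nu)\lambda}-\bar g^{\mu\nu}(\bar D^\lambda\bar D_\lambda h-\bar D_\lambda\bar D_\rho h^{\rho\lambda})\Big).$$ The perturbation $h_{\mu\nu}$ is called asymptotically conserved (for $\Lambda$) if for every asymptotic Killing vector $\xi$ one has $d^nx\,\mathcal H^{\mu\nu}_\Lambda L_\xi\bar g_{\mu\nu}\to0$, with $dr$ counted as order $r$, i.e. $r\,\mathcal H^{\mu\nu}_\Lambda L_\xi\bar g_{\mu\nu}\to o(1)$. For real $p,q,s$ let $\mathcal F(p,q,s)$ be the class of perturbations with $h_{rr}\to O(r^p)$, $h_{ar}\to O(r^q)$, $h_{ab}\to O(r^s)$ with two regular derivatives. Then: 1. For every $\Lambda$, a perturbation $h_{\mu\nu}$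 is asymptotically conserved if and only if $$\mathcal H^{rr}_\Lambda\to O(r),\quad \mathcal H^{ar}_\Lambda\to O(r^{-2}),\quad \mathcal H^{ab}_\Lambda\to O(r^{-3}).$$ 2. Let $\Lambda=-\frac{(n-1)(n-2)}{l^2}$. All $h\in\mathcal F(p,q,s)$ are asymptotically conserved if and only if $p\le-n-1$, $q\le-n$ and $s\le-n+3$. That is, the fall-off conditions that asymptotic conservation forces on generic perturbations are $$h_{rr}\to O(r^{-n-1}),\quad h_{ar}\to O(r^{-n}),\quad h_{ab}\to O(r^{-n+3}).$$ 3. Let $\Lambda=-\frac{(n-1)(n-2)}{2l^2}$, the value for which $\bar g$ solves the field equations of $\int\sqrt{-g}(R-2\Lambda)$. All $h\in\mathcal F(p,q,s)$ are asymptotically conserved if and only if $p\le-n-1$, $q\le-n+2$ and $s\le-n+3$. In particular the conditions displayed in 2 are again sufficient. 4. Let $h\in\mathcal F(-n-1,-n,-n+3)$, let $\xi$ be an asymptotic Killing vector, and let $$k^{\nu\mu}_\xi=-\frac{\sqrt{-\bar g}}{16\pi}\Big[\bar D^\nu(h\xi^\mu)+\bar D_\sigma(h^{\mu\sigma}\xi^\nu)+\bar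 D^\mu(h^{\nu\sigma}\xi_\sigma)+\tfrac32h\bar D^\mu\xi^\nu+\tfrac32h^{\sigma\mu}\bar D^\nu\xi_\sigma+\tfrac32h^{\nu\sigma}\bar D_\sigma\xi^\mu-(\mu\leftrightarrow\nu)\Big].$$ Then the charge $Q_\xi=-\lim_{r\to\infty}\int\prod_A dy^A\,k^{[\tau r]}_\xi$ is finite: for each $\tau$ the integrand is integrable over the sphere for all large $r$ and the integrals remain bounded as $r\to\infty$. If moreover $r^{n+1}h_{rr}$, $r^nh_{ar}$, $r^{n-3}h_{ab}$, $r^{-1}\xi^r$, $\xi^a$, the expressions obtained from these five by replacing the component by its $\partial_a$-derivatives, and those obtained by replacing it by $r$ times its $\partial_r$-derivative, all converge pointwise as $r\to\infty$, then the limit $Q_\xi$ exists as a real number. -/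

import Mathlib

open Filter Topology MeasureTheory
open scoped ContDiff

noncomputable section

namespace AdS

/-- Coordinate tuples. In static coordinates the entry `0` is `τ`, the entry `1` is `r`, and the
entries `A` with `2 ≤ A` are the angles `y^A`. Cartesian static coordinates use the same index type:
the entry `0` is `τ`, the entries `k ≥ 1` are the embedding coordinates `X^(k+1)`. -/
abbrev Pt (n : ℕ) := Fin n → ℝ

/-- `∂_μ u`. -/
def pd {n : ℕ} (μ : Fin n) (u : Pt n → ℝ) (x : Pt n) : ℝ :=
  fderiv ℝ u x (Pi.single μ 1)

section Background

variable {n : ℕ} [NeZero n]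

/-- `f_A = ∏_{2 ≤ B < A} sin² y^B`. -/
def angFactor (x : Pt n) (A : Fin n) : ℝ :=
  ∏ B ∈ Finset.univ.filter (fun B : Fin n => 2 ≤ B.val ∧ B.val < A.val), Real.sin (x B) ^ 2

/-- The anti-de Sitter metric
`-(1 + r²/l²) dτ² + (1 + r²/l²)⁻¹ dr² + r² ∑_A f_A (dy^A)²`. -/
def gbar (l : ℝ) (x : Pt n) : Matrix (Fin n) (Fin n) ℝ :=
  Matrix.diagonal fun μ =>
    if μ = 0 then -(1 + x 1 ^ 2 / l ^ 2)
    else if μ = 1 then (1 + x 1 ^ 2 / l ^ 2)⁻¹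
    else x 1 ^ 2 * angFactor x μ

/-- `√(-det ḡ)`. -/
def sqrtNegDet (l : ℝ) (x : Pt n) : ℝ := Real.sqrt (-(gbar l x).det)

/-- The Christoffel symbol `Γ^κ_{μν}` of the background. -/
def christoffel (l : ℝ) (x : Pt n) (κ μ ν : Fin n) : ℝ :=
  (1 / 2) * ∑ σ, (gbar l x)⁻¹ κ σ *
    (pd μ (fun z => gbar l z σ ν) x + pd ν (fun z => gbar l z σ μ) x
      - pd σ (fun z => gbar l z μ ν) x)

/-- Components `T^{a_0 … a_{k-1}}` of a contravariant tensor field of rank `k`. -/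
abbrev Tensor (n k : ℕ) := (Fin k → Fin n) → Pt n → ℝ

/-- `D̄_σ T^{a_0 … a_{k-1}}`. -/
def covD (l : ℝ) {k : ℕ} (T : Tensor n k) (σ : Fin n) (a : Fin k → Fin n) (x : Pt n) : ℝ :=
  pd σ (T a) x + ∑ i, ∑ ρ, christoffel l x (a i) σ ρ * T (Function.update a i ρ) x

/-- `D̄^{a_0} T^{a_1 … a_k}`, a contravariant tensor of rank `k + 1`. -/
def gradUp (l : ℝ) {k : ℕ} (T : Tensor n k) : Tensor n (k + 1) :=
  fun a x => ∑ σ, (gbar l x)⁻¹ (a 0) σ * covD l T σ (Fin.tail a) x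

/-- `h^{μν}`, indices raised with the background metric. -/
def raise (l : ℝ) (h : Fin n → Fin n → Pt n → ℝ) : Tensor n 2 :=
  fun a x => ∑ α, ∑ β, (gbar l x)⁻¹ (a 0) α * (gbar l x)⁻¹ (a 1) β * h α β x

/-- The scalar `h = ḡ^{μν} h_{μν}`. -/
def trace (l : ℝ) (h : Fin n → Fin n → Pt n → ℝ) : Tensor n 0 :=
  fun _ x => ∑ α, ∑ β, (gbar l x)⁻¹ α β * h α β x

/-- The density `𝓗^{μν}[h; ḡ]`:
`√(-ḡ)/(32π) ( 2Λ/(n-2) (2 h^{μν} - ḡ^{μν} h) + D^μ D^ν h + D^λ D_λ h^{μν} - 2 D_λ D^{(μ} h^{ν)λ}`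
`- ḡ^{μν} (D^λ D_λ h - D_λ D_ρ h^{ρλ}) )`. -/
def linOp (l Λ : ℝ) (h : Fin n → Fin n → Pt n → ℝ) (μ ν : Fin n) (x : Pt n) : ℝ :=
  let g := gbar l x
  let DDh := gradUp l (gradUp l (raise l h))
  let DDt := gradUp l (gradUp l (trace l h))
  sqrtNegDet l x / (32 * Real.pi) *
    (2 * Λ / ((n : ℝ) - 2) * (2 * raise l h ![μ, ν] x - g⁻¹ μ ν * trace l h ![] x)
      + DDt ![μ, ν] x
      + (∑ κ, ∑ ρ, g κ ρ * DDh ![κ, ρ, μ, ν] x)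
      - (∑ κ, ∑ ρ, g κ ρ * (DDh ![κ, μ, ν, ρ] x + DDh ![κ, ν, μ, ρ] x))
      - g⁻¹ μ ν *
        ((∑ κ, ∑ ρ, g κ ρ * DDt ![κ, ρ] x)
          - ∑ κ, ∑ ρ, ∑ σ, ∑ θ, g κ ρ * g σ θ * DDh ![κ, σ, θ, ρ] x))

/-- `(L_ξ ḡ)_{μν}`. -/
def lieMetric (l : ℝ) (ξ : Fin n → Pt n → ℝ) (μ ν : Fin n) (x : Pt n) : ℝ :=
  ∑ σ, (ξ σ x * pd σ (fun z => gbar l z μ ν) x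
    + gbar l x σ ν * pd μ (ξ σ) x + gbar l x μ σ * pd ν (ξ σ) x)

/-- The terms of the superpotential before antisymmetrization:
`D^ν(h ξ^μ) + D_σ(h^{μσ} ξ^ν) + D^μ(h^{νσ} ξ_σ) + 3/2 h D^μ ξ^ν + 3/2 h^{σμ} D^ν ξ_σ`
`+ 3/2 h^{νσ} D_σ ξ^μ`. -/
def superpotTerms (l : ℝ) (h : Fin n → Fin n → Pt n → ℝ) (ξ : Fin n → Pt n → ℝ)
    (ν μ : Fin n) (x : Pt n) : ℝ :=
  let hu := raise l h
  let X : Tensor n 1 := fun a => ξ (a 0)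
  let hX : Tensor n 1 := fun a z => trace l h ![] z * ξ (a 0) z
  let hhX : Tensor n 3 := fun a z => hu ![a 0, a 1] z * ξ (a 2) z
  let W : Tensor n 1 := fun a z => ∑ σ, ∑ ρ, hu ![a 0, σ] z * gbar l z σ ρ * ξ ρ z
  gradUp l hX ![ν, μ] x
    + (∑ σ, covD l hhX σ ![μ, σ, ν] x)
    + gradUp l W ![μ, ν] x
    + 3 / 2 * (trace l h ![] x * gradUp l X ![μ, ν] x)
    + 3 / 2 * (∑ σ, ∑ ρ, hu ![σ, μ] x * gbar l x σ ρ * gradUp l X ![ν, ρ] x)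
    + 3 / 2 * (∑ σ, hu ![ν, σ] x * covD l X σ ![μ] x)

/-- The superpotential `k^{νμ}_ξ[h; ḡ]`. -/
def superpot (l : ℝ) (h : Fin n → Fin n → Pt n → ℝ) (ξ : Fin n → Pt n → ℝ)
    (ν μ : Fin n) (x : Pt n) : ℝ :=
  -(sqrtNegDet l x / (16 * Real.pi)) * (superpotTerms l h ξ ν μ x - superpotTerms l h ξ μ ν x)

end Background

section Charts

variable {n : ℕ} [NeZero n]

/-- From static to Cartesian static coordinates: `τ` is kept, and
`X^(k+1) = r sin y² ⋯ sin y^k cos y^(k+1)` for `1 ≤ k < n - 1`, `X^n = r sin y² ⋯ sin y^(n-1)`. -/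
def toCartesian (x : Pt n) : Pt n := fun k =>
  if k = 0 then x 0
  else x 1 * (∏ B ∈ Finset.univ.filter (fun B : Fin n => 2 ≤ B.val ∧ B.val ≤ k.val),
      Real.sin (x B)) *
    (if hk : k.val + 1 < n then Real.cos (x ⟨k.val + 1, hk⟩) else 1)

/-- The range of the angles: `0 < y^A < π` for `A < n - 1` and `0 < y^(n-1) < 2π`. -/
def InAngleRange (A : Fin n) (t : ℝ) : Prop :=
  0 < t ∧ t < if A.val + 1 = n then 2 * Real.pi else Real.pi

/-- The coordinate domain of a static chart (no condition on `τ`, `r`). -/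
def chartBox (n : ℕ) : Set (Pt n) := {x | ∀ A : Fin n, 2 ≤ A.val → InAngleRange A (x A)}

/-- Orthogonal transformations of the spatial Cartesian coordinates, leaving `τ` fixed. -/
def IsSpatialRotation (R : Matrix (Fin n) (Fin n) ℝ) : Prop :=
  R ∈ Matrix.orthogonalGroup (Fin n) ℝ ∧ R 0 0 = 1

/-- The static chart whose polar axes are rotated by `R`. These charts cover the sphere; in each of
them the background metric is `gbar`. -/
def chart (R : Matrix (Fin n) (Fin n) ℝ) (x : Pt n) : Pt n := R.mulVec (toCartesian x)

/-- The Jacobian `∂X^α/∂x^μ` of the static chart rotated by `R`. -/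
def jac (R : Matrix (Fin n) (Fin n) ℝ) (x : Pt n) : Matrix (Fin n) (Fin n) ℝ :=
  Matrix.of fun α μ => pd μ (fun z => chart R z α) x

/-- The region near spatial infinity `r > ρ`, in Cartesian static coordinates. -/
def exterior (n : ℕ) [NeZero n] (ρ : ℝ) : Set (Pt n) :=
  {z | ρ ^ 2 < ∑ k ∈ Finset.univ.filter (fun k : Fin n => k ≠ 0), z k ^ 2}

/-- A smooth symmetric covariant two-tensor field near spatial infinity, given by its Cartesian
static components. -/
def IsSmoothPerturbation (h : Fin n → Fin n → Pt n → ℝ) : Prop :=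
  ∃ ρ : ℝ, 0 < ρ ∧ (∀ α β, ContDiffOn ℝ ∞ (h α β) (exterior n ρ)) ∧
    ∀ α β, ∀ z ∈ exterior n ρ, h α β z = h β α z

/-- A smooth vector field near spatial infinity, given by its Cartesian static components. -/
def IsSmoothVectorField (ξ : Fin n → Pt n → ℝ) : Prop :=
  ∃ ρ : ℝ, 0 < ρ ∧ ∀ α, ContDiffOn ℝ ∞ (ξ α) (exterior n ρ)

/-- The static components `h_{μν}(τ, r, y)` in the chart rotated by `R`. -/
def comp2 (h : Fin n → Fin n → Pt n → ℝ) (R : Matrix (Fin n) (Fin n) ℝ) (μ ν : Fin n) (x : Pt n) :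
    ℝ :=
  ∑ α, ∑ β, jac R x α μ * jac R x β ν * h α β (chart R x)

/-- The static components `ξ^μ(τ, r, y)` in the chart rotated by `R`. -/
def compV (ξ : Fin n → Pt n → ℝ) (R : Matrix (Fin n) (Fin n) ℝ) (μ : Fin n) (x : Pt n) : ℝ :=
  ((jac R x)⁻¹.mulVec fun α => ξ α (chart R x)) μ

end Charts

section FallOffs

variable {n : ℕ} [NeZero n]

/-- A function of the static coordinates, one for each static chart. -/
abbrev ChartFun (n : ℕ) := Matrix (Fin n) (Fin n) ℝ → Pt n → ℝ

/-- `u → O(r^m)` as `r → ∞`, uniformly for `(τ, y)` in compact sets, in every static chart.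
(The `r`-entry of the points of `K` is overwritten.) -/
def BigO (m : ℝ) (u : ChartFun n) : Prop :=
  ∀ R, IsSpatialRotation R → ∀ K : Set (Pt n), IsCompact K → K ⊆ chartBox n →
    ∃ C : ℝ, ∀ᶠ r : ℝ in atTop, ∀ x ∈ K, |u R (Function.update x 1 r)| ≤ C * r ^ m

/-- `u → o(r^m)` as `r → ∞`, in the same sense. -/
def LittleO (m : ℝ) (u : ChartFun n) : Prop :=
  ∀ R, IsSpatialRotation R → ∀ K : Set (Pt n), IsCompact K → K ⊆ chartBox n →
    ∀ ε : ℝ, 0 < ε → ∀ᶠ r : ℝ in atTop, ∀ x ∈ K, |u R (Function.update x 1 r)| ≤ ε * r ^ m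

/-- `u → O(r^m)`, where the estimate may be differentiated up to `k` times: each `∂_r` lowers the
exponent by one, and the derivatives `∂_a` (`a ≠ r`) do not change it. -/
def FallOff : ℕ → ℝ → ChartFun n → Prop
  | 0, m, u => BigO m u
  | k + 1, m, u => BigO m u ∧
      ∀ μ : Fin n, FallOff k (if μ = 1 then m - 1 else m) fun R => pd μ (u R)

/-- Perturbations with `h_rr → O(r^p)`, `h_ar → O(r^q)`, `h_ab → O(r^s)`, with regular
derivatives up to second order. -/
def FallOffClass (p q s : ℝ) (h : Fin n → Fin n → Pt n → ℝ) : Prop :=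
  IsSmoothPerturbation h ∧
  FallOff 2 p (fun R => comp2 h R 1 1) ∧
  (∀ a : Fin n, a ≠ 1 → FallOff 2 q (fun R => comp2 h R a 1)) ∧
  ∀ a b : Fin n, a ≠ 1 → b ≠ 1 → FallOff 2 s (fun R => comp2 h R a b)

/-- Asymptotic Killing vectors: `ξ^r → O(r)`, `ξ^a → O(r^0)` with regular first derivatives, and
`L_ξ ḡ_rr → o(r^-2)`, `L_ξ ḡ_ar → o(r)`, `L_ξ ḡ_ab → o(r^2)`. -/
def IsAsymptoticKilling (l : ℝ) (ξ : Fin n → Pt n → ℝ) : Prop :=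
  IsSmoothVectorField ξ ∧
  FallOff 1 1 (fun R => compV ξ R 1) ∧
  (∀ a : Fin n, a ≠ 1 → FallOff 1 0 (fun R => compV ξ R a)) ∧
  LittleO (-2) (fun R => lieMetric l (compV ξ R) 1 1) ∧
  (∀ a : Fin n, a ≠ 1 → LittleO 1 (fun R => lieMetric l (compV ξ R) a 1)) ∧
  ∀ a b : Fin n, a ≠ 1 → b ≠ 1 → LittleO 2 (fun R => lieMetric l (compV ξ R) a b)

/-- Asymptotic conservation, for all asymptotic Killing vectors:
`d^n x 𝓗^{μν} L_ξ ḡ_{μν} → 0`, where `dr` counts as order `r`. -/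
def AsymptoticallyConserved (l Λ : ℝ) (h : Fin n → Fin n → Pt n → ℝ) : Prop :=
  ∀ ξ : Fin n → Pt n → ℝ, IsAsymptoticKilling l ξ →
    LittleO 0 (fun R x => x 1 *
      ∑ μ, ∑ ν, linOp l Λ (comp2 h R) μ ν x * lieMetric l (compV ξ R) μ ν x)

/-- `𝓗^{rr} → O(r)`, `𝓗^{ar} → O(r^-2)`, `𝓗^{ab} → O(r^-3)`. -/
def LinOpBounds (l Λ : ℝ) (h : Fin n → Fin n → Pt n → ℝ) : Prop :=
  BigO 1 (fun R => linOp l Λ (comp2 h R) 1 1) ∧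
  (∀ a : Fin n, a ≠ 1 → BigO (-2) (fun R => linOp l Λ (comp2 h R) a 1)) ∧
  ∀ a b : Fin n, a ≠ 1 → b ≠ 1 → BigO (-3) (fun R => linOp l Λ (comp2 h R) a b)

/-- In the unrotated static chart, `r^-m u`, `r^(1-m) ∂_r u` and `r^-m ∂_a u` converge pointwise
as `r → ∞`. -/
def HasLeadingCoefficient (m : ℝ) (u : Pt n → ℝ) : Prop :=
  ∀ x ∈ chartBox n,
    (∃ c : ℝ, Tendsto (fun r : ℝ => r ^ (-m) * u (Function.update x 1 r)) atTop (𝓝 c)) ∧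
    (∃ c : ℝ, Tendsto (fun r : ℝ => r ^ (1 - m) * pd 1 u (Function.update x 1 r))
      atTop (𝓝 c)) ∧
    ∀ a : Fin n, a ≠ 1 →
      ∃ c : ℝ, Tendsto (fun r : ℝ => r ^ (-m) * pd a u (Function.update x 1 r)) atTop (𝓝 c)

end FallOffs

section Charges

variable {n : ℕ} [NeZero n]

/-- The point with static coordinates `(τ, r, y)`. -/
def staticPt (τ r : ℝ) (y : {A : Fin n // 2 ≤ A.val} → ℝ) : Pt n := fun μ =>
  if hμ : 2 ≤ μ.val then y ⟨μ, hμ⟩ else if μ = 0 then τ else r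

/-- The domain of the angles `y^2, …, y^(n-1)`. -/
def angleBox (n : ℕ) : Set ({A : Fin n // 2 ≤ A.val} → ℝ) := {y | ∀ A, InAngleRange A.1 (y A)}

/-- The integrand `k^{[τr]}_ξ` at `(τ, r, y)`. -/
def chargeIntegrand (l : ℝ) (h : Fin n → Fin n → Pt n → ℝ) (ξ : Fin n → Pt n → ℝ) (τ r : ℝ)
    (y : {A : Fin n // 2 ≤ A.val} → ℝ) : ℝ :=
  (superpot l (comp2 h 1) (compV ξ 1) 0 1 (staticPt τ r y)
    - superpot l (comp2 h 1) (compV ξ 1) 1 0 (staticPt τ r y)) / 2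

/-- `-∫ ∏ dy^A k^{[τr]}_ξ` over the sphere of radius `r` at time `τ`; the charge `Q_ξ` is its limit
as `r → ∞`. -/
def chargeAt (l : ℝ) (h : Fin n → Fin n → Pt n → ℝ) (ξ : Fin n → Pt n → ℝ) (τ r : ℝ) : ℝ :=
  -∫ y in angleBox n, chargeIntegrand l h ξ τ r y

end Charges

end AdS

end

set_option linter.unusedSectionVars false

/-! Everything rests on power counting in `r`. In the frame `r ∂_r`, `r⁻¹ ∂_a` the background has
bounded coefficients, and a derivative along a non-radial frame vector costs a factor `r⁻¹`. Hence,
once a weight `om` has been stripped from every index, the order of a tensor component depends only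
on the parity `par` of the number of its non-radial indices. A pair of orders (even, odd) whose
entries differ by at most one is preserved by covariant differentiation (`TQ.covD`, `TQ.gradUp`), so
that `HQ.linOp` and `HQ.superpotTerms` bound complete tensor expressions without computing
components. The calculus is set up for an abstract `Gauge`, with two instances: `O`-estimates
(`bigO`) and convergence of leading coefficients (`leading`).

Conservation against bounds on `𝓗` (`asymptoticallyConserved_iff`). The bounds give conservation by
multiplying orders. Conversely, any vector field of order strictly below the admissible growth is
asymptotically Killing, so there are many test fields. For a slowly decaying radial function `e`, a
bounded scalar `u` and a vector field `W`, the combination `L_{euW} ḡ - u L_{eW} ḡ` equals `e` times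
the symmetrized product of `du` with the covector of `W`. Thus `e r 𝓗(du, W) → 0`. As `e` may decay
along any prescribed sequence slower than a would-be divergence of `r 𝓗(du, W)`, that quantity is
bounded. Enough pairs `u`, `W` then isolate every component of `𝓗`.

Fall-off conditions. The weights with orders `(-n+1, -n)` give exactly the required bounds for every
`Λ` (`FallOffClass.linOpBounds`). For the vacuum value of `Λ` two more powers are allowed in `h_ar`:
in `𝓗^{ar}` all radial derivatives of `h^{ar}` cancel, and the `1/l²` part of its remaining
coefficient cancels against the `Λ` term (`linCore_mixed`, `FallOffClass.linOpBounds_vacuum`).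
Necessity is tested on perturbations in the `(τ, r)` plane, evaluated at `τ = 0` on the equator
along radii `exp(2πk)`. Oscillating profiles and a factor `τ` make most lower jets vanish there, so
one explicit term remains (`exponents_of_forall_conserved`). For the other value of `Λ`, the
difference of the two operators is a multiple of `√(-ḡ) h^{ar}`, which sharpens the condition on `q`
(`forall_conserved_iff`).

Charges. Power counting bounds the integrand on compact parts of every static chart. To reach the
poles, the `τr` components of the superpotential terms are shown to be scalars: they are components
of a tensor, and `τ`, `r` are common to all charts (`isBitensor_superpotTerms`,
`IsBitensor.isScalar_apply`). Finitely many charts with permuted polar axes cover each sphere by one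
fixed compact set of angles (`exists_chart_eq`), so the bound is uniform (`IsScalar.uniform_bound`).
This gives boundedness, and with pointwise convergence from `leading` also the limit by dominated
convergence. -/

namespace AdS

/-! ### Partial derivatives near infinity and the abstract calculus of orders. -/

section Calculus

variable {n : ℕ} [NeZero n]

/-- The part `r > ρ` of the domain of a static chart. -/
def reg (n : ℕ) [NeZero n] (ρ : ℝ) : Set (Pt n) := {x | x ∈ chartBox n ∧ ρ < x 1}

/-- The filter of neighbourhoods of `r = ∞` in the domain of a static chart. -/
def atInf (n : ℕ) [NeZero n] : Filter (Pt n) := ⨅ ρ : ℝ, 𝓟 (reg n ρ)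

theorem reg_anti {ρ σ : ℝ} (h : ρ ≤ σ) : reg n σ ⊆ reg n ρ :=
  fun _ hx => ⟨hx.1, h.trans_lt hx.2⟩

theorem eventually_atInf {p : Pt n → Prop} :
    (∀ᶠ x in atInf n, p x) ↔ ∃ ρ, ∀ x ∈ reg n ρ, p x := by
  have hd : Directed (· ≥ ·) fun ρ : ℝ => 𝓟 (reg n ρ) := fun a b =>
    ⟨max a b, principal_mono.2 (reg_anti (le_max_left a b)),
      principal_mono.2 (reg_anti (le_max_right a b))⟩
  simp only [atInf, Filter.Eventually, mem_iInf_of_directed hd, mem_principal]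
  rfl

theorem eventually_reg (ρ : ℝ) : ∀ᶠ x in atInf n, x ∈ reg n ρ :=
  eventually_atInf.2 ⟨ρ, fun _ h => h⟩

theorem isOpen_setOf_inAngleRange (A : Fin n) : IsOpen {t : ℝ | InAngleRange A t} := isOpen_Ioo

theorem isOpen_chartBox : IsOpen (chartBox n) := by
  have : chartBox n = ⋂ A : Fin n, {x | 2 ≤ A.val → InAngleRange A (x A)} := by
    ext x; simp [chartBox]
  rw [this]
  refine isOpen_iInter_of_finite fun A => ?_
  by_cases hA : 2 ≤ A.val
  · simpa [hA] using (isOpen_setOf_inAngleRange A).preimage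
      (continuous_apply (A := fun _ : Fin n => ℝ) A)
  · simp [hA]

theorem isOpen_reg (ρ : ℝ) : IsOpen (reg n ρ) :=
  isOpen_chartBox.inter (isOpen_lt continuous_const (continuous_apply _))

/-- The regions `reg` are open, so a property near infinity holds on neighbourhoods of points near
infinity. This is what permits differentiating identities that hold only eventually. -/
theorem eventually_nhds_of_atInf {p : Pt n → Prop} (h : ∀ᶠ x in atInf n, p x) :
    ∀ᶠ x in atInf n, ∀ᶠ z in 𝓝 x, p z := by
  obtain ⟨ρ, hρ⟩ := eventually_atInf.1 h
  exact eventually_atInf.2 ⟨ρ, fun x hx => ((isOpen_reg ρ).eventually_mem hx).mono hρ⟩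

theorem pd_congr {μ : Fin n} {u v : Pt n → ℝ} {x : Pt n} (h : u =ᶠ[𝓝 x] v) :
    pd μ u x = pd μ v x := by
  simp only [pd, h.fderiv_eq]

theorem pd_congr_atInf {u v : Pt n → ℝ} (h : u =ᶠ[atInf n] v) (μ : Fin n) :
    pd μ u =ᶠ[atInf n] pd μ v :=
  (eventually_nhds_of_atInf h).mono fun _ hx => pd_congr hx

theorem pd_add {μ : Fin n} {u v : Pt n → ℝ} {x : Pt n} (hu : DifferentiableAt ℝ u x)
    (hv : DifferentiableAt ℝ v x) : pd μ (fun z => u z + v z) x = pd μ u x + pd μ v x := by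
  simp only [pd, fderiv_fun_add hu hv, _root_.add_apply]

theorem pd_sub {μ : Fin n} {u v : Pt n → ℝ} {x : Pt n} (hu : DifferentiableAt ℝ u x)
    (hv : DifferentiableAt ℝ v x) : pd μ (fun z => u z - v z) x = pd μ u x - pd μ v x := by
  simp only [pd, fderiv_fun_sub hu hv, _root_.sub_apply]

theorem pd_mul {μ : Fin n} {u v : Pt n → ℝ} {x : Pt n} (hu : DifferentiableAt ℝ u x)
    (hv : DifferentiableAt ℝ v x) :
    pd μ (fun z => u z * v z) x = pd μ u x * v x + u x * pd μ v x := by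
  simp only [pd, fderiv_fun_mul hu hv, _root_.add_apply,
    _root_.smul_apply, smul_eq_mul]
  ring

theorem pd_sum {ι : Type*} (s : Finset ι) {μ : Fin n} {u : ι → Pt n → ℝ} {x : Pt n}
    (hu : ∀ i ∈ s, DifferentiableAt ℝ (u i) x) :
    pd μ (fun z => ∑ i ∈ s, u i z) x = ∑ i ∈ s, pd μ (u i) x := by
  simp only [pd, fderiv_fun_sum hu, _root_.sum_apply]

@[simp] theorem pd_const (μ : Fin n) (c : ℝ) (x : Pt n) : pd μ (fun _ => c) x = 0 := by
  simp [pd]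

theorem pd_const_mul {μ : Fin n} (c : ℝ) {u : Pt n → ℝ} {x : Pt n}
    (hu : DifferentiableAt ℝ u x) : pd μ (fun z => c * u z) x = c * pd μ u x := by
  rw [pd_mul (differentiableAt_const c) hu, pd_const]; ring

theorem pd_comp_coord {μ ν : Fin n} {φ : ℝ → ℝ} {x : Pt n} (hφ : DifferentiableAt ℝ φ (x ν)) :
    pd μ (fun z => φ (z ν)) x = if μ = ν then deriv φ (x ν) else 0 := by
  have h1 : HasFDerivAt (fun z : Pt n => z ν) (ContinuousLinearMap.proj (R := ℝ) ν) x :=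
    (ContinuousLinearMap.proj (R := ℝ) (φ := fun _ : Fin n => ℝ) ν).hasFDerivAt
  have h2 := hφ.hasDerivAt.comp_hasFDerivAt x h1
  have h3 : fderiv ℝ (fun z : Pt n => φ (z ν)) x = _ := h2.fderiv
  rw [pd, h3]
  by_cases h : μ = ν
  · subst h; simp
  · simp [h, Ne.symm h]

theorem pd_coord (μ ν : Fin n) (x : Pt n) :
    pd μ (fun z => z ν) x = if μ = ν then 1 else 0 := by
  simpa using pd_comp_coord (φ := fun t => t) (μ := μ) (ν := ν) (x := x) differentiableAt_fun_id

theorem pd_eventually_zero {μ : Fin n} {u : Pt n → ℝ} {x : Pt n} (h : u =ᶠ[𝓝 x] fun _ => 0) :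
    pd μ u x = 0 := by
  rw [pd_congr h, pd_const]

theorem contDiffAt_pd {μ : Fin n} {u : Pt n → ℝ} {x : Pt n} (h : ContDiffAt ℝ ∞ u x) :
    ContDiffAt ℝ ∞ (pd μ u) x :=
  (h.fderiv_right (m := ∞) (by simp)).clm_apply contDiffAt_const

theorem pd_comm {μ ν : Fin n} {u : Pt n → ℝ} {x : Pt n} (h : ContDiffAt ℝ ∞ u x) :
    pd μ (pd ν u) x = pd ν (pd μ u) x := by
  have hs := h.isSymmSndFDerivAt (by
    simpa using (WithTop.coe_le_coe.2 (le_top : (2 : ℕ∞) ≤ ⊤)))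
  have hd : DifferentiableAt ℝ (fderiv ℝ u) x :=
    (h.fderiv_right (m := ∞) (by simp)).differentiableAt (by simp)
  have key : ∀ α β : Fin n, pd α (pd β u) x
      = fderiv ℝ (fderiv ℝ u) x (Pi.single α 1) (Pi.single β 1) := by
    intro α β
    have := (hd.hasFDerivAt.clm_apply (hasFDerivAt_const (Pi.single β (1 : ℝ)) x)).fderiv
    rw [pd, show pd β u = fun y => fderiv ℝ u y (Pi.single β 1) from rfl, this]
    simp
  rw [key, key, hs.eq]

/-- Smoothness near `r = ∞`. -/
def Sm (u : Pt n → ℝ) : Prop := ∀ᶠ x in atInf n, ContDiffAt ℝ ∞ u x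

theorem Sm.diff {u : Pt n → ℝ} (h : Sm u) : ∀ᶠ x in atInf n, DifferentiableAt ℝ u x :=
  h.mono fun _ hx => hx.differentiableAt (by simp)

theorem Sm.congr {u v : Pt n → ℝ} (h : Sm u) (huv : u =ᶠ[atInf n] v) : Sm v := by
  filter_upwards [h, eventually_nhds_of_atInf huv] with x hx hxv
  exact hx.congr_of_eventuallyEq (hxv.mono fun _ h => h.symm)

theorem Sm.pd {u : Pt n → ℝ} (h : Sm u) (μ : Fin n) : Sm (pd μ u) :=
  h.mono fun _ hx => contDiffAt_pd hx

theorem Sm.add {u v : Pt n → ℝ} (h : Sm u) (h' : Sm v) : Sm fun x => u x + v x := by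
  filter_upwards [h, h'] with x hx hx' using hx.add hx'

theorem Sm.mul {u v : Pt n → ℝ} (h : Sm u) (h' : Sm v) : Sm fun x => u x * v x := by
  filter_upwards [h, h'] with x hx hx' using hx.mul hx'

theorem Sm.const (c : ℝ) : Sm fun _ : Pt n => c := .of_forall fun _ => contDiffAt_const

theorem Sm.sum {ι : Type*} (s : Finset ι) {u : ι → Pt n → ℝ} (h : ∀ i ∈ s, Sm (u i)) :
    Sm fun x => ∑ i ∈ s, u i x := by
  classical
  induction s using Finset.induction_on with
  | empty => simpa using Sm.const 0
  | insert a s ha ih =>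
    simp only [Finset.sum_insert ha]
    exact (h a (by simp)).add (ih fun i hi => h i (by simp [hi]))

/-- A notion of "order `r^m`" for functions of the static coordinates: it is compatible with sums
and products, and the building blocks of the background have their natural orders. -/
structure Gauge (n : ℕ) [NeZero n] where
  /-- `u` is of order `r^m`. -/
  P : ℝ → (Pt n → ℝ) → Prop
  congr : ∀ {m u v}, u =ᶠ[atInf n] v → P m u → P m v
  add : ∀ {m u v}, P m u → P m v → P m fun x => u x + v x
  mul : ∀ {m k u v}, P m u → P k v → P (m + k) fun x => u x * v x
  mono : ∀ {m k u}, m ≤ k → P m u → P k u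
  const : ∀ c, P 0 fun _ => c
  rpow : ∀ m, P m fun x => x 1 ^ m
  lapse : ∀ l : ℝ, 0 < l → P (-2) fun x => (1 + x 1 ^ 2 / l ^ 2)⁻¹
  angle : ∀ (A : Fin n) (φ : ℝ → ℝ), 2 ≤ A.val → ContinuousOn φ {t | InAngleRange A t} →
    P 0 fun x => φ (x A)
  time : P 0 fun x => x 0

namespace Gauge

variable (G : Gauge n)

theorem zero (m : ℝ) : G.P m fun _ => 0 := by
  have := G.mul (G.rpow m) (G.const 0)
  simpa using this

/-- `u` is of order `r^m`, with `k` regular derivatives. -/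
def Pk : ℕ → ℝ → (Pt n → ℝ) → Prop
  | 0, m, u => G.P m u
  | k + 1, m, u => G.P m u ∧ ∀ μ : Fin n, Pk k (if μ = 1 then m - 1 else m) (AdS.pd μ u)

variable {G}

theorem Pk.base {k : ℕ} {m : ℝ} {u : Pt n → ℝ} (h : G.Pk k m u) : G.P m u := by
  cases k with
  | zero => exact h
  | succ k => exact h.1

theorem Pk.congr {k : ℕ} {m : ℝ} {u v : Pt n → ℝ} (huv : u =ᶠ[atInf n] v) (h : G.Pk k m u) :
    G.Pk k m v := by
  induction k generalizing m u v with
  | zero => exact G.congr huv h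
  | succ k ih => exact ⟨G.congr huv h.1, fun μ => ih (pd_congr_atInf huv μ) (h.2 μ)⟩

theorem Pk.mono {k : ℕ} {m m' : ℝ} {u : Pt n → ℝ} (hm : m ≤ m') (h : G.Pk k m u) :
    G.Pk k m' u := by
  induction k generalizing m m' u with
  | zero => exact G.mono hm h
  | succ k ih =>
    refine ⟨G.mono hm h.1, fun μ => ih ?_ (h.2 μ)⟩
    split_ifs <;> linarith

theorem Pk.pred {k : ℕ} {m : ℝ} {u : Pt n → ℝ} (h : G.Pk (k + 1) m u) : G.Pk k m u := by
  induction k generalizing m u with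
  | zero => exact h.1
  | succ k ih => exact ⟨h.1, fun μ => ih (h.2 μ)⟩

theorem Pk.add {k : ℕ} {m : ℝ} {u v : Pt n → ℝ} (hu : Sm u) (hv : Sm v) (h : G.Pk k m u)
    (h' : G.Pk k m v) : G.Pk k m fun x => u x + v x := by
  induction k generalizing m u v with
  | zero => exact G.add h h'
  | succ k ih =>
    refine ⟨G.add h.1 h'.1, fun μ => Pk.congr ?_ (ih (hu.pd μ) (hv.pd μ) (h.2 μ) (h'.2 μ))⟩
    filter_upwards [hu.diff, hv.diff] with x hx hx' using (pd_add hx hx').symm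

/-- Induction through the Leibniz rule: both terms of the derivative of a product carry the same
shifted exponent. Smoothness serves to compute the actual derivative, which the order conditions
alone do not control. -/
theorem Pk.mul {k : ℕ} {m m' : ℝ} {u v : Pt n → ℝ} (hu : Sm u) (hv : Sm v) (h : G.Pk k m u)
    (h' : G.Pk k m' v) : G.Pk k (m + m') fun x => u x * v x := by
  induction k generalizing m m' u v with
  | zero => exact G.mul h h'
  | succ k ih =>
    refine ⟨G.mul h.1 h'.1, fun μ => ?_⟩
    have h1 := ih (hu.pd μ) hv (h.2 μ) h'.pred
    have h2 := ih hu (hv.pd μ) h.pred (h'.2 μ)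
    have h3 : (if μ = 1 then m - 1 else m) + m' = if μ = 1 then m + m' - 1 else m + m' := by
      split_ifs <;> ring
    have h4 : m + (if μ = 1 then m' - 1 else m') = if μ = 1 then m + m' - 1 else m + m' := by
      split_ifs <;> ring
    rw [h3] at h1
    rw [h4] at h2
    refine Pk.congr ?_ (Pk.add ((hu.pd μ).mul hv) (hu.mul (hv.pd μ)) h1 h2)
    filter_upwards [hu.diff, hv.diff] with x hx hx' using (pd_mul hx hx').symm

variable (G) in
theorem Pk.zero (k : ℕ) (m : ℝ) : G.Pk k m fun _ => 0 := by
  induction k generalizing m with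
  | zero => exact G.zero m
  | succ k ih =>
    refine ⟨G.zero m, fun μ => ?_⟩
    have : AdS.pd μ (fun _ : Pt n => (0 : ℝ)) = fun _ => 0 := by ext x; simp
    rw [this]; exact ih _

variable (G)

/-- Smooth functions of order `r^m`, with `k` regular derivatives. -/
structure Q (k : ℕ) (m : ℝ) (u : Pt n → ℝ) : Prop where
  sm : Sm u
  pk : G.Pk k m u

variable {G}

namespace Q

variable {k : ℕ} {m m' : ℝ} {u v : Pt n → ℝ}

theorem base (h : G.Q k m u) : G.P m u := h.pk.base

theorem congr (h : G.Q k m u) (huv : u =ᶠ[atInf n] v) : G.Q k m v :=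
  ⟨h.sm.congr huv, h.pk.congr huv⟩

theorem mono (h : G.Q k m u) (hm : m ≤ m') : G.Q k m' u := ⟨h.sm, h.pk.mono hm⟩

theorem pred (h : G.Q (k + 1) m u) : G.Q k m u := ⟨h.sm, h.pk.pred⟩

theorem add (h : G.Q k m u) (h' : G.Q k m v) : G.Q k m fun x => u x + v x :=
  ⟨h.sm.add h'.sm, h.pk.add h.sm h'.sm h'.pk⟩

theorem mul (h : G.Q k m u) (h' : G.Q k m' v) : G.Q k (m + m') fun x => u x * v x :=
  ⟨h.sm.mul h'.sm, h.pk.mul h.sm h'.sm h'.pk⟩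

variable (G k m) in
theorem zero : G.Q k m fun _ => 0 := ⟨.const 0, .zero G k m⟩

variable (G k) in
theorem const (c : ℝ) : G.Q k 0 fun _ => c := by
  refine ⟨.const c, ?_⟩
  cases k with
  | zero => exact G.const c
  | succ k =>
    refine ⟨G.const c, fun μ => ?_⟩
    have : AdS.pd μ (fun _ : Pt n => c) = fun _ => 0 := by ext x; simp
    rw [this]; exact Pk.zero G _ _

theorem const_mul (h : G.Q k m u) (c : ℝ) : G.Q k m fun x => c * u x := by
  simpa using (const G k c).mul h

theorem neg (h : G.Q k m u) : G.Q k m fun x => -u x := by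
  simpa using h.const_mul (-1)

theorem sub (h : G.Q k m u) (h' : G.Q k m v) : G.Q k m fun x => u x - v x := by
  simpa [sub_eq_add_neg] using h.add h'.neg

theorem sum {ι : Type*} (s : Finset ι) {u : ι → Pt n → ℝ} (h : ∀ i ∈ s, G.Q k m (u i)) :
    G.Q k m fun x => ∑ i ∈ s, u i x := by
  classical
  induction s using Finset.induction_on with
  | empty => simpa using zero G k m
  | insert a s ha ih =>
    simp only [Finset.sum_insert ha]
    exact (h a (by simp)).add (ih fun i hi => h i (by simp [hi]))

theorem prod {ι : Type*} (s : Finset ι) {u : ι → Pt n → ℝ} (h : ∀ i ∈ s, G.Q k 0 (u i)) :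
    G.Q k 0 fun x => ∏ i ∈ s, u i x := by
  classical
  induction s using Finset.induction_on with
  | empty => simpa using const G k 1
  | insert a s ha ih =>
    simp only [Finset.prod_insert ha]
    simpa using (h a (by simp)).mul (ih fun i hi => h i (by simp [hi]))

theorem pd (h : G.Q (k + 1) m u) (μ : Fin n) :
    G.Q k (if μ = 1 then m - 1 else m) (pd μ u) := ⟨h.sm.pd μ, h.pk.2 μ⟩

end Q

/-- Functions of `r` which have a chain of derivatives. -/
theorem Q.of_radial {ι : Type*} (φ : ι → ℝ → ℝ) (e : ι → ℝ)
    (hP : ∀ i, G.P (e i) fun x => φ i (x 1))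
    (hs : ∀ i, ∀ᶠ r in atTop, ContDiffAt ℝ ∞ (φ i) r)
    (hd : ∀ k, (∀ i, G.Pk k (e i) fun x => φ i (x 1)) →
      ∀ i, G.Pk k (e i - 1) fun x => deriv (φ i) (x 1)) (k : ℕ) (i : ι) :
    G.Q k (e i) fun x => φ i (x 1) := by
  have hsm : ∀ i, Sm fun x : Pt n => φ i (x 1) := fun i => by
    obtain ⟨ρ, hρ⟩ := eventually_atTop.1 (hs i)
    exact eventually_atInf.2 ⟨ρ, fun x hx => (hρ _ hx.2.le).comp x (contDiffAt_apply ℝ ℝ 1 x)⟩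
  refine ⟨hsm i, ?_⟩
  induction k generalizing i with
  | zero => exact hP i
  | succ k ih =>
    refine ⟨hP i, fun μ => ?_⟩
    obtain ⟨ρ, hρ⟩ := eventually_atTop.1 (hs i)
    have hev : (fun x : Pt n => if μ = 1 then deriv (φ i) (x 1) else 0) =ᶠ[atInf n]
        AdS.pd μ fun x => φ i (x 1) := by
      filter_upwards [eventually_reg ρ] with x hx
      exact (pd_comp_coord ((hρ _ hx.2.le).differentiableAt (by simp))).symm
    refine Pk.congr hev ?_
    split_ifs with hμ
    · exact hd k ih i
    · exact Pk.zero G _ _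

/-- Functions of one angle which have a chain of derivatives. -/
theorem Q.of_angular {A : Fin n} (hA : 2 ≤ A.val) {ι : Type*} (φ : ι → ℝ → ℝ)
    (hs : ∀ i t, InAngleRange A t → ContDiffAt ℝ ∞ (φ i) t)
    (hd : ∀ k, (∀ i, G.Pk k 0 fun x => φ i (x A)) →
      ∀ i, G.Pk k 0 fun x => deriv (φ i) (x A)) (k : ℕ) (i : ι) :
    G.Q k 0 fun x => φ i (x A) := by
  have hsm : ∀ i, Sm fun x : Pt n => φ i (x A) := fun i => by
    exact eventually_atInf.2 ⟨0, fun x hx => (hs i _ (hx.1 A hA)).comp x (contDiffAt_apply ℝ ℝ A x)⟩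
  have hP : ∀ i, G.P 0 fun x => φ i (x A) := fun i =>
    G.angle A _ hA fun t ht => (hs i t ht).continuousAt.continuousWithinAt
  refine ⟨hsm i, ?_⟩
  induction k generalizing i with
  | zero => exact hP i
  | succ k ih =>
    refine ⟨hP i, fun μ => ?_⟩
    have hev : (fun x : Pt n => if μ = A then deriv (φ i) (x A) else 0) =ᶠ[atInf n]
        AdS.pd μ fun x => φ i (x A) := by
      filter_upwards [eventually_reg 0] with x hx
      exact (pd_comp_coord ((hs i _ (hx.1 A hA)).differentiableAt (by simp))).symm
    refine Pk.congr hev ?_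
    by_cases hμ : μ = A
    · simp only [hμ, if_true]
      refine Pk.congr (G := G) .rfl ?_
      by_cases h1 : A = 1
      · exfalso
        subst h1
        have : ((1 : Fin n) : ℕ) ≤ 1 := by
          rw [Fin.val_one']; exact Nat.mod_le _ _
        omega
      · simpa [h1] using hd k ih i
    · simp only [hμ, if_false]; exact Pk.zero G _ _

theorem Q.rpow (k : ℕ) (m : ℝ) : G.Q k m fun x => x 1 ^ m := by
  -- All powers are treated simultaneously, since differentiation leads from one exponent to
  -- another.
  refine Q.of_radial (ι := ℝ) (fun m r => r ^ m) id (fun m => G.rpow m) (fun m => ?_) ?_ k m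
  · filter_upwards [eventually_gt_atTop 0] with r hr
    exact Real.contDiffAt_rpow_const_of_ne hr.ne'
  · intro k hk m
    have h1 : Pk G k (m - 1) fun x : Pt n => m * x 1 ^ (m - 1) := by
      have hs : Sm fun x : Pt n => x 1 ^ (m - 1) := eventually_atInf.2 ⟨0, fun x hx =>
        (Real.contDiffAt_rpow_const_of_ne hx.2.ne').comp x (contDiffAt_apply ℝ ℝ 1 x)⟩
      simpa using Pk.mul (Sm.const m) hs (Q.const G k m).pk (hk (m - 1))
    refine Pk.congr ?_ h1
    filter_upwards [eventually_reg 0] with x hx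
    exact (Real.hasDerivAt_rpow_const (Or.inl hx.2.ne')).deriv.symm

theorem Q.rad (k : ℕ) : G.Q k 1 fun x => x 1 := by
  simpa using Q.rpow (G := G) k 1

theorem Q.sin (k : ℕ) {A : Fin n} (hA : 2 ≤ A.val) :
    G.Q k 0 (fun x => Real.sin (x A)) ∧ G.Q k 0 fun x => Real.cos (x A) := by
  -- Sine and cosine form a family closed under differentiation up to sign, so the pair is treated
  -- together.
  have key : ∀ b : Bool, G.Q k 0 fun x => (cond b Real.sin Real.cos) (x A) := by
    refine Q.of_angular hA (fun b : Bool => cond b Real.sin Real.cos) ?_ ?_ k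
    · rintro (_ | _) t -
      · exact Real.contDiff_cos.contDiffAt
      · exact Real.contDiff_sin.contDiffAt
    · rintro k hk (_ | _)
      · have hs : Sm fun x : Pt n => Real.sin (x A) := .of_forall fun x =>
          Real.contDiff_sin.contDiffAt.comp x (contDiffAt_apply ℝ ℝ A x)
        simpa using Pk.mul (Sm.const (-1)) hs (Q.const G k (-1)).pk (hk true)
      · simpa using hk false
  exact ⟨key true, key false⟩

end Gauge

end Calculus


/-! ### Time, radial and angular indices. -/

section Indices

variable {n : ℕ} [NeZero n] [h3 : Fact (3 ≤ n)]

theorem val_one : ((1 : Fin n) : ℕ) = 1 := by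
  rw [Fin.val_one', Nat.mod_eq_of_lt (by have := h3.out; omega)]

theorem one_ne_zero' : (1 : Fin n) ≠ 0 := by
  intro h
  have := congrArg Fin.val h
  rw [val_one] at this
  simp at this

theorem zero_ne_one' : (0 : Fin n) ≠ 1 := one_ne_zero'.symm

theorem ne_one_of_two_le {A : Fin n} (hA : 2 ≤ A.val) : A ≠ 1 := by
  rintro rfl
  rw [val_one] at hA
  omega

theorem ne_zero_of_two_le {A : Fin n} (hA : 2 ≤ A.val) : A ≠ 0 := by
  rintro rfl
  simp at hA

theorem two_le_of_ne {A : Fin n} (h0 : A ≠ 0) (h1 : A ≠ 1) : 2 ≤ A.val := by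
  by_contra h
  have h2 : A.val ≠ 0 := fun h => h0 (Fin.ext h)
  have h4 : A.val ≠ 1 := fun h => h1 (Fin.ext (h.trans val_one.symm))
  omega

/-- The index of the first angle. -/
def angleOne (n : ℕ) [h3 : Fact (3 ≤ n)] : Fin n := ⟨2, h3.out⟩

theorem val_angleOne : (angleOne n).val = 2 := rfl

end Indices

/-! ### The two gauges: uniform estimates and pointwise leading coefficients. -/

section Instances

variable {n : ℕ} [NeZero n] [h3 : Fact (3 ≤ n)]

theorem update_mem_reg {x : Pt n} (hx : x ∈ chartBox n) {ρ r : ℝ} (hr : ρ < r) :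
    Function.update x 1 r ∈ reg n ρ := by
  refine ⟨fun A hA => ?_, by simpa using hr⟩
  rw [Function.update_of_ne (ne_one_of_two_le hA)]
  exact hx A hA

theorem eventually_update {p : Pt n → Prop} (h : ∀ᶠ x in atInf n, p x) :
    ∀ᶠ r : ℝ in atTop, ∀ x ∈ chartBox n, p (Function.update x 1 r) := by
  obtain ⟨ρ, hρ⟩ := eventually_atInf.1 h
  filter_upwards [eventually_gt_atTop ρ] with r hr x hx using hρ _ (update_mem_reg hx hr)

/-- `u → O(r^m)` in one chart. -/
def ChartBigO (m : ℝ) (u : Pt n → ℝ) : Prop :=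
  ∀ K : Set (Pt n), IsCompact K → K ⊆ chartBox n →
    ∃ C : ℝ, ∀ᶠ r : ℝ in atTop, ∀ x ∈ K, |u (Function.update x 1 r)| ≤ C * r ^ m

/-- A nonnegative constant is needed to multiply two estimates and to enlarge the exponent. -/
theorem ChartBigO.nonneg {m : ℝ} {u : Pt n → ℝ} (h : ChartBigO m u) {K : Set (Pt n)}
    (hK : IsCompact K) (hKb : K ⊆ chartBox n) :
    ∃ C : ℝ, 0 ≤ C ∧ ∀ᶠ r : ℝ in atTop, ∀ x ∈ K, |u (Function.update x 1 r)| ≤ C * r ^ m := by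
  obtain ⟨C, hC⟩ := h K hK hKb
  refine ⟨|C|, abs_nonneg C, ?_⟩
  filter_upwards [hC, eventually_gt_atTop 0] with r hr hr0 x hx
  exact (hr x hx).trans (by gcongr; exact le_abs_self C)

theorem chartBigO_angle (A : Fin n) (hA : A ≠ 1) (φ : ℝ → ℝ) (s : Set ℝ)
    (hs : ∀ x ∈ chartBox n, x A ∈ s) (hφ : ContinuousOn φ s) :
    ChartBigO 0 fun x : Pt n => φ (x A) := by
  intro K hK hKb
  have hc : ContinuousOn (fun x : Pt n => φ (x A)) K :=
    hφ.comp (continuous_apply A).continuousOn fun x hx => hs x (hKb hx)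
  obtain ⟨C, hC⟩ := hK.exists_bound_of_continuousOn hc
  refine ⟨C, .of_forall fun r x hx => ?_⟩
  change |φ (Function.update x 1 r A)| ≤ _
  rw [Function.update_of_ne hA]
  simpa using hC x hx

/-- The gauge of `O`-estimates in one chart. -/
def bigO (n : ℕ) [NeZero n] [Fact (3 ≤ n)] : Gauge n where
  P := ChartBigO
  congr := by
    intro m u v huv h K hK hKb
    obtain ⟨C, hC⟩ := h K hK hKb
    refine ⟨C, ?_⟩
    filter_upwards [hC, eventually_update huv] with r hr hr' x hx
    rw [← hr' x (hKb hx)]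
    exact hr x hx
  add := by
    intro m u v hu hv K hK hKb
    obtain ⟨C, hC⟩ := hu K hK hKb
    obtain ⟨D, hD⟩ := hv K hK hKb
    refine ⟨C + D, ?_⟩
    filter_upwards [hC, hD] with r hr hr' x hx
    rw [add_mul]
    exact (abs_add_le _ _).trans (add_le_add (hr x hx) (hr' x hx))
  mul := by
    intro m k u v hu hv K hK hKb
    obtain ⟨C, hC0, hC⟩ := hu.nonneg hK hKb
    obtain ⟨D, hD0, hD⟩ := hv.nonneg hK hKb
    refine ⟨C * D, ?_⟩
    filter_upwards [hC, hD, eventually_gt_atTop 0] with r hr hr' hr0 x hx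
    rw [abs_mul, Real.rpow_add hr0, mul_mul_mul_comm]
    exact mul_le_mul (hr x hx) (hr' x hx) (abs_nonneg _) (by positivity)
  mono := by
    intro m k u hmk hu K hK hKb
    obtain ⟨C, hC0, hC⟩ := ChartBigO.nonneg hu hK hKb
    refine ⟨C, ?_⟩
    filter_upwards [hC, eventually_ge_atTop 1] with r hr hr1 x hx
    exact (hr x hx).trans (by gcongr)
  const := fun c K _ _ => ⟨|c|, .of_forall fun r x _ => by simp⟩
  rpow := fun m K _ _ => ⟨1, by
    filter_upwards [eventually_gt_atTop 0] with r hr x _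
    rw [Function.update_self, abs_of_pos (by positivity), one_mul]⟩
  lapse := fun l hl K _ _ => ⟨l ^ 2, by
    filter_upwards [eventually_gt_atTop 0] with r hr x _
    rw [Function.update_self, abs_of_pos (by positivity), Real.rpow_neg hr.le, Real.rpow_two,
      ← div_eq_mul_inv, inv_eq_one_div, div_le_div_iff₀ (by positivity) (by positivity)]
    have : l ^ 2 * (1 + r ^ 2 / l ^ 2) = l ^ 2 + r ^ 2 := by field_simp
    rw [this]
    nlinarith [sq_nonneg l]⟩
  angle := fun A φ hA hφ =>
    chartBigO_angle A (ne_one_of_two_le hA) φ _ (fun x hx => hx A hA) hφ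
  time := chartBigO_angle 0 zero_ne_one' (fun t => t) Set.univ (fun _ _ => trivial)
    continuousOn_id

theorem bigO_P {m : ℝ} {u : ChartFun n} :
    BigO m u ↔ ∀ R, IsSpatialRotation R → (bigO n).P m (u R) := Iff.rfl

theorem fallOff_iff {k : ℕ} {m : ℝ} {u : ChartFun n} :
    FallOff k m u ↔ ∀ R, IsSpatialRotation R → (bigO n).Pk k m (u R) := by
  induction k generalizing m u with
  | zero => exact Iff.rfl
  | succ k ih =>
    simp only [FallOff, Gauge.Pk, ih, bigO_P]
    exact ⟨fun h R hR => ⟨h.1 R hR, fun μ => h.2 μ R hR⟩,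
      fun h => ⟨fun R hR => (h R hR).1, fun μ R hR => (h R hR).2 μ⟩⟩

/-- The gauge of pointwise convergence of `r^-m u` as `r → ∞`. -/
def leading (n : ℕ) [NeZero n] [Fact (3 ≤ n)] : Gauge n where
  P := fun m u => ∀ x ∈ chartBox n,
    ∃ c : ℝ, Tendsto (fun r : ℝ => r ^ (-m) * u (Function.update x 1 r)) atTop (𝓝 c)
  congr := by
    intro m u v huv h x hx
    obtain ⟨c, hc⟩ := h x hx
    refine ⟨c, hc.congr' ?_⟩
    filter_upwards [eventually_update huv] with r hr
    rw [hr x hx]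
  add := by
    intro m u v hu hv x hx
    obtain ⟨c, hc⟩ := hu x hx
    obtain ⟨d, hd⟩ := hv x hx
    exact ⟨c + d, (hc.add hd).congr fun r => by ring⟩
  mul := by
    intro m k u v hu hv x hx
    obtain ⟨c, hc⟩ := hu x hx
    obtain ⟨d, hd⟩ := hv x hx
    refine ⟨c * d, (hc.mul hd).congr' ?_⟩
    filter_upwards [eventually_gt_atTop 0] with r hr
    rw [neg_add, Real.rpow_add hr]
    ring
  mono := by
    intro m k u hmk hu x hx
    obtain ⟨c, hc⟩ := hu x hx
    rcases hmk.eq_or_lt with rfl | hlt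
    · exact ⟨c, hc⟩
    -- A strictly larger exponent turns the limit into zero.
    · refine ⟨0 * c, ((tendsto_rpow_neg_atTop (sub_pos.2 hlt)).mul hc).congr' ?_⟩
      filter_upwards [eventually_gt_atTop 0] with r hr
      rw [← mul_assoc, ← Real.rpow_add hr]
      congr 2
      ring
  const := fun c x _ => ⟨c, by simp⟩
  rpow := fun m x _ => ⟨1, by
    refine (tendsto_const_nhds (x := (1 : ℝ))).congr' ?_
    filter_upwards [eventually_gt_atTop 0] with r hr
    rw [Function.update_self, ← Real.rpow_add hr]
    simp⟩
  -- The limit is `l ^ 2`, in the form in which the quotient produces it.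
  lapse := fun l hl x _ => ⟨(0 + 1 / l ^ 2)⁻¹, by
    have h1 : Tendsto (fun r : ℝ => r ^ (-2 : ℝ)) atTop (𝓝 0) := tendsto_rpow_neg_atTop two_pos
    refine ((h1.add_const (1 / l ^ 2)).inv₀ (by positivity)).congr' ?_
    filter_upwards [eventually_gt_atTop 0] with r hr
    rw [Function.update_self, neg_neg, Real.rpow_neg hr.le, Real.rpow_two]
    field_simp⟩
  angle := fun A φ hA _ x _ => ⟨φ (x A), by
    simp [Function.update_of_ne (ne_one_of_two_le hA)]⟩
  time := fun x _ => ⟨x 0, by simp [Function.update_of_ne zero_ne_one']⟩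

theorem hasLeadingCoefficient_iff {m : ℝ} {u : Pt n → ℝ} :
    HasLeadingCoefficient m u ↔ (leading n).Pk 1 m u := by
  simp only [HasLeadingCoefficient, Gauge.Pk]
  constructor
  · intro h
    refine ⟨fun x hx => (h x hx).1, fun μ x hx => ?_⟩
    by_cases hμ : μ = 1
    · subst hμ
      simpa [show -(m - 1) = 1 - m by ring] using (h x hx).2.1
    · simpa [hμ] using (h x hx).2.2 μ hμ
  · intro h x hx
    refine ⟨h.1 x hx, ?_, fun a ha => ?_⟩
    · simpa [show -(m - 1) = 1 - m by ring] using h.2 1 x hx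
    · simpa [ha] using h.2 a x hx

end Instances

/-! ### Orders of the building blocks of the metric. -/

namespace Gauge

variable {n : ℕ} [NeZero n] [h3 : Fact (3 ≤ n)] {G : Gauge n}

theorem Q.time (k : ℕ) : G.Q k 0 fun x => x 0 := by
  refine ⟨.of_forall fun x => contDiffAt_apply ℝ ℝ 0 x, ?_⟩
  cases k with
  | zero => exact G.time
  | succ k =>
    refine ⟨G.time, fun μ => ?_⟩
    have : AdS.pd μ (fun x : Pt n => x 0) = fun _ => if μ = 0 then 1 else 0 := by
      ext x; exact pd_coord _ _ _
    rw [this]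
    by_cases h : μ = 1
    · subst h
      rw [if_neg one_ne_zero']
      exact Pk.zero G _ _
    · simpa [h] using (Q.const G k _).pk

/-- The last angle is excluded because its range contains the zero `π` of the sine. It never occurs
in `angFactor`, where only angles preceding another one appear. -/
theorem Q.inv_sin (k : ℕ) {A : Fin n} (hA : 2 ≤ A.val) (hA' : A.val + 1 ≠ n) :
    G.Q k 0 (fun x => (Real.sin (x A))⁻¹) := by
  have hpos : ∀ t, InAngleRange A t → 0 < Real.sin t := fun t ht => by
    rw [InAngleRange, if_neg hA'] at ht
    exact Real.sin_pos_of_pos_of_lt_pi ht.1 ht.2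
  refine Q.of_angular hA (fun (_ : Unit) t => (Real.sin t)⁻¹) ?_ ?_ k ()
  · exact fun _ t ht => Real.contDiff_sin.contDiffAt.inv (hpos t ht).ne'
  · intro k hk _
    have hs : Sm fun x : Pt n => (Real.sin (x A))⁻¹ := eventually_atInf.2 ⟨0, fun x hx =>
      ContDiffAt.comp (g := fun t => (Real.sin t)⁻¹) x
        (Real.contDiff_sin.contDiffAt.inv (hpos _ (hx.1 A hA)).ne') (contDiffAt_apply ℝ ℝ A x)⟩
    have hQ : G.Q k 0 fun x => (Real.sin (x A))⁻¹ := ⟨hs, hk ()⟩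
    have := (((Q.sin (G := G) k hA).2.mul hQ).mul hQ).neg
    simp only [add_zero] at this
    refine Pk.congr ?_ this.pk
    filter_upwards [eventually_reg 0] with x hx
    have h0 := (hpos _ (hx.1 A hA)).ne'
    rw [((Real.hasDerivAt_sin (x A)).fun_inv h0).deriv]
    field_simp

theorem Q.lapse (k : ℕ) {l : ℝ} (hl : 0 < l) : G.Q k (-2) fun x => (1 + x 1 ^ 2 / l ^ 2)⁻¹ := by
  have hc : ∀ t : ℝ, ContDiffAt ℝ ∞ (fun r : ℝ => (1 + r ^ 2 / l ^ 2)⁻¹) t := fun t =>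
    ContDiffAt.inv (by fun_prop) (by positivity)
  refine Q.of_radial (fun (_ : Unit) r => (1 + r ^ 2 / l ^ 2)⁻¹) (fun _ => -2)
    (fun _ => G.lapse l hl) (fun _ => .of_forall hc) ?_ k ()
  intro k hk _
  have hs : Sm fun x : Pt n => (1 + x 1 ^ 2 / l ^ 2)⁻¹ :=
    .of_forall fun x => (hc _).comp x (contDiffAt_apply ℝ ℝ 1 x)
  have hQ : G.Q k (-2) fun x => (1 + x 1 ^ 2 / l ^ 2)⁻¹ := ⟨hs, hk ()⟩
  have := (((Q.rad (G := G) k).const_mul (-2 / l ^ 2)).mul hQ).mul hQ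
  refine Pk.congr ?_ (this.mono (m' := -2 - 1) (by norm_num)).pk
  refine .of_forall fun x => ?_
  have h1 : HasDerivAt (fun r : ℝ => 1 + r ^ 2 / l ^ 2) (2 * x 1 / l ^ 2) (x 1) := by
    simpa using ((hasDerivAt_pow 2 (x 1)).div_const (l ^ 2)).const_add 1
  have h0 : 1 + x 1 ^ 2 / l ^ 2 ≠ 0 := by positivity
  change _ = deriv (fun r : ℝ => (1 + r ^ 2 / l ^ 2)⁻¹) (x 1)
  rw [(h1.fun_inv h0).deriv]
  field_simp

end Gauge


/-! ### The diagonal background metric and its Christoffel symbols. -/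

section Metric

variable {n : ℕ} [NeZero n] [h3 : Fact (3 ≤ n)]

/-- The diagonal entries of the background metric. -/
noncomputable def gdiag (l : ℝ) (μ : Fin n) (x : Pt n) : ℝ :=
  if μ = 0 then -(1 + x 1 ^ 2 / l ^ 2)
  else if μ = 1 then (1 + x 1 ^ 2 / l ^ 2)⁻¹
  else x 1 ^ 2 * angFactor x μ

theorem gdiag_zero (l : ℝ) (x : Pt n) : gdiag l 0 x = -(1 + x 1 ^ 2 / l ^ 2) := if_pos rfl

theorem gdiag_one (l : ℝ) (x : Pt n) : gdiag l 1 x = (1 + x 1 ^ 2 / l ^ 2)⁻¹ := by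
  rw [gdiag, if_neg one_ne_zero', if_pos rfl]

theorem gdiag_angle (l : ℝ) (x : Pt n) {A : Fin n} (hA : 2 ≤ A.val) :
    gdiag l A x = x 1 ^ 2 * angFactor x A := by
  rw [gdiag, if_neg (ne_zero_of_two_le hA), if_neg (ne_one_of_two_le hA)]

theorem gbar_apply (l : ℝ) (x : Pt n) (μ ν : Fin n) :
    gbar l x μ ν = if μ = ν then gdiag l μ x else 0 := Matrix.diagonal_apply _ _ _

theorem sin_pos_of_chartBox {x : Pt n} (hx : x ∈ chartBox n) {A B : Fin n} (hB : 2 ≤ B.val)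
    (hBA : B.val < A.val) : 0 < Real.sin (x B) := by
  have h := hx B hB
  rw [InAngleRange, if_neg (by omega)] at h
  exact Real.sin_pos_of_pos_of_lt_pi h.1 h.2

theorem angFactor_pos {x : Pt n} (hx : x ∈ chartBox n) (A : Fin n) : 0 < angFactor x A := by
  refine Finset.prod_pos fun B hB => ?_
  rw [Finset.mem_filter] at hB
  exact pow_pos (sin_pos_of_chartBox hx hB.2.1 hB.2.2) 2

theorem gdiag_ne_zero {l : ℝ} (hl : 0 < l) {x : Pt n} (hx : x ∈ reg n 0) (μ : Fin n) :
    gdiag l μ x ≠ 0 := by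
  have h1 : 0 < 1 + x 1 ^ 2 / l ^ 2 := by positivity
  have h2 := hx.2
  have h3 := angFactor_pos hx.1 μ
  rw [gdiag]
  split_ifs
  · exact neg_ne_zero.2 h1.ne'
  · positivity
  · positivity

theorem gbar_inv {l : ℝ} (hl : 0 < l) {x : Pt n} (hx : x ∈ reg n 0) (μ ν : Fin n) :
    (gbar l x)⁻¹ μ ν = if μ = ν then (gdiag l μ x)⁻¹ else 0 := by
  have : (gbar l x)⁻¹ = Matrix.diagonal fun μ => (gdiag l μ x)⁻¹ := by
    refine Matrix.inv_eq_right_inv ?_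
    have : gbar l x = Matrix.diagonal fun μ => gdiag l μ x := rfl
    rw [this, Matrix.diagonal_mul_diagonal]
    simp [mul_inv_cancel₀ (gdiag_ne_zero hl hx _)]
  rw [this, Matrix.diagonal_apply]

theorem pd_gbar (l : ℝ) (x : Pt n) (μ σ ν : Fin n) :
    pd μ (fun z => gbar l z σ ν) x = if σ = ν then pd μ (gdiag l σ) x else 0 := by
  simp only [gbar_apply]
  split_ifs
  · rfl
  · simp

theorem christoffel_eq {l : ℝ} (hl : 0 < l) {x : Pt n} (hx : x ∈ reg n 0) (κ μ ν : Fin n) :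
    christoffel l x κ μ ν = 1 / 2 * (gdiag l κ x)⁻¹ *
      ((if κ = ν then pd μ (gdiag l κ) x else 0) + (if κ = μ then pd ν (gdiag l κ) x else 0)
        - if μ = ν then pd κ (gdiag l μ) x else 0) := by
  simp only [christoffel, gbar_inv hl hx, pd_gbar, ite_mul, zero_mul, Finset.sum_ite_eq,
    Finset.mem_univ, if_true]
  ring

theorem christoffel_symm {l : ℝ} (hl : 0 < l) {x : Pt n} (hx : x ∈ reg n 0) (κ μ ν : Fin n) :
    christoffel l x κ μ ν = christoffel l x κ ν μ := by
  rw [christoffel_eq hl hx, christoffel_eq hl hx]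
  by_cases h : μ = ν
  · subst h; ring
  · simp only [h, Ne.symm h, if_false]; ring

end Metric

/-! ### Index weights, parity and covariant differentiation. -/

section Weights

variable {n : ℕ} [NeZero n]

/-- The weight of a contravariant index: `r` counts one, the other directions count minus one. -/
noncomputable def om (μ : Fin n) : ℝ := if μ = 1 then 1 else -1

/-- The parity of an index: only the directions other than `r` are odd. -/
noncomputable def par (μ : Fin n) : ZMod 2 := if μ = 1 then 0 else 1

/-- A pair of orders, one for each parity. -/
noncomputable def two (e o : ℝ) (p : ZMod 2) : ℝ := if p = 0 then e else o

/-- The orders of the background. -/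
noncomputable def eps : ZMod 2 → ℝ := two 0 (-1)

theorem zmod_two_cases (p : ZMod 2) : p = 0 ∨ p = 1 := by revert p; decide

theorem zmod_two_add_self (p : ZMod 2) : p + p = 0 := by revert p; decide

@[simp] theorem two_zero (e o : ℝ) : two e o 0 = e := rfl

@[simp] theorem two_one (e o : ℝ) : two e o 1 = o := rfl

/-- With only two parities, compatibility for all pairs reduces to four numerical inequalities. -/
theorem two_add_le {a b c : ZMod 2 → ℝ} (h00 : a 0 + b 0 ≤ c 0) (h11 : a 1 + b 1 ≤ c 0)
    (h01 : a 0 + b 1 ≤ c 1) (h10 : a 1 + b 0 ≤ c 1) (p q : ZMod 2) : a p + b q ≤ c (p + q) := by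
  rcases zmod_two_cases p with rfl | rfl <;> rcases zmod_two_cases q with rfl | rfl
  · simpa using h00
  · simpa using h01
  · simpa using h10
  · simpa [show (1 : ZMod 2) + 1 = 0 from rfl] using h11

/-- The orders `c` are compatible with covariant differentiation. -/
noncomputable def Compat (c : ZMod 2 → ℝ) : Prop := ∀ p q, eps p + c q ≤ c (p + q)

/-- Only a background factor of odd parity changes the class, and it contributes `r⁻¹`. The even and
odd orders may therefore differ by at most one in either direction. -/
theorem compat_two {e o : ℝ} (h : e ≤ o + 1) (h' : o ≤ e + 1) : Compat (two e o) :=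
  two_add_le (by simp [eps]) (by simp [eps]; linarith) (by simp [eps]) (by simp [eps]; linarith)

theorem compat_eps : Compat eps := compat_two (by norm_num) (by norm_num)

theorem om_one : om (1 : Fin n) = 1 := if_pos rfl

theorem om_ne {μ : Fin n} (h : μ ≠ 1) : om μ = -1 := if_neg h

theorem par_one : par (1 : Fin n) = 0 := if_pos rfl

theorem par_ne {μ : Fin n} (h : μ ≠ 1) : par μ = 1 := if_neg h

namespace Gauge

variable [h3 : Fact (3 ≤ n)] {G : Gauge n}

/-- The exponent in terms of weights: `∂_r` removes its weight one, while for `∂_a` the weight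
gained is paid back by the odd order `-1` of the background. -/
theorem Q.pd' {k : ℕ} {m : ℝ} {u : Pt n → ℝ} (h : G.Q (k + 1) m u) (μ : Fin n) :
    G.Q k (m - om μ + eps (par μ)) (AdS.pd μ u) := by
  refine (h.pd μ).mono (le_of_eq ?_)
  by_cases hμ : μ = 1
  · subst hμ; simp [om_one, par_one, eps]
  · simp [om_ne hμ, par_ne hμ, eps, hμ]

theorem Q.sq_rad_div (k : ℕ) (l : ℝ) : G.Q k 2 fun x => 1 + x 1 ^ 2 / l ^ 2 := by
  have h1 := ((Q.const G k 1).mono (m' := 2) (by norm_num)).add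
    (((Q.rad (G := G) k).mul (Q.rad k)).const_mul (1 / l ^ 2) |>.mono (m' := 2) (by norm_num))
  refine h1.congr (.of_forall fun x => ?_)
  simp only
  ring

theorem Q.angFactor (k : ℕ) (A : Fin n) : G.Q k 0 fun x => angFactor x A := by
  refine Q.prod _ fun B hB => ?_
  rw [Finset.mem_filter] at hB
  have h := (Q.sin (G := G) k hB.2.1).1
  refine ((h.mul h).mono (m' := 0) (by norm_num)).congr (.of_forall fun x => ?_)
  simp only
  ring

theorem Q.inv_angFactor (k : ℕ) (A : Fin n) : G.Q k 0 fun x => (AdS.angFactor x A)⁻¹ := by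
  simp only [AdS.angFactor, ← Finset.prod_inv_distrib]
  refine Q.prod _ fun B hB => ?_
  rw [Finset.mem_filter] at hB
  have h := Q.inv_sin (G := G) k hB.2.1 (by omega)
  refine ((h.mul h).mono (m' := 0) (by norm_num)).congr (.of_forall fun x => ?_)
  simp only
  rw [← mul_inv, sq]

theorem Q.gdiag (k : ℕ) {l : ℝ} (hl : 0 < l) (μ : Fin n) : G.Q k (-2 * om μ) (gdiag l μ) := by
  by_cases h0 : μ = 0
  · subst h0
    refine ((Q.sq_rad_div (G := G) k l).neg.mono (m' := -2 * om 0) ?_).congr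
      (.of_forall fun x => ?_)
    · rw [om_ne zero_ne_one']; norm_num
    · exact (gdiag_zero l x).symm
  by_cases h1 : μ = 1
  · subst h1
    refine ((Q.lapse (G := G) k hl).mono (m' := -2 * om 1) ?_).congr (.of_forall fun x => ?_)
    · rw [om_one]; norm_num
    · exact (gdiag_one l x).symm
  · have h2 := two_le_of_ne h0 h1
    refine ((((Q.rad (G := G) k).mul (Q.rad k)).mul (Q.angFactor k μ)).mono
      (m' := -2 * om μ) ?_).congr (.of_forall fun x => ?_)
    · rw [om_ne h1]; norm_num
    · rw [gdiag_angle l x h2]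
      ring

theorem Q.inv_gdiag (k : ℕ) {l : ℝ} (hl : 0 < l) (μ : Fin n) :
    G.Q k (2 * om μ) fun x => (AdS.gdiag l μ x)⁻¹ := by
  by_cases h0 : μ = 0
  · subst h0
    refine ((Q.lapse (G := G) k hl).neg.mono (m' := 2 * om 0) ?_).congr
      (.of_forall fun x => ?_)
    · rw [om_ne zero_ne_one']; norm_num
    · simp only [gdiag_zero, inv_neg]
  by_cases h1 : μ = 1
  · subst h1
    refine ((Q.sq_rad_div (G := G) k l).mono (m' := 2 * om 1) ?_).congr (.of_forall fun x => ?_)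
    · rw [om_one]; norm_num
    · simp only [gdiag_one, inv_inv]
  · have h2 := two_le_of_ne h0 h1
    refine (((Q.rpow (G := G) k (-2)).mul (Q.inv_angFactor k μ)).mono
      (m' := 2 * om μ) ?_).congr ?_
    · rw [om_ne h1]; norm_num
    · filter_upwards [eventually_reg 0] with x hx
      rw [gdiag_angle l x h2, Real.rpow_neg hx.2.le, Real.rpow_two, mul_inv]

theorem Q.pd_gbar (k : ℕ) {l : ℝ} (hl : 0 < l) (μ σ ν : Fin n) :
    G.Q k (-om σ - om ν - om μ + eps (par σ + par ν + par μ))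
      (AdS.pd μ fun z => gbar l z σ ν) := by
  have he : (AdS.pd μ fun z => gbar l z σ ν) = fun x => if σ = ν then AdS.pd μ (AdS.gdiag l σ) x
      else 0 := funext fun x => AdS.pd_gbar l x μ σ ν
  rw [he]
  by_cases h : σ = ν
  · subst h
    simp only [if_true, zmod_two_add_self, zero_add]
    exact ((Q.gdiag (k + 1) hl σ).pd' μ).mono (by linarith)
  · simp only [h, if_false]
    exact Q.zero _ _ _

theorem Q.gbar_inv (k : ℕ) {l : ℝ} (hl : 0 < l) (κ σ : Fin n) :
    G.Q k (om κ + om σ + eps (par κ + par σ)) fun x => (gbar l x)⁻¹ κ σ := by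
  by_cases h : κ = σ
  · subst h
    rw [zmod_two_add_self]
    refine ((Q.inv_gdiag (G := G) k hl κ).mono ?_).congr ?_
    · simp [eps]; linarith
    · filter_upwards [eventually_reg 0] with x hx
      rw [AdS.gbar_inv hl hx, if_pos rfl]
  · refine (Q.zero G k _).congr ?_
    filter_upwards [eventually_reg 0] with x hx
    rw [AdS.gbar_inv hl hx, if_neg h]

theorem Q.gbar (k : ℕ) {l : ℝ} (hl : 0 < l) (κ σ : Fin n) :
    G.Q k (-om κ - om σ + eps (par κ + par σ)) fun x => AdS.gbar l x κ σ := by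
  simp only [gbar_apply]
  by_cases h : κ = σ
  · subst h
    simp only [zmod_two_add_self, if_true]
    refine (Q.gdiag (G := G) k hl κ).mono ?_
    simp [eps]; linarith
  · simp only [h, if_false]
    exact Q.zero G k _

/-- Each of the three terms is an inverse metric entry times a first derivative of the metric. The
weights of the summed index `σ` cancel, and its parity occurs twice. -/
theorem Q.christoffel (k : ℕ) {l : ℝ} (hl : 0 < l) (κ μ ν : Fin n) :
    G.Q k (om κ - om μ - om ν + eps (par κ + par μ + par ν))
      fun x => christoffel l x κ μ ν := by
  unfold AdS.christoffel
  refine Q.const_mul (Q.sum _ fun σ _ => ?_) _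
  have e1 : ∀ α β : Fin n, om κ + om σ + eps (par κ + par σ) + (-om σ - om α - om β
      + eps (par σ + par α + par β)) ≤ om κ - om α - om β + eps (par κ + par α + par β) := by
    intro α β
    have := compat_eps (par κ + par σ) (par σ + par α + par β)
    rw [show par κ + par σ + (par σ + par α + par β)
      = par κ + (par σ + par σ) + par α + par β by ring, zmod_two_add_self, add_zero] at this
    linarith
  have h1 := ((Q.gbar_inv (G := G) k hl κ σ).mul (Q.pd_gbar k hl μ σ ν)).mono
    (m' := om κ - om μ - om ν + eps (par κ + par μ + par ν)) (by
      have := e1 ν μ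
      rw [show par κ + par ν + par μ = par κ + par μ + par ν by ring] at this
      linarith)
  have h2 := ((Q.gbar_inv (G := G) k hl κ σ).mul (Q.pd_gbar k hl ν σ μ)).mono
    (m' := om κ - om μ - om ν + eps (par κ + par μ + par ν)) (by
      have := e1 μ ν
      linarith)
  have h4 := ((Q.gbar_inv (G := G) k hl κ σ).mul (Q.pd_gbar k hl σ μ ν)).mono
    (m' := om κ - om μ - om ν + eps (par κ + par μ + par ν)) (by
      have := e1 μ ν
      rw [show par μ + par ν + par σ = par σ + par μ + par ν by ring]
      linarith)
  refine ((h1.add h2).sub h4).congr (.of_forall fun x => ?_)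
  simp only
  ring

variable (G) in
/-- Tensors whose components have the order which their indices and their parity prescribe. -/
noncomputable def TQ (k : ℕ) (c : ZMod 2 → ℝ) {j : ℕ} (T : Tensor n j) : Prop :=
  ∀ a, G.Q k (∑ i, om (a i) + c (∑ i, par (a i))) (T a)

theorem _root_.Function.sum_update {j : ℕ} {M : Type*} [AddCommGroup M] (f : Fin n → M)
    (a : Fin j → Fin n) (i : Fin j) (ρ : Fin n) :
    ∑ t, f (Function.update a i ρ t) = ∑ t, f (a t) - f (a i) + f ρ := by
  have h1 : ∀ t, f (Function.update a i ρ t) = Function.update (fun t => f (a t)) i (f ρ) t := by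
    intro t
    by_cases h : t = i
    · subst h; simp
    · simp [h]
  simp only [h1]
  rw [Finset.sum_update_of_mem (Finset.mem_univ i)]
  rw [← Finset.sum_sdiff (Finset.subset_univ {i})]
  simp
  abel

/-- The partial derivative and the Christoffel terms are each a background object of order `eps`
acting on `T`, so `Compat` absorbs both. Vanishing components are given harmless nominal orders,
which avoids any distinction of index types. -/
theorem TQ.covD {k j : ℕ} {c : ZMod 2 → ℝ} (hc : Compat c) {l : ℝ} (hl : 0 < l) {T : Tensor n j}
    (h : G.TQ (k + 1) c T) (σ : Fin n) (a : Fin j → Fin n) :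
    G.Q k (∑ i, om (a i) - om σ + c (∑ i, par (a i) + par σ)) (covD l T σ a) := by
  unfold AdS.covD
  refine Q.add ?_ (Q.sum _ fun i _ => Q.sum _ fun ρ _ => ?_)
  · refine ((h a).pd' σ).mono ?_
    have := hc (par σ) (∑ i, par (a i))
    rw [add_comm (par σ)] at this
    linarith
  · refine ((Q.christoffel (G := G) k hl (a i) σ ρ).mul (h (Function.update a i ρ)).pred).mono ?_
    -- Replacing one index by `ρ` shifts the weight and parity sums. The contributions of `ρ` cancel
    -- against those of the Christoffel symbol.
    rw [Function.sum_update om, Function.sum_update par]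
    have := hc (par (a i) + par σ + par ρ) (∑ t, par (a t) - par (a i) + par ρ)
    rw [show par (a i) + par σ + par ρ + (∑ t, par (a t) - par (a i) + par ρ)
      = ∑ t, par (a t) + par σ + (par ρ + par ρ) by ring, zmod_two_add_self, add_zero] at this
    linarith

theorem TQ.gradUp {k j : ℕ} {c : ZMod 2 → ℝ} (hc : Compat c) {l : ℝ} (hl : 0 < l)
    {T : Tensor n j} (h : G.TQ (k + 1) c T) : G.TQ k c (gradUp l T) := by
  intro a
  unfold AdS.gradUp
  refine Q.sum _ fun σ _ => ?_
  refine ((Q.gbar_inv (G := G) k hl (a 0) σ).mul (h.covD hc hl σ (Fin.tail a))).mono ?_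
  rw [Fin.sum_univ_succ, Fin.sum_univ_succ (f := fun i => par (a i))]
  simp only [Fin.tail]
  have := hc (par (a 0) + par σ) (∑ i : Fin j, par (a i.succ) + par σ)
  rw [show par (a 0) + par σ + (∑ i : Fin j, par (a i.succ) + par σ)
    = par (a 0) + ∑ i : Fin j, par (a i.succ) + (par σ + par σ) by ring, zmod_two_add_self,
    add_zero] at this
  linarith

end Gauge

end Weights


/-! ### The volume density and the orders of the linear operator and the superpotential. -/

section Density

variable {n : ℕ} [NeZero n] [h3 : Fact (3 ≤ n)]

/-- The angular part of `√(-ḡ)`. -/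
noncomputable def sphereDensity (x : Pt n) : ℝ :=
  ∏ A ∈ Finset.univ.filter (fun A : Fin n => 2 ≤ A.val),
    ∏ B ∈ Finset.univ.filter (fun B : Fin n => 2 ≤ B.val ∧ B.val < A.val), Real.sin (x B)

theorem sphereDensity_pos {x : Pt n} (hx : x ∈ chartBox n) : 0 < sphereDensity x := by
  refine Finset.prod_pos fun A _ => Finset.prod_pos fun B hB => ?_
  rw [Finset.mem_filter] at hB
  exact sin_pos_of_chartBox hx hB.2.1 hB.2.2

theorem sphereDensity_le_one {x : Pt n} (hx : x ∈ chartBox n) : sphereDensity x ≤ 1 := by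
  refine Finset.prod_le_one (fun A _ => Finset.prod_nonneg fun B hB => ?_)
    fun A _ => Finset.prod_le_one (fun B hB => ?_) fun B _ => Real.sin_le_one _
  all_goals
    rw [Finset.mem_filter] at hB
    exact (sin_pos_of_chartBox hx hB.2.1 hB.2.2).le

theorem filter_not_two_le :
    Finset.univ.filter (fun A : Fin n => ¬ 2 ≤ A.val) = {0, 1} := by
  ext A
  simp only [Finset.mem_filter, Finset.mem_univ, true_and, Finset.mem_insert,
    Finset.mem_singleton]
  constructor
  · intro h
    by_contra h'
    push Not at h'
    exact h (two_le_of_ne h'.1 h'.2)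
  · rintro (rfl | rfl)
    · simp
    · rw [val_one]; norm_num

theorem card_two_le : (Finset.univ.filter (fun A : Fin n => 2 ≤ A.val)).card = n - 2 := by
  have h := Finset.card_filter_add_card_filter_not (s := (Finset.univ : Finset (Fin n)))
    (fun A : Fin n => 2 ≤ A.val)
  rw [filter_not_two_le, Finset.card_pair zero_ne_one', Finset.card_univ, Fintype.card_fin] at h
  omega

theorem sum_univ_split {M : Type*} [AddCommMonoid M] (f : Fin n → M) :
    ∑ μ, f μ = f 0 + f 1 + ∑ A ∈ Finset.univ.filter (fun A : Fin n => 2 ≤ A.val), f A := by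
  rw [← Finset.sum_filter_add_sum_filter_not Finset.univ (fun A : Fin n => 2 ≤ A.val),
    filter_not_two_le, Finset.sum_pair zero_ne_one', add_comm]

/-- Since `ḡ_ττ ḡ_rr = -1`, the lapse drops out; the radial power comes from the `n - 2` angular
directions alone. -/
theorem sqrtNegDet_eq {l : ℝ} {x : Pt n} (hx : x ∈ reg n 0) :
    sqrtNegDet l x = x 1 ^ (n - 2) * sphereDensity x := by
  have hdet : (gbar l x).det = ∏ μ, gdiag l μ x := Matrix.det_diagonal
  have h2 : ∏ μ, gdiag l μ x = -(x 1 ^ (n - 2) * sphereDensity x) ^ 2 := by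
    rw [← Finset.prod_filter_mul_prod_filter_not Finset.univ (fun A : Fin n => 2 ≤ A.val),
      filter_not_two_le, Finset.prod_pair zero_ne_one', gdiag_zero, gdiag_one,
      Finset.prod_congr rfl fun A hA => gdiag_angle l x (Finset.mem_filter.1 hA).2,
      Finset.prod_mul_distrib, Finset.prod_const, card_two_le]
    have h1 : 1 + x 1 ^ 2 / l ^ 2 ≠ 0 := by positivity
    rw [neg_mul, mul_inv_cancel₀ h1, mul_pow, sphereDensity, ← Finset.prod_pow]
    simp only [← Finset.prod_pow, angFactor]
    ring
  have h0 := sphereDensity_pos hx.1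
  have h1 := hx.2
  rw [sqrtNegDet, hdet, h2, neg_neg, Real.sqrt_sq (by positivity)]

namespace Gauge

variable {G : Gauge n}

theorem Q.sphereDensity (k : ℕ) : G.Q k 0 (sphereDensity (n := n)) :=
  Q.prod _ fun _ _ => Q.prod _ fun _ hB => (Q.sin k (Finset.mem_filter.1 hB).2.1).1

theorem Q.sqrtNegDet (k : ℕ) (l : ℝ) : G.Q k ((n : ℝ) - 2) (sqrtNegDet l) := by
  have := h3.out
  refine (((Q.rpow (G := G) k ((n : ℝ) - 2)).mul (Q.sphereDensity k)).mono (by simp)).congr ?_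
  filter_upwards [eventually_reg 0] with x hx
  rw [sqrtNegDet_eq hx, ← Real.rpow_natCast, Nat.cast_sub (by omega), Nat.cast_two]

theorem TQ.two {k : ℕ} {c : ZMod 2 → ℝ} {T : Tensor n 2} (h : G.TQ k c T) (μ ν : Fin n) :
    G.Q k (om μ + om ν + c (par μ + par ν)) (T ![μ, ν]) := by
  simpa [Fin.sum_univ_succ] using h ![μ, ν]

theorem TQ.four {k : ℕ} {c : ZMod 2 → ℝ} {T : Tensor n 4} (h : G.TQ k c T) (κ ρ μ ν : Fin n) :
    G.Q k (om κ + (om ρ + (om μ + om ν)) + c (par κ + (par ρ + (par μ + par ν))))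
      (T ![κ, ρ, μ, ν]) := by
  have := h ![κ, ρ, μ, ν]
  simp only [Fin.sum_univ_four, Matrix.cons_val] at this
  convert this using 2
  · ring
  · congr 1; ring

variable (G) in
/-- Covariant tensors of rank two of the prescribed order. -/
def HQ (k : ℕ) (c : ZMod 2 → ℝ) (h : Fin n → Fin n → Pt n → ℝ) : Prop :=
  ∀ μ ν, G.Q k (-om μ - om ν + c (par μ + par ν)) (h μ ν)

variable (G) in
/-- Vector fields of the prescribed order. -/
def VQ (k : ℕ) (c : ZMod 2 → ℝ) (ξ : Fin n → Pt n → ℝ) : Prop :=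
  ∀ μ, G.Q k (om μ + c (par μ)) (ξ μ)

theorem HQ.raise {k : ℕ} {c : ZMod 2 → ℝ} (hc : Compat c) {l : ℝ} (hl : 0 < l)
    {h : Fin n → Fin n → Pt n → ℝ} (hh : G.HQ k c h) : G.TQ k c (raise l h) := by
  intro a
  refine Q.sum _ fun α _ => Q.sum _ fun β _ => ?_
  refine (((Q.gbar_inv (G := G) k hl (a 0) α).mul (Q.gbar_inv k hl (a 1) β)).mul
    (hh α β)).mono ?_
  have h1 := hc (par (a 0) + par α) (par (a 1) + par β + (par α + par β))
  have h2 := hc (par (a 1) + par β) (par α + par β)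
  simp only [Fin.sum_univ_two]
  rw [show par (a 0) + par α + (par (a 1) + par β + (par α + par β))
    = par (a 0) + par (a 1) + (par α + par α) + (par β + par β) by ring, zmod_two_add_self,
    zmod_two_add_self, add_zero, add_zero] at h1
  linarith

theorem HQ.trace {k : ℕ} {c : ZMod 2 → ℝ} (hc : Compat c) {l : ℝ} (hl : 0 < l)
    {h : Fin n → Fin n → Pt n → ℝ} (hh : G.HQ k c h) : G.TQ k c (trace l h) := by
  intro a
  refine Q.sum _ fun α _ => Q.sum _ fun β _ => ?_
  refine ((Q.gbar_inv (G := G) k hl α β).mul (hh α β)).mono ?_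
  have h1 := hc (par α + par β) (par α + par β)
  rw [zmod_two_add_self] at h1
  simp only [Finset.univ_eq_empty, Finset.sum_empty]
  linarith

/-- A contracted pair loses its weights to `gbar`. The parity of the pair appears once in the metric
and once in `T`, so only the free parity `p` is left. -/
theorem Q.contract {k : ℕ} {c : ZMod 2 → ℝ} (hc : Compat c) {l : ℝ} (hl : 0 < l) {m : ℝ}
    {p : ZMod 2} {T : Fin n → Fin n → Pt n → ℝ}
    (h : ∀ κ ρ, G.Q k (om κ + om ρ + m + c (par κ + par ρ + p)) (T κ ρ)) :
    G.Q k (m + c p) fun x => ∑ κ, ∑ ρ, AdS.gbar l x κ ρ * T κ ρ x := by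
  refine Q.sum _ fun κ _ => Q.sum _ fun ρ _ => ?_
  refine ((Q.gbar k hl κ ρ).mul (h κ ρ)).mono ?_
  have := hc (par κ + par ρ) (par κ + par ρ + p)
  rw [← add_assoc, zmod_two_add_self, zero_add] at this
  linarith

/-- The linear operator without the density factor. -/
noncomputable def _root_.AdS.linCore (l Λ : ℝ) (h : Fin n → Fin n → Pt n → ℝ) (μ ν : Fin n)
    (x : Pt n) : ℝ :=
  let g := AdS.gbar l x
  let DDh := AdS.gradUp l (AdS.gradUp l (AdS.raise l h))
  let DDt := AdS.gradUp l (AdS.gradUp l (AdS.trace l h))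
  2 * Λ / ((n : ℝ) - 2) * (2 * AdS.raise l h ![μ, ν] x - g⁻¹ μ ν * AdS.trace l h ![] x)
      + DDt ![μ, ν] x
      + (∑ κ, ∑ ρ, g κ ρ * DDh ![κ, ρ, μ, ν] x)
      - (∑ κ, ∑ ρ, g κ ρ * (DDh ![κ, μ, ν, ρ] x + DDh ![κ, ν, μ, ρ] x))
      - g⁻¹ μ ν *
        ((∑ κ, ∑ ρ, g κ ρ * DDt ![κ, ρ] x)
          - ∑ κ, ∑ ρ, ∑ σ, ∑ θ, g κ ρ * g σ θ * DDh ![κ, σ, θ, ρ] x)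

theorem _root_.AdS.linOp_eq (l Λ : ℝ) (h : Fin n → Fin n → Pt n → ℝ) (μ ν : Fin n) (x : Pt n) :
    linOp l Λ h μ ν x = AdS.sqrtNegDet l x / (32 * Real.pi) * linCore l Λ h μ ν x := rfl

/-- Every term is a product of background factors with at most two covariant derivatives of `h`,
with the same free indices. Hence all terms have the order of the raised perturbation itself, and no
cancellation is used here. -/
theorem HQ.linCore {k : ℕ} {c : ZMod 2 → ℝ} (hc : Compat c) {l : ℝ} (hl : 0 < l) (Λ : ℝ)
    {h : Fin n → Fin n → Pt n → ℝ} (hh : G.HQ (k + 2) c h) (μ ν : Fin n) :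
    G.Q k (om μ + om ν + c (par μ + par ν)) (linCore l Λ h μ ν) := by
  have hr := hh.raise hc hl
  have ht := hh.trace hc hl
  have hDDh := (hr.gradUp hc hl).gradUp hc hl
  have hDDt := (ht.gradUp hc hl).gradUp hc hl
  -- A metric factor times a scalar: only the even order of the scalar enters, and `Compat` covers
  -- the nominally odd entries of the inverse metric.
  have hg : ∀ {m : ℝ} {u : Pt n → ℝ}, m = c 0 → G.Q k m u → G.Q k (om μ + om ν + c (par μ + par ν))
      fun x => (AdS.gbar l x)⁻¹ μ ν * u x := by
    rintro m u rfl hu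
    refine ((Q.gbar_inv (G := G) k hl μ ν).mul hu).mono ?_
    have := hc (par μ + par ν) 0
    rw [add_zero] at this
    linarith
  refine Q.sub (Q.sub (Q.add (Q.add ?_ ?_) ?_) ?_) ?_
  · exact (((hr.two μ ν).pred.pred.const_mul 2).sub (hg (by simp) (ht ![]).pred.pred)).const_mul _
  · exact hDDt.two μ ν
  · refine Q.contract hc hl fun κ ρ => (hDDh.four κ ρ μ ν).mono (le_of_eq ?_)
    rw [show par κ + (par ρ + (par μ + par ν)) = par κ + par ρ + (par μ + par ν) by ring]
    ring
  · refine Q.contract hc hl fun κ ρ => Q.add ?_ ?_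
    · refine (hDDh.four κ μ ν ρ).mono (le_of_eq ?_)
      rw [show par κ + (par μ + (par ν + par ρ)) = par κ + par ρ + (par μ + par ν) by ring]
      ring
    · refine (hDDh.four κ ν μ ρ).mono (le_of_eq ?_)
      rw [show par κ + (par ν + (par μ + par ρ)) = par κ + par ρ + (par μ + par ν) by ring]
      ring
  · refine hg (m := 0 + c 0) (by simp) (Q.sub (Q.contract hc hl fun κ ρ => ?_) ?_)
    · simpa using hDDt.two κ ρ
    · have : (fun x => ∑ κ, ∑ ρ, ∑ σ, ∑ θ, AdS.gbar l x κ ρ * AdS.gbar l x σ θ *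
          AdS.gradUp l (AdS.gradUp l (AdS.raise l h)) ![κ, σ, θ, ρ] x)
          = fun x => ∑ κ, ∑ ρ, AdS.gbar l x κ ρ * ∑ σ, ∑ θ, AdS.gbar l x σ θ *
          AdS.gradUp l (AdS.gradUp l (AdS.raise l h)) ![κ, σ, θ, ρ] x := by
        ext x
        simp only [Finset.mul_sum, mul_assoc]
      rw [this]
      refine Q.contract hc hl fun κ ρ => ?_
      refine (Q.contract (m := om κ + om ρ) (p := par κ + par ρ) hc hl fun σ θ => ?_).mono
        (by simp)
      refine (hDDh.four κ σ θ ρ).mono (le_of_eq ?_)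
      rw [show par κ + (par σ + (par θ + par ρ)) = par σ + par θ + (par κ + par ρ) by ring]
      ring

theorem HQ.linOp {k : ℕ} {c : ZMod 2 → ℝ} (hc : Compat c) {l : ℝ} (hl : 0 < l) (Λ : ℝ)
    {h : Fin n → Fin n → Pt n → ℝ} (hh : G.HQ (k + 2) c h) (μ ν : Fin n) :
    G.Q k ((n : ℝ) - 2 + (om μ + om ν + c (par μ + par ν))) (linOp l Λ h μ ν) := by
  refine (((Q.sqrtNegDet (G := G) k l).const_mul (1 / (32 * Real.pi))).mul
    (hh.linCore hc hl Λ μ ν)).congr (.of_forall fun x => ?_)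
  simp only [linOp_eq]
  ring

/-- The orders of the terms of the superpotential. -/
theorem HQ.superpotTerms {k : ℕ} {a b c : ZMod 2 → ℝ} (ha : Compat a) (hb : Compat b)
    (hc : Compat c) (habc : ∀ p q, a p + b q ≤ c (p + q)) {l : ℝ} (hl : 0 < l)
    {h : Fin n → Fin n → Pt n → ℝ} {ξ : Fin n → Pt n → ℝ} (hh : G.HQ (k + 1) a h)
    (hξ : G.VQ (k + 1) b ξ) (ν μ : Fin n) :
    G.Q k (om ν + om μ + c (par ν + par μ)) (superpotTerms l h ξ ν μ) := by
  have hr := hh.raise ha hl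
  have ht := hh.trace ha hl
  have hX : G.TQ (k + 1) b (fun a : Fin 1 → Fin n => ξ (a 0)) := fun a => by
    simpa using hξ (a 0)
  have hhX : G.TQ (k + 1) c (fun (a : Fin 1 → Fin n) z => AdS.trace l h ![] z * ξ (a 0) z) := by
    intro a
    refine ((ht ![]).mul (hξ (a 0))).mono ?_
    have := habc 0 (par (a 0))
    simp at this ⊢
    linarith
  have hhhX : G.TQ (k + 1) c
      (fun (a : Fin 3 → Fin n) z => AdS.raise l h ![a 0, a 1] z * ξ (a 2) z) := by
    intro a
    refine ((hr.two (a 0) (a 1)).mul (hξ (a 2))).mono ?_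
    have := habc (par (a 0) + par (a 1)) (par (a 2))
    simp only [Fin.sum_univ_three]
    linarith
  have hW : G.TQ (k + 1) c (fun (a : Fin 1 → Fin n) z =>
      ∑ σ, ∑ ρ, AdS.raise l h ![a 0, σ] z * AdS.gbar l z σ ρ * ξ ρ z) := by
    intro a
    refine Q.sum _ fun σ _ => Q.sum _ fun ρ _ => ?_
    refine (((hr.two (a 0) σ).mul (Q.gbar _ hl σ ρ)).mul (hξ ρ)).mono ?_
    have h1 := habc (par (a 0) + par ρ) (par ρ)
    have h2 := ha (par σ + par ρ) (par (a 0) + par σ)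
    rw [add_assoc, zmod_two_add_self, add_zero] at h1
    rw [show par σ + par ρ + (par (a 0) + par σ) = par (a 0) + par ρ + (par σ + par σ) by ring,
      zmod_two_add_self, add_zero] at h2
    simp only [Finset.univ_unique, Fin.default_eq_zero, Finset.sum_singleton]
    linarith
  have hDX := hX.gradUp hb hl
  unfold AdS.superpotTerms
  refine Q.add (Q.add (Q.add (Q.add (Q.add ?_ ?_) ?_) (Q.const_mul ?_ _)) (Q.const_mul ?_ _))
    (Q.const_mul ?_ _)
  · exact (hhX.gradUp hc hl).two ν μ
  · refine Q.sum _ fun σ _ => (hhhX.covD hc hl σ ![μ, σ, ν]).mono (le_of_eq ?_)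
    simp only [Fin.sum_univ_three, Matrix.cons_val]
    rw [show par μ + par σ + par ν + par σ = par ν + par μ + (par σ + par σ) by ring,
      zmod_two_add_self, add_zero]
    ring
  · refine ((hW.gradUp hc hl).two μ ν).mono (le_of_eq ?_)
    rw [add_comm (par μ)]
    ring
  · refine ((ht ![]).pred.mul (hDX.two μ ν)).mono ?_
    have := habc 0 (par μ + par ν)
    rw [zero_add, add_comm (par μ)] at this
    rw [add_comm (par μ)]
    simp
    linarith
  · refine Q.sum _ fun σ _ => Q.sum _ fun ρ _ => ?_
    refine (((hr.two σ μ).pred.mul (Q.gbar _ hl σ ρ)).mul (hDX.two ν ρ)).mono ?_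
    have h1 := habc (par μ + par ρ) (par ν + par ρ)
    have h2 := ha (par σ + par ρ) (par σ + par μ)
    rw [show par μ + par ρ + (par ν + par ρ) = par ν + par μ + (par ρ + par ρ) by ring,
      zmod_two_add_self, add_zero] at h1
    rw [show par σ + par ρ + (par σ + par μ) = par μ + par ρ + (par σ + par σ) by ring,
      zmod_two_add_self, add_zero] at h2
    linarith
  · refine Q.sum _ fun σ _ => ?_
    refine ((hr.two ν σ).pred.mul (hX.covD hb hl σ ![μ])).mono ?_
    have h1 := habc (par ν + par σ) (par μ + par σ)
    rw [show par ν + par σ + (par μ + par σ) = par ν + par μ + (par σ + par σ) by ring,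
      zmod_two_add_self, add_zero] at h1
    simp
    linarith

end Gauge

end Density


/-! ### Trigonometric identities for spherical coordinates. -/

section SphereCoordinates

/-- `cos y_(j+1) ∏_{a < B ≤ j} sin y_B`. -/
noncomputable def tailCoord (y : ℕ → ℝ) (a j : ℕ) : ℝ :=
  (∏ B ∈ Finset.Ioc a j, Real.sin (y B)) * Real.cos (y (j + 1))

/-- The derivative of `tailCoord y 1 k` in the direction `y_A`. -/
noncomputable def dirCoord (y : ℕ → ℝ) (A k : ℕ) : ℝ :=
  if k + 1 < A then 0
  else if k + 1 = A then -((∏ B ∈ Finset.Ioc 1 (A - 1), Real.sin (y B)) * Real.sin (y A))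
  else (∏ B ∈ Finset.Ioc 1 (A - 1), Real.sin (y B)) * Real.cos (y A) * tailCoord y A k

theorem tailCoord_split (y : ℕ → ℝ) {a b j : ℕ} (hab : a < b) (hbj : b ≤ j) :
    tailCoord y a j
      = (∏ B ∈ Finset.Ioc a (b - 1), Real.sin (y B)) * Real.sin (y b) * tailCoord y b j := by
  obtain ⟨c, rfl⟩ : ∃ c, b = c + 1 := ⟨b - 1, by omega⟩
  rw [tailCoord, tailCoord, ← Finset.prod_Ioc_consecutive _ hab.le hbj, Nat.add_sub_cancel,
    Finset.prod_Ioc_succ_top (by omega)]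
  ring

theorem tailCoord_pred (y : ℕ → ℝ) {a b : ℕ} (hb : 1 ≤ b) :
    tailCoord y a (b - 1) = (∏ B ∈ Finset.Ioc a (b - 1), Real.sin (y B)) * Real.cos (y b) := by
  rw [tailCoord, Nat.sub_add_cancel hb]

/-- The tails beyond angle `a` are the coordinates of a lower-dimensional unit sphere. The
convention `y m = 0` closes the recursion: the last coordinate has no cosine factor, and `cos 0 =
1`. -/
theorem sum_tailCoord_sq {y : ℕ → ℝ} {m : ℕ} (hy : y m = 0) (d a : ℕ) (h : a + d + 1 = m) :
    ∑ j ∈ Finset.Ico a m, tailCoord y a j ^ 2 = 1 := by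
  induction d generalizing a with
  | zero =>
    have : m = a + 1 := by omega
    subst this
    simp [tailCoord, hy]
  | succ d ih =>
    rw [Finset.sum_eq_sum_Ico_succ_bot (by omega)]
    have h1 : ∀ j ∈ Finset.Ico (a + 1) m,
        tailCoord y a j ^ 2 = Real.sin (y (a + 1)) ^ 2 * tailCoord y (a + 1) j ^ 2 := by
      intro j hj
      rw [Finset.mem_Ico] at hj
      rw [tailCoord_split y (Nat.lt_succ_self a) hj.1]
      simp
      ring
    rw [Finset.sum_congr rfl h1, ← Finset.mul_sum, ih (a + 1) (by omega)]
    simp [tailCoord]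

theorem sum_dirCoord {y : ℕ → ℝ} {m : ℕ} {B : ℕ} (hB : 2 ≤ B) (hBm : B < m)
    (F : ℕ → ℝ) :
    ∑ k ∈ Finset.Ico 1 m, F k * dirCoord y B k
      = (∏ C ∈ Finset.Ioc 1 (B - 1), Real.sin (y C)) *
        (-F (B - 1) * Real.sin (y B)
          + Real.cos (y B) * ∑ k ∈ Finset.Ico B m, F k * tailCoord y B k) := by
  rw [← Finset.sum_Ico_consecutive _ (show 1 ≤ B - 1 by omega) (show B - 1 ≤ m by omega),
    Finset.sum_eq_zero, zero_add, Finset.sum_eq_sum_Ico_succ_bot (by omega),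
    show B - 1 + 1 = B by omega, mul_add, Finset.mul_sum, Finset.mul_sum]
  · congr 1
    · rw [dirCoord, if_neg (by omega), if_pos (by omega)]
      ring
    · refine Finset.sum_congr rfl fun k hk => ?_
      rw [Finset.mem_Ico] at hk
      rw [dirCoord, if_neg (by omega), if_neg (by omega)]
      ring
  · intro k hk
    rw [Finset.mem_Ico] at hk
    rw [dirCoord, if_pos (by omega), mul_zero]

/-- In the plane spanned by the coordinate `B - 1` and the unit tail beyond `B`, `F` is proportional
to `(cos y_B, sin y_B)` and the derivative direction to `(-sin y_B, cos y_B)`. The coordinates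
before `B - 1` do not depend on `y_B`. -/
theorem sum_dirCoord_orthogonal {y : ℕ → ℝ} {m : ℕ} (hy : y m = 0) {B : ℕ} (hB : 2 ≤ B)
    (hBm : B < m) (F : ℕ → ℝ) (q : ℝ) (h1 : F (B - 1) = q * Real.cos (y B))
    (h2 : ∀ k, B ≤ k → F k = q * Real.sin (y B) * tailCoord y B k) :
    ∑ k ∈ Finset.Ico 1 m, F k * dirCoord y B k = 0 := by
  rw [sum_dirCoord hB hBm, h1]
  have : ∑ k ∈ Finset.Ico B m, F k * tailCoord y B k = q * Real.sin (y B) := by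
    rw [Finset.sum_congr rfl fun k hk => by
      rw [h2 k (Finset.mem_Ico.1 hk).1, mul_assoc, ← sq], ← Finset.mul_sum,
      sum_tailCoord_sq hy (m - B - 1) B (by omega), mul_one]
  rw [this]
  ring

theorem sum_tail_dirCoord {y : ℕ → ℝ} {m : ℕ} (hy : y m = 0) {B : ℕ} (hB : 2 ≤ B)
    (hBm : B < m) : ∑ k ∈ Finset.Ico 1 m, tailCoord y 1 k * dirCoord y B k = 0 :=
  sum_dirCoord_orthogonal hy hB hBm _ _ (tailCoord_pred y (by omega))
    fun _ hk => tailCoord_split y (by omega) hk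

theorem sum_dirCoord_ne {y : ℕ → ℝ} {m : ℕ} (hy : y m = 0) {A B : ℕ} (hA : 2 ≤ A) (hAB : A < B)
    (hBm : B < m) : ∑ k ∈ Finset.Ico 1 m, dirCoord y A k * dirCoord y B k = 0 := by
  refine sum_dirCoord_orthogonal hy (by omega) hBm _
    ((∏ C ∈ Finset.Ioc 1 (A - 1), Real.sin (y C)) * Real.cos (y A) *
      ∏ C ∈ Finset.Ioc A (B - 1), Real.sin (y C)) ?_ fun k hk => ?_
  · rw [dirCoord, if_neg (by omega), if_neg (by omega), tailCoord_pred y (by omega)]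
    ring
  · rw [dirCoord, if_neg (by omega), if_neg (by omega), tailCoord_split y hAB hk]
    ring

theorem sum_dirCoord_self {y : ℕ → ℝ} {m : ℕ} (hy : y m = 0) {B : ℕ} (hB : 2 ≤ B)
    (hBm : B < m) : ∑ k ∈ Finset.Ico 1 m, dirCoord y B k * dirCoord y B k
      = ∏ C ∈ Finset.Ioc 1 (B - 1), Real.sin (y C) ^ 2 := by
  rw [sum_dirCoord hB hBm]
  have : ∑ k ∈ Finset.Ico B m, dirCoord y B k * tailCoord y B k
      = (∏ C ∈ Finset.Ioc 1 (B - 1), Real.sin (y C)) * Real.cos (y B) := by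
    have h : ∀ k ∈ Finset.Ico B m, dirCoord y B k * tailCoord y B k
        = (∏ C ∈ Finset.Ioc 1 (B - 1), Real.sin (y C)) * Real.cos (y B) *
          tailCoord y B k ^ 2 := by
      intro k hk
      rw [Finset.mem_Ico] at hk
      rw [dirCoord, if_neg (by omega), if_neg (by omega)]
      ring
    rw [Finset.sum_congr rfl h, ← Finset.mul_sum,
      sum_tailCoord_sq hy (m - B - 1) B (by omega), mul_one]
  rw [this, dirCoord, if_neg (by omega), if_pos (by omega), Finset.prod_pow]
  linear_combination ((∏ C ∈ Finset.Ioc 1 (B - 1), Real.sin (y C)) ^ 2) *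
    Real.sin_sq_add_cos_sq (y B)

end SphereCoordinates

/-! ### The Jacobian of spherical coordinates and its Gram matrix. -/

section ChartGeometry

variable {n : ℕ} [NeZero n] [h3 : Fact (3 ≤ n)]

/-- The coordinates as a sequence, continued by zero. -/
noncomputable def seqExt (x : Pt n) (j : ℕ) : ℝ := if h : j < n then x ⟨j, h⟩ else 0

theorem seqExt_self (x : Pt n) : seqExt x n = 0 := by simp [seqExt]

theorem seqExt_val (x : Pt n) (A : Fin n) : seqExt x A.val = x A := by simp [seqExt]

theorem seqExt_update (x : Pt n) (A : Fin n) (t : ℝ) {j : ℕ} (hj : j ≠ A.val) :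
    seqExt (Function.update x A t) j = seqExt x j := by
  unfold seqExt
  split_ifs with h
  · rw [Function.update_of_ne]
    rintro rfl
    exact hj rfl
  · rfl

theorem prod_filter_fin {M : Type*} [CommMonoid M] (a b : ℕ) (hb : b < n) (f : ℕ → M) :
    ∏ B ∈ Finset.univ.filter (fun B : Fin n => a + 1 ≤ B.val ∧ B.val ≤ b), f B.val
      = ∏ j ∈ Finset.Ioc a b, f j := by
  refine Finset.prod_bij (fun B _ => B.val) ?_ ?_ ?_ ?_
  · intro B hB
    simp only [Finset.mem_filter, Finset.mem_univ, true_and, Finset.mem_Ioc] at hB ⊢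
    omega
  · intro B _ C _ h
    exact Fin.ext h
  · intro j hj
    rw [Finset.mem_Ioc] at hj
    exact ⟨⟨j, by omega⟩, by simp; omega, rfl⟩
  · intros; rfl

theorem angFactor_eq (x : Pt n) (A : Fin n) :
    angFactor x A = ∏ j ∈ Finset.Ioc 1 (A.val - 1), Real.sin (seqExt x j) ^ 2 := by
  rw [← prod_filter_fin (n := n) 1 (A.val - 1) (by omega)]
  simp only [seqExt_val, angFactor]
  refine Finset.prod_congr (Finset.filter_congr fun B _ => ?_) fun _ _ => rfl
  omega

theorem toCartesian_zero (x : Pt n) : toCartesian x 0 = x 0 := if_pos rfl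

/-- The zero continuation of `seqExt` supplies the missing cosine of the last coordinate, so one
formula holds for all spatial coordinates. -/
theorem toCartesian_of_ne (x : Pt n) {k : Fin n} (hk : k ≠ 0) :
    toCartesian x k = x 1 * tailCoord (seqExt x) 1 k.val := by
  rw [toCartesian, if_neg hk, tailCoord, ← prod_filter_fin (n := n) 1 k.val k.isLt, mul_assoc]
  simp only [seqExt_val]
  congr 2
  rw [seqExt]
  split_ifs <;> simp

theorem contDiff_toCartesian (k : Fin n) : ContDiff ℝ ∞ fun x : Pt n => toCartesian x k := by
  unfold toCartesian
  split_ifs with h0 h1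
  · exact contDiff_apply ℝ ℝ _
  · refine ((contDiff_apply ℝ ℝ _).mul (contDiff_prod fun B _ => ?_)).mul ?_
    · exact Real.contDiff_sin.comp (contDiff_apply ℝ ℝ _)
    · exact Real.contDiff_cos.comp (contDiff_apply ℝ ℝ _)
  · refine ((contDiff_apply ℝ ℝ _).mul (contDiff_prod fun B _ => ?_)).mul contDiff_const
    exact Real.contDiff_sin.comp (contDiff_apply ℝ ℝ _)

theorem hasDerivAt_update_pd {u : Pt n → ℝ} {x : Pt n} (hu : DifferentiableAt ℝ u x)
    (A : Fin n) : HasDerivAt (fun t => u (Function.update x A t)) (pd A u x) (x A) := by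
  have h1 := hasDerivAt_update (𝕜 := ℝ) x A (x A)
  have h2 : HasFDerivAt u (fderiv ℝ u x) (Function.update x A (x A)) := by
    rw [Function.update_eq_self]; exact hu.hasFDerivAt
  exact h2.comp_hasDerivAt (x A) h1

/-- The entries of the Jacobian of `toCartesian`. -/
noncomputable def sphJac (x : Pt n) (k μ : Fin n) : ℝ :=
  if k = 0 then (if μ = 0 then 1 else 0)
  else if μ = 0 then 0
  else if μ = 1 then tailCoord (seqExt x) 1 k.val
  else x 1 * dirCoord (seqExt x) μ.val k.val

/-- Each coordinate is a product of functions of one variable. Along a coordinate line every factor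
but one is frozen, so the derivative is one-dimensional. -/
theorem pd_toCartesian (x : Pt n) (k μ : Fin n) :
    pd μ (fun z => toCartesian z k) x = sphJac x k μ := by
  have hd : DifferentiableAt ℝ (fun z : Pt n => toCartesian z k) x :=
    ((contDiff_toCartesian k).differentiable (by simp)) x
  have h1 := hasDerivAt_update_pd hd μ
  refine h1.unique ?_
  by_cases hk : k = 0
  · subst hk
    simp only [toCartesian_zero, sphJac, if_true]
    by_cases hμ : μ = 0
    · subst hμ
      simpa using hasDerivAt_id' (x 0)
    · simp only [hμ, if_false, Function.update_of_ne (Ne.symm hμ)]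
      exact hasDerivAt_const _ _
  simp only [toCartesian_of_ne _ hk, sphJac, if_neg hk]
  have hagree : ∀ t, ∀ j, j ≠ μ.val → seqExt (Function.update x μ t) j = seqExt x j :=
    fun t j hj => seqExt_update x μ t hj
  have htail : ∀ (t : ℝ) (a b : ℕ), (μ.val ≤ a ∨ b + 1 < μ.val) →
      tailCoord (seqExt (Function.update x μ t)) a b = tailCoord (seqExt x) a b ∨ b < a := by
    intro t a b hab
    by_cases hba : b < a
    · exact Or.inr hba
    · refine Or.inl ?_
      rw [tailCoord, tailCoord, hagree t (b + 1) (by omega)]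
      congr 1
      refine Finset.prod_congr rfl fun j hj => ?_
      rw [Finset.mem_Ioc] at hj
      rw [hagree t j (by omega)]
  have hkv : 1 ≤ k.val := Nat.one_le_iff_ne_zero.2 fun h => hk (Fin.ext h)
  by_cases h0 : μ = 0
  · subst h0
    have : ∀ t, Function.update x 0 t 1 * tailCoord (seqExt (Function.update x 0 t)) 1 k.val
        = x 1 * tailCoord (seqExt x) 1 k.val := by
      intro t
      rw [Function.update_of_ne one_ne_zero',
        (htail t 1 k.val (by simp)).resolve_right (by omega)]
    simp only [this, if_true]
    exact hasDerivAt_const _ _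
  by_cases h1' : μ = 1
  · subst h1'
    have : ∀ t, Function.update x 1 t 1 * tailCoord (seqExt (Function.update x 1 t)) 1 k.val
        = t * tailCoord (seqExt x) 1 k.val := by
      intro t
      rw [Function.update_self, (htail t 1 k.val (Or.inl val_one.le)).resolve_right (by omega)]
    simp only [this, if_true, if_neg one_ne_zero']
    simpa using (hasDerivAt_id' (x 1)).mul_const (tailCoord (seqExt x) 1 k.val)
  · have h2 := two_le_of_ne h0 h1'
    simp only [if_neg h0, if_neg h1', Function.update_of_ne (Ne.symm h1')]
    refine HasDerivAt.const_mul _ ?_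
    have hprod : ∀ t, ∏ B ∈ Finset.Ioc 1 (μ.val - 1),
        Real.sin (seqExt (Function.update x μ t) B)
        = ∏ B ∈ Finset.Ioc 1 (μ.val - 1), Real.sin (seqExt x B) := by
      intro t
      refine Finset.prod_congr rfl fun j hj => ?_
      rw [Finset.mem_Ioc] at hj
      rw [hagree t j (by omega)]
    have hself : ∀ t, seqExt (Function.update x μ t) μ.val = t := by
      intro t; rw [seqExt_val, Function.update_self]
    rw [dirCoord]
    split_ifs with hc1 hc2
    · have : ∀ t, tailCoord (seqExt (Function.update x μ t)) 1 k.val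
          = tailCoord (seqExt x) 1 k.val :=
        fun t => (htail t 1 k.val (by omega)).resolve_right (by omega)
      simp only [this]
      exact hasDerivAt_const _ _
    · have : ∀ t, tailCoord (seqExt (Function.update x μ t)) 1 k.val
          = (∏ B ∈ Finset.Ioc 1 (μ.val - 1), Real.sin (seqExt x B)) * Real.cos t := by
        intro t
        rw [show k.val = μ.val - 1 by omega, tailCoord_pred _ (by omega), hprod, hself]
      simp only [this, seqExt_val]
      simpa using (Real.hasDerivAt_cos (x μ)).const_mul
        (∏ B ∈ Finset.Ioc 1 (μ.val - 1), Real.sin (seqExt x B))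
    · have : ∀ t, tailCoord (seqExt (Function.update x μ t)) 1 k.val
          = (∏ B ∈ Finset.Ioc 1 (μ.val - 1), Real.sin (seqExt x B)) * Real.sin t *
            tailCoord (seqExt x) μ.val k.val := by
        intro t
        rw [tailCoord_split _ (show 1 < μ.val by omega) (show μ.val ≤ k.val by omega), hprod, hself,
          (htail t μ.val k.val (Or.inl le_rfl)).resolve_right (by omega)]
      simp only [this, seqExt_val]
      exact ((Real.hasDerivAt_sin (x μ)).const_mul _).mul_const _

/-- The diagonal entries of the flat metric in static coordinates. -/
noncomputable def flatDiag (μ : Fin n) (x : Pt n) : ℝ :=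
  if μ = 0 then 1 else if μ = 1 then 1 else x 1 ^ 2 * angFactor x μ

theorem sum_fin_ne_zero (F : ℕ → ℝ) (G : Fin n → ℝ) (h0 : G 0 = 0)
    (h : ∀ k : Fin n, k ≠ 0 → G k = F k.val) : ∑ k, G k = ∑ j ∈ Finset.Ico 1 n, F j := by
  have h1 : ∀ k : Fin n, G k = (fun j : ℕ => if j = 0 then 0 else F j) k.val := by
    intro k
    by_cases hk : k = 0
    · subst hk; simp [h0]
    · have : k.val ≠ 0 := fun h => hk (Fin.ext h)
      simp [this, h k hk]
  rw [Finset.sum_congr rfl fun k _ => h1 k,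
    Fin.sum_univ_eq_sum_range (fun j : ℕ => if j = 0 then 0 else F j),
    Finset.sum_range_eq_add_Ico _ (by have := h3.out; omega)]
  simp only [if_true, zero_add]
  refine Finset.sum_congr rfl fun j hj => ?_
  rw [Finset.mem_Ico] at hj
  rw [if_neg (by omega)]

/-- Static coordinates are orthogonal for the Euclidean metric `dτ² + ∑ dX²`. This yields the
inverse of every chart Jacobian explicitly, and with it the regularity of all components away from
the poles. -/
theorem sphJac_gram (x : Pt n) (μ ν : Fin n) :
    ∑ k, sphJac x k μ * sphJac x k ν = if μ = ν then flatDiag μ x else 0 := by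
  have hy := seqExt_self x
  have hn := h3.out
  wlog hle : μ.val ≤ ν.val generalizing μ ν with H
  · rw [Finset.sum_congr rfl fun k _ => mul_comm _ _, H ν μ (by omega)]
    by_cases h : μ = ν
    · subst h; rfl
    · rw [if_neg h, if_neg (Ne.symm h)]
  by_cases hμ0 : μ = 0
  · subst hμ0
    rw [Finset.sum_eq_single 0]
    · by_cases hν : ν = 0
      · subst hν; simp [sphJac, flatDiag]
      · simp [sphJac, hν, Ne.symm hν]
    · intro k _ hk
      simp [sphJac, hk]
    · simp
  have hν0 : ν ≠ 0 := by
    rintro rfl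
    exact hμ0 (Fin.ext (Nat.le_zero.1 hle))
  have h0 : sphJac x 0 μ * sphJac x 0 ν = 0 := by simp [sphJac, hμ0]
  by_cases hμ1 : μ = 1
  · subst hμ1
    by_cases hν1 : ν = 1
    · subst hν1
      rw [sum_fin_ne_zero (fun k => tailCoord (seqExt x) 1 k ^ 2) _ h0,
        sum_tailCoord_sq hy (n - 2) 1 (by omega)]
      · simp [flatDiag]
      · intro k hk
        simp only [sphJac, hk, hμ0, if_false, if_true]
        ring
    · have h2 := two_le_of_ne hν0 hν1
      rw [sum_fin_ne_zero (fun k => x 1 * (tailCoord (seqExt x) 1 k * dirCoord (seqExt x) ν.val k))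
        _ h0, ← Finset.mul_sum, sum_tail_dirCoord hy h2 ν.isLt, mul_zero, if_neg (Ne.symm hν1)]
      intro k hk
      simp only [sphJac, hk, hμ0, hν0, hν1, if_false, if_true]
      ring
  have hμ2 := two_le_of_ne hμ0 hμ1
  have hν1 : ν ≠ 1 := by
    rintro rfl
    rw [val_one] at hle
    omega
  have hν2 := two_le_of_ne hν0 hν1
  rw [sum_fin_ne_zero (fun k => x 1 ^ 2 *
    (dirCoord (seqExt x) μ.val k * dirCoord (seqExt x) ν.val k)) _ h0, ← Finset.mul_sum]
  · by_cases h : μ = ν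
    · subst h
      rw [sum_dirCoord_self hy hμ2 μ.isLt, if_pos rfl, flatDiag, if_neg hμ0, if_neg hμ1,
        angFactor_eq]
    · rw [sum_dirCoord_ne hy hμ2 (lt_of_le_of_ne hle fun hv => h (Fin.ext hv)) ν.isLt, mul_zero,
        if_neg h]
  · intro k hk
    simp only [sphJac, hk, hμ0, hμ1, hν0, hν1, if_false]
    ring

end ChartGeometry


/-! ### Rotations that fix the time axis. -/

section Rotations

variable {n : ℕ} [NeZero n] [h3 : Fact (3 ≤ n)] {R : Matrix (Fin n) (Fin n) ℝ}

theorem isSpatialRotation_one : IsSpatialRotation (1 : Matrix (Fin n) (Fin n) ℝ) :=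
  ⟨one_mem _, by simp⟩

theorem IsSpatialRotation.mul_transpose (hR : IsSpatialRotation R) (i j : Fin n) :
    ∑ k, R i k * R j k = if i = j then 1 else 0 := by
  have h := congrFun (congrFun ((Matrix.mem_orthogonalGroup_iff (Fin n) ℝ).1 hR.1) i) j
  simpa [Matrix.mul_apply, Matrix.star_apply, Matrix.one_apply] using h

theorem IsSpatialRotation.transpose_mul (hR : IsSpatialRotation R) (i j : Fin n) :
    ∑ k, R k i * R k j = if i = j then 1 else 0 := by
  have h := congrFun (congrFun ((Matrix.mem_orthogonalGroup_iff' (Fin n) ℝ).1 hR.1) i) j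
  simpa [Matrix.mul_apply, Matrix.star_apply, Matrix.one_apply] using h

/-- A unit vector with one entry equal to one has no length left for the others. Thus the
normalization `R 0 0 = 1` alone makes rows and columns of `R` split off the time direction. -/
theorem sq_sum_eq_zero {f : Fin n → ℝ} (h : ∑ k, f k * f k = 1) (h0 : f 0 = 1) {k : Fin n}
    (hk : k ≠ 0) : f k = 0 := by
  have h1 : ∑ k ∈ Finset.univ.erase (0 : Fin n), f k * f k = 0 := by
    have := Finset.add_sum_erase Finset.univ (fun k => f k * f k) (Finset.mem_univ (0 : Fin n))
    simp only [h, h0] at this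
    linarith
  have h2 := (Finset.sum_eq_zero_iff_of_nonneg fun k _ => mul_self_nonneg (f k)).1 h1 k
    (by simp [hk])
  exact mul_self_eq_zero.1 h2

theorem IsSpatialRotation.zero_row (hR : IsSpatialRotation R) (k : Fin n) :
    R 0 k = if k = 0 then 1 else 0 := by
  split_ifs with hk
  · rw [hk, hR.2]
  · exact sq_sum_eq_zero (f := fun k => R 0 k) (by simpa using hR.mul_transpose 0 0) hR.2 hk

theorem IsSpatialRotation.zero_col (hR : IsSpatialRotation R) (k : Fin n) :
    R k 0 = if k = 0 then 1 else 0 := by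
  split_ifs with hk
  · rw [hk, hR.2]
  · exact sq_sum_eq_zero (f := fun k => R k 0) (by simpa using hR.transpose_mul 0 0) hR.2 hk

end Rotations

/-! ### Rotated static charts and components of tensors in them. -/

section Charts

variable {n : ℕ} [NeZero n] [h3 : Fact (3 ≤ n)] {R : Matrix (Fin n) (Fin n) ℝ}

theorem chart_apply (R : Matrix (Fin n) (Fin n) ℝ) (x : Pt n) (α : Fin n) :
    chart R x α = ∑ k, R α k * toCartesian x k := rfl

theorem contDiff_chart_apply (R : Matrix (Fin n) (Fin n) ℝ) (α : Fin n) :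
    ContDiff ℝ ∞ fun x => chart R x α := by
  simp only [chart_apply]
  exact ContDiff.sum fun k _ => contDiff_const.mul (contDiff_toCartesian k)

theorem contDiff_chart (R : Matrix (Fin n) (Fin n) ℝ) : ContDiff ℝ ∞ (chart R) :=
  contDiff_pi.2 (contDiff_chart_apply R)

theorem jac_eq_pd (R : Matrix (Fin n) (Fin n) ℝ) (x : Pt n) (α μ : Fin n) :
    jac R x α μ = pd μ (fun z => chart R z α) x := rfl

theorem jac_apply (R : Matrix (Fin n) (Fin n) ℝ) (x : Pt n) (α μ : Fin n) :
    jac R x α μ = ∑ k, R α k * sphJac x k μ := by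
  have hd : ∀ k, DifferentiableAt ℝ (fun z : Pt n => toCartesian z k) x := fun k =>
    ((contDiff_toCartesian k).differentiable (by simp)) x
  simp only [jac_eq_pd, chart_apply]
  rw [pd_sum _ fun k _ => (hd k).const_mul _]
  exact Finset.sum_congr rfl fun k _ => by rw [pd_const_mul _ (hd k), pd_toCartesian]

theorem contDiff_jac (R : Matrix (Fin n) (Fin n) ℝ) (α μ : Fin n) :
    ContDiff ℝ ∞ fun x => jac R x α μ :=
  contDiff_iff_contDiffAt.2 fun _ => contDiffAt_pd (contDiff_chart_apply R α).contDiffAt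

theorem chart_zero (hR : IsSpatialRotation R) (x : Pt n) : chart R x 0 = x 0 := by
  simp [chart_apply, hR.zero_row, toCartesian_zero]

theorem jac_gram (hR : IsSpatialRotation R) (x : Pt n) (μ ν : Fin n) :
    ∑ α, jac R x α μ * jac R x α ν = if μ = ν then flatDiag μ x else 0 := by
  rw [← sphJac_gram]
  simp only [jac_apply, Finset.sum_mul_sum]
  calc ∑ α, ∑ i, ∑ j, R α i * sphJac x i μ * (R α j * sphJac x j ν)
      = ∑ i, ∑ j, (∑ α, R α i * R α j) * (sphJac x i μ * sphJac x j ν) := by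
        rw [Finset.sum_comm]
        refine Finset.sum_congr rfl fun i _ => ?_
        rw [Finset.sum_comm]
        refine Finset.sum_congr rfl fun j _ => ?_
        rw [Finset.sum_mul]
        exact Finset.sum_congr rfl fun α _ => by ring
    _ = _ := by simp [hR.transpose_mul]

theorem jac_zero_row (hR : IsSpatialRotation R) (x : Pt n) (μ : Fin n) :
    jac R x 0 μ = if μ = 0 then 1 else 0 := by
  rw [jac_apply, Finset.sum_eq_single 0 (fun k _ hk => by simp [hR.zero_row, hk]) (by simp)]
  simp [sphJac, hR.2]

theorem jac_zero_col (hR : IsSpatialRotation R) (x : Pt n) (α : Fin n) :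
    jac R x α 0 = if α = 0 then 1 else 0 := by
  rw [jac_apply, Finset.sum_eq_single 0 (fun k _ hk => by simp [sphJac, hk]) (by simp)]
  simp [sphJac, hR.zero_col]

/-- Euler's identity: the spatial Cartesian coordinates are homogeneous of degree one in `r`. -/
theorem chart_of_ne (hR : IsSpatialRotation R) (x : Pt n) {α : Fin n} (hα : α ≠ 0) :
    chart R x α = x 1 * jac R x α 1 := by
  rw [chart_apply, jac_apply, Finset.mul_sum]
  refine Finset.sum_congr rfl fun k _ => ?_
  by_cases hk : k = 0
  · subst hk; simp [hR.zero_col, hα]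
  · rw [toCartesian_of_ne x hk]
    simp only [sphJac, hk, one_ne_zero', if_false, if_true]
    ring

/-- This is the pullback of `∑ X dX = r dr`, obtained from the radial row of the Gram matrix. -/
theorem sum_chart_jac (hR : IsSpatialRotation R) (x : Pt n) (μ : Fin n) :
    ∑ α ∈ Finset.univ.filter (fun k : Fin n => k ≠ 0), chart R x α * jac R x α μ
      = if μ = 1 then x 1 else 0 := by
  have h := jac_gram hR x 1 μ
  rw [← Finset.sum_filter_add_sum_filter_not Finset.univ (fun k : Fin n => k ≠ 0)] at h
  have h0 : ∑ α ∈ Finset.univ.filter (fun k : Fin n => ¬ k ≠ 0), jac R x α 1 * jac R x α μ = 0 :=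
    Finset.sum_eq_zero fun α hα => by
      rw [Finset.mem_filter, not_not] at hα
      rw [hα.2, jac_zero_row hR, if_neg one_ne_zero', zero_mul]
  rw [h0, add_zero] at h
  rw [Finset.sum_congr rfl fun α hα => by
    rw [chart_of_ne hR x (Finset.mem_filter.1 hα).2, mul_assoc], ← Finset.mul_sum, h]
  by_cases hμ : μ = 1
  · subst hμ; simp [flatDiag]
  · simp [hμ, Ne.symm hμ]

theorem sum_chart_sq (hR : IsSpatialRotation R) (x : Pt n) :
    ∑ α ∈ Finset.univ.filter (fun k : Fin n => k ≠ 0), chart R x α ^ 2 = x 1 ^ 2 := by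
  have h := sum_chart_jac hR x 1
  rw [if_pos rfl] at h
  rw [sq (x 1)]
  nth_rewrite 2 [← h]
  rw [Finset.mul_sum]
  refine Finset.sum_congr rfl fun α hα => ?_
  rw [chart_of_ne hR x (Finset.mem_filter.1 hα).2]
  ring

theorem chart_mem_exterior (hR : IsSpatialRotation R) {ρ : ℝ} (hρ : 0 ≤ ρ) {x : Pt n}
    (hx : ρ < x 1) : chart R x ∈ exterior n ρ := by
  change ρ ^ 2 < _
  rw [sum_chart_sq hR]
  exact pow_lt_pow_left₀ hx hρ two_ne_zero

theorem isOpen_exterior (ρ : ℝ) : IsOpen (exterior n ρ) :=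
  isOpen_lt continuous_const (by fun_prop)

theorem exterior_anti {ρ σ : ℝ} (h0 : 0 ≤ ρ) (h : ρ ≤ σ) : exterior n σ ⊆ exterior n ρ :=
  fun _ hz => lt_of_le_of_lt (pow_le_pow_left₀ h0 h 2) hz

theorem flatDiag_pos {x : Pt n} (hx : x ∈ reg n 0) (μ : Fin n) : 0 < flatDiag μ x := by
  have h1 := hx.2
  have h2 := angFactor_pos hx.1 μ
  rw [flatDiag]
  split_ifs <;> positivity

theorem jac_inv_mul (hR : IsSpatialRotation R) {x : Pt n} (hx : x ∈ reg n 0) :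
    Matrix.of (fun μ α => (flatDiag μ x)⁻¹ * jac R x α μ) * jac R x = 1 := by
  ext μ ν
  rw [Matrix.mul_apply, Matrix.one_apply]
  simp only [Matrix.of_apply, mul_assoc]
  rw [← Finset.mul_sum, jac_gram hR]
  split_ifs with h
  · exact inv_mul_cancel₀ (flatDiag_pos hx μ).ne'
  · simp

/-- Since the columns of the Jacobian are orthogonal, its inverse is the transpose with rows divided
by squared lengths. -/
theorem jac_inv_apply (hR : IsSpatialRotation R) {x : Pt n} (hx : x ∈ reg n 0) (μ α : Fin n) :
    (jac R x)⁻¹ μ α = (flatDiag μ x)⁻¹ * jac R x α μ := by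
  rw [Matrix.inv_eq_left_inv (jac_inv_mul hR hx)]
  rfl

theorem isUnit_det_jac (hR : IsSpatialRotation R) {x : Pt n} (hx : x ∈ reg n 0) :
    IsUnit (jac R x).det :=
  (Matrix.isUnit_iff_isUnit_det _).1 (IsUnit.of_mul_eq_one_right _ (jac_inv_mul hR hx))

theorem compV_eq (hR : IsSpatialRotation R) {x : Pt n} (hx : x ∈ reg n 0)
    (ξ : Fin n → Pt n → ℝ) (μ : Fin n) :
    compV ξ R μ x = (flatDiag μ x)⁻¹ * ∑ α, jac R x α μ * ξ α (chart R x) := by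
  simp only [compV, Matrix.mulVec, dotProduct, jac_inv_apply hR hx, mul_assoc, Finset.mul_sum]

theorem flatDiag_zero (x : Pt n) : flatDiag 0 x = 1 := if_pos rfl

theorem flatDiag_one (x : Pt n) : flatDiag 1 x = 1 := by simp [flatDiag]

theorem flatDiag_angle (x : Pt n) {A : Fin n} (hA : 2 ≤ A.val) :
    flatDiag A x = x 1 ^ 2 * angFactor x A := by
  rw [flatDiag, if_neg (ne_zero_of_two_le hA), if_neg (ne_one_of_two_le hA)]

namespace Gauge

variable {G : Gauge n}

theorem Q.tailCoord (k : ℕ) {j : ℕ} (hj : 1 ≤ j) :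
    G.Q k 0 fun x : Pt n => tailCoord (seqExt x) 1 j := by
  have h : ∀ j, 1 < j → G.Q k 0 (fun x : Pt n => Real.sin (seqExt x j)) ∧
      G.Q k 0 fun x : Pt n => Real.cos (seqExt x j) := by
    intro j hj
    by_cases h : j < n
    · simp only [seqExt, h, dif_pos]
      exact Q.sin k (A := ⟨j, h⟩) hj
    · simp only [seqExt, h, dif_neg, not_false_iff]
      exact ⟨Q.const G k _, Q.const G k _⟩
  unfold AdS.tailCoord
  simpa using (Q.prod (Finset.Ioc 1 j) fun B hB =>
    (h B (Finset.mem_Ioc.1 hB).1).1).mul (h (j + 1) (by omega)).2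

theorem Q.radialJac (k : ℕ) (R : Matrix (Fin n) (Fin n) ℝ) (α : Fin n) :
    G.Q k 0 fun x => jac R x α 1 := by
  simp only [jac_apply]
  refine Q.sum _ fun i _ => Q.const_mul ?_ _
  by_cases hi : i = 0
  · simp only [sphJac, hi, if_true, if_neg one_ne_zero']
    exact Q.zero G k 0
  · simp only [sphJac, hi, if_false, if_neg one_ne_zero', if_true]
    exact Q.tailCoord k (Nat.one_le_iff_ne_zero.2 fun h => hi (Fin.ext h))

end Gauge

/-- Smooth functions of the Cartesian coordinates are smooth in each chart. -/
theorem sm_comp_chart (hR : IsSpatialRotation R) {f : Pt n → ℝ} {ρ : ℝ} (hρ : 0 ≤ ρ)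
    (hf : ContDiffOn ℝ ∞ f (exterior n ρ)) : Sm fun x => f (chart R x) := by
  refine eventually_atInf.2 ⟨ρ, fun x hx => ?_⟩
  have hm := chart_mem_exterior hR hρ hx.2
  exact ContDiffAt.comp x (hf.contDiffAt ((isOpen_exterior ρ).mem_nhds hm))
    (contDiff_chart R).contDiffAt

theorem sm_jac (α μ : Fin n) : Sm fun x => jac R x α μ :=
  .of_forall fun _ => (contDiff_jac R α μ).contDiffAt

theorem IsSmoothPerturbation.sm_comp2 {h : Fin n → Fin n → Pt n → ℝ}
    (hh : IsSmoothPerturbation h) (hR : IsSpatialRotation R) (μ ν : Fin n) :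
    Sm (comp2 h R μ ν) := by
  obtain ⟨ρ, hρ, hs, -⟩ := hh
  exact Sm.sum _ fun α _ => Sm.sum _ fun β _ =>
    ((sm_jac α μ).mul (sm_jac β ν)).mul (sm_comp_chart hR hρ.le (hs α β))

theorem IsSmoothPerturbation.comp2_symm {h : Fin n → Fin n → Pt n → ℝ}
    (hh : IsSmoothPerturbation h) (hR : IsSpatialRotation R) :
    ∀ᶠ x in atInf n, ∀ μ ν, comp2 h R μ ν x = comp2 h R ν μ x := by
  obtain ⟨ρ, hρ, -, hs⟩ := hh
  filter_upwards [eventually_reg ρ] with x hx μ ν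
  simp only [comp2]
  rw [Finset.sum_comm]
  refine Finset.sum_congr rfl fun α _ => Finset.sum_congr rfl fun β _ => ?_
  rw [hs β α _ (chart_mem_exterior hR hρ.le hx.2)]
  ring

/-- The inverse of the Jacobian. -/
noncomputable def coframe (R : Matrix (Fin n) (Fin n) ℝ) (μ α : Fin n) (x : Pt n) : ℝ :=
  (flatDiag μ x)⁻¹ * jac R x α μ

theorem sm_inv_flatDiag (μ : Fin n) : Sm fun x : Pt n => (flatDiag μ x)⁻¹ := by
  have h : Sm (flatDiag (n := n) μ) := by
    unfold flatDiag
    split_ifs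
    · exact Sm.const 1
    · exact Sm.const 1
    · refine ((Gauge.Q.rpow (G := bigO n) 0 2).mul (Gauge.Q.angFactor 0 μ)).sm.congr
        (.of_forall fun x => ?_)
      simp only [Real.rpow_two]
  filter_upwards [h, eventually_reg 0] with x hx hx0 using hx.inv (flatDiag_pos hx0 μ).ne'

theorem sm_coframe (μ α : Fin n) : Sm (coframe R μ α) := (sm_inv_flatDiag μ).mul (sm_jac α μ)

theorem compV_eventuallyEq (hR : IsSpatialRotation R) (ξ : Fin n → Pt n → ℝ) (μ : Fin n) :
    compV ξ R μ =ᶠ[atInf n] fun x => ∑ α, coframe R μ α x * ξ α (chart R x) := by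
  filter_upwards [eventually_reg 0] with x hx
  rw [compV_eq hR hx, Finset.mul_sum]
  simp only [coframe, mul_assoc]

theorem IsSmoothVectorField.sm_compV {ξ : Fin n → Pt n → ℝ} (hξ : IsSmoothVectorField ξ)
    (hR : IsSpatialRotation R) (μ : Fin n) : Sm (compV ξ R μ) := by
  obtain ⟨ρ, hρ, hs⟩ := hξ
  exact (Sm.sum _ fun α _ => (sm_coframe μ α).mul (sm_comp_chart hR hρ.le (hs α))).congr
    (compV_eventuallyEq hR ξ μ).symm

/-- The distance from the origin in Cartesian static coordinates. -/
noncomputable def radius (z : Pt n) : ℝ :=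
  Real.sqrt (∑ k ∈ Finset.univ.filter (fun k : Fin n => k ≠ 0), z k ^ 2)

theorem radius_chart (hR : IsSpatialRotation R) {x : Pt n} (hx : 0 ≤ x 1) :
    radius (chart R x) = x 1 := by
  rw [radius, sum_chart_sq hR, Real.sqrt_sq hx]

theorem radius_pos {z : Pt n} {ρ : ℝ} (hz : z ∈ exterior n ρ) : 0 < radius z :=
  Real.sqrt_pos.2 ((sq_nonneg ρ).trans_lt hz)

theorem contDiffOn_radius (ρ : ℝ) : ContDiffOn ℝ ∞ (radius (n := n)) (exterior n ρ) := by
  intro z hz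
  have h0 : (∑ k ∈ Finset.univ.filter (fun k : Fin n => k ≠ 0), z k ^ 2) ≠ 0 :=
    ((sq_nonneg ρ).trans_lt hz).ne'
  refine (ContDiffAt.sqrt (f := fun z : Pt n =>
    ∑ k ∈ Finset.univ.filter (fun k : Fin n => k ≠ 0), z k ^ 2) ?_ h0).contDiffWithinAt
  exact (ContDiff.sum fun k _ => (contDiff_apply ℝ ℝ k).pow 2).contDiffAt

end Charts


/-! ### Covariant derivatives written out in components. -/

section Expansions

variable {n : ℕ} [NeZero n] [h3 : Fact (3 ≤ n)]

theorem update_vec_two_zero (μ ν ρ : Fin n) : Function.update ![μ, ν] 0 ρ = ![ρ, ν] := by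
  ext i; fin_cases i <;> rfl

theorem update_vec_two_one (μ ν ρ : Fin n) : Function.update ![μ, ν] 1 ρ = ![μ, ρ] := by
  ext i; fin_cases i <;> rfl

theorem update_vec_three_zero (κ μ ν ρ : Fin n) :
    Function.update ![κ, μ, ν] 0 ρ = ![ρ, μ, ν] := by
  ext i; fin_cases i <;> rfl

theorem update_vec_three_one (κ μ ν ρ : Fin n) :
    Function.update ![κ, μ, ν] 1 ρ = ![κ, ρ, ν] := by
  ext i; fin_cases i <;> rfl

theorem update_vec_three_two (κ μ ν ρ : Fin n) :
    Function.update ![κ, μ, ν] 2 ρ = ![κ, μ, ρ] := by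
  ext i; fin_cases i <;> rfl

theorem covD_zero (l : ℝ) (T : Tensor n 0) (σ : Fin n) (a : Fin 0 → Fin n) (x : Pt n) :
    covD l T σ a x = pd σ (T a) x := by
  simp [covD]

theorem covD_one (l : ℝ) (T : Tensor n 1) (σ μ : Fin n) (x : Pt n) :
    covD l T σ ![μ] x = pd σ (T ![μ]) x + ∑ ρ, christoffel l x μ σ ρ * T ![ρ] x := by
  have : ∀ ρ : Fin n, Function.update ![μ] 0 ρ = ![ρ] := fun ρ => by
    ext i; fin_cases i; rfl
  simp [covD, this]

theorem covD_two (l : ℝ) (T : Tensor n 2) (σ μ ν : Fin n) (x : Pt n) :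
    covD l T σ ![μ, ν] x = pd σ (T ![μ, ν]) x + ∑ ρ, christoffel l x μ σ ρ * T ![ρ, ν] x
      + ∑ ρ, christoffel l x ν σ ρ * T ![μ, ρ] x := by
  simp only [covD, Fin.sum_univ_two, update_vec_two_zero, update_vec_two_one, Matrix.cons_val]
  ring

theorem covD_three (l : ℝ) (T : Tensor n 3) (σ κ μ ν : Fin n) (x : Pt n) :
    covD l T σ ![κ, μ, ν] x = pd σ (T ![κ, μ, ν]) x
      + ∑ ρ, christoffel l x κ σ ρ * T ![ρ, μ, ν] x
      + ∑ ρ, christoffel l x μ σ ρ * T ![κ, ρ, ν] x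
      + ∑ ρ, christoffel l x ν σ ρ * T ![κ, μ, ρ] x := by
  simp only [covD, Fin.sum_univ_three, update_vec_three_zero, update_vec_three_one,
    update_vec_three_two, Matrix.cons_val]
  ring

theorem gradUp_cons {l : ℝ} (hl : 0 < l) {k : ℕ} (T : Tensor n k) (ρ : Fin n)
    (a : Fin k → Fin n) {x : Pt n} (hx : x ∈ reg n 0) :
    gradUp l T (Fin.cons ρ a) x = (gdiag l ρ x)⁻¹ * covD l T ρ a x := by
  simp [gradUp, gbar_inv hl hx]

theorem gradUp_zero {l : ℝ} (hl : 0 < l) (T : Tensor n 0) (ρ : Fin n) {x : Pt n}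
    (hx : x ∈ reg n 0) : gradUp l T ![ρ] x = (gdiag l ρ x)⁻¹ * pd ρ (T ![]) x := by
  rw [← covD_zero]
  exact gradUp_cons hl T ρ ![] hx

theorem gradUp_one {l : ℝ} (hl : 0 < l) (T : Tensor n 1) (ρ μ : Fin n) {x : Pt n}
    (hx : x ∈ reg n 0) : gradUp l T ![ρ, μ] x = (gdiag l ρ x)⁻¹ * covD l T ρ ![μ] x :=
  gradUp_cons hl T ρ ![μ] hx

theorem gradUp_two {l : ℝ} (hl : 0 < l) (T : Tensor n 2) (ρ μ ν : Fin n) {x : Pt n}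
    (hx : x ∈ reg n 0) : gradUp l T ![ρ, μ, ν] x = (gdiag l ρ x)⁻¹ * covD l T ρ ![μ, ν] x :=
  gradUp_cons hl T ρ ![μ, ν] hx

theorem gradUp_three {l : ℝ} (hl : 0 < l) (T : Tensor n 3) (κ ρ μ ν : Fin n) {x : Pt n}
    (hx : x ∈ reg n 0) :
    gradUp l T ![κ, ρ, μ, ν] x = (gdiag l κ x)⁻¹ * covD l T κ ![ρ, μ, ν] x :=
  gradUp_cons hl T κ ![ρ, μ, ν] hx

theorem contDiff_angFactor (A : Fin n) : ContDiff ℝ ∞ fun x : Pt n => angFactor x A :=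
  contDiff_prod fun B _ => (Real.contDiff_sin.comp (contDiff_apply ℝ ℝ B)).pow 2

theorem contDiff_gdiag {l : ℝ} (hl : 0 < l) (μ : Fin n) : ContDiff ℝ ∞ (gdiag (n := n) l μ) := by
  have h1 : ContDiff ℝ ∞ fun x : Pt n => 1 + x 1 ^ 2 / l ^ 2 := by fun_prop
  unfold gdiag
  split_ifs
  · exact h1.neg
  · exact h1.inv fun x => by positivity
  · exact ((contDiff_apply ℝ ℝ 1).pow 2).mul (contDiff_angFactor μ)

theorem contDiffAt_inv_gdiag {l : ℝ} (hl : 0 < l) (μ : Fin n) {x : Pt n} (hx : x ∈ reg n 0) :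
    ContDiffAt ℝ ∞ (fun z => (gdiag l μ z)⁻¹) x :=
  (contDiff_gdiag hl μ).contDiffAt.inv (gdiag_ne_zero hl hx μ)

theorem pd_inv {μ : Fin n} {u : Pt n → ℝ} {x : Pt n} (hu : DifferentiableAt ℝ u x)
    (h0 : u x ≠ 0) : pd μ (fun z => (u z)⁻¹) x = -(u x)⁻¹ ^ 2 * pd μ u x := by
  have h := (hasDerivAt_inv h0).comp_hasFDerivAt x hu.hasFDerivAt
  have h' : fderiv ℝ (fun z => (u z)⁻¹) x = _ := h.fderiv
  rw [pd, h', pd]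
  simp

/-- The vanishing of the covariant derivative of the inverse metric, in a form that trades the
connection term on a raised derivative index for the usual one on a lowered index. -/
theorem metric_compat {l : ℝ} (hl : 0 < l) {x : Pt n} (hx : x ∈ reg n 0) (μ ν σ : Fin n) :
    (if ν = σ then pd μ (fun z => (gdiag l ν z)⁻¹) x else 0)
      + christoffel l x ν μ σ * (gdiag l σ x)⁻¹
      = -((gdiag l ν x)⁻¹ * christoffel l x σ μ ν) := by
  rw [pd_inv ((contDiff_gdiag hl ν).differentiable (by simp) x) (gdiag_ne_zero hl hx ν),
    christoffel_eq hl hx, christoffel_eq hl hx]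
  by_cases h1 : ν = σ
  · subst h1
    by_cases h2 : ν = μ
    · subst h2; simp; ring
    · simp [h2, Ne.symm h2]; ring
  · by_cases h2 : ν = μ
    · subst h2
      simp [h1, Ne.symm h1]
      ring
    · by_cases h4 : σ = μ
      · subst h4
        simp [h1, Ne.symm h1]
        ring
      · simp [h1, Ne.symm h1, h2, h4, Ne.symm h2, Ne.symm h4]

theorem contDiff_christoffel {l : ℝ} (hl : 0 < l) {x : Pt n} (hx : x ∈ reg n 0)
    (κ μ ν : Fin n) : ContDiffAt ℝ ∞ (fun z => christoffel l z κ μ ν) x := by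
  have hp : ∀ α β : Fin n, ContDiffAt ℝ ∞ (pd α (gdiag l β)) x := fun α β =>
    contDiffAt_pd (contDiff_gdiag hl β).contDiffAt
  have h : ContDiffAt ℝ ∞ (fun z => 1 / 2 * (gdiag l κ z)⁻¹ *
      ((if κ = ν then pd μ (gdiag l κ) z else 0) + (if κ = μ then pd ν (gdiag l κ) z else 0)
        - if μ = ν then pd κ (gdiag l μ) z else 0)) x := by
    refine (contDiffAt_const.mul (contDiffAt_inv_gdiag hl κ hx)).mul ((ContDiffAt.add ?_ ?_).sub ?_)
    all_goals
      split_ifs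
      · exact hp _ _
      · exact contDiffAt_const
  refine h.congr_of_eventuallyEq ?_
  filter_upwards [(isOpen_reg 0).mem_nhds hx] with z hz using christoffel_eq hl hz κ μ ν

theorem contDiffAt_covD {l : ℝ} (hl : 0 < l) {x : Pt n} (hx : x ∈ reg n 0) {k : ℕ}
    {T : Tensor n k} (hT : ∀ a, ContDiffAt ℝ ∞ (T a) x) (σ : Fin n) (a : Fin k → Fin n) :
    ContDiffAt ℝ ∞ (covD l T σ a) x := by
  refine (contDiffAt_pd (hT a)).add (ContDiffAt.sum fun i _ => ContDiffAt.sum fun ρ _ => ?_)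
  exact (contDiff_christoffel hl hx _ _ _).mul (hT _)

/-- The Hessian of a scalar. -/
theorem gradUp_gradUp_zero {l : ℝ} (hl : 0 < l) {x : Pt n} (hx : x ∈ reg n 0)
    {t : Tensor n 0} (ht : ContDiffAt ℝ ∞ (t ![]) x) (μ ν : Fin n) :
    gradUp l (gradUp l t) ![μ, ν] x = (gdiag l μ x)⁻¹ * (gdiag l ν x)⁻¹ *
      (pd μ (pd ν (t ![])) x - ∑ σ, christoffel l x σ μ ν * pd σ (t ![]) x) := by
  have hB : ∀ ρ : Fin n, gradUp l t ![ρ] =ᶠ[𝓝 x] fun z => (gdiag l ρ z)⁻¹ * pd ρ (t ![]) z := by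
    intro ρ
    filter_upwards [(isOpen_reg 0).mem_nhds hx] with z hz using gradUp_zero hl t ρ hz
  rw [gradUp_one hl _ _ _ hx, covD_one, pd_congr (hB ν),
    pd_mul ((contDiffAt_inv_gdiag hl ν hx).differentiableAt (by simp))
      ((contDiffAt_pd ht).differentiableAt (by simp))]
  simp only [fun ρ => (hB ρ).eq_of_nhds]
  -- The derivative of the inverse metric cancels against part of the connection term, leaving the
  -- classical Hessian with lowered indices.
  have h1 : ∑ ρ, christoffel l x ν μ ρ * ((gdiag l ρ x)⁻¹ * pd ρ (t ![]) x)
      = ∑ ρ, (-((gdiag l ν x)⁻¹ * christoffel l x ρ μ ν) * pd ρ (t ![]) x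
        - (if ν = ρ then pd μ (fun z => (gdiag l ν z)⁻¹) x else 0) * pd ρ (t ![]) x) := by
    refine Finset.sum_congr rfl fun ρ _ => ?_
    rw [← metric_compat hl hx]
    ring
  rw [h1, Finset.sum_sub_distrib]
  simp only [ite_mul, zero_mul, Finset.sum_ite_eq, Finset.mem_univ, if_true, neg_mul,
    Finset.sum_neg_distrib, mul_assoc, ← Finset.mul_sum]
  ring

/-- The second covariant derivative of a tensor of rank two. -/
theorem gradUp_gradUp_two {l : ℝ} (hl : 0 < l) {x : Pt n} (hx : x ∈ reg n 0)
    {T : Tensor n 2} (hT : ∀ a, ContDiffAt ℝ ∞ (T a) x) (κ ρ μ ν : Fin n) :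
    gradUp l (gradUp l T) ![κ, ρ, μ, ν] x = (gdiag l κ x)⁻¹ * (gdiag l ρ x)⁻¹ *
      (pd κ (covD l T ρ ![μ, ν]) x - ∑ σ, christoffel l x σ κ ρ * covD l T σ ![μ, ν] x
        + ∑ σ, christoffel l x μ κ σ * covD l T ρ ![σ, ν] x
        + ∑ σ, christoffel l x ν κ σ * covD l T ρ ![μ, σ] x) := by
  have hB : ∀ ρ μ ν : Fin n, gradUp l T ![ρ, μ, ν] =ᶠ[𝓝 x]
      fun z => (gdiag l ρ z)⁻¹ * covD l T ρ ![μ, ν] z := by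
    intro ρ μ ν
    filter_upwards [(isOpen_reg 0).mem_nhds hx] with z hz using gradUp_two hl T ρ μ ν hz
  rw [gradUp_three hl _ _ _ _ _ hx, covD_three, pd_congr (hB ρ μ ν),
    pd_mul ((contDiffAt_inv_gdiag hl ρ hx).differentiableAt (by simp))
      ((contDiffAt_covD hl hx hT ρ _).differentiableAt (by simp))]
  simp only [fun ρ μ ν => (hB ρ μ ν).eq_of_nhds]
  have h1 : ∑ σ, christoffel l x ρ κ σ * ((gdiag l σ x)⁻¹ * covD l T σ ![μ, ν] x)
      = ∑ σ, (-((gdiag l ρ x)⁻¹ * christoffel l x σ κ ρ) * covD l T σ ![μ, ν] x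
        - (if ρ = σ then pd κ (fun z => (gdiag l ρ z)⁻¹) x else 0) * covD l T σ ![μ, ν] x) := by
    refine Finset.sum_congr rfl fun σ _ => ?_
    rw [← metric_compat hl hx]
    ring
  have h2 : ∀ α : Fin n, ∀ f : Fin n → ℝ, ∑ σ, christoffel l x α κ σ * ((gdiag l ρ x)⁻¹ * f σ)
      = (gdiag l ρ x)⁻¹ * ∑ σ, christoffel l x α κ σ * f σ := by
    intro α f
    rw [Finset.mul_sum]
    exact Finset.sum_congr rfl fun σ _ => by ring
  rw [h1, Finset.sum_sub_distrib, h2, h2]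
  simp only [ite_mul, zero_mul, Finset.sum_ite_eq, Finset.mem_univ, if_true, neg_mul,
    Finset.sum_neg_distrib, mul_assoc, ← Finset.mul_sum]
  ring

end Expansions

/-! ### Symmetry of the linear operator. -/

section Symmetry

variable {n : ℕ} [NeZero n] [h3 : Fact (3 ≤ n)]

theorem raise_apply {l : ℝ} (hl : 0 < l) {x : Pt n} (hx : x ∈ reg n 0)
    (h : Fin n → Fin n → Pt n → ℝ) (μ ν : Fin n) :
    raise l h ![μ, ν] x = (gdiag l μ x)⁻¹ * (gdiag l ν x)⁻¹ * h μ ν x := by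
  simp [raise, gbar_inv hl hx]

theorem trace_apply {l : ℝ} (hl : 0 < l) {x : Pt n} (hx : x ∈ reg n 0)
    (h : Fin n → Fin n → Pt n → ℝ) :
    trace l h ![] x = ∑ α, (gdiag l α x)⁻¹ * h α α x := by
  simp [trace, gbar_inv hl hx]

theorem contDiffAt_raise {l : ℝ} (hl : 0 < l) {x : Pt n} (hx : x ∈ reg n 0)
    {h : Fin n → Fin n → Pt n → ℝ} (hh : ∀ μ ν, ContDiffAt ℝ ∞ (h μ ν) x) (a : Fin 2 → Fin n) :
    ContDiffAt ℝ ∞ (raise l h a) x := by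
  have ha : a = ![a 0, a 1] := by ext i; fin_cases i <;> rfl
  rw [ha]
  refine (((contDiffAt_inv_gdiag hl (a 0) hx).mul (contDiffAt_inv_gdiag hl (a 1) hx)).mul
    (hh (a 0) (a 1))).congr_of_eventuallyEq ?_
  filter_upwards [(isOpen_reg 0).mem_nhds hx] with z hz using raise_apply hl hz h _ _

theorem contDiffAt_trace {l : ℝ} (hl : 0 < l) {x : Pt n} (hx : x ∈ reg n 0)
    {h : Fin n → Fin n → Pt n → ℝ} (hh : ∀ μ ν, ContDiffAt ℝ ∞ (h μ ν) x) :
    ContDiffAt ℝ ∞ (trace l h ![]) x := by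
  refine (ContDiffAt.sum (s := Finset.univ) fun α _ => (contDiffAt_inv_gdiag hl α hx).mul
    (hh α α)).congr_of_eventuallyEq ?_
  filter_upwards [(isOpen_reg 0).mem_nhds hx] with z hz using trace_apply hl hz h

theorem covD_two_symm {l : ℝ} {x : Pt n} {T : Tensor n 2}
    (hT : ∀ᶠ z in 𝓝 x, ∀ μ ν, T ![μ, ν] z = T ![ν, μ] z) (σ μ ν : Fin n) :
    covD l T σ ![μ, ν] x = covD l T σ ![ν, μ] x := by
  have h0 := hT.self_of_nhds
  have h1 : T ![μ, ν] =ᶠ[𝓝 x] T ![ν, μ] := hT.mono fun z hz => hz μ ν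
  rw [covD_two, covD_two, pd_congr h1]
  simp only [h0 _ ν, h0 μ _]
  ring

/-- The Hessian of the trace is symmetric because the connection has no torsion. The terms `D_λ D^μ
h^{νλ}` occur symmetrized, and the others inherit the symmetry of `h`. -/
theorem linCore_symm {l : ℝ} (hl : 0 < l) (Λ : ℝ) {x : Pt n} (hx : x ∈ reg n 0)
    {h : Fin n → Fin n → Pt n → ℝ} (hh : ∀ μ ν, ContDiffAt ℝ ∞ (h μ ν) x)
    (hs : ∀ᶠ z in 𝓝 x, ∀ μ ν, h μ ν z = h ν μ z) (μ ν : Fin n) :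
    linCore l Λ h μ ν x = linCore l Λ h ν μ x := by
  have hr : ∀ᶠ z in 𝓝 x, ∀ μ ν, raise l h ![μ, ν] z = raise l h ![ν, μ] z := by
    filter_upwards [hs, (isOpen_reg 0).mem_nhds hx] with z hz hzr μ ν
    rw [raise_apply hl hzr, raise_apply hl hzr, hz μ ν]
    ring
  have hcov : ∀ᶠ z in 𝓝 x, ∀ σ μ ν,
      covD l (raise l h) σ ![μ, ν] z = covD l (raise l h) σ ![ν, μ] z :=
    hr.eventually_nhds.mono fun z hz σ μ ν => covD_two_symm hz σ μ ν
  have hcr := contDiffAt_raise hl hx hh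
  have hct := contDiffAt_trace hl hx hh
  have hDDh : ∀ κ ρ, gradUp l (gradUp l (raise l h)) ![κ, ρ, μ, ν] x
      = gradUp l (gradUp l (raise l h)) ![κ, ρ, ν, μ] x := by
    intro κ ρ
    have h1 : covD l (raise l h) ρ ![μ, ν] =ᶠ[𝓝 x] covD l (raise l h) ρ ![ν, μ] :=
      hcov.mono fun z hz => hz ρ μ ν
    have h0 := hcov.self_of_nhds
    rw [gradUp_gradUp_two hl hx hcr, gradUp_gradUp_two hl hx hcr, pd_congr h1]
    simp only [fun σ α => h0 σ α ν, fun σ α => h0 σ μ α]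
    ring
  have hDDt : gradUp l (gradUp l (trace l h)) ![μ, ν] x
      = gradUp l (gradUp l (trace l h)) ![ν, μ] x := by
    rw [gradUp_gradUp_zero hl hx hct, gradUp_gradUp_zero hl hx hct, pd_comm hct]
    simp only [christoffel_symm hl hx _ μ ν]
    ring
  have hg : (gbar l x)⁻¹ μ ν = (gbar l x)⁻¹ ν μ := by
    rw [gbar_inv hl hx, gbar_inv hl hx]
    by_cases h : μ = ν
    · subst h; rfl
    · rw [if_neg h, if_neg (Ne.symm h)]
  simp only [linCore]
  rw [hr.self_of_nhds μ ν, hDDt, hg]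
  simp only [hDDh]
  congr 2
  refine Finset.sum_congr rfl fun κ _ => Finset.sum_congr rfl fun ρ _ => ?_
  rw [add_comm (gradUp l (gradUp l (raise l h)) ![κ, μ, ν, ρ] x)]

theorem linOp_symm {l : ℝ} (hl : 0 < l) (Λ : ℝ) {h : Fin n → Fin n → Pt n → ℝ}
    (hh : IsSmoothPerturbation h) {R : Matrix (Fin n) (Fin n) ℝ} (hR : IsSpatialRotation R) :
    ∀ᶠ x in atInf n, ∀ μ ν,
      linOp l Λ (comp2 h R) μ ν x = linOp l Λ (comp2 h R) ν μ x := by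
  have hsm : ∀ᶠ x in atInf n, ∀ μ ν, ContDiffAt ℝ ∞ (comp2 h R μ ν) x :=
    eventually_all.2 fun μ => eventually_all.2 fun ν => hh.sm_comp2 hR μ ν
  filter_upwards [eventually_reg 0, hsm, eventually_nhds_of_atInf (hh.comp2_symm hR)]
    with x hx hx1 hx2 μ ν
  rw [linOp_eq, linOp_eq, linCore_symm hl Λ hx hx1 hx2]

end Symmetry


/-! ### Functions that decay arbitrarily slowly along a sequence. -/

section SlowFunctions

/-- Smooth functions which tend to zero together with their derivatives, but not fast along a
given sequence. -/
theorem exists_slow_decay (s : ℕ → ℝ) : ∃ E : ℝ → ℝ, ContDiff ℝ ∞ E ∧ Tendsto E atTop (𝓝 0) ∧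
    Tendsto (deriv E) atTop (𝓝 0) ∧ ∀ k, (1 / 2 : ℝ) ^ k ≤ E (s k) := by
  let φ : ContDiffBump (0 : ℝ) := default
  have hφ : ContDiff ℝ ∞ φ := φ.contDiff
  have hsupp : HasCompactSupport φ := φ.hasCompactSupport
  have hbound : ∀ m : ℕ, ∃ C, ∀ t, ‖iteratedFDeriv ℝ m φ t‖ ≤ C := fun m =>
    (hsupp.iteratedFDeriv m).exists_bound_of_continuous
      (hφ.continuous_iteratedFDeriv (by exact_mod_cast le_top))
  choose C hC using hbound
  have hsum : Summable fun k : ℕ => (1 / 2 : ℝ) ^ k := summable_geometric_two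
  let F : ℕ → ℝ → ℝ := fun k t => (1 / 2 : ℝ) ^ k * φ (t - s k)
  have hFc : ∀ k, ContDiff ℝ ∞ (F k) := fun k =>
    contDiff_const.mul (hφ.comp (contDiff_id.sub contDiff_const))
  have hE : ContDiff ℝ ∞ fun t => ∑' k, F k t := by
    -- All summands are weighted translates of one bump, so a single bound per derivative works and
    -- the geometric weights give convergence of every derivative.
    refine contDiff_tsum (v := fun m k => (1 / 2 : ℝ) ^ k * C m) hFc
      (fun m _ => hsum.mul_right _) fun m k t _ => ?_
    have h1 : F k = fun t => ((1 / 2 : ℝ) ^ k) • (φ (t - s k)) := rfl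
    rw [h1, iteratedFDeriv_const_smul_apply' (f := fun t => φ (t - s k))
      ((hφ.comp (contDiff_id.sub contDiff_const)).contDiffAt.of_le (by exact_mod_cast le_top)),
      norm_smul, iteratedFDeriv_comp_sub, Real.norm_of_nonneg (by positivity)]
    exact mul_le_mul_of_nonneg_left (hC m _) (by positivity)
  have hev : ∀ ψ : ℝ → ℝ, HasCompactSupport ψ → ∀ k, ∀ᶠ t in atTop, ψ (t - s k) = 0 := by
    intro ψ hψ k
    obtain ⟨M, hM⟩ := hψ.isCompact.isBounded.exists_norm_le
    filter_upwards [eventually_gt_atTop (s k + M)] with t ht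
    by_contra h
    have := hM _ (subset_tsupport ψ h)
    rw [Real.norm_eq_abs] at this
    have := (le_abs_self _).trans this
    linarith
  have hdF : ∀ k t, HasDerivAt (F k) ((1 / 2 : ℝ) ^ k * deriv φ (t - s k)) t := by
    intro k t
    have h1 := ((hφ.differentiable (by simp)) (t - s k)).hasDerivAt
    exact (h1.comp_sub_const t (s k)).const_mul _
  have hd1 : ∀ t, |deriv φ t| ≤ C 1 := fun t => by
    have := hC 1 t
    rwa [norm_iteratedFDeriv_one, ← norm_deriv_eq_norm_fderiv, Real.norm_eq_abs] at this
  have hle : ∀ k t, |φ (t - s k)| ≤ 1 := fun k t => by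
    rw [abs_of_nonneg φ.nonneg]; exact φ.le_one
  have hs0 : ∀ t, Summable fun k => F k t := fun t =>
    hsum.of_norm_bounded fun k => by
      rw [norm_mul, Real.norm_of_nonneg (by positivity : (0 : ℝ) ≤ (1 / 2) ^ k)]
      exact mul_le_of_le_one_right (by positivity) (hle k t)
  have hderiv : deriv (fun t => ∑' k, F k t) = fun t => ∑' k, (1 / 2 : ℝ) ^ k * deriv φ (t - s k) := by
    ext t
    refine (hasDerivAt_tsum (hsum.mul_right (C 1)) hdF (fun k t => ?_) (hs0 0) t).deriv
    rw [norm_mul, Real.norm_of_nonneg (by positivity)]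
    exact mul_le_mul_of_nonneg_left (hd1 _) (by positivity)
  refine ⟨fun t => ∑' k, F k t, hE, ?_, ?_, fun k => ?_⟩
  -- Each summand vanishes for large `t` by compact support; the geometric weights dominate the sum.
  · have := tendsto_tsum_of_dominated_convergence (𝓕 := atTop) (f := fun t k => F k t)
      (g := fun _ => (0 : ℝ)) hsum (fun k => ?_) (.of_forall fun t k => ?_)
    · simpa using this
    · refine tendsto_const_nhds.congr' ?_
      filter_upwards [hev φ hsupp k] with t ht
      simp [F, ht]
    · rw [norm_mul, Real.norm_of_nonneg (by positivity : (0 : ℝ) ≤ (1 / 2) ^ k)]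
      exact mul_le_of_le_one_right (by positivity) (hle k t)
  · rw [hderiv]
    have := tendsto_tsum_of_dominated_convergence (𝓕 := atTop)
      (f := fun t k => (1 / 2 : ℝ) ^ k * deriv φ (t - s k))
      (g := fun _ => (0 : ℝ)) (hsum.mul_right (C 1)) (fun k => ?_) (.of_forall fun t k => ?_)
    · simpa using this
    · refine tendsto_const_nhds.congr' ?_
      filter_upwards [hev (deriv φ) hsupp.deriv k] with t ht
      simp [ht]
    · rw [norm_mul, Real.norm_of_nonneg (by positivity)]
      exact mul_le_mul_of_nonneg_left (hd1 _) (by positivity)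
  -- All summands are nonnegative and the `k`-th one equals its weight at `s k`. No separation of
  -- the points `s k` is needed.
  · refine le_trans ?_ ((hs0 (s k)).le_tsum k fun j _ => ?_)
    · have : φ 0 = 1 := φ.one_of_mem_closedBall (by simpa using φ.rIn_pos.le)
      simp [F, this]
    · exact mul_nonneg (by positivity) φ.nonneg

end SlowFunctions

/-! ### Small vector fields are asymptotic Killing vectors. -/

section SmallFunctions

variable {n : ℕ} [NeZero n] [h3 : Fact (3 ≤ n)]

theorem Gauge.P_sum (G : Gauge n) {ι : Type*} (s : Finset ι) {m : ℝ} {u : ι → Pt n → ℝ}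
    (h : ∀ i ∈ s, G.P m (u i)) : G.P m fun x => ∑ i ∈ s, u i x := by
  classical
  induction s using Finset.induction_on with
  | empty => simpa using G.zero m
  | insert a s ha ih =>
    simp only [Finset.sum_insert ha]
    exact G.add (h a (by simp)) (ih fun i hi => h i (by simp [hi]))

/-- `u → o(r^m)` in one chart. -/
def ChartLittleO (m : ℝ) (u : Pt n → ℝ) : Prop :=
  ∀ K : Set (Pt n), IsCompact K → K ⊆ chartBox n →
    ∀ ε : ℝ, 0 < ε → ∀ᶠ r : ℝ in atTop, ∀ x ∈ K, |u (Function.update x 1 r)| ≤ ε * r ^ m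

theorem LittleO.chart {m : ℝ} {u : ChartFun n} (h : LittleO m u)
    {R : Matrix (Fin n) (Fin n) ℝ} (hR : IsSpatialRotation R) : ChartLittleO m (u R) := h R hR

namespace ChartLittleO

variable {m k : ℝ} {u v : Pt n → ℝ}

theorem bigO (h : ChartLittleO m u) : (bigO n).P m u := fun K hK hKb =>
  ⟨1, h K hK hKb 1 one_pos⟩

theorem congr (h : ChartLittleO m u) (huv : u =ᶠ[atInf n] v) : ChartLittleO m v := by
  intro K hK hKb ε hε
  filter_upwards [h K hK hKb ε hε, eventually_update huv] with r hr hr' x hx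
  rw [← hr' x (hKb hx)]
  exact hr x hx

theorem add (h : ChartLittleO m u) (h' : ChartLittleO m v) :
    ChartLittleO m fun x => u x + v x := by
  intro K hK hKb ε hε
  filter_upwards [h K hK hKb (ε / 2) (half_pos hε), h' K hK hKb (ε / 2) (half_pos hε)]
    with r hr hr' x hx
  refine (abs_add_le _ _).trans ((add_le_add (hr x hx) (hr' x hx)).trans (le_of_eq ?_))
  ring

theorem mono (h : ChartLittleO m u) (hmk : m ≤ k) : ChartLittleO k u := by
  intro K hK hKb ε hε
  filter_upwards [h K hK hKb ε hε, eventually_ge_atTop 1] with r hr hr1 x hx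
  exact (hr x hx).trans (by gcongr)

theorem mul (h : ChartLittleO m u) (h' : (AdS.bigO n).P k v) :
    ChartLittleO (m + k) fun x => u x * v x := by
  intro K hK hKb ε hε
  obtain ⟨C, hC0, hC⟩ := ChartBigO.nonneg h' hK hKb
  filter_upwards [h K hK hKb (ε / (C + 1)) (by positivity), hC, eventually_gt_atTop 0]
    with r hr hr' hr0 x hx
  rw [abs_mul, Real.rpow_add hr0]
  have h2 : ε / (C + 1) * C ≤ ε := by
    rw [div_mul_eq_mul_div, div_le_iff₀ (by positivity)]
    nlinarith
  calc _ ≤ (ε / (C + 1) * r ^ m) * (C * r ^ k) :=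
        mul_le_mul (hr x hx) (hr' x hx) (abs_nonneg _) (by positivity)
    _ = (ε / (C + 1) * C) * (r ^ m * r ^ k) := by ring
    _ ≤ ε * (r ^ m * r ^ k) := by gcongr

theorem zero (m : ℝ) : ChartLittleO m fun _ : Pt n => 0 := by
  intro K hK hKb ε hε
  filter_upwards [eventually_gt_atTop 0] with r hr x hx
  simp
  positivity

theorem sum {ι : Type*} (s : Finset ι) {u : ι → Pt n → ℝ} (h : ∀ i ∈ s, ChartLittleO m (u i)) :
    ChartLittleO m fun x => ∑ i ∈ s, u i x := by
  classical
  induction s using Finset.induction_on with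
  | empty => simpa using zero m
  | insert a s ha ih =>
    simp only [Finset.sum_insert ha]
    exact add (h a (by simp)) (ih fun i hi => h i (by simp [hi]))

theorem neg (h : ChartLittleO m u) : ChartLittleO m fun x => -u x := by
  intro K hK hKb ε hε
  simpa using h K hK hKb ε hε

end ChartLittleO

/-- Smooth functions of order `o(r^m)`, with one regular derivative. -/
structure SmallQ (m : ℝ) (u : Pt n → ℝ) : Prop where
  sm : Sm u
  base : ChartLittleO m u
  pd : ∀ μ, ChartLittleO (m - om μ + eps (par μ)) (pd μ u)

namespace SmallQ

variable {m k : ℝ} {u v : Pt n → ℝ}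

theorem congr (h : SmallQ m u) (huv : u =ᶠ[atInf n] v) : SmallQ m v :=
  ⟨h.sm.congr huv, h.base.congr huv, fun μ => (h.pd μ).congr (pd_congr_atInf huv μ)⟩

theorem mul (h : SmallQ m u) (h' : (bigO n).Q 1 k v) : SmallQ (m + k) fun x => u x * v x := by
  refine ⟨h.sm.mul h'.sm, h.base.mul h'.base, fun μ => ?_⟩
  refine (((h.pd μ).mul h'.base |>.mono (k := m + k - om μ + eps (par μ)) (by linarith)).add
    (h.base.mul (h'.pd' μ).base |>.mono (k := m + k - om μ + eps (par μ)) (by linarith))).congr ?_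
  filter_upwards [h.sm.diff, h'.sm.diff] with x hx hx'
  rw [pd_mul hx hx']

theorem pk (h : SmallQ m u) : (bigO n).Pk 1 m u := by
  refine ⟨h.base.bigO, fun μ => ?_⟩
  refine (bigO n).mono (le_of_eq ?_) (h.pd μ).bigO
  by_cases hμ : μ = 1
  · subst hμ; simp [om_one, par_one, eps]
  · simp [om_ne hμ, par_ne hμ, eps, hμ]

end SmallQ

theorem gbar_symm (l : ℝ) (x : Pt n) (μ ν : Fin n) : gbar l x μ ν = gbar l x ν μ := by
  rw [gbar_apply, gbar_apply]
  by_cases h : μ = ν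
  · subst h; rfl
  · rw [if_neg h, if_neg (Ne.symm h)]

theorem lieMetric_symm (l : ℝ) (ξ : Fin n → Pt n → ℝ) (μ ν : Fin n) (x : Pt n) :
    lieMetric l ξ μ ν x = lieMetric l ξ ν μ x := by
  simp only [lieMetric, gbar_symm l _ ν μ]
  refine Finset.sum_congr rfl fun σ _ => ?_
  rw [gbar_symm l x σ ν, gbar_symm l x μ σ]
  ring

/-- The Lie derivative is linear in the field and its first derivatives with background coefficients
of the natural orders, so smallness of the field passes to it. -/
theorem chartLittleO_lieMetric {l : ℝ} (hl : 0 < l) {c : ZMod 2 → ℝ} (hc : Compat c)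
    {ξ : Fin n → Pt n → ℝ} (hξ : ∀ μ, SmallQ (om μ + c (par μ)) (ξ μ)) (μ ν : Fin n) :
    ChartLittleO (-om μ - om ν + c (par μ + par ν)) (lieMetric l ξ μ ν) := by
  unfold lieMetric
  refine ChartLittleO.sum _ fun σ _ => ChartLittleO.add (ChartLittleO.add ?_ ?_) ?_
  · refine ((hξ σ).base.mul (Gauge.Q.pd_gbar (G := bigO n) 0 hl σ μ ν).base).mono ?_
    have := hc (par μ + par ν + par σ) (par σ)
    rw [add_assoc (par μ + par ν), zmod_two_add_self, add_zero] at this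
    linarith
  · refine (((hξ σ).pd μ).mul (Gauge.Q.gbar (G := bigO n) 0 hl σ ν).base).mono ?_ |>.congr
      (.of_forall fun x => mul_comm _ _)
    have h1 := hc (par σ + par ν) (par μ + par σ)
    have h2 := hc (par μ) (par σ)
    rw [show par σ + par ν + (par μ + par σ) = par μ + par ν + (par σ + par σ) by ring,
      zmod_two_add_self, add_zero] at h1
    linarith
  · refine (((hξ σ).pd ν).mul (Gauge.Q.gbar (G := bigO n) 0 hl μ σ).base).mono ?_ |>.congr
      (.of_forall fun x => mul_comm _ _)
    have h1 := hc (par μ + par σ) (par ν + par σ)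
    have h2 := hc (par ν) (par σ)
    rw [show par μ + par σ + (par ν + par σ) = par μ + par ν + (par σ + par σ) by ring,
      zmod_two_add_self, add_zero] at h1
    linarith

/-- The orders of an asymptotic Killing vector. -/
noncomputable def killingOrder : ZMod 2 → ℝ := two 0 1

theorem compat_killingOrder : Compat killingOrder := compat_two (by norm_num) (by norm_num)

/-- With `killingOrder` the natural orders of `L_ξ ḡ` are exactly those in the definition of
asymptotic Killing vectors. A field that is `o` of the admissible growth therefore satisfies the
Killing conditions without any equation; this is the source of test fields. -/
theorem isAsymptoticKilling_of_smallQ {l : ℝ} (hl : 0 < l) {ξ : Fin n → Pt n → ℝ}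
    (hs : IsSmoothVectorField ξ)
    (h : ∀ R, IsSpatialRotation R → ∀ μ, SmallQ (om μ + killingOrder (par μ)) (compV ξ R μ)) :
    IsAsymptoticKilling l ξ := by
  have e1 : om (1 : Fin n) + killingOrder (par (1 : Fin n)) = 1 := by
    simp [om_one, par_one, killingOrder]
  have ea : ∀ a : Fin n, a ≠ 1 → om a + killingOrder (par a) = 0 := fun a ha => by
    simp [om_ne ha, par_ne ha, killingOrder]
  have hL := fun R hR => chartLittleO_lieMetric hl compat_killingOrder (h R hR)
  refine ⟨hs, fallOff_iff.2 fun R hR => e1 ▸ (h R hR 1).pk,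
    fun a ha => fallOff_iff.2 fun R hR => ea a ha ▸ (h R hR a).pk,
    fun R hR => (hL R hR 1 1).mono ?_, fun a ha R hR => (hL R hR a 1).mono ?_,
    fun a b ha hb R hR => (hL R hR a b).mono ?_⟩
  · simp [om_one, par_one, killingOrder]; norm_num
  · simp [om_one, par_one, om_ne ha, par_ne ha, killingOrder]
  · rw [om_ne ha, om_ne hb, par_ne ha, par_ne hb, zmod_two_add_self]
    simp [killingOrder]; norm_num

/-- The conditions on the linear operator imply asymptotic conservation. -/
theorem LinOpBounds.asymptoticallyConserved {l Λ : ℝ} (hl : 0 < l)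
    {h : Fin n → Fin n → Pt n → ℝ} (hh : IsSmoothPerturbation h) (hb : LinOpBounds l Λ h) :
    AsymptoticallyConserved l Λ h := by
  intro ξ hξ R hR
  obtain ⟨-, -, -, L1, L2, L3⟩ := hξ
  change ChartLittleO 0 fun x => x 1 *
    ∑ μ, ∑ ν, linOp l Λ (comp2 h R) μ ν x * lieMetric l (compV ξ R) μ ν x
  have hterm : ∀ μ ν, ChartLittleO 0 fun x => lieMetric l (compV ξ R) μ ν x *
      (x 1 * linOp l Λ (comp2 h R) μ ν x) := by
    -- The factor `r` stands for the measure `dr`; in each of the three cases the exponents add up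
    -- to zero.
    have H : ∀ {m k : ℝ} {μ ν : Fin n}, (bigO n).P m (linOp l Λ (comp2 h R) μ ν) →
        ChartLittleO k (lieMetric l (compV ξ R) μ ν) → k + (1 + m) ≤ 0 →
        ChartLittleO 0 fun x => lieMetric l (compV ξ R) μ ν x *
          (x 1 * linOp l Λ (comp2 h R) μ ν x) := fun h1 h2 h12 =>
      (ChartLittleO.mul h2 ((bigO n).mul (Gauge.Q.rad (G := bigO n) 0).base h1)).mono h12
    intro μ ν
    by_cases hμ : μ = 1 <;> by_cases hν : ν = 1
    · subst hμ hν
      exact H (hb.1 R hR) (L1 R hR) (by norm_num)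
    · subst hμ
      refine (H (μ := ν) (ν := 1) (hb.2.1 ν hν R hR) (L2 ν hν R hR) (by norm_num)).congr ?_
      filter_upwards [linOp_symm hl Λ hh hR] with x hx
      rw [hx 1 ν, lieMetric_symm]
    · subst hν
      exact H (hb.2.1 μ hμ R hR) (L2 μ hμ R hR) (by norm_num)
    · exact H (hb.2.2 μ ν hμ hν R hR) (L3 μ ν hμ hν R hR) (by norm_num)
  refine (ChartLittleO.sum Finset.univ fun μ _ =>
    ChartLittleO.sum Finset.univ fun ν _ => hterm μ ν).congr (.of_forall fun x => ?_)
  simp only [Finset.mul_sum]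
  exact Finset.sum_congr rfl fun μ _ => Finset.sum_congr rfl fun ν _ => by ring

end SmallFunctions


/-! ### Testing asymptotic conservation. -/

section TestFields

variable {n : ℕ} [NeZero n] [h3 : Fact (3 ≤ n)] {R : Matrix (Fin n) (Fin n) ℝ}

theorem compV_mul (f : Pt n → ℝ) (W : Fin n → Pt n → ℝ) (R : Matrix (Fin n) (Fin n) ℝ)
    (μ : Fin n) (x : Pt n) :
    compV (fun α z => f z * W α z) R μ x = f (chart R x) * compV W R μ x := by
  simp only [compV, Matrix.mulVec, dotProduct, Finset.mul_sum]
  exact Finset.sum_congr rfl fun α _ => by ring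

/-- Multiplying a field by a scalar adds the symmetrized product of the differential and the lowered
field. A difference of two such products isolates that extra term. -/
theorem lieMetric_mul (l : ℝ) {f : Pt n → ℝ} {w : Fin n → Pt n → ℝ} {x : Pt n}
    (hf : DifferentiableAt ℝ f x) (hw : ∀ μ, DifferentiableAt ℝ (w μ) x) (μ ν : Fin n) :
    lieMetric l (fun σ z => f z * w σ z) μ ν x = f x * lieMetric l w μ ν x
      + (pd μ f x * (gdiag l ν x * w ν x) + pd ν f x * (gdiag l μ x * w μ x)) := by
  have h1 : gdiag l ν x * w ν x = ∑ σ, gbar l x σ ν * w σ x := by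
    simp [gbar_apply]
  have h2 : gdiag l μ x * w μ x = ∑ σ, gbar l x μ σ * w σ x := by
    simp [gbar_apply]
  rw [h1, h2]
  simp only [lieMetric, Finset.mul_sum, ← Finset.sum_add_distrib, fun σ α => pd_mul (μ := α) hf (hw σ)]
  exact Finset.sum_congr rfl fun σ _ => by ring

/-- Vector fields and scalars from which the test fields are built. -/
structure IsTestField (W : Fin n → Pt n → ℝ) : Prop where
  smooth : ∀ α, ContDiffOn ℝ ∞ (W α) (exterior n 0)
  order : ∀ R, IsSpatialRotation R → (bigO n).VQ 1 killingOrder (compV W R)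

/-- Bounded scalars with regular derivatives. -/
structure IsTestScalar (u : Pt n → ℝ) : Prop where
  smooth : ContDiffOn ℝ ∞ u (exterior n 0)
  order : ∀ R, IsSpatialRotation R → (bigO n).Q 1 0 fun x => u (chart R x)

/-- In the variable `log r` the operator `r ∂_r` becomes the ordinary derivative, so decay of `E`
and of its derivative is exactly smallness with one regular derivative. -/
theorem smallQ_radial {E : ℝ → ℝ} (hE : ContDiff ℝ ∞ E) (h0 : Tendsto E atTop (𝓝 0))
    (h1 : Tendsto (deriv E) atTop (𝓝 0)) : SmallQ 0 fun x : Pt n => E (Real.log (x 1)) := by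
  have hd : ∀ t : ℝ, 0 < t → HasDerivAt (fun t => E (Real.log t)) (deriv E (Real.log t) / t) t := by
    intro t ht
    exact ((hE.differentiable (by simp)) _).hasDerivAt.comp t (Real.hasDerivAt_log ht.ne')
  have hpd : ∀ μ, (fun x : Pt n => if μ = 1 then deriv E (Real.log (x 1)) / x 1 else 0) =ᶠ[atInf n]
      pd μ fun x : Pt n => E (Real.log (x 1)) := by
    intro μ
    filter_upwards [eventually_reg 0] with x hx
    rw [pd_comp_coord (φ := fun t => E (Real.log t)) (hd _ hx.2).differentiableAt, (hd _ hx.2).deriv]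
  have hsmall : ∀ f : ℝ → ℝ, Tendsto f atTop (𝓝 0) → ∀ ε : ℝ, 0 < ε →
      ∀ᶠ r in atTop, |f (Real.log r)| ≤ ε := by
    intro f hf ε hε
    have := (hf.comp Real.tendsto_log_atTop).eventually (Metric.closedBall_mem_nhds 0 hε)
    simpa using this
  refine ⟨eventually_atInf.2 ⟨0, fun x hx => ?_⟩, fun K _ _ ε hε => ?_, fun μ => ?_⟩
  · exact hE.contDiffAt.comp x
      ((Real.contDiffAt_log.2 hx.2.ne').comp x (contDiffAt_apply ℝ ℝ 1 x))
  · filter_upwards [hsmall E h0 ε hε] with r hr x _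
    simpa using hr
  · refine ChartLittleO.congr ?_ (hpd μ)
    by_cases hμ : μ = 1
    · subst hμ
      intro K _ _ ε hε
      filter_upwards [hsmall _ h1 ε hε, eventually_gt_atTop 0] with r hr hr0 x _
      simp only [if_true, Function.update_self, om_one, par_one, eps, two_zero, zero_sub, add_zero,
        abs_div, abs_of_pos hr0, Real.rpow_neg_one]
      rw [div_eq_mul_inv]
      gcongr
    · simpa [hμ] using ChartLittleO.zero (n := n) _

theorem isAsymptoticKilling_test {l : ℝ} (hl : 0 < l) {W : Fin n → Pt n → ℝ}
    (hW : IsTestField W) {f : Pt n → ℝ} (hf : ContDiffOn ℝ ∞ f (exterior n 0))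
    (hfs : ∀ R, IsSpatialRotation R → SmallQ 0 fun x => f (chart R x)) :
    IsAsymptoticKilling l fun α z => f z * W α z := by
  refine isAsymptoticKilling_of_smallQ hl
    ⟨1, one_pos, fun α => (hf.mul (hW.smooth α)).mono (exterior_anti le_rfl zero_le_one)⟩
    fun R hR μ => ?_
  have h1 : compV (fun α z => f z * W α z) R μ = fun x => f (chart R x) * compV W R μ x :=
    funext fun x => compV_mul _ _ _ _ _
  rw [h1]
  simpa using (hfs R hR).mul (hW.order R hR μ)

/-- Asymptotic conservation bounds the contraction of the linear operator with `∂u ⊗ W`. -/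
theorem AsymptoticallyConserved.bounded {l Λ : ℝ} (hl : 0 < l) {h : Fin n → Fin n → Pt n → ℝ}
    (hA : AsymptoticallyConserved l Λ h) {W : Fin n → Pt n → ℝ}
    (hW : IsTestField W) {u : Pt n → ℝ} (hu : IsTestScalar u) (hR : IsSpatialRotation R) :
    (bigO n).P 0 fun x => x 1 * ∑ μ, ∑ ν, linOp l Λ (comp2 h R) μ ν x *
      (pd μ (fun z => u (chart R z)) x * (gdiag l ν x * compV W R ν x)
        + pd ν (fun z => u (chart R z)) x * (gdiag l μ x * compV W R μ x)) := by
  set F : Pt n → ℝ := fun x => x 1 * ∑ μ, ∑ ν, linOp l Λ (comp2 h R) μ ν x *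
      (pd μ (fun z => u (chart R z)) x * (gdiag l ν x * compV W R ν x)
        + pd ν (fun z => u (chart R z)) x * (gdiag l μ x * compV W R μ x)) with hF
  intro K hK hKb
  by_contra hcon
  push Not at hcon
  -- Growth `4 ^ k` is chosen to beat the lower bound `(1 / 2) ^ k` of the slow function at the
  -- logarithms of these radii.
  have hseq : ∀ k : ℕ, ∃ r : ℝ, (k : ℝ) ≤ r ∧ ∃ x ∈ K, (4 : ℝ) ^ k < |F (Function.update x 1 r)| := by
    intro k
    obtain ⟨r, ⟨x, hx, hlt⟩, hr⟩ := ((hcon ((4 : ℝ) ^ k)).and_eventually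
      (eventually_ge_atTop (k : ℝ))).exists
    exact ⟨r, hr, x, hx, by simpa using hlt⟩
  choose r hr x hxK hx using hseq
  obtain ⟨E, hEs, hE0, hE1, hEk⟩ := exists_slow_decay fun k => Real.log (r k)
  let e : Pt n → ℝ := fun z => E (Real.log (radius z))
  have hes : ContDiffOn ℝ ∞ e (exterior n 0) := by
    refine hEs.comp_contDiffOn ((contDiffOn_radius 0).log fun z hz => (radius_pos hz).ne')
  have hec : ∀ R, IsSpatialRotation R → (fun x : Pt n => E (Real.log (x 1))) =ᶠ[atInf n]
      fun x => e (chart R x) := by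
    intro R hR
    filter_upwards [eventually_reg 0] with x hx
    simp only [e, radius_chart hR hx.2.le]
  have heS : ∀ R, IsSpatialRotation R → SmallQ 0 fun x : Pt n => e (chart R x) := fun R hR =>
    (smallQ_radial hEs hE0 hE1).congr (hec R hR)
  have heuS : ∀ R, IsSpatialRotation R → SmallQ 0 fun x : Pt n => e (chart R x) * u (chart R x) :=
    fun R hR => by simpa using (heS R hR).mul (hu.order R hR)
  have k1 := (hA _ (isAsymptoticKilling_test hl hW hes heS)).chart hR
  have k2 := (hA _ (isAsymptoticKilling_test hl hW (hes.mul hu.smooth) heuS)).chart hR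
  -- Conservation for `e u W` minus `u` times conservation for `e W`: the terms with `L_W ḡ` and
  -- with the derivative of `e` cancel, and `e` times the contraction remains.
  have k3 : ChartLittleO 0 fun x => e (chart R x) * F x := by
    have k1' := (ChartLittleO.mul k1 (hu.order R hR).base).neg.mono (k := 0) (by simp)
    refine (ChartLittleO.add k2 k1').congr ?_
    have hwd : ∀ᶠ x in atInf n, ∀ μ, DifferentiableAt ℝ (compV W R μ) x :=
      eventually_all.2 fun μ => (hW.order R hR μ).sm.diff
    filter_upwards [(heS R hR).sm.diff, (hu.order R hR).sm.diff, hwd] with x he hux hw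
    have hc1 : compV (fun α z => e z * W α z) R = fun μ x => e (chart R x) * compV W R μ x := by
      ext μ x; exact compV_mul _ _ _ _ _
    have hc2 : compV (fun α z => e z * u z * W α z) R
        = fun μ x => (e (chart R x) * u (chart R x)) * compV W R μ x := by
      ext μ x; exact compV_mul (fun z => e z * u z) _ _ _ _
    have l2 := fun μ ν => lieMetric_mul (μ := μ) (ν := ν) l (he.mul hux) hw
    have p2 := fun μ => pd_mul (μ := μ) he hux
    simp only [Pi.mul_apply] at l2
    simp only [hF, hc1, hc2, lieMetric_mul l he hw, l2]
    change _ * _ + -(_ * _) = _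
    have p3 : ∀ μ, pd μ ((fun z => e (chart R z)) * fun z => u (chart R z)) x = _ := p2
    simp only [p3, Finset.mul_sum, Finset.sum_mul, ← Finset.sum_neg_distrib,
      ← Finset.sum_add_distrib]
    refine Finset.sum_congr rfl fun μ _ => Finset.sum_congr rfl fun ν _ => ?_
    ring
  have hfin := k3 K hK hKb 1 one_pos
  obtain ⟨r0, hr0⟩ := eventually_atTop.1 hfin
  obtain ⟨k, hk⟩ := exists_nat_ge (max r0 1)
  have h1 : (1 : ℝ) ≤ r k := (le_max_right _ _).trans (hk.trans (hr k))
  have h2 := hr0 (r k) ((le_max_left _ _).trans (hk.trans (hr k))) (x k) (hxK k)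
  have h4 : e (chart R (Function.update (x k) 1 (r k))) = E (Real.log (r k)) := by
    simp only [e]
    rw [radius_chart hR (by simpa using (zero_le_one.trans h1)), Function.update_self]
  simp only [h4, Real.rpow_zero, mul_one, abs_mul] at h2
  have h5 := (hEk k).trans (le_abs_self _)
  have h6 : (1 / 2 : ℝ) ^ k * 4 ^ k = 2 ^ k := by rw [← mul_pow]; norm_num
  have h7 : (1 : ℝ) ≤ 2 ^ k := one_le_pow₀ (by norm_num)
  have h8 : (1 / 2 : ℝ) ^ k * 4 ^ k < |E (Real.log (r k))| * |F (Function.update (x k) 1 (r k))| :=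
    mul_lt_mul' h5 (hx k) (by positivity) (lt_of_lt_of_le (by positivity) h5)
  linarith

end TestFields


/-! ### Recovering the components of the linear operator. -/

section Inversion

variable {n : ℕ} [NeZero n] [h3 : Fact (3 ≤ n)] {R : Matrix (Fin n) (Fin n) ℝ}

/-- The time coordinate (`j = 0`) and the Cartesian coordinates of the unit sphere. -/
noncomputable def unitCoord (R : Matrix (Fin n) (Fin n) ℝ) (j : Fin n) (x : Pt n) : ℝ :=
  if j = 0 then x 0 else jac R x j 1

theorem Q_unitCoord (G : Gauge n) (k : ℕ) (R : Matrix (Fin n) (Fin n) ℝ) (j : Fin n) :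
    G.Q k 0 (unitCoord R j) := by
  unfold unitCoord
  split_ifs
  · exact Gauge.Q.time k
  · exact Gauge.Q.radialJac k R j

theorem differentiableAt_unitCoord (R : Matrix (Fin n) (Fin n) ℝ) (j : Fin n) (x : Pt n) :
    DifferentiableAt ℝ (unitCoord R j) x := by
  unfold unitCoord
  split_ifs
  · exact differentiableAt_apply 0 x
  · exact (contDiff_jac R j 1).differentiable (by simp) x

theorem pd_chart (hR : IsSpatialRotation R) (x : Pt n) {j : Fin n} (hj : j ≠ 0) (μ : Fin n) :
    jac R x j μ = (if μ = 1 then unitCoord R j x else 0) + x 1 * pd μ (unitCoord R j) x := by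
  have h : (fun z => chart R z j) = fun z => z 1 * unitCoord R j z := by
    ext z
    rw [chart_of_ne hR z hj, unitCoord, if_neg hj]
  rw [jac_eq_pd, h, pd_mul (differentiableAt_apply 1 x) (differentiableAt_unitCoord R j x),
    pd_coord]
  simp

theorem pd_one_unitCoord (hR : IsSpatialRotation R) {x : Pt n} (hx : x ∈ reg n 0) (j : Fin n) :
    pd 1 (unitCoord R j) x = 0 := by
  by_cases hj : j = 0
  · have : unitCoord R j = fun z => z 0 := by ext z; simp [unitCoord, hj]
    rw [this, pd_coord, if_neg one_ne_zero']
  · have := pd_chart hR x hj 1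
    rw [if_pos rfl, unitCoord, if_neg hj] at this
    have h0 : x 1 * pd 1 (unitCoord R j) x = 0 := by linarith
    exact (mul_eq_zero.1 h0).resolve_left hx.2.ne'

theorem pd_unitCoord (hR : IsSpatialRotation R) {x : Pt n} (hx : x ∈ reg n 0) (j : Fin n)
    {a : Fin n} (ha : a ≠ 1) :
    pd a (unitCoord R j) x = jac R x j a * if a = 0 then 1 else (x 1)⁻¹ := by
  by_cases hj : j = 0
  · have : unitCoord R j = fun z => z 0 := by ext z; simp [unitCoord, hj]
    rw [this, pd_coord, hj, jac_zero_row hR]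
    by_cases h0 : a = 0 <;> simp [h0]
  · have h := pd_chart hR x hj a
    rw [if_neg ha, zero_add] at h
    have hx1 := hx.2.ne'
    split_ifs with h0
    · subst h0
      rw [jac_zero_col hR, if_neg hj] at h ⊢
      rw [zero_mul]
      exact (mul_eq_zero.1 h.symm).resolve_left hx1
    · rw [h]; field_simp

theorem angFactor_zero (x : Pt n) : angFactor x 0 = 1 := by
  simp [angFactor]

/-- The time and the unit sphere coordinates embed `ℝ × S^(n-2)` isometrically, so the sum over
their gradients is the product metric. Unlike a frame on the sphere, these functions are globally
smooth. -/
theorem unitCoord_gram (hR : IsSpatialRotation R) {x : Pt n} (hx : x ∈ reg n 0) {a b : Fin n}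
    (ha : a ≠ 1) (hb : b ≠ 1) : ∑ j, pd a (unitCoord R j) x * pd b (unitCoord R j) x
      = if a = b then angFactor x a else 0 := by
  have h1 : ∀ j, pd a (unitCoord R j) x * pd b (unitCoord R j) x
      = ((if a = 0 then 1 else (x 1)⁻¹) * if b = 0 then 1 else (x 1)⁻¹) *
        (jac R x j a * jac R x j b) := by
    intro j
    rw [pd_unitCoord hR hx j ha, pd_unitCoord hR hx j hb]
    ring
  have hx1 := hx.2.ne'
  rw [Finset.sum_congr rfl fun j _ => h1 j, ← Finset.mul_sum, jac_gram hR]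
  by_cases hab : a = b
  · subst hab
    rw [if_pos rfl, if_pos rfl]
    by_cases h0 : a = 0
    · subst h0; simp [flatDiag_zero, angFactor_zero]
    · rw [if_neg h0, flatDiag_angle x (two_le_of_ne h0 ha)]
      field_simp
  · rw [if_neg hab, if_neg hab, mul_zero]

/-- The scalars whose components are `unitCoord`, in Cartesian coordinates. -/
noncomputable def unitScalar (j : Fin n) (z : Pt n) : ℝ := if j = 0 then z 0 else z j / radius z

theorem unitScalar_chart (hR : IsSpatialRotation R) {x : Pt n} (hx : 0 < x 1) (j : Fin n) :
    unitScalar j (chart R x) = unitCoord R j x := by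
  rw [unitScalar, unitCoord]
  split_ifs with hj
  · exact chart_zero hR x
  · rw [radius_chart hR hx.le, chart_of_ne hR x hj]
    field_simp

theorem isTestScalar_unit (j : Fin n) : IsTestScalar (unitScalar j) := by
  refine ⟨?_, fun R hR => (Q_unitCoord _ 1 R j).congr ?_⟩
  · unfold unitScalar
    split_ifs
    · exact (contDiff_apply ℝ ℝ 0).contDiffOn
    · exact (contDiff_apply ℝ ℝ j).contDiffOn.div (contDiffOn_radius 0)
        fun z hz => (radius_pos hz).ne'
  · filter_upwards [eventually_reg 0] with x hx using (unitScalar_chart hR hx.2 j).symm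

/-- A test scalar must be bounded, which excludes `log r`. Its sine and cosine are bounded, and
together their radial derivatives recover `dr / r`. -/
theorem Q_logTrig (k : ℕ) : ((bigO n).Q k 0 fun x : Pt n => Real.sin (Real.log (x 1))) ∧
    (bigO n).Q k 0 fun x : Pt n => Real.cos (Real.log (x 1)) := by
  have key : ∀ b : Bool, (bigO n).Q k 0
      fun x : Pt n => (fun b : Bool => fun t => (cond b Real.sin Real.cos) (Real.log t)) b (x 1) := by
    refine Gauge.Q.of_radial (G := bigO n)
      (fun b : Bool => fun t => (cond b Real.sin Real.cos) (Real.log t)) (fun _ => 0) ?_ ?_ ?_ k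
    · rintro b K _ _
      refine ⟨1, .of_forall fun r x _ => ?_⟩
      cases b
      · simpa using Real.abs_cos_le_one _
      · simpa using Real.abs_sin_le_one _
    · intro b
      filter_upwards [eventually_gt_atTop 0] with r hr
      cases b
      · exact Real.contDiff_cos.contDiffAt.comp r (Real.contDiffAt_log.2 hr.ne')
      · exact Real.contDiff_sin.contDiffAt.comp r (Real.contDiffAt_log.2 hr.ne')
    · intro k hk b
      have hs : ∀ b : Bool, Sm fun x : Pt n => (cond b Real.sin Real.cos) (Real.log (x 1)) := by
        intro b
        refine eventually_atInf.2 ⟨0, fun x hx => ?_⟩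
        have : ContDiffAt ℝ ∞ (Real.log ∘ fun z : Pt n => z 1) x :=
          (Real.contDiffAt_log.2 hx.2.ne').comp x (contDiff_apply ℝ ℝ 1).contDiffAt
        cases b
        · exact Real.contDiff_cos.contDiffAt.comp x this
        · exact Real.contDiff_sin.contDiffAt.comp x this
      have hr := Gauge.Q.rpow (G := bigO n) k (-1)
      cases b
      · refine Gauge.Pk.congr ?_ ((Gauge.Q.neg ⟨hs true, hk true⟩).mul hr).pk
        filter_upwards [eventually_reg 0] with x hx
        have := ((Real.hasDerivAt_cos _).comp _ (Real.hasDerivAt_log hx.2.ne')).deriv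
        change _ = deriv (Real.cos ∘ Real.log) (x 1)
        rw [this, Real.rpow_neg_one]
        rfl
      · refine Gauge.Pk.congr ?_ ((⟨hs false, hk false⟩ : (bigO n).Q k 0 _).mul hr).pk
        filter_upwards [eventually_reg 0] with x hx
        have := ((Real.hasDerivAt_sin _).comp _ (Real.hasDerivAt_log hx.2.ne')).deriv
        change _ = deriv (Real.sin ∘ Real.log) (x 1)
        rw [this, Real.rpow_neg_one]
        rfl
  exact ⟨key true, key false⟩

theorem isTestScalar_sin : IsTestScalar fun z : Pt n => Real.sin (Real.log (radius z)) := by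
  refine ⟨Real.contDiff_sin.comp_contDiffOn
    ((contDiffOn_radius 0).log fun z hz => (radius_pos hz).ne'), fun R hR =>
    (Q_logTrig 1).1.congr ?_⟩
  filter_upwards [eventually_reg 0] with x hx
  rw [radius_chart hR hx.2.le]

theorem isTestScalar_cos : IsTestScalar fun z : Pt n => Real.cos (Real.log (radius z)) := by
  refine ⟨Real.contDiff_cos.comp_contDiffOn
    ((contDiffOn_radius 0).log fun z hz => (radius_pos hz).ne'), fun R hR =>
    (Q_logTrig 1).2.congr ?_⟩
  filter_upwards [eventually_reg 0] with x hx
  rw [radius_chart hR hx.2.le]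

/-- The vector field `r ∂_r`. -/
def radialField (α : Fin n) (z : Pt n) : ℝ := if α = 0 then 0 else z α

theorem compV_radialField (hR : IsSpatialRotation R) {x : Pt n} (hx : x ∈ reg n 0) (μ : Fin n) :
    compV radialField R μ x = if μ = 1 then x 1 else 0 := by
  have h : ∑ α, jac R x α μ * radialField α (chart R x) = if μ = 1 then x 1 else 0 := by
    rw [← sum_chart_jac hR x μ, Finset.sum_filter]
    refine Finset.sum_congr rfl fun α _ => ?_
    by_cases hα : α = 0 <;> simp [radialField, hα, mul_comm]
  rw [compV_eq hR hx, h]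
  by_cases hμ : μ = 1
  · subst hμ; simp [flatDiag_one]
  · simp [hμ]

theorem isTestField_radial : IsTestField (radialField (n := n)) := by
  refine ⟨fun α => ?_, fun R hR μ => ?_⟩
  · unfold radialField
    split_ifs
    · exact contDiffOn_const
    · exact (contDiff_apply ℝ ℝ α).contDiffOn
  · have hev : (fun x : Pt n => if μ = 1 then x 1 else 0) =ᶠ[atInf n] compV radialField R μ := by
      filter_upwards [eventually_reg 0] with x hx using (compV_radialField hR hx μ).symm
    refine Gauge.Q.congr ?_ hev
    by_cases hμ : μ = 1
    · subst hμ
      simpa [om_one, par_one, killingOrder] using Gauge.Q.rad (G := bigO n) 1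
    · simp only [hμ, if_false]
      exact Gauge.Q.zero _ _ _

/-- The vector fields `∂_τ` and `r` times the tangential parts of the Cartesian basis. -/
noncomputable def unitField (j α : Fin n) (z : Pt n) : ℝ :=
  if j = 0 then (if α = 0 then 1 else 0)
  else if α = 0 then 0
  else radius z * ((if α = j then 1 else 0) - z α * z j / radius z ^ 2)

/-- The field is the gradient of `unitCoord` for the product metric on `ℝ × S^(n-2)`. In Cartesian
terms it is `r` times the projection of a basis vector to the tangent space of the sphere. -/
theorem compV_unitField (hR : IsSpatialRotation R) {x : Pt n} (hx : x ∈ reg n 0) (j μ : Fin n) :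
    compV (unitField j) R μ x
      = if μ = 1 then 0 else (angFactor x μ)⁻¹ * pd μ (unitCoord R j) x := by
  rw [compV_eq hR hx]
  have hx1 := hx.2.ne'
  by_cases hj : j = 0
  · have h : ∑ α, jac R x α μ * unitField j α (chart R x) = if μ = 0 then 1 else 0 := by
      simp [unitField, hj, jac_zero_row hR]
    rw [h]
    by_cases h1 : μ = 1
    · subst h1
      rw [if_neg one_ne_zero', if_pos rfl, mul_zero]
    · rw [if_neg h1, pd_unitCoord hR hx j h1, hj, jac_zero_row hR]
      by_cases h0 : μ = 0
      · subst h0; simp [flatDiag_zero, angFactor_zero]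
      · simp [h0]
  · have h : ∑ α, jac R x α μ * unitField j α (chart R x)
        = x 1 * (jac R x j μ - if μ = 1 then unitCoord R j x else 0) := by
      have h1 : ∀ α, jac R x α μ * unitField j α (chart R x)
          = (if α = j then x 1 * jac R x α μ else 0)
            - (if α ≠ 0 then chart R x α * jac R x α μ else 0) * (chart R x j / x 1) := by
        intro α
        rw [unitField, if_neg hj, radius_chart hR hx.2.le]
        by_cases hα : α = 0
        · subst hα; simp [Ne.symm hj]
        · by_cases hαj : α = j
          · subst hαj; simp [hα]; field_simp
          · simp [hα, hαj]; field_simp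
      have h2 : ∑ α, (if α ≠ 0 then chart R x α * jac R x α μ else 0) = if μ = 1 then x 1 else 0 := by
        rw [← Finset.sum_filter, sum_chart_jac hR]
      rw [Finset.sum_congr rfl fun α _ => h1 α, Finset.sum_sub_distrib, ← Finset.sum_mul,
        h2, Finset.sum_ite_eq' Finset.univ j, if_pos (Finset.mem_univ j), chart_of_ne hR x hj,
        unitCoord, if_neg hj]
      by_cases hμ : μ = 1
      · simp [hμ]; field_simp; ring
      · simp [hμ]
    rw [h, pd_chart hR x hj]
    by_cases h1 : μ = 1
    · subst h1
      simp [pd_one_unitCoord hR hx]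
    · simp only [h1, if_false, zero_add, sub_zero]
      by_cases h0 : μ = 0
      · subst h0
        have h4 := pd_unitCoord hR hx j zero_ne_one'
        rw [jac_zero_col hR, if_neg hj, zero_mul] at h4
        simp [h4]
      · have := (angFactor_pos hx.1 μ).ne'
        rw [flatDiag_angle x (two_le_of_ne h0 h1)]
        field_simp

theorem isTestField_unit (j : Fin n) : IsTestField (unitField j) := by
  refine ⟨fun α => ?_, fun R hR μ => ?_⟩
  · unfold unitField
    split_ifs
    · exact contDiffOn_const
    · exact contDiffOn_const
    · exact contDiffOn_const
    all_goals
      exact (contDiffOn_radius 0).mul (contDiffOn_const.sub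
        (((contDiff_apply ℝ ℝ α).contDiffOn.mul (contDiff_apply ℝ ℝ j).contDiffOn).div
        ((contDiffOn_radius 0).pow 2) fun z hz => pow_ne_zero 2 (radius_pos hz).ne'))
  · have hev : (fun x : Pt n => if μ = 1 then 0 else (angFactor x μ)⁻¹ * pd μ (unitCoord R j) x)
        =ᶠ[atInf n] compV (unitField j) R μ := by
      filter_upwards [eventually_reg 0] with x hx using (compV_unitField hR hx j μ).symm
    refine Gauge.Q.congr ?_ hev
    by_cases hμ : μ = 1
    · simp only [hμ, if_true]
      exact Gauge.Q.zero _ _ _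
    · simp only [hμ, if_false]
      refine ((Gauge.Q.inv_angFactor 1 μ).mul ((Q_unitCoord (bigO n) 2 R j).pd' μ)).mono ?_
      simp [om_ne hμ, par_ne hμ, killingOrder, eps]

/-- Asymptotic conservation implies the conditions on the linear operator. -/
theorem AsymptoticallyConserved.linOpBounds {l Λ : ℝ} (hl : 0 < l) {h : Fin n → Fin n → Pt n → ℝ}
    (hh : IsSmoothPerturbation h) (hA : AsymptoticallyConserved l Λ h) : LinOpBounds l Λ h := by
  have key : ∀ R, IsSpatialRotation R → ∀ W, IsTestField W → ∀ u, IsTestScalar u →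
      (bigO n).P 0 fun x => x 1 * ∑ μ, ∑ ν, linOp l Λ (comp2 h R) μ ν x *
        (pd μ (fun z => u (chart R z)) x * (gdiag l ν x * compV W R ν x)) := by
    intro R hR W hW u hu
    -- By symmetry of the operator the two halves of the symmetrized contraction agree, hence the
    -- factor one half.
    refine (bigO n).congr ?_ ((bigO n).mul ((bigO n).const (1 / 2)) (hA.bounded hl hW hu hR))
      |> fun t => by simpa using t
    filter_upwards [linOp_symm hl Λ hh hR] with x hx
    have : ∑ μ, ∑ ν, linOp l Λ (comp2 h R) μ ν x *
        (pd ν (fun z => u (chart R z)) x * (gdiag l μ x * compV W R μ x))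
        = ∑ μ, ∑ ν, linOp l Λ (comp2 h R) μ ν x *
        (pd μ (fun z => u (chart R z)) x * (gdiag l ν x * compV W R ν x)) := by
      rw [Finset.sum_comm]
      refine Finset.sum_congr rfl fun μ _ => Finset.sum_congr rfl fun ν _ => ?_
      rw [hx ν μ]
    simp only [mul_add, Finset.sum_add_distrib]
    rw [this]
    ring
  have hang : ∀ {a : Fin n}, a ≠ 1 → ∀ R j, (bigO n).P 0 (pd a (unitCoord R j)) := fun ha R j =>
    (bigO n).mono (by simp [om_ne ha, par_ne ha, eps]) ((Q_unitCoord (bigO n) 1 R j).pd' _).base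
  have hpu : ∀ R, IsSpatialRotation R → ∀ᶠ x in atInf n, ∀ μ j,
      pd μ (fun z => unitScalar j (chart R z)) x = pd μ (unitCoord R j) x := by
    intro R hR
    filter_upwards [eventually_reg 0] with x hx μ j
    refine pd_congr ?_
    filter_upwards [(isOpen_reg 0).mem_nhds hx] with z hz using unitScalar_chart hR hz.2 j
  have hlog : ∀ R, IsSpatialRotation R → ∀ W, IsTestField W → (bigO n).P 0 fun x =>
      ∑ ν, linOp l Λ (comp2 h R) 1 ν x * (gdiag l ν x * compV W R ν x) := by
    intro R hR W hW
    -- The combination `cos · d(sin log r) - sin · d(cos log r)` is `dr / r`, and the `1 / r`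
    -- cancels the factor `r` of the measure.
    have hs := (bigO n).mul (Q_logTrig (n := n) 0).2.base (key R hR W hW _ isTestScalar_sin)
    have hc := (bigO n).mul ((Q_logTrig (n := n) 0).1.neg).base (key R hR W hW _ isTestScalar_cos)
    rw [add_zero] at hs hc
    refine (bigO n).congr ?_ ((bigO n).add hs hc)
    filter_upwards [eventually_reg 0] with x hx
    have hev : ∀ f : ℝ → ℝ, (fun z => f (Real.log (radius (chart R z)))) =ᶠ[𝓝 x]
        fun z => f (Real.log (z 1)) := by
      intro f
      filter_upwards [(isOpen_reg 0).mem_nhds hx] with z hz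
      rw [radius_chart hR hz.2.le]
    have hps : ∀ μ, pd μ (fun z => Real.sin (Real.log (radius (chart R z)))) x
        = if μ = 1 then Real.cos (Real.log (x 1)) / x 1 else 0 := by
      intro μ
      have hd := (Real.hasDerivAt_log hx.2.ne').sin
      rw [pd_congr (hev Real.sin), pd_comp_coord hd.differentiableAt,
        hd.deriv, div_eq_mul_inv]
    have hpc : ∀ μ, pd μ (fun z => Real.cos (Real.log (radius (chart R z)))) x
        = if μ = 1 then -Real.sin (Real.log (x 1)) / x 1 else 0 := by
      intro μ
      have hd := (Real.hasDerivAt_log hx.2.ne').cos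
      rw [pd_congr (hev Real.cos), pd_comp_coord hd.differentiableAt,
        hd.deriv, div_eq_mul_inv]
    have hx1 := hx.2.ne'
    have hsum : ∀ c : ℝ, ∑ μ, ∑ ν, linOp l Λ (comp2 h R) μ ν x *
        ((if μ = 1 then c else 0) * (gdiag l ν x * compV W R ν x))
        = c * ∑ ν, linOp l Λ (comp2 h R) 1 ν x * (gdiag l ν x * compV W R ν x) := by
      intro c
      rw [Finset.sum_eq_single 1 (fun μ _ hμ => by simp [hμ]) (by simp), Finset.mul_sum]
      refine Finset.sum_congr rfl fun ν _ => ?_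
      rw [if_pos rfl]
      ring
    simp only [hps, hpc, hsum]
    have := Real.sin_sq_add_cos_sq (Real.log (x 1))
    generalize ∑ ν, linOp l Λ (comp2 h R) 1 ν x * (gdiag l ν x * compV W R ν x) = S
    field_simp
    linear_combination S * this
  have hinv : ∀ (R : Matrix (Fin n) (Fin n) ℝ), ∀ {a : Fin n}, a ≠ 1 →
      (bigO n).P (-2) fun x => (gdiag l a x)⁻¹ := fun R a ha =>
    (bigO n).mono (by rw [om_ne ha]; norm_num) (Gauge.Q.inv_gdiag 0 hl a).base
  refine ⟨fun R hR => ?_, fun a ha R hR => ?_, fun a b ha hb R hR => ?_⟩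
  -- Pairing with `r ∂_r` bounds `𝓗^{rr} ḡ_rr r`, where `ḡ_rr r` is of order `r⁻¹`.
  · have h1 := (bigO n).mul ((bigO n).mul (hlog R hR _ isTestField_radial)
      (Gauge.Q.inv_gdiag 0 hl 1).base) ((bigO n).rpow (-1))
    refine (bigO n).congr ?_ ((bigO n).mono (by rw [om_one]; norm_num) h1)
    filter_upwards [eventually_reg 0] with x hx
    have hx1 := hx.2.ne'
    have hg := gdiag_ne_zero hl hx 1
    simp only [compV_radialField hR hx, mul_ite, mul_zero, Finset.sum_ite_eq', Finset.mem_univ,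
      if_true, Real.rpow_neg_one]
    field_simp
  -- Summing over `j` against the gradients of the unit coordinates projects, through the Gram
  -- identity, onto the single component `𝓗^{ra}`.
  · have h1 : (bigO n).P (-2) fun x => (gdiag l a x)⁻¹ * ∑ j, pd a (unitCoord R j) x *
        ∑ ν, linOp l Λ (comp2 h R) 1 ν x * (gdiag l ν x * compV (unitField j) R ν x) := by
      have := (bigO n).mul (hinv R ha) ((bigO n).P_sum Finset.univ fun j _ => (bigO n).mul (hang ha R j)
        (hlog R hR _ (isTestField_unit j)))
      simpa using this
    refine (bigO n).congr ?_ h1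
    filter_upwards [eventually_reg 0, linOp_symm hl Λ hh hR] with x hx hsy
    have hg := gdiag_ne_zero hl hx a
    have hf := (angFactor_pos hx.1 a).ne'
    have h2 : ∑ j, pd a (unitCoord R j) x *
        ∑ ν, linOp l Λ (comp2 h R) 1 ν x * (gdiag l ν x * compV (unitField j) R ν x)
        = ∑ ν, if ν = 1 then 0 else linOp l Λ (comp2 h R) 1 ν x * gdiag l ν x * (angFactor x ν)⁻¹ *
          ∑ j, pd a (unitCoord R j) x * pd ν (unitCoord R j) x := by
      simp only [Finset.mul_sum]
      rw [Finset.sum_comm]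
      refine Finset.sum_congr rfl fun ν _ => ?_
      split_ifs with hν
      · exact Finset.sum_eq_zero fun j _ => by rw [compV_unitField hR hx, if_pos hν]; ring
      · exact Finset.sum_congr rfl fun j _ => by rw [compV_unitField hR hx, if_neg hν]; ring
    rw [h2, Finset.sum_eq_single a, if_neg ha, unitCoord_gram hR hx ha ha, if_pos rfl, hsy 1 a]
    · field_simp
    · intro ν _ hν
      split_ifs with hν1
      · rfl
      · rw [unitCoord_gram hR hx ha hν1, if_neg (Ne.symm hν), mul_zero]
    · simp
  -- The same projection in both slots. Here the factor `r` of the measure is not compensated by `dr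
  -- / r`, which gains one more power.
  · have h1 : (bigO n).P (-3) fun x => (x 1) ^ (-1 : ℝ) * ((angFactor x a)⁻¹ * ((gdiag l b x)⁻¹ *
        ∑ i, ∑ j, pd a (unitCoord R i) x * (pd b (unitCoord R j) x *
        (x 1 * ∑ μ, ∑ ν, linOp l Λ (comp2 h R) μ ν x *
        (pd μ (fun z => unitScalar i (chart R z)) x *
          (gdiag l ν x * compV (unitField j) R ν x)))))) := by
      refine (bigO n).mono (by norm_num) ((bigO n).mul ((bigO n).rpow (-1)) ((bigO n).mul
        (Gauge.Q.inv_angFactor 0 a).base ((bigO n).mul (hinv R hb)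
        ((bigO n).P_sum (m := 0) Finset.univ fun i _ =>
          (bigO n).P_sum Finset.univ fun j _ => (bigO n).mono (m := 0 + (0 + 0)) (by norm_num)
          ((bigO n).mul (hang ha R i) ((bigO n).mul (hang hb R j)
          (key R hR _ (isTestField_unit j) _ (isTestScalar_unit i))))))))
    refine (bigO n).congr ?_ h1
    filter_upwards [eventually_reg 0, hpu R hR] with x hx hpx
    have hx1 := hx.2.ne'
    have hg := gdiag_ne_zero hl hx b
    have hf := (angFactor_pos hx.1 a).ne'
    have hfb := (angFactor_pos hx.1 b).ne'
    have h2 : ∑ i, ∑ j, pd a (unitCoord R i) x * (pd b (unitCoord R j) x *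
        (x 1 * ∑ μ, ∑ ν, linOp l Λ (comp2 h R) μ ν x *
        (pd μ (fun z => unitScalar i (chart R z)) x *
          (gdiag l ν x * compV (unitField j) R ν x))))
        = ∑ μ, ∑ ν, x 1 * (linOp l Λ (comp2 h R) μ ν x * gdiag l ν x) *
          ((∑ i, pd a (unitCoord R i) x * pd μ (unitCoord R i) x) *
          (∑ j, pd b (unitCoord R j) x * compV (unitField j) R ν x)) := by
      simp only [hpx, Finset.mul_sum, Finset.sum_mul]
      trans ∑ i, ∑ μ, ∑ j, ∑ ν, pd a (unitCoord R i) x * (pd b (unitCoord R j) x *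
        (x 1 * (linOp l Λ (comp2 h R) μ ν x * (pd μ (unitCoord R i) x *
          (gdiag l ν x * compV (unitField j) R ν x)))))
      · exact Finset.sum_congr rfl fun i _ => Finset.sum_comm
      rw [Finset.sum_comm]
      refine Finset.sum_congr rfl fun μ _ => ?_
      trans ∑ i, ∑ ν, ∑ j, pd a (unitCoord R i) x * (pd b (unitCoord R j) x *
        (x 1 * (linOp l Λ (comp2 h R) μ ν x * (pd μ (unitCoord R i) x *
          (gdiag l ν x * compV (unitField j) R ν x)))))
      · exact Finset.sum_congr rfl fun i _ => Finset.sum_comm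
      rw [Finset.sum_comm]
      refine Finset.sum_congr rfl fun ν _ => ?_
      rw [Finset.sum_comm]
      refine Finset.sum_congr rfl fun i _ => Finset.sum_congr rfl fun j _ => ?_
      ring
    rw [h2, Finset.sum_eq_single a, Finset.sum_eq_single b]
    · have h5 : ∑ j, pd b (unitCoord R j) x * compV (unitField j) R b x = 1 := by
        have : ∀ j, pd b (unitCoord R j) x * compV (unitField j) R b x
            = (angFactor x b)⁻¹ * (pd b (unitCoord R j) x * pd b (unitCoord R j) x) := by
          intro j
          rw [compV_unitField hR hx, if_neg hb]
          ring
        rw [Finset.sum_congr rfl fun j _ => this j, ← Finset.mul_sum, unitCoord_gram hR hx hb hb,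
          if_pos rfl, inv_mul_cancel₀ hfb]
      rw [h5, unitCoord_gram hR hx ha ha, if_pos rfl, Real.rpow_neg_one]
      field_simp
    · intro ν _ hν
      have h5 : ∑ j, pd b (unitCoord R j) x * compV (unitField j) R ν x = 0 := by
        have : ∀ j, pd b (unitCoord R j) x * compV (unitField j) R ν x
            = if ν = 1 then 0 else
              (angFactor x ν)⁻¹ * (pd b (unitCoord R j) x * pd ν (unitCoord R j) x) := by
          intro j
          rw [compV_unitField hR hx]
          split_ifs <;> ring
        rw [Finset.sum_congr rfl fun j _ => this j]
        by_cases hν1 : ν = 1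
        · simp [hν1]
        · simp only [hν1, if_false]
          rw [← Finset.mul_sum, unitCoord_gram hR hx hb hν1, if_neg (Ne.symm hν), mul_zero]
      rw [h5]; ring
    · simp
    · intro μ _ hμ
      have h5 : ∑ i, pd a (unitCoord R i) x * pd μ (unitCoord R i) x = 0 := by
        by_cases hμ1 : μ = 1
        · subst hμ1
          simp [pd_one_unitCoord hR hx]
        · rw [unitCoord_gram hR hx ha hμ1, if_neg (Ne.symm hμ)]
      exact Finset.sum_eq_zero fun ν _ => by rw [h5]; ring
    · simp

/-- Asymptotic conservation is a condition on the linear operator. -/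
theorem asymptoticallyConserved_iff {l Λ : ℝ} (hl : 0 < l) {h : Fin n → Fin n → Pt n → ℝ}
    (hh : IsSmoothPerturbation h) : AsymptoticallyConserved l Λ h ↔ LinOpBounds l Λ h :=
  ⟨fun hA => hA.linOpBounds hl hh, fun hb => hb.asymptoticallyConserved hl hh⟩

end Inversion


/-! ### Divergence form of the linear operator and the splitting off of the radial index. -/

section Flux

variable {n : ℕ} [NeZero n] [h3 : Fact (3 ≤ n)]

/-- Half the logarithmic `r`-derivative of a diagonal entry of the metric. -/
noncomputable def dlog (l : ℝ) (μ : Fin n) (x : Pt n) : ℝ :=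
  1 / 2 * (gdiag l μ x)⁻¹ * pd 1 (gdiag l μ) x

theorem hasDerivAt_lapse (l r : ℝ) : HasDerivAt (fun r : ℝ => 1 + r ^ 2 / l ^ 2) (2 * r / l ^ 2) r := by
  simpa using ((hasDerivAt_pow 2 r).div_const (l ^ 2)).const_add 1

theorem pd_gdiag_zero (l : ℝ) (μ : Fin n) (x : Pt n) :
    pd μ (gdiag l 0) x = if μ = 1 then -(2 * x 1 / l ^ 2) else 0 := by
  have h := (hasDerivAt_lapse l (x 1)).fun_neg
  have he : gdiag (n := n) l 0 = fun z => (fun r : ℝ => -(1 + r ^ 2 / l ^ 2)) (z 1) :=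
    funext fun z => gdiag_zero l z
  rw [he, pd_comp_coord h.differentiableAt, h.deriv]

theorem pd_gdiag_one {l : ℝ} (hl : 0 < l) (μ : Fin n) (x : Pt n) :
    pd μ (gdiag l 1) x = if μ = 1 then -(2 * x 1 / l ^ 2) / (1 + x 1 ^ 2 / l ^ 2) ^ 2 else 0 := by
  have h := (hasDerivAt_lapse l (x 1)).fun_inv (by positivity : 1 + x 1 ^ 2 / l ^ 2 ≠ 0)
  have he : gdiag (n := n) l 1 = fun z => (fun r : ℝ => (1 + r ^ 2 / l ^ 2)⁻¹) (z 1) :=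
    funext fun z => gdiag_one l z
  rw [he, pd_comp_coord h.differentiableAt, h.deriv]

theorem pd_one_angFactor (A : Fin n) (x : Pt n) : pd 1 (fun z => angFactor z A) x = 0 := by
  have h : (fun t : ℝ => angFactor (x + t • Pi.single (1 : Fin n) (1 : ℝ)) A)
      = fun _ => angFactor x A := by
    ext t
    refine Finset.prod_congr rfl fun B hB => ?_
    have hB1 : B ≠ 1 := ne_one_of_two_le (Finset.mem_filter.1 hB).2.1
    simp [hB1]
  have hd := ((contDiff_angFactor A).differentiable (by simp) x).hasFDerivAt.hasLineDerivAt
    (Pi.single (1 : Fin n) (1 : ℝ))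
  have h2 := hd.lineDeriv
  rw [lineDeriv, h, deriv_const] at h2
  exact h2.symm

theorem pd_one_gdiag_angle (l : ℝ) {A : Fin n} (hA : 2 ≤ A.val) (x : Pt n) :
    pd 1 (gdiag l A) x = 2 * x 1 * angFactor x A := by
  have he : gdiag (n := n) l A = fun z => z 1 ^ 2 * angFactor z A :=
    funext fun z => gdiag_angle l z hA
  rw [he, pd_mul (by fun_prop) ((contDiff_angFactor A).differentiable (by simp) x),
    pd_comp_coord (φ := fun r => r ^ 2) (by fun_prop), pd_one_angFactor]
  simp

theorem dlog_zero {l : ℝ} (hl : 0 < l) (x : Pt n) :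
    dlog l 0 x = x 1 / l ^ 2 / (1 + x 1 ^ 2 / l ^ 2) := by
  have : 1 + x 1 ^ 2 / l ^ 2 ≠ 0 := by positivity
  rw [dlog, pd_gdiag_zero, if_pos rfl, gdiag_zero]
  field_simp

theorem dlog_one {l : ℝ} (hl : 0 < l) (x : Pt n) :
    dlog l 1 x = -(x 1 / l ^ 2 / (1 + x 1 ^ 2 / l ^ 2)) := by
  have : 1 + x 1 ^ 2 / l ^ 2 ≠ 0 := by positivity
  rw [dlog, pd_gdiag_one hl, if_pos rfl, gdiag_one]
  field_simp

theorem dlog_angle (l : ℝ) {x : Pt n} (hx : x ∈ reg n 0) {A : Fin n} (hA : 2 ≤ A.val) :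
    dlog l A x = (x 1)⁻¹ := by
  have h1 := hx.2.ne'
  have h2 := (angFactor_pos hx.1 A).ne'
  rw [dlog, pd_one_gdiag_angle l hA, gdiag_angle l x hA]
  field_simp

/-- `Γ^μ_{rρ}`. -/
theorem christoffel_one {l : ℝ} (hl : 0 < l) {x : Pt n} (hx : x ∈ reg n 0) (μ ρ : Fin n) :
    christoffel l x μ 1 ρ = if μ = ρ then dlog l μ x else 0 := by
  rw [christoffel_eq hl hx]
  by_cases h : μ = ρ
  · subst h
    by_cases h1 : μ = 1
    · subst h1; simp [dlog]
    · simp [h1, Ne.symm h1, dlog]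
  · by_cases h1 : μ = 1
    · subst h1
      simp [h, pd_gdiag_one hl, Ne.symm h]
    · by_cases h2 : ρ = 1
      · subst h2
        simp [h1, pd_gdiag_one hl]
      · simp [h, h1, Ne.symm h2]

/-- `Γ^r_{bρ}` for `b ≠ r`. -/
theorem christoffel_up_one {l : ℝ} (hl : 0 < l) {x : Pt n} (hx : x ∈ reg n 0) {b : Fin n}
    (hb : b ≠ 1) (ρ : Fin n) : christoffel l x 1 b ρ
      = if ρ = b then -((1 + x 1 ^ 2 / l ^ 2) * dlog l b x * gdiag l b x) else 0 := by
  have h0 := gdiag_ne_zero hl hx b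
  rw [christoffel_eq hl hx, gdiag_one, inv_inv, pd_gdiag_one hl, if_neg hb]
  by_cases h : ρ = b
  · subst h
    simp [Ne.symm hb, dlog]
    field_simp
  · by_cases h1 : ρ = 1
    · subst h1; simp [hb, Ne.symm hb]
    · simp [h, Ne.symm h, Ne.symm hb, Ne.symm h1]

/-- The tensor whose divergence is the second order part of the linear operator, apart from the
terms with the trace and with the metric. -/
noncomputable def flux (l : ℝ) (T : Tensor n 2) : Tensor n 3 := fun b z =>
  gradUp l T ![b 0, b 1, b 2] z - gradUp l T ![b 1, b 2, b 0] z - gradUp l T ![b 2, b 1, b 0] z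

theorem contDiffAt_gradUp {l : ℝ} (hl : 0 < l) {x : Pt n} (hx : x ∈ reg n 0) {k : ℕ}
    {T : Tensor n k} (hT : ∀ a, ContDiffAt ℝ ∞ (T a) x) (a : Fin (k + 1) → Fin n) :
    ContDiffAt ℝ ∞ (gradUp l T a) x := by
  have ha : a = Fin.cons (a 0) (Fin.tail a) := (Fin.cons_self_tail a).symm
  rw [ha]
  refine ((contDiffAt_inv_gdiag hl (a 0) hx).mul
    (contDiffAt_covD hl hx hT (a 0) (Fin.tail a))).congr_of_eventuallyEq ?_
  filter_upwards [(isOpen_reg 0).mem_nhds hx] with z hz using gradUp_cons hl T _ _ hz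

/-- For distinct indices the inverse metric entry vanishes, so every term with a metric factor drops
out. The remaining second-order terms in `h^{μν}` form one divergence, because `gbar` undoes the
raising of the outer derivative. -/
theorem linCore_off_diag {l : ℝ} (hl : 0 < l) (Λ : ℝ) {x : Pt n} (hx : x ∈ reg n 0)
    {h : Fin n → Fin n → Pt n → ℝ} (hh : ∀ μ ν, ContDiffAt ℝ ∞ (h μ ν) x) {a b : Fin n}
    (hab : a ≠ b) : linCore l Λ h a b x = 4 * Λ / ((n : ℝ) - 2) * raise l h ![a, b] x
      + gradUp l (gradUp l (trace l h)) ![a, b] x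
      + ∑ κ, covD l (flux l (raise l h)) κ ![κ, a, b] x := by
  have hT := contDiffAt_raise hl hx hh
  have hg : (gbar l x)⁻¹ a b = 0 := by rw [gbar_inv hl hx, if_neg hab]
  have hc : ∀ κ μ ν ρ : Fin n, gbar l x κ κ * gradUp l (gradUp l (raise l h)) ![κ, μ, ν, ρ] x
      = covD l (gradUp l (raise l h)) κ ![μ, ν, ρ] x := by
    intro κ μ ν ρ
    rw [gradUp_three hl _ _ _ _ _ hx, gbar_apply, if_pos rfl, mul_inv_cancel_left₀
      (gdiag_ne_zero hl hx κ)]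
  have hs : ∀ f : Fin n → Fin n → ℝ, ∑ κ, ∑ ρ, gbar l x κ ρ * f κ ρ = ∑ κ, gbar l x κ κ * f κ κ := by
    intro f
    simp [gbar_apply]
  have hd : ∀ c, DifferentiableAt ℝ (gradUp l (raise l h) c) x := fun c =>
    (contDiffAt_gradUp hl hx hT c).differentiableAt (by simp)
  have hf : ∀ κ, covD l (flux l (raise l h)) κ ![κ, a, b] x
      = covD l (gradUp l (raise l h)) κ ![κ, a, b] x - covD l (gradUp l (raise l h)) κ ![a, b, κ] x
        - covD l (gradUp l (raise l h)) κ ![b, a, κ] x := by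
    intro κ
    have hp : pd κ (flux l (raise l h) ![κ, a, b]) x
        = pd κ (gradUp l (raise l h) ![κ, a, b]) x - pd κ (gradUp l (raise l h) ![a, b, κ]) x
          - pd κ (gradUp l (raise l h) ![b, a, κ]) x := by
      rw [← pd_sub (hd _) (hd _), ← pd_sub ((hd _).fun_sub (hd _)) (hd _)]
      rfl
    simp only [covD_three, hp, flux, Matrix.cons_val, mul_sub, Finset.sum_sub_distrib]
    ring
  simp only [linCore, hg, hs, mul_add, hc, hf, Finset.sum_add_distrib, Finset.sum_sub_distrib]
  ring

/-- The divergence of the flux, split according to the index `r`. -/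
theorem div_flux {l : ℝ} (hl : 0 < l) {x : Pt n} (hx : x ∈ reg n 0) (E : Tensor n 3) {a : Fin n}
    (ha : a ≠ 1) : ∑ κ, covD l E κ ![κ, a, 1] x
      = pd 1 (E ![1, a, 1]) x
        + (2 * dlog l 1 x + dlog l a x + ∑ b ∈ Finset.univ.erase 1, dlog l b x) * E ![1, a, 1] x
        + dlog l a x * E ![a, 1, 1] x
        - ∑ b ∈ Finset.univ.erase 1,
          (1 + x 1 ^ 2 / l ^ 2) * dlog l b x * gdiag l b x * E ![b, a, b] x
        + ∑ b ∈ Finset.univ.erase 1, (pd b (E ![b, a, 1]) x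
          + ∑ c ∈ Finset.univ.erase 1, christoffel l x b b c * E ![c, a, 1] x
          + ∑ c ∈ Finset.univ.erase 1, christoffel l x a b c * E ![b, c, 1] x) := by
  have hsplit : ∀ f : Fin n → ℝ, ∑ κ, f κ = f 1 + ∑ κ ∈ Finset.univ.erase 1, f κ := fun f =>
    (Finset.add_sum_erase _ f (Finset.mem_univ 1)).symm
  have h1 : covD l E 1 ![1, a, 1] x = pd 1 (E ![1, a, 1]) x
      + (2 * dlog l 1 x + dlog l a x) * E ![1, a, 1] x := by
    simp only [covD_three, christoffel_one hl hx, ite_mul, zero_mul, Finset.sum_ite_eq,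
      Finset.mem_univ, if_true]
    ring
  have h2 : ∀ b ∈ Finset.univ.erase (1 : Fin n), covD l E b ![b, a, 1] x
      = (pd b (E ![b, a, 1]) x
          + ∑ c ∈ Finset.univ.erase 1, christoffel l x b b c * E ![c, a, 1] x
          + ∑ c ∈ Finset.univ.erase 1, christoffel l x a b c * E ![b, c, 1] x)
        + dlog l b x * E ![1, a, 1] x + (if a = b then dlog l a x * E ![a, 1, 1] x else 0)
        - (1 + x 1 ^ 2 / l ^ 2) * dlog l b x * gdiag l b x * E ![b, a, b] x := by
    intro b hb
    have hb1 := Finset.ne_of_mem_erase hb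
    rw [covD_three, hsplit, hsplit fun ρ => christoffel l x a b ρ * _]
    simp only [christoffel_up_one hl hx hb1, christoffel_symm hl hx _ b 1, christoffel_one hl hx,
      if_true, ite_mul, zero_mul, Finset.sum_ite_eq', Finset.mem_univ]
    by_cases hab : a = b
    · subst hab; simp only [if_true]; ring
    · simp only [hab, if_false]; ring
  rw [hsplit, h1, Finset.sum_congr rfl h2, Finset.sum_sub_distrib, Finset.sum_add_distrib,
    Finset.sum_add_distrib, Finset.sum_ite_eq, if_pos (Finset.mem_erase.2 ⟨ha, Finset.mem_univ a⟩),
    ← Finset.sum_mul]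
  ring

end Flux


/-! ### Fall-off conditions that suffice for asymptotic conservation. -/

section Sufficiency

variable {n : ℕ} [NeZero n] [h3 : Fact (3 ≤ n)]

theorem Gauge.hq_of_components {G : Gauge n} {k : ℕ} {p q s e o : ℝ} {h : Fin n → Fin n → Pt n → ℝ}
    (h11 : G.Q k p (h 1 1)) (ha1 : ∀ a, a ≠ 1 → G.Q k q (h a 1))
    (hab : ∀ a b, a ≠ 1 → b ≠ 1 → G.Q k s (h a b)) (hsymm : ∀ ν, h ν 1 =ᶠ[atInf n] h 1 ν)
    (hp : p ≤ e - 2) (hq : q ≤ o) (hs : s ≤ e + 2) : G.HQ k (two e o) h := by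
  intro μ ν
  by_cases hμ : μ = 1
  · by_cases hν : ν = 1
    · subst hμ hν
      refine h11.mono ?_
      simp [om_one, par_one]
      linarith
    · subst hμ
      refine ((ha1 ν hν).congr (hsymm ν)).mono (m' := -om 1 - om ν + two e o (par 1 + par ν)) ?_
      simp [om_one, par_one, om_ne hν, par_ne hν]
      linarith
  · by_cases hν : ν = 1
    · subst hν
      refine (ha1 μ hμ).mono ?_
      simp [om_one, par_one, om_ne hμ, par_ne hμ]
      linarith
    · refine (hab μ ν hμ hν).mono ?_
      rw [om_ne hμ, om_ne hν, par_ne hμ, par_ne hν, zmod_two_add_self, two_zero]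
      linarith

theorem FallOffClass.hq {p q s e o : ℝ} {h : Fin n → Fin n → Pt n → ℝ}
    (hh : FallOffClass p q s h) (hp : p ≤ e - 2) (hq : q ≤ o) (hs : s ≤ e + 2)
    {R : Matrix (Fin n) (Fin n) ℝ} (hR : IsSpatialRotation R) :
    (bigO n).HQ 2 (two e o) (comp2 h R) := by
  obtain ⟨hsm, h11, ha1, hab⟩ := hh
  have hQ : ∀ μ ν m, FallOff 2 m (fun R => comp2 h R μ ν) → (bigO n).Q 2 m (comp2 h R μ ν) :=
    fun μ ν m hm => ⟨hsm.sm_comp2 hR μ ν, fallOff_iff.1 hm R hR⟩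
  exact Gauge.hq_of_components (hQ _ _ _ h11) (fun a ha => hQ _ _ _ (ha1 a ha))
    (fun a b ha hb => hQ _ _ _ (hab a b ha hb))
    (fun ν => (hsm.comp2_symm hR).mono fun _ hx => hx ν 1) hp hq hs

/-- The choice of even order `-n + 1` and odd order `-n` turns the weight formula, including the
density `r^(n-2)`, into the three required exponents. The value of `Λ` plays no role. -/
theorem FallOffClass.linOpBounds {l : ℝ} (hl : 0 < l) (Λ : ℝ) {p q s : ℝ}
    {h : Fin n → Fin n → Pt n → ℝ} (hh : FallOffClass p q s h) (hp : p ≤ -n - 1) (hq : q ≤ -n)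
    (hs : s ≤ -n + 3) : LinOpBounds l Λ h := by
  have key := fun R (hR : IsSpatialRotation R) μ ν =>
    ((hh.hq (e := -n + 1) (o := -n) (by linarith) hq (by linarith) hR).linOp
      (compat_two (by linarith) (by linarith)) hl Λ μ ν).base
  refine ⟨fun R hR => (bigO n).mono ?_ (key R hR 1 1), fun a ha R hR =>
    (bigO n).mono ?_ (key R hR a 1), fun a b ha hb R hR => (bigO n).mono ?_ (key R hR a b)⟩
  · simp [om_one, par_one]; linarith
  · simp [om_one, par_one, om_ne ha, par_ne ha]
  · rw [om_ne ha, om_ne hb, par_ne ha, par_ne hb, zmod_two_add_self, two_zero]; linarith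

namespace Gauge

variable {G : Gauge n}

theorem TQ.three {k : ℕ} {c : ZMod 2 → ℝ} {T : Tensor n 3} (h : G.TQ k c T) (κ μ ν : Fin n) :
    G.Q k (om κ + om μ + om ν + c (par κ + par μ + par ν)) (T ![κ, μ, ν]) := by
  simpa [Fin.sum_univ_three] using h ![κ, μ, ν]

theorem TQ.flux {k : ℕ} {c : ZMod 2 → ℝ} (hc : Compat c) {l : ℝ} (hl : 0 < l) {T : Tensor n 2}
    (h : G.TQ (k + 1) c T) (κ μ ν : Fin n) :
    G.Q k (om κ + om μ + om ν + c (par κ + par μ + par ν)) (flux l T ![κ, μ, ν]) := by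
  have hB := h.gradUp hc hl
  refine Q.sub (Q.sub (hB.three κ μ ν) ((hB.three μ ν κ).mono (le_of_eq ?_)))
    ((hB.three ν μ κ).mono (le_of_eq ?_))
  · rw [show par μ + par ν + par κ = par κ + par μ + par ν by ring]; ring
  · rw [show par ν + par μ + par κ = par κ + par μ + par ν by ring]; ring

theorem Q.dlog (k : ℕ) {l : ℝ} (hl : 0 < l) (μ : Fin n) : G.Q k (-1) (dlog l μ) := by
  refine ((((Q.inv_gdiag (G := G) k hl μ).const_mul (1 / 2)).mul
    ((Q.gdiag (k + 1) hl μ).pd 1)).mono ?_)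
  simp
  linarith

end Gauge

/-- The remainder of the mixed component of the linear operator. -/
noncomputable def mixedRemainder (l : ℝ) (h : Fin n → Fin n → Pt n → ℝ) (a : Fin n) (x : Pt n) :
    ℝ :=
  gradUp l (gradUp l (trace l h)) ![a, 1] x
  - (pd 1 (fun z => (gdiag l a z)⁻¹ * pd a (raise l h ![1, 1]) z) x
    + (2 * dlog l 1 x + ∑ b ∈ Finset.univ.erase 1, dlog l b x) *
      ((gdiag l a x)⁻¹ * pd a (raise l h ![1, 1]) x))
  + ∑ b ∈ Finset.univ.erase 1, (1 + x 1 ^ 2 / l ^ 2) * dlog l b x * gdiag l b x *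
    ((gdiag l a x)⁻¹ * (pd a (raise l h ![b, b]) x
      + 2 * ∑ c ∈ Finset.univ.erase 1, christoffel l x b a c * raise l h ![c, b] x))
  + ∑ b ∈ Finset.univ.erase 1, (pd b (flux l (raise l h) ![b, a, 1]) x
          + ∑ c ∈ Finset.univ.erase 1, christoffel l x b b c * flux l (raise l h) ![c, a, 1] x
          + ∑ c ∈ Finset.univ.erase 1, christoffel l x a b c * flux l (raise l h) ![b, c, 1] x)

/-- This is half the logarithmic radial derivative of the determinant; the contributions of `τ` and
`r` cancel as `ḡ_ττ ḡ_rr = -1`. -/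
theorem sum_dlog {l : ℝ} (hl : 0 < l) {x : Pt n} (hx : x ∈ reg n 0) :
    dlog l 1 x + ∑ b ∈ Finset.univ.erase 1, dlog l b x = ((n : ℝ) - 2) * (x 1)⁻¹ := by
  have := h3.out
  rw [Finset.add_sum_erase _ (fun b => dlog l b x) (Finset.mem_univ 1), sum_univ_split,
    dlog_zero hl, dlog_one hl, add_neg_cancel, zero_add,
    Finset.sum_congr rfl fun A hA => dlog_angle l hx (Finset.mem_filter.1 hA).2, Finset.sum_const,
    card_two_le, nsmul_eq_mul, Nat.cast_sub (by omega), Nat.cast_two]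

/-- The mixed components of the linear operator contain no derivative of the mixed components of the
perturbation, up to lower order terms. -/
theorem linCore_mixed {l : ℝ} (hl : 0 < l) (Λ : ℝ) {x : Pt n} (hx : x ∈ reg n 0)
    {h : Fin n → Fin n → Pt n → ℝ} (hh : ∀ μ ν, ContDiffAt ℝ ∞ (h μ ν) x)
    (hs : ∀ᶠ z in 𝓝 x, ∀ μ ν, h μ ν z = h ν μ z) {a : Fin n} (ha : a ≠ 1) :
    linCore l Λ h a 1 x = (4 * Λ / ((n : ℝ) - 2) + 2 * ((1 / l ^ 2 + if a = 0 then 0 else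
      -(x 1)⁻¹ ^ 2) + (x 1 / l ^ 2 + if a = 0 then 0 else (x 1)⁻¹) * (((n : ℝ) - 2) * (x 1)⁻¹))) *
        raise l h ![a, 1] x + mixedRemainder l h a x := by
  set T := raise l h with hTdef
  have hT := contDiffAt_raise hl hx hh
  have hr : ∀ᶠ z in 𝓝 x, ∀ μ ν, T ![μ, ν] z = T ![ν, μ] z := by
    filter_upwards [hs, (isOpen_reg 0).mem_nhds hx] with z hz hzr μ ν
    rw [hTdef, raise_apply hl hzr, raise_apply hl hzr, hz μ ν]
    ring
  have hsplit : ∀ f : Fin n → ℝ, ∑ κ, f κ = f 1 + ∑ κ ∈ Finset.univ.erase 1, f κ := fun f =>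
    (Finset.add_sum_erase _ f (Finset.mem_univ 1)).symm
  have hcov : ∀ᶠ z in 𝓝 x, ∀ σ μ ν, covD l T σ ![μ, ν] z = covD l T σ ![ν, μ] z :=
    hr.eventually_nhds.mono fun z hz σ μ ν => covD_two_symm hz σ μ ν
  have hc0 := hcov.self_of_nhds
  have hr0 := hr.self_of_nhds
  set φ : ℝ → ℝ := fun r => r / l ^ 2 + if a = 0 then 0 else r⁻¹ with hφ
  have hφk : ∀ z ∈ reg n 0, (1 + z 1 ^ 2 / l ^ 2) * dlog l a z = φ (z 1) := by
    intro z hz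
    have hz1 := hz.2.ne'
    have hN : 1 + z 1 ^ 2 / l ^ 2 ≠ 0 := by positivity
    by_cases h0 : a = 0
    · subst h0; rw [dlog_zero hl, hφ]; simp; field_simp
    · rw [dlog_angle l hz (two_le_of_ne h0 ha), hφ]; simp [h0]; field_simp; ring
  have hφd : HasDerivAt φ (1 / l ^ 2 + if a = 0 then 0 else -(x 1)⁻¹ ^ 2) (x 1) := by
    have h1 : HasDerivAt (fun r : ℝ => r / l ^ 2) (1 / l ^ 2) (x 1) := (hasDerivAt_id _).div_const _
    by_cases h0 : a = 0
    · simp only [hφ, h0, if_true, add_zero]; exact h1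
    · simp only [hφ, h0, if_false]
      refine h1.add ((hasDerivAt_inv hx.2.ne').congr_deriv ?_)
      rw [inv_pow]
  -- In the component `r a r` of the flux the two terms `D^r h^{ar}` cancel. Only `-D^a h^{rr}`
  -- remains, where `h^{ar}` enters undifferentiated through the connection.
  have hE1 : ∀ᶠ z in 𝓝 x, flux l T ![1, a, 1] z
      = 2 * (φ (z 1) * T ![a, 1] z) - (gdiag l a z)⁻¹ * pd a (T ![1, 1]) z := by
    filter_upwards [hr, (isOpen_reg 0).mem_nhds hx] with z hz hzr
    have h0 := gdiag_ne_zero hl hzr a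
    simp only [flux, Matrix.cons_val]
    rw [gradUp_two hl T a 1 1 hzr, covD_two]
    simp only [christoffel_up_one hl hzr ha, ite_mul, zero_mul, Finset.sum_ite_eq',
      Finset.mem_univ, if_true]
    rw [← hφk z hzr, hz 1 a]
    field_simp
    ring
  -- The component `a r r` does contain `∂_r h^{ar}`; it enters the divergence multiplied by `dlog l
  -- a`.
  have hE2 : flux l T ![a, 1, 1] x = -flux l T ![1, a, 1] x - 2 * ((1 + x 1 ^ 2 / l ^ 2) *
      (pd 1 (T ![a, 1]) x + (dlog l a x + dlog l 1 x) * T ![a, 1] x)) := by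
    have h2 : gradUp l T ![1, a, 1] x = (1 + x 1 ^ 2 / l ^ 2) *
      (pd 1 (T ![a, 1]) x + (dlog l a x + dlog l 1 x) * T ![a, 1] x) := by
      rw [gradUp_two hl _ _ _ _ hx, covD_two, gdiag_one, inv_inv]
      simp only [christoffel_one hl hx, ite_mul, zero_mul, Finset.sum_ite_eq,
        Finset.mem_univ, if_true]
      ring
    have h4 : gradUp l T ![1, 1, a] x = gradUp l T ![1, a, 1] x := by
      rw [gradUp_two hl _ _ _ _ hx, gradUp_two hl _ _ _ _ hx, hc0]
    simp only [flux, Matrix.cons_val]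
    rw [h4, h2]
    ring
  have hE3 : ∀ b ∈ Finset.univ.erase (1 : Fin n), (1 + x 1 ^ 2 / l ^ 2) * dlog l b x *
      gdiag l b x * flux l T ![b, a, b] x
      = -((1 + x 1 ^ 2 / l ^ 2) * dlog l b x * gdiag l b x *
        ((gdiag l a x)⁻¹ * (pd a (T ![b, b]) x
        + 2 * ∑ c ∈ Finset.univ.erase 1, christoffel l x b a c * T ![c, b] x)))
        - if a = b then 2 * (φ (x 1) * dlog l a x * T ![a, 1] x) else 0 := by
    intro b hb
    have hb1 := Finset.ne_of_mem_erase hb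
    have h0 := gdiag_ne_zero hl hx a
    simp only [flux, Matrix.cons_val]
    have h2 : gradUp l T ![a, b, b] x = (gdiag l a x)⁻¹ * (pd a (T ![b, b]) x
        + 2 * (∑ c ∈ Finset.univ.erase 1, christoffel l x b a c * T ![c, b] x)
        + if a = b then 2 * (dlog l a x * T ![a, 1] x) else 0) := by
      rw [gradUp_two hl _ _ _ _ hx, covD_two]
      simp only [fun ρ => hr0 b ρ]
      rw [hsplit, christoffel_symm hl hx, christoffel_one hl hx]
      by_cases hab : a = b
      · subst hab; simp only [if_true, hr0 1 a]; ring
      · simp only [hab, Ne.symm hab, if_false]; ring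
    rw [h2]
    by_cases hab : a = b
    · subst hab
      simp only [if_true]
      rw [← hφk x hx]
      field_simp
      ring
    · simp only [hab, if_false]; ring
  have hd1 : DifferentiableAt ℝ (T ![a, 1]) x := (hT _).differentiableAt (by simp)
  have hY : DifferentiableAt ℝ (fun z => (gdiag l a z)⁻¹ * pd a (T ![1, 1]) z) x :=
    ((contDiffAt_inv_gdiag hl a hx).mul (contDiffAt_pd (hT _))).differentiableAt (by simp)
  have hφx : DifferentiableAt ℝ (fun z : Pt n => φ (z 1)) x :=
    DifferentiableAt.comp (g := φ) x hφd.differentiableAt (differentiableAt_apply 1 x)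
  have hpE : pd 1 (flux l T ![1, a, 1]) x
      = 2 * ((1 / l ^ 2 + if a = 0 then 0 else -(x 1)⁻¹ ^ 2) * T ![a, 1] x
        + φ (x 1) * pd 1 (T ![a, 1]) x)
        - pd 1 (fun z => (gdiag l a z)⁻¹ * pd a (T ![1, 1]) z) x := by
    rw [pd_congr hE1, pd_sub ((hφx.fun_mul hd1).const_mul 2) hY, pd_const_mul 2 (hφx.fun_mul hd1),
      pd_mul hφx hd1, pd_comp_coord hφd.differentiableAt, hφd.deriv, if_pos rfl]
  rw [linCore_off_diag hl Λ hx hh ha, div_flux hl hx _ ha, ← hTdef, hpE,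
    Finset.sum_congr rfl hE3, Finset.sum_sub_distrib, Finset.sum_ite_eq,
    if_pos (Finset.mem_erase.2 ⟨ha, Finset.mem_univ a⟩), Finset.sum_neg_distrib, hE2,
    hE1.self_of_nhds, mixedRemainder, ← hTdef]
  have hsd := sum_dlog hl hx
  have hk := hφk x hx
  have hφ1 : φ (x 1) = x 1 / l ^ 2 + if a = 0 then 0 else (x 1)⁻¹ := rfl
  rw [← hφ1, ← hsd]
  generalize pd 1 (T ![a, 1]) x = V'
  generalize φ (x 1) = f at *
  generalize ∑ b ∈ Finset.univ.erase 1, dlog l b x = S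
  -- The radial derivative from differentiating `φ h^{ar}` cancels the one from the component `a r
  -- r`, because `φ` is the lapse function times `dlog l a`.
  linear_combination (-2 * dlog l a x * T ![a, 1] x - 2 * dlog l 1 x * T ![a, 1] x - 2 * V') * hk

/-- The terms contain the trace, `h^{rr}`, components with two non-radial indices, or flux
components with two non-radial indices. All of these have even parity, so the larger odd order `e +
1` never shows, and the free index pair costs one power. -/
theorem mixedRemainder_order {G : Gauge n} {e : ℝ} {l : ℝ} (hl : 0 < l)
    {h : Fin n → Fin n → Pt n → ℝ} (hh : G.HQ 2 (two e (e + 1)) h) {a : Fin n} (ha : a ≠ 1) :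
    G.P (e - 1) (mixedRemainder l h a) := by
  have hc : Compat (two e (e + 1)) := compat_two (by linarith) (by linarith)
  have hc' : Compat (two e (e - 1)) := compat_two (by linarith) (by linarith)
  have hT := hh.raise hc hl
  -- A scalar has only an even component, so its odd order may be lowered to `e - 1`; the mixed
  -- component of its Hessian then has that order.
  have ht : G.TQ 2 (two e (e - 1)) (trace l h) := fun b => (hh.trace hc hl b).mono (by simp)
  have hF := fun κ μ ν => hT.flux (k := 1) hc hl κ μ ν
  have hTe : ∀ {b c : Fin n}, b ≠ 1 → c ≠ 1 → G.Q 2 (e - 2) (raise l h ![b, c]) := fun hb hc =>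
    (hT.two _ _).mono (by
      rw [om_ne hb, om_ne hc, par_ne hb, par_ne hc, zmod_two_add_self, two_zero]; linarith)
  have hF1 : ∀ {b c : Fin n}, b ≠ 1 → c ≠ 1 → G.Q 1 (e - 1) (flux l (raise l h) ![b, c, 1]) :=
    fun hb hc => (hF _ _ _).mono (by
      rw [om_ne hb, om_ne hc, par_ne hb, par_ne hc, om_one, par_one, zmod_two_add_self, add_zero,
        two_zero]
      linarith)
  have hpd : ∀ {k : ℕ} {b : Fin n} {m : ℝ} {u : Pt n → ℝ}, b ≠ 1 → G.Q (k + 1) m u →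
      G.Q k m (pd b u) := fun hb hu => (hu.pd _).mono (by rw [if_neg hb])
  have hΓ : ∀ {b c d : Fin n}, b ≠ 1 → c ≠ 1 → d ≠ 1 →
      G.Q 0 0 fun x => christoffel l x b c d := fun hb hc hd =>
    (Gauge.Q.christoffel 0 hl _ _ _).mono (by
      rw [om_ne hb, om_ne hc, om_ne hd, par_ne hb, par_ne hc, par_ne hd, zmod_two_add_self]
      simp [eps])
  have hY : G.Q 1 e fun z => (gdiag l a z)⁻¹ * pd a (raise l h ![1, 1]) z := by
    refine ((Gauge.Q.inv_gdiag 1 hl a).mul (hpd ha (hT.two 1 1))).mono ?_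
    simp [om_ne ha, om_one, par_one]
    linarith
  have hne : ∀ {b : Fin n}, b ∈ Finset.univ.erase 1 → b ≠ 1 := fun hb => Finset.ne_of_mem_erase hb
  refine (Gauge.Q.add (k := 0) (Gauge.Q.add (Gauge.Q.sub ?_ (Gauge.Q.add ?_ ?_)) ?_) ?_).base
  · refine (((ht.gradUp hc' hl).gradUp hc' hl).two a 1).mono ?_
    simp [om_ne ha, par_ne ha, om_one, par_one]
  · exact (hY.pd 1).mono (by simp)
  · refine ((Gauge.Q.add ((Gauge.Q.dlog 0 hl 1).const_mul 2)
      (Gauge.Q.sum _ fun b _ => Gauge.Q.dlog 0 hl b)).mul hY.pred).mono (by linarith)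
  · refine Gauge.Q.sum _ fun b hb => ?_
    have hb := hne hb
    refine ((((Gauge.Q.sq_rad_div 0 l).mul (Gauge.Q.dlog 0 hl b)).mul (Gauge.Q.gdiag 0 hl b)).mul
      ((Gauge.Q.inv_gdiag 0 hl a).mul (m' := e - 2) (Gauge.Q.add ((hpd ha (hTe hb hb)).pred)
        (Gauge.Q.const_mul (Gauge.Q.sum _ fun c hc => ?_) 2)))).mono ?_
    · exact ((hΓ hb ha (hne hc)).mul (hTe (hne hc) hb).pred.pred).mono (by linarith)
    · rw [om_ne ha, om_ne hb]; linarith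
  · refine Gauge.Q.sum _ fun b hb => Gauge.Q.add (Gauge.Q.add ?_ ?_) ?_
    · exact hpd (hne hb) (hF1 (hne hb) ha)
    · exact Gauge.Q.sum _ fun c hc =>
        ((hΓ (hne hb) (hne hb) (hne hc)).mul (hF1 (hne hc) ha).pred).mono (by linarith)
    · exact Gauge.Q.sum _ fun c hc =>
        ((hΓ ha (hne hb) (hne hc)).mul (hF1 (hne hb) (hne hc)).pred).mono (by linarith)

/-- Power counting with odd order `-n + 2` misses the bound on `𝓗^{ar}` by two powers. In
`linCore_mixed` the coefficient of `h^{ar}` loses its constant part for this `Λ`, since `4Λ / (n -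
2) = -2 (n - 1) / l²`, and what remains is of order `r⁻²`. -/
theorem FallOffClass.linOpBounds_vacuum {l : ℝ} (hl : 0 < l) {p q s : ℝ}
    {h : Fin n → Fin n → Pt n → ℝ} (hh : FallOffClass p q s h) (hp : p ≤ -n - 1)
    (hq : q ≤ -n + 2) (hs : s ≤ -n + 3) :
    LinOpBounds l (-((n - 1) * (n - 2)) / (2 * l ^ 2)) h := by
  set Λ : ℝ := -((n - 1) * (n - 2)) / (2 * l ^ 2) with hΛ
  have hHQ := fun R (hR : IsSpatialRotation R) => hh.hq (e := -n + 1) (o := -n + 1 + 1)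
    (by linarith) (by linarith) (by linarith) hR
  have key := fun R (hR : IsSpatialRotation R) μ ν =>
    ((hHQ R hR).linOp (compat_two (by linarith) (by linarith)) hl Λ μ ν).base
  have hn : (n : ℝ) - 2 ≠ 0 := by
    have : (3 : ℝ) ≤ n := by exact_mod_cast h3.out
    linarith
  refine ⟨fun R hR => (bigO n).mono ?_ (key R hR 1 1), fun a ha R hR => ?_,
    fun a b ha hb R hR => (bigO n).mono ?_ (key R hR a b)⟩
  · simp [om_one, par_one]; linarith
  · have hT := (hHQ R hR).raise (compat_two (by linarith) (by linarith)) hl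
    -- After the cancellation the coefficient is zero for `a = τ`, and `2 (n - 3) r⁻²` for an angle.
    have hcoef : (bigO n).Q 2 (-2) fun x : Pt n =>
        2 * (if a = 0 then 0 else (n : ℝ) - 3) * x 1 ^ (-2 : ℝ) := (Gauge.Q.rpow 2 (-2)).const_mul _
    have hmain : (bigO n).P (-n) fun x : Pt n =>
        2 * (if a = 0 then 0 else (n : ℝ) - 3) * x 1 ^ (-2 : ℝ) *
          raise l (comp2 h R) ![a, 1] x + mixedRemainder l (comp2 h R) a x := by
      refine (bigO n).add ((bigO n).mono ?_ (hcoef.mul (hT.two a 1)).base)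
        ((bigO n).mono ?_ (mixedRemainder_order hl (hHQ R hR) ha))
      · simp [om_ne ha, om_one, par_ne ha, par_one]
        linarith
      · linarith
    have h1 : (bigO n).P (-2) fun x : Pt n => sqrtNegDet l x / (32 * Real.pi) *
        (2 * (if a = 0 then 0 else (n : ℝ) - 3) * x 1 ^ (-2 : ℝ) *
          raise l (comp2 h R) ![a, 1] x + mixedRemainder l (comp2 h R) a x) := by
      refine (bigO n).congr (.of_forall fun x => ?_) ((bigO n).mono (by linarith) ((bigO n).mul
        ((Gauge.Q.sqrtNegDet (G := bigO n) 0 l).const_mul (1 / (32 * Real.pi))).base hmain))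
      simp only
      ring
    refine (bigO n).congr ?_ h1
    have hsm : ∀ᶠ x in atInf n, ∀ μ ν, ContDiffAt ℝ ∞ (comp2 h R μ ν) x :=
      eventually_all.2 fun μ => eventually_all.2 fun ν => hh.1.sm_comp2 hR μ ν
    filter_upwards [eventually_reg 0, hsm, eventually_nhds_of_atInf (hh.1.comp2_symm hR)]
      with x hx hx1 hx2
    have hx0 := hx.2.ne'
    rw [linOp_eq, linCore_mixed hl Λ hx hx1 hx2 ha]
    congr 3
    rw [Real.rpow_neg hx.2.le, Real.rpow_two, hΛ]
    split_ifs
    · field_simp; ring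
    · field_simp; ring
  · rw [om_ne ha, om_ne hb, par_ne ha, par_ne hb, zmod_two_add_self, two_zero]; linarith

end Sufficiency


/-! ### Perturbations in the `(τ, r)` plane. -/

section TestPerturbations

variable {n : ℕ} [NeZero n] [h3 : Fact (3 ≤ n)] {R : Matrix (Fin n) (Fin n) ℝ}

/-- The covectors `dτ` (`i = 0`) and `dr`. -/
noncomputable def testCovector (i α : Fin n) (z : Pt n) : ℝ :=
  if i = 0 then (if α = 0 then 1 else 0) else if α = 0 then 0 else z α / radius z

/-- The perturbation `a(τ) ψ(r) (dx^i dx^j + dx^j dx^i)` with `i`, `j` in the `(τ, r)` plane. -/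
noncomputable def testPert (a ψ : ℝ → ℝ) (i j α β : Fin n) (z : Pt n) : ℝ :=
  a (z 0) * ψ (radius z) * (testCovector i α z * testCovector j β z
    + testCovector j α z * testCovector i β z)

/-- The constant components of `dx^i dx^j + dx^j dx^i`. -/
noncomputable def symDelta (i j μ ν : Fin n) : ℝ :=
  (if μ = i then 1 else 0) * (if ν = j then 1 else 0)
    + (if μ = j then 1 else 0) * (if ν = i then 1 else 0)

theorem sum_jac_testCovector (hR : IsSpatialRotation R) {x : Pt n} (hx : x ∈ reg n 0) {i : Fin n}
    (hi : i = 0 ∨ i = 1) (μ : Fin n) :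
    ∑ α, jac R x α μ * testCovector i α (chart R x) = if μ = i then 1 else 0 := by
  have hx1 := hx.2.ne'
  rcases hi with rfl | rfl
  · simp [testCovector, jac_zero_row hR]
  · have h : ∀ α, jac R x α μ * testCovector 1 α (chart R x)
        = (if α ≠ 0 then chart R x α * jac R x α μ else 0) * (x 1)⁻¹ := by
      intro α
      rw [testCovector, if_neg one_ne_zero', radius_chart hR hx.2.le]
      by_cases hα : α = 0
      · simp [hα]
      · simp [hα]; ring
    rw [Finset.sum_congr rfl fun α _ => h α, ← Finset.sum_mul, ← Finset.sum_filter,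
      sum_chart_jac hR]
    split_ifs
    · field_simp
    · simp

theorem comp2_testPert (hR : IsSpatialRotation R) {x : Pt n} (hx : x ∈ reg n 0) {i j : Fin n}
    (hi : i = 0 ∨ i = 1) (hj : j = 0 ∨ j = 1) (a ψ : ℝ → ℝ) (μ ν : Fin n) :
    comp2 (testPert a ψ i j) R μ ν x = a (x 0) * ψ (x 1) * symDelta i j μ ν := by
  rw [symDelta, ← sum_jac_testCovector hR hx hi μ, ← sum_jac_testCovector hR hx hi ν,
    ← sum_jac_testCovector hR hx hj μ, ← sum_jac_testCovector hR hx hj ν, Finset.sum_mul_sum,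
    Finset.sum_mul_sum, ← Finset.sum_add_distrib, Finset.mul_sum, comp2]
  refine Finset.sum_congr rfl fun α _ => ?_
  rw [← Finset.sum_add_distrib, Finset.mul_sum]
  refine Finset.sum_congr rfl fun β _ => ?_
  rw [testPert, radius_chart hR hx.2.le, chart_zero hR]
  ring

theorem isSmoothPerturbation_testPert {a ψ : ℝ → ℝ} (ha : ContDiff ℝ ∞ a)
    (hψ : ContDiffOn ℝ ∞ ψ (Set.Ioi 0)) (i j : Fin n) :
    IsSmoothPerturbation (testPert (n := n) a ψ i j) := by
  have hc : ∀ i α : Fin n, ContDiffOn ℝ ∞ (testCovector (n := n) i α) (exterior n 1) := by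
    intro i α
    unfold testCovector
    split_ifs
    · exact contDiffOn_const
    · exact contDiffOn_const
    · exact contDiffOn_const
    · exact (contDiff_apply ℝ ℝ α).contDiffOn.div (contDiffOn_radius 1)
        fun z hz => (radius_pos hz).ne'
  refine ⟨1, one_pos, fun α β => ?_, fun α β z _ => ?_⟩
  · refine ((ha.comp (contDiff_apply ℝ ℝ 0)).contDiffOn.mul
      (hψ.comp (contDiffOn_radius 1) fun z hz => radius_pos hz)).mul ?_
    exact ((hc i α).mul (hc j β)).add ((hc j α).mul (hc i β))
  · rw [testPert, testPert]; ring

/-- The only nonvanishing static components are the pair `i`, `j`, and they are the same in all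
charts. Hence only one of the three exponents is constrained. -/
theorem fallOffClass_testPert {a ψ : ℝ → ℝ} (ha : ContDiff ℝ ∞ a)
    (hψ : ContDiffOn ℝ ∞ ψ (Set.Ioi 0)) {i j : Fin n} (hi : i = 0 ∨ i = 1) (hj : j = 0 ∨ j = 1)
    {m p q s : ℝ} (hQ : (bigO n).Q 2 m fun x => a (x 0) * ψ (x 1)) (hp : i = 1 → j = 1 → m ≤ p)
    (hq : i ≠ j → m ≤ q) (hs : i = 0 → j = 0 → m ≤ s) :
    FallOffClass p q s (testPert (n := n) a ψ i j) := by
  have key : ∀ (μ ν : Fin n) (m' : ℝ), (symDelta i j μ ν ≠ 0 → m ≤ m') →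
      FallOff 2 m' fun R => comp2 (testPert a ψ i j) R μ ν := by
    intro μ ν m' hm
    refine fallOff_iff.2 fun R hR => ?_
    by_cases h0 : symDelta i j μ ν = 0
    · refine Gauge.Pk.congr ?_ (Gauge.Pk.zero (bigO n) 2 m')
      filter_upwards [eventually_reg 0] with x hx
      rw [comp2_testPert hR hx hi hj, h0, mul_zero]
    · refine Gauge.Pk.congr ?_ ((hQ.const_mul (symDelta i j μ ν)).mono (hm h0)).pk
      filter_upwards [eventually_reg 0] with x hx
      rw [comp2_testPert hR hx hi hj, mul_comm]
  refine ⟨isSmoothPerturbation_testPert ha hψ i j, key _ _ _ fun h => ?_,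
    fun b hb => key _ _ _ fun h => ?_, fun b c hb hc => key _ _ _ fun h => ?_⟩
  · rcases hi with rfl | rfl <;> rcases hj with rfl | rfl
    · simp only [symDelta, if_neg (one_ne_zero' (n := n)), mul_zero, add_zero] at h; exact absurd rfl h
    · simp only [symDelta, if_neg (one_ne_zero' (n := n)), zero_mul, mul_zero, add_zero] at h; exact absurd rfl h
    · simp only [symDelta, if_neg (one_ne_zero' (n := n)), zero_mul, mul_zero, add_zero] at h; exact absurd rfl h
    · exact hp rfl rfl
  · refine hq fun hij => h ?_
    subst hij
    rcases hi with rfl | rfl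
    · simp only [symDelta, if_neg (one_ne_zero' (n := n)), mul_zero, add_zero]
    · simp only [symDelta, if_neg hb, zero_mul, add_zero]
  · rcases hi with rfl | rfl <;> rcases hj with rfl | rfl
    · exact hs rfl rfl
    all_goals simp only [symDelta, if_neg hb, if_neg hc, zero_mul, mul_zero, add_zero] at h; exact absurd rfl h

theorem pd_pair {a ψ a' ψ' : ℝ → ℝ} {x : Pt n} (ha : HasDerivAt a (a' (x 0)) (x 0))
    (hψ : HasDerivAt ψ (ψ' (x 1)) (x 1)) (κ : Fin n) : pd κ (fun z => a (z 0) * ψ (z 1)) x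
      = (if κ = 0 then a' (x 0) * ψ (x 1) else 0) + if κ = 1 then a (x 0) * ψ' (x 1) else 0 := by
  have h1 : DifferentiableAt ℝ (fun z : Pt n => a (z 0)) x :=
    DifferentiableAt.comp (g := a) x ha.differentiableAt (differentiableAt_apply 0 x)
  have h2 : DifferentiableAt ℝ (fun z : Pt n => ψ (z 1)) x :=
    DifferentiableAt.comp (g := ψ) x hψ.differentiableAt (differentiableAt_apply 1 x)
  rw [pd_mul h1 h2, pd_comp_coord ha.differentiableAt, pd_comp_coord hψ.differentiableAt, ha.deriv, hψ.deriv]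
  split_ifs <;> ring

/-- The second derivatives of a product. -/
theorem pd_pd_pair {a ψ a' ψ' a'' ψ'' : ℝ → ℝ} (ha : ∀ t, HasDerivAt a (a' t) t)
    (ha' : ∀ t, HasDerivAt a' (a'' t) t) (hψ : ∀ t, 0 < t → HasDerivAt ψ (ψ' t) t)
    (hψ' : ∀ t, 0 < t → HasDerivAt ψ' (ψ'' t) t) {x : Pt n} (hx : x ∈ reg n 0) (κ ρ : Fin n) :
    pd κ (pd ρ fun z => a (z 0) * ψ (z 1)) x
      = (if ρ = 0 then (if κ = 0 then a'' (x 0) * ψ (x 1) else 0)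
          + if κ = 1 then a' (x 0) * ψ' (x 1) else 0 else 0)
        + if ρ = 1 then (if κ = 0 then a' (x 0) * ψ' (x 1) else 0)
          + if κ = 1 then a (x 0) * ψ'' (x 1) else 0 else 0 := by
  have h : (pd ρ fun z => a (z 0) * ψ (z 1)) =ᶠ[𝓝 x] fun z =>
      (if ρ = 0 then a' (z 0) * ψ (z 1) else 0) + if ρ = 1 then a (z 0) * ψ' (z 1) else 0 := by
    filter_upwards [(isOpen_reg 0).mem_nhds hx] with z hz using pd_pair (ha _) (hψ _ hz.2) ρ
  rw [pd_congr h]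
  by_cases h0 : ρ = 0
  · subst h0
    simp only [if_true, if_neg (zero_ne_one' (n := n)), add_zero]
    exact pd_pair (ha' _) (hψ _ hx.2) κ
  · by_cases h1 : ρ = 1
    · subst h1
      simp only [if_true, h0, if_false, zero_add]
      exact pd_pair (ha _) (hψ' _ hx.2) κ
    · simp [h0, h1]

end TestPerturbations

/-! ### The linear operator at points where the one-jet vanishes. -/

section Jets

variable {n : ℕ} [NeZero n] [h3 : Fact (3 ≤ n)]

theorem pd_mul_of_zero {u v : Pt n → ℝ} {x : Pt n} (hu : DifferentiableAt ℝ u x)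
    (hv : DifferentiableAt ℝ v x) (h0 : v x = 0) (μ : Fin n) :
    pd μ (fun z => u z * v z) x = u x * pd μ v x := by
  rw [pd_mul hu hv, h0]; ring

theorem pd_pd_mul_of_zero {u v : Pt n → ℝ} {x : Pt n} (hu : ContDiffAt ℝ ∞ u x)
    (hv : ContDiffAt ℝ ∞ v x) (h0 : v x = 0) (h1 : ∀ μ, pd μ v x = 0) (κ ρ : Fin n) :
    pd κ (pd ρ fun z => u z * v z) x = u x * pd κ (pd ρ v) x := by
  have hd : ∀ {w : Pt n → ℝ}, ContDiffAt ℝ ∞ w x → ∀ᶠ z in 𝓝 x, DifferentiableAt ℝ w z :=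
    fun hw => (hw.of_le (m := 1) (by simp)).eventually (by simp) |>.mono
      fun z hz => hz.differentiableAt (by simp)
  have h : (pd ρ fun z => u z * v z) =ᶠ[𝓝 x] fun z => pd ρ u z * v z + u z * pd ρ v z := by
    filter_upwards [hd hu, hd hv] with z hz hz' using pd_mul hz hz'
  have hD : ∀ {w : Pt n → ℝ}, ContDiffAt ℝ ∞ w x → DifferentiableAt ℝ w x :=
    fun hw => hw.differentiableAt (by simp)
  rw [pd_congr h, pd_add ((hD (contDiffAt_pd hu)).fun_mul (hD hv))
    ((hD hu).fun_mul (hD (contDiffAt_pd hv))), pd_mul_of_zero (hD (contDiffAt_pd hu)) (hD hv) h0,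
    pd_mul_of_zero (hD hu) (hD (contDiffAt_pd hv)) (h1 ρ), h1]
  ring

/-- Where a tensor and its first derivatives vanish, its second covariant derivatives are the
second partial derivatives. -/
theorem gradUp_gradUp_two_of_zero {l : ℝ} (hl : 0 < l) {x : Pt n} (hx : x ∈ reg n 0)
    {T : Tensor n 2} (hT : ∀ a, ContDiffAt ℝ ∞ (T a) x) (h0 : ∀ a, T a x = 0)
    (h1 : ∀ a μ, pd μ (T a) x = 0) (κ ρ μ ν : Fin n) :
    gradUp l (gradUp l T) ![κ, ρ, μ, ν] x
      = (gdiag l κ x)⁻¹ * (gdiag l ρ x)⁻¹ * pd κ (pd ρ (T ![μ, ν])) x := by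
  have hD : ∀ {w : Pt n → ℝ}, ContDiffAt ℝ ∞ w x → DifferentiableAt ℝ w x :=
    fun hw => hw.differentiableAt (by simp)
  have hc : ∀ σ α β, covD l T σ ![α, β] x = 0 := fun σ α β => by
    rw [covD_two, h1]; simp [h0]
  have hs : ∀ (f : Fin n → Pt n → ℝ) (g : Fin n → Pt n → ℝ), (∀ i, ContDiffAt ℝ ∞ (f i) x) →
      (∀ i, ContDiffAt ℝ ∞ (g i) x) → (∀ i, g i x = 0) → (∀ i μ, pd μ (g i) x = 0) →
      pd κ (fun z => ∑ i, f i z * g i z) x = 0 := by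
    intro f g hf hg hg0 hg1
    rw [pd_sum _ fun i _ => (hD (hf i)).fun_mul (hD (hg i))]
    refine Finset.sum_eq_zero fun i _ => ?_
    rw [pd_mul_of_zero (hD (hf i)) (hD (hg i)) (hg0 i), hg1, mul_zero]
  -- The derivative of a connection term falls on a coefficient of a vanishing component or on that
  -- component, whose first derivative also vanishes.
  have hp : pd κ (covD l T ρ ![μ, ν]) x = pd κ (pd ρ (T ![μ, ν])) x := by
    have he : covD l T ρ ![μ, ν] = fun z => pd ρ (T ![μ, ν]) z
        + ∑ σ, christoffel l z μ ρ σ * T ![σ, ν] z + ∑ σ, christoffel l z ν ρ σ * T ![μ, σ] z :=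
      funext fun z => covD_two l T ρ μ ν z
    have hΓ := fun α σ => contDiff_christoffel hl hx α ρ σ
    rw [he, pd_add, pd_add, hs _ _ (fun σ => hΓ μ σ) (fun σ => hT _) (fun _ => h0 _) (fun _ => h1 _),
      hs _ _ (fun σ => hΓ ν σ) (fun σ => hT _) (fun _ => h0 _) (fun _ => h1 _), add_zero, add_zero]
    · exact hD (contDiffAt_pd (hT _))
    · exact DifferentiableAt.fun_sum fun σ _ => (hD (hΓ μ σ)).fun_mul (hD (hT _))
    · exact (hD (contDiffAt_pd (hT _))).fun_add
        (DifferentiableAt.fun_sum fun σ _ => (hD (hΓ μ σ)).fun_mul (hD (hT _)))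
    · exact DifferentiableAt.fun_sum fun σ _ => (hD (hΓ ν σ)).fun_mul (hD (hT _))
  rw [gradUp_gradUp_two hl hx hT, hp]
  simp [hc]

/-- The linear operator where the perturbation and its first derivatives vanish. -/
theorem linCore_diag_of_zero {l : ℝ} (hl : 0 < l) (Λ : ℝ) {x : Pt n} (hx : x ∈ reg n 0)
    {h : Fin n → Fin n → Pt n → ℝ} (hh : ∀ μ ν, ContDiffAt ℝ ∞ (h μ ν) x)
    (h0 : ∀ μ ν, h μ ν x = 0) (h1 : ∀ μ ν κ, pd κ (h μ ν) x = 0) {A : Fin n}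
    (hA : ∀ κ μ ν, pd κ (pd A (h μ ν)) x = 0) (hA' : ∀ κ ρ μ, pd κ (pd ρ (h μ A)) x = 0) :
    linCore l Λ h A A x = -(gdiag l A x)⁻¹ * ∑ κ, ∑ σ, (gdiag l κ x)⁻¹ * (gdiag l σ x)⁻¹ *
      (pd κ (pd κ (h σ σ)) x - pd κ (pd σ (h σ κ)) x) := by
  have hT := contDiffAt_raise hl hx hh
  have ht := contDiffAt_trace hl hx hh
  have hg := fun μ => contDiffAt_inv_gdiag hl μ hx
  have hD : ∀ {w : Pt n → ℝ}, ContDiffAt ℝ ∞ w x → DifferentiableAt ℝ w x :=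
    fun hw => hw.differentiableAt (by simp)
  have hTe : ∀ μ ν, raise l h ![μ, ν] =ᶠ[𝓝 x]
      fun z => (gdiag l μ z)⁻¹ * (gdiag l ν z)⁻¹ * h μ ν z := fun μ ν => by
    filter_upwards [(isOpen_reg 0).mem_nhds hx] with z hz using raise_apply hl hz h μ ν
  have hte : trace l h ![] =ᶠ[𝓝 x] fun z => ∑ α, (gdiag l α z)⁻¹ * h α α z := by
    filter_upwards [(isOpen_reg 0).mem_nhds hx] with z hz using trace_apply hl hz h
  have hvec : ∀ a : Fin 2 → Fin n, a = ![a 0, a 1] := fun a => by ext i; fin_cases i <;> rfl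
  have hT0 : ∀ a, raise l h a x = 0 := fun a => by
    rw [hvec a, (hTe _ _).eq_of_nhds, h0, mul_zero]
  have hT1 : ∀ a μ, pd μ (raise l h a) x = 0 := fun a μ => by
    rw [hvec a, pd_congr (hTe _ _), pd_mul_of_zero (hD ((hg _).mul (hg _))) (hD (hh _ _)) (h0 _ _),
      h1, mul_zero]
  have hT2 : ∀ κ ρ μ ν, pd κ (pd ρ (raise l h ![μ, ν])) x
      = (gdiag l μ x)⁻¹ * (gdiag l ν x)⁻¹ * pd κ (pd ρ (h μ ν)) x := by
    intro κ ρ μ ν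
    rw [pd_congr ((hTe μ ν).eventuallyEq_nhds.mono fun z hz => pd_congr hz),
      pd_pd_mul_of_zero ((hg μ).mul (hg ν)) (hh μ ν) (h0 μ ν) (h1 μ ν)]
  have ht1 : ∀ μ, pd μ (trace l h ![]) x = 0 := fun μ => by
    rw [pd_congr hte, pd_sum _ fun α _ => (hD (hg α)).fun_mul (hD (hh α α))]
    exact Finset.sum_eq_zero fun α _ => by
      rw [pd_mul_of_zero (hD (hg α)) (hD (hh α α)) (h0 α α), h1, mul_zero]
  have ht2 : ∀ κ ρ, pd κ (pd ρ (trace l h ![])) x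
      = ∑ α, (gdiag l α x)⁻¹ * pd κ (pd ρ (h α α)) x := by
    intro κ ρ
    have hsm : ∀ α, ∀ᶠ z in 𝓝 x, DifferentiableAt ℝ (fun z => (gdiag l α z)⁻¹ * h α α z) z :=
      fun α => (((hg α).mul (hh α α)).of_le (m := 1) (by simp)).eventually (by simp) |>.mono
        fun z hz => hz.differentiableAt (by simp)
    have he : pd ρ (trace l h ![]) =ᶠ[𝓝 x]
        fun z => ∑ α, pd ρ (fun z => (gdiag l α z)⁻¹ * h α α z) z := by
      filter_upwards [hte.eventuallyEq_nhds, eventually_all.2 hsm] with z hz hz'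
      rw [pd_congr hz, pd_sum _ fun α _ => hz' α]
    rw [pd_congr he, pd_sum _ fun α _ => hD (contDiffAt_pd ((hg α).mul (hh α α)))]
    exact Finset.sum_congr rfl fun α _ =>
      pd_pd_mul_of_zero (hg α) (hh α α) (h0 α α) (h1 α α) κ ρ
  have hDDh := fun κ ρ μ ν => gradUp_gradUp_two_of_zero hl hx hT hT0 hT1 κ ρ μ ν
  have hDDt : ∀ μ ν, gradUp l (gradUp l (trace l h)) ![μ, ν] x
      = (gdiag l μ x)⁻¹ * (gdiag l ν x)⁻¹ * ∑ α, (gdiag l α x)⁻¹ * pd μ (pd ν (h α α)) x := by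
    intro μ ν
    rw [gradUp_gradUp_zero hl hx ht, ht2]
    simp [ht1]
  have ht0 : trace l h ![] x = 0 := by rw [hte.eq_of_nhds]; simp [h0]
  have hgg : ∀ κ, gdiag l κ x ≠ 0 := gdiag_ne_zero hl hx
  have hA2 : ∀ κ ρ, pd κ (pd ρ (h A A)) x = 0 := fun κ ρ => hA' κ ρ A
  -- Without components or derivatives along `A`, only the terms multiplied by `ḡ^{AA}` survive: the
  -- wave operator on the trace minus the double divergence.
  simp only [linCore, hDDh, hDDt, hT2, hT0, ht0, gbar_inv hl hx, gbar_apply, if_true, hA2, hA,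
    ite_mul, zero_mul, Finset.sum_ite_eq, Finset.mem_univ, mul_zero, mul_ite,
    Finset.sum_const_zero, add_zero, sub_zero, zero_sub, Finset.sum_ite_irrel]
  rw [neg_mul, ← mul_neg, ← mul_neg, ← Finset.sum_sub_distrib]
  congr 2
  refine Finset.sum_congr rfl fun κ _ => ?_
  rw [Finset.mul_sum, Finset.mul_sum, ← Finset.sum_sub_distrib]
  refine Finset.sum_congr rfl fun σ _ => ?_
  have := hgg κ
  have := hgg σ
  field_simp

end Jets


/-! ### Necessity of the fall-off conditions. -/

section Necessity

variable {n : ℕ} [NeZero n] [h3 : Fact (3 ≤ n)]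

/-- The family `r^m (A + B cos (log r) + C sin (log r))`, closed under differentiation. -/
noncomputable def wave (m A B C r : ℝ) : ℝ :=
  r ^ m * (A + B * Real.cos (Real.log r) + C * Real.sin (Real.log r))

theorem hasDerivAt_wave (m A B C : ℝ) {r : ℝ} (hr : 0 < r) :
    HasDerivAt (wave m A B C) (wave (m - 1) (m * A) (m * B + C) (m * C - B) r) r := by
  have hlog := Real.hasDerivAt_log hr.ne'
  have h := (Real.hasDerivAt_rpow_const (p := m) (Or.inl hr.ne')).mul
    (((hlog.cos.const_mul B).const_add A).add (hlog.sin.const_mul C))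
  refine h.congr_deriv ?_
  simp only [wave, Real.rpow_sub_one hr.ne', Pi.add_apply]
  field_simp
  ring

theorem contDiffOn_wave (m A B C : ℝ) : ContDiffOn ℝ ∞ (wave m A B C) (Set.Ioi 0) := by
  have hlog : ContDiffOn ℝ ∞ Real.log (Set.Ioi 0) := fun r hr =>
    (Real.contDiffAt_log.2 (ne_of_gt hr)).contDiffWithinAt
  exact ContDiffOn.mul (fun r hr =>
      (Real.contDiffAt_rpow_const_of_ne (ne_of_gt hr)).contDiffWithinAt)
    ((contDiffOn_const.add (contDiffOn_const.mul (Real.contDiff_cos.comp_contDiffOn hlog))).add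
      (contDiffOn_const.mul (Real.contDiff_sin.comp_contDiffOn hlog)))

theorem Q_wave (k : ℕ) (m A B C : ℝ) : (bigO n).Q k m fun x : Pt n => wave m A B C (x 1) := by
  have h := (((Gauge.Q.const (bigO n) k A).add ((Q_logTrig (n := n) k).2.const_mul B)).add
    ((Q_logTrig (n := n) k).1.const_mul C))
  exact ((Gauge.Q.rpow (G := bigO n) k m).mul h).mono (by simp)

/-- A sequence of radii on which the logarithm is a multiple of the period. -/
noncomputable def testRadius (k : ℕ) : ℝ := Real.exp (k * (2 * Real.pi))

theorem testRadius_pos (k : ℕ) : 0 < testRadius k := Real.exp_pos _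

theorem tendsto_testRadius : Tendsto testRadius atTop atTop :=
  Real.tendsto_exp_atTop.comp
    (tendsto_natCast_atTop_atTop.atTop_mul_const (by positivity))

theorem wave_testRadius (m A B C : ℝ) (k : ℕ) :
    wave m A B C (testRadius k) = testRadius k ^ m * (A + B) := by
  have h1 : Real.log (testRadius k) = k * (2 * Real.pi) := Real.log_exp _
  have h2 := Real.sin_periodic.nat_mul_eq k
  rw [wave, h1, Real.cos_nat_mul_two_pi, h2, Real.sin_zero]
  ring

/-- The point of the equator with `τ = 0` and radius `r`. -/
noncomputable def equatorPt (n : ℕ) [NeZero n] (r : ℝ) : Pt n :=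
  Function.update (fun μ => if μ = 0 then 0 else Real.pi / 2) 1 r

theorem equator_mem_chartBox :
    (fun μ : Fin n => if μ = 0 then 0 else Real.pi / 2) ∈ chartBox n := by
  intro A hA
  have := Real.pi_pos
  simp only [if_neg (ne_zero_of_two_le hA), InAngleRange]
  split_ifs <;> constructor <;> linarith

theorem equatorPt_mem_reg {r : ℝ} (hr : 0 < r) : equatorPt n r ∈ reg n 0 :=
  update_mem_reg equator_mem_chartBox hr

theorem equatorPt_zero (r : ℝ) : equatorPt n r 0 = 0 := by
  rw [equatorPt, Function.update_of_ne zero_ne_one', if_pos rfl]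

theorem equatorPt_one (r : ℝ) : equatorPt n r 1 = r := Function.update_self _ _ _

theorem sphereDensity_equatorPt (r : ℝ) : sphereDensity (equatorPt n r) = 1 := by
  refine Finset.prod_eq_one fun A _ => Finset.prod_eq_one fun B hB => ?_
  have hB := (Finset.mem_filter.1 hB).2.1
  rw [equatorPt, Function.update_of_ne (ne_one_of_two_le hB), if_neg (ne_zero_of_two_le hB),
    Real.sin_pi_div_two]

/-- An `O`-estimate at one point of the chart compares powers along a sequence of radii tending to
infinity. Lower bounds on that sequence suffice, so oscillating test functions are allowed. -/
theorem exponent_le {m m' c : ℝ} {u : Pt n → ℝ} (hu : (bigO n).P m u) (hc : 0 < c)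
    (h : ∀ k, c * testRadius k ^ m' ≤ |u (equatorPt n (testRadius k))|) : m' ≤ m := by
  obtain ⟨C, hC⟩ := hu {fun μ => if μ = 0 then 0 else Real.pi / 2} isCompact_singleton
    (Set.singleton_subset_iff.2 equator_mem_chartBox)
  by_contra! hlt
  have h1 := ((tendsto_rpow_atTop (sub_pos.2 hlt)).const_mul_atTop hc).comp tendsto_testRadius
  obtain ⟨k, hk1, hk2⟩ := ((tendsto_testRadius.eventually hC).and
    (h1.eventually_gt_atTop C)).exists
  have h2 := (h k).trans (hk1 _ rfl)
  simp only [Function.comp, Real.rpow_sub (testRadius_pos k)] at hk2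
  have := Real.rpow_pos_of_pos (testRadius_pos k) m
  rw [mul_div_assoc', lt_div_iff₀ this] at hk2
  linarith

theorem linOp_exponent_le {l Λ m e c : ℝ} {h : Fin n → Fin n → Pt n → ℝ} {μ ν : Fin n}
    (hu : (bigO n).P m (linOp l Λ h μ ν)) (hc : 0 < c) (hb : ∀ k, c * testRadius k ^ e ≤
      |linCore l Λ h μ ν (equatorPt n (testRadius k))|) : n - 2 + e ≤ m := by
  have hn := h3.out
  refine exponent_le (c := c / (32 * Real.pi)) hu (by positivity) fun k => ?_
  have hr := testRadius_pos k
  rw [linOp_eq, sqrtNegDet_eq (equatorPt_mem_reg hr), sphereDensity_equatorPt, equatorPt_one,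
    mul_one, abs_mul, abs_of_pos (by positivity), Real.rpow_add hr, ← Real.rpow_natCast,
    Nat.cast_sub (by omega), Nat.cast_two]
  have h1 : 0 < testRadius k ^ ((n : ℝ) - 2) / (32 * Real.pi) := by positivity
  calc _ = testRadius k ^ ((n : ℝ) - 2) / (32 * Real.pi) * (c * testRadius k ^ e) := by ring
    _ ≤ _ := mul_le_mul_of_nonneg_left (hb k) h1.le

variable {a a' ψ ψ' ψ'' : ℝ → ℝ} {i j : Fin n}

theorem comp2_testPert_nhds (hi : i = 0 ∨ i = 1) (hj : j = 0 ∨ j = 1) (a ψ : ℝ → ℝ) {x : Pt n}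
    (hx : x ∈ reg n 0) (μ ν : Fin n) : comp2 (testPert a ψ i j) 1 μ ν
      =ᶠ[𝓝 x] fun z => symDelta i j μ ν * (a (z 0) * ψ (z 1)) := by
  filter_upwards [(isOpen_reg 0).mem_nhds hx] with z hz
  rw [comp2_testPert isSpatialRotation_one hz hi hj, mul_comm]

theorem contDiffAt_pair (ha : ContDiff ℝ ∞ a) (hψ : ContDiffOn ℝ ∞ ψ (Set.Ioi 0)) {x : Pt n}
    (hx : x ∈ reg n 0) : ContDiffAt ℝ ∞ (fun z : Pt n => a (z 0) * ψ (z 1)) x :=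
  (ha.comp (contDiff_apply ℝ ℝ 0)).contDiffAt.mul
    (ContDiffAt.comp (g := ψ) x (hψ.contDiffAt (Ioi_mem_nhds hx.2))
      (contDiff_apply ℝ ℝ 1).contDiffAt)

theorem contDiffAt_comp2_testPert (hi : i = 0 ∨ i = 1) (hj : j = 0 ∨ j = 1) (ha : ContDiff ℝ ∞ a)
    (hψ : ContDiffOn ℝ ∞ ψ (Set.Ioi 0)) {x : Pt n} (hx : x ∈ reg n 0) (μ ν : Fin n) :
    ContDiffAt ℝ ∞ (comp2 (testPert a ψ i j) 1 μ ν) x :=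
  (contDiffAt_const.mul (contDiffAt_pair ha hψ hx)).congr_of_eventuallyEq
    (comp2_testPert_nhds hi hj a ψ hx μ ν)

theorem symDelta_eq_zero (hi : i = 0 ∨ i = 1) (hj : j = 0 ∨ j = 1) {μ ν A : Fin n}
    (hA : 2 ≤ A.val) (h : μ = A ∨ ν = A) : symDelta i j μ ν = 0 := by
  have h1 := ne_one_of_two_le hA
  have h0 := ne_zero_of_two_le hA
  have hAi : A ≠ i := by rcases hi with rfl | rfl <;> assumption
  have hAj : A ≠ j := by rcases hj with rfl | rfl <;> assumption
  rcases h with rfl | rfl <;> simp [symDelta, hAi, hAj]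

/-- The angular component of the linear operator where the test perturbation and its first
derivatives vanish. -/
theorem linCore_testPert {l : ℝ} (hl : 0 < l) (Λ : ℝ) (hi : i = 0 ∨ i = 1) (hj : j = 0 ∨ j = 1)
    (hac : ContDiff ℝ ∞ a) (hψc : ContDiffOn ℝ ∞ ψ (Set.Ioi 0)) {c : ℝ}
    (ha : ∀ t, HasDerivAt a c t) (hψ : ∀ t, 0 < t → HasDerivAt ψ (ψ' t) t)
    (hψ' : ∀ t, 0 < t → HasDerivAt ψ' (ψ'' t) t) {r : ℝ} (hr : 0 < r) (h0 : ψ r = 0)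
    (h1 : a 0 * ψ' r = 0) : linCore l Λ (comp2 (testPert a ψ i j) 1) (angleOne n) (angleOne n)
        (equatorPt n r)
      = r⁻¹ ^ 2 * (symDelta i j 0 0 * (a 0 * ψ'' r) - 2 * (symDelta i j 0 1 * (c * ψ' r))) := by
  set x := equatorPt n r with hxdef
  have hx : x ∈ reg n 0 := equatorPt_mem_reg hr
  have hx0 : x 0 = 0 := equatorPt_zero r
  have hx1 : x 1 = r := equatorPt_one r
  have hA : 2 ≤ (angleOne n).val := by rw [val_angleOne]
  have hA1 := ne_one_of_two_le hA
  have hA0 := ne_zero_of_two_le hA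
  have hev := comp2_testPert_nhds hi hj a ψ hx
  have hpair := contDiffAt_pair hac hψc hx
  have hd := hpair.differentiableAt (by simp)
  have hpp : ∀ κ ρ μ ν, pd κ (pd ρ (comp2 (testPert a ψ i j) 1 μ ν)) x
      = symDelta i j μ ν * ((if ρ = 0 then (if κ = 1 then c * ψ' r else 0) else 0)
        + if ρ = 1 then (if κ = 0 then c * ψ' r else 0)
          + if κ = 1 then a 0 * ψ'' r else 0 else 0) := by
    intro κ ρ μ ν
    have h2 : pd ρ (comp2 (testPert a ψ i j) 1 μ ν) =ᶠ[𝓝 x]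
        fun z => symDelta i j μ ν * pd ρ (fun z => a (z 0) * ψ (z 1)) z := by
      filter_upwards [(hev μ ν).eventuallyEq_nhds, (isOpen_reg 0).mem_nhds hx] with z hz hzr
      rw [pd_congr hz, pd_const_mul _ ((contDiffAt_pair hac hψc hzr).differentiableAt (by simp))]
    rw [pd_congr h2, pd_const_mul _ ((contDiffAt_pd hpair).differentiableAt (by simp)),
      pd_pd_pair ha (a'' := fun _ => 0) (fun t => hasDerivAt_const t c) hψ hψ' hx, hx0, hx1]
    simp
  rw [linCore_diag_of_zero hl Λ hx (contDiffAt_comp2_testPert hi hj hac hψc hx)]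
  · have hs : ∀ f : Fin n → ℝ, (∀ A, 2 ≤ A.val → f A = 0) → ∑ μ, f μ = f 0 + f 1 := fun f hf => by
      rw [sum_univ_split, Finset.sum_eq_zero fun A hA => hf A (Finset.mem_filter.1 hA).2, add_zero]
    have hin : ∀ κ A : Fin n, 2 ≤ A.val → (gdiag l κ x)⁻¹ * (gdiag l A x)⁻¹ *
        (pd κ (pd κ (comp2 (testPert a ψ i j) 1 A A)) x
          - pd κ (pd A (comp2 (testPert a ψ i j) 1 A κ)) x) = 0 := fun κ A hA => by
      simp only [hpp, symDelta_eq_zero hi hj hA (Or.inl rfl)]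
      ring
    rw [hs _ fun A hA => Finset.sum_eq_zero fun σ _ => by
        simp only [hpp, symDelta_eq_zero hi hj hA (Or.inr rfl), ne_zero_of_two_le hA,
          ne_one_of_two_le hA, if_false]
        simp, hs _ (hin 0), hs _ (hin 1)]
    simp only [hpp, if_true, if_neg (one_ne_zero' (n := n)), if_neg (zero_ne_one' (n := n)),
      gdiag_zero, gdiag_one, gdiag_angle l x hA, hx1]
    have hf : angFactor x (angleOne n) = 1 := by
      refine Finset.prod_eq_one fun B hB => ?_
      have := (Finset.mem_filter.1 hB).2
      rw [val_angleOne] at this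
      omega
    have hsd : symDelta i j 1 0 = symDelta i j 0 1 := by rw [symDelta, symDelta]; ring
    have hN : 1 + r ^ 2 / l ^ 2 ≠ 0 := by positivity
    rw [hf, hsd]
    field_simp
    ring
  · intro μ ν
    rw [(hev μ ν).eq_of_nhds, hx1, h0]; ring
  · intro μ ν κ
    rw [pd_congr (hev μ ν), pd_const_mul _ hd, pd_pair (a' := fun _ => c) (ha _)
      (hψ _ hx.2), hx0, hx1, h0, h1]
    simp
  · intro κ μ ν
    simp [hpp, hA1, hA0]
  · intro κ ρ μ
    rw [hpp, symDelta_eq_zero hi hj hA (Or.inr rfl), zero_mul]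

theorem eventually_mem_reg {x : Pt n} (hx : x ∈ reg n 0) : ∀ᶠ z in 𝓝 x, z ∈ reg n 0 :=
  (isOpen_reg 0).mem_nhds hx

/-- When only `T^{rr}` is present, `D^b T^{cr}` and `D^c T^{rb}` both reduce to the same diagonal
connection term and cancel, and `D^r T^{cb}` vanishes. -/
theorem flux_eq_zero {l : ℝ} (hl : 0 < l) {T : Tensor n 2}
    (hT : ∀ μ ν, ¬(μ = 1 ∧ ν = 1) → ∀ z ∈ reg n 0, T ![μ, ν] z = 0) {b c : Fin n} (hb : b ≠ 1)
    (hc : c ≠ 1) {z : Pt n} (hz : z ∈ reg n 0) : flux l T ![b, c, 1] z = 0 := by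
  have hp : ∀ κ μ ν, ¬(μ = 1 ∧ ν = 1) → pd κ (T ![μ, ν]) z = 0 := fun κ μ ν h =>
    pd_eventually_zero ((eventually_mem_reg hz).mono (hT μ ν h))
  have hs : ∀ κ μ ν ρ : Fin n, ∑ σ, christoffel l z μ κ σ * T ![σ, ρ] z
      = if ρ = 1 then christoffel l z μ κ 1 * T ![1, 1] z else 0 := by
    intro κ μ ν ρ
    split_ifs with h
    · subst h
      exact Finset.sum_eq_single 1 (fun σ _ hσ => by rw [hT _ _ (by simp [hσ]) z hz, mul_zero])
        (by simp)
    · exact Finset.sum_eq_zero fun σ _ => by rw [hT _ _ (by simp [h]) z hz, mul_zero]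
  have hs' : ∀ κ μ ρ : Fin n, ρ ≠ 1 → ∑ σ, christoffel l z μ κ σ * T ![ρ, σ] z = 0 :=
    fun κ μ ρ h => Finset.sum_eq_zero fun σ _ => by rw [hT _ _ (by simp [h]) z hz, mul_zero]
  have hs'' : ∀ κ μ : Fin n, ∑ σ, christoffel l z μ κ σ * T ![1, σ] z
      = christoffel l z μ κ 1 * T ![1, 1] z := fun κ μ =>
    Finset.sum_eq_single 1 (fun σ _ hσ => by rw [hT _ _ (by simp [hσ]) z hz, mul_zero]) (by simp)
  simp only [flux, Matrix.cons_val]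
  rw [gradUp_two hl _ _ _ _ hz, gradUp_two hl _ _ _ _ hz, gradUp_two hl _ _ _ _ hz, covD_two,
    covD_two, covD_two, hp _ _ _ (by simp [hc]), hp _ _ _ (by simp [hb]), hp _ _ _ (by simp [hc]),
    hs _ _ 1, hs _ _ 1, hs _ _ 1, hs' _ _ _ hc, hs'', hs' _ _ _ hc, if_pos rfl, if_neg hb, if_neg hb,
    christoffel_symm hl hz _ _ 1, christoffel_symm hl hz _ _ 1, christoffel_one hl hz,
    christoffel_one hl hz]
  by_cases h : c = b
  · subst h; simp
  · simp [h, Ne.symm h]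

/-- The mixed component of the linear operator for `h_rr = 2 τ ψ(r)`, at `τ = 0`. -/
theorem linCore_mixed_testPert {l : ℝ} (hl : 0 < l) (Λ : ℝ) (hψc : ContDiffOn ℝ ∞ ψ (Set.Ioi 0))
    {r : ℝ} (hr : 0 < r) : linCore l Λ (comp2 (testPert (fun t => t) ψ 1 1) 1) 0 1 (equatorPt n r)
      = 2 * ((n : ℝ) - 2) * r⁻¹ * (1 + r ^ 2 / l ^ 2) * ψ r := by
  set x := equatorPt n r with hxdef
  have hx : x ∈ reg n 0 := equatorPt_mem_reg hr
  have hx0 : x 0 = 0 := equatorPt_zero r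
  have hx1 : x 1 = r := equatorPt_one r
  set h := comp2 (testPert (fun t => t) ψ 1 1) (1 : Matrix (Fin n) (Fin n) ℝ) with hh
  have hi : (1 : Fin n) = 0 ∨ (1 : Fin n) = 1 := Or.inr rfl
  have hsm : ∀ μ ν, ContDiffAt ℝ ∞ (h μ ν) x :=
    contDiffAt_comp2_testPert (a := fun t => t) hi hi contDiff_id hψc hx
  have hval : ∀ z ∈ reg n 0, ∀ μ ν, h μ ν z = symDelta 1 1 μ ν * (z 0 * ψ (z 1)) :=
    fun z hz μ ν => (comp2_testPert_nhds hi hi (fun t => t) ψ hz μ ν).eq_of_nhds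
  have hnear : ∀ᶠ z in 𝓝 x, z ∈ reg n 0 := (isOpen_reg 0).mem_nhds hx
  have hs0 : ∀ μ ν : Fin n, ¬(μ = 1 ∧ ν = 1) → symDelta 1 1 μ ν = 0 := by
    intro μ ν hμν
    by_cases h1 : μ = 1
    · have h2 : ν ≠ 1 := fun h2 => hμν ⟨h1, h2⟩
      simp [symDelta, h2]
    · simp [symDelta, h1]
  have hT0 : ∀ μ ν, ¬(μ = 1 ∧ ν = 1) → ∀ z ∈ reg n 0, raise l h ![μ, ν] z = 0 := by
    intro μ ν hμν z hz
    rw [raise_apply hl hz, hval z hz, hs0 μ ν hμν]; ring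
  have hp0 : ∀ κ μ ν, ¬(μ = 1 ∧ ν = 1) → pd κ (raise l h ![μ, ν]) x = 0 := fun κ μ ν hμν =>
    pd_eventually_zero (hnear.mono (hT0 μ ν hμν))
  set Ψ : ℝ → ℝ := fun t => 2 * (1 + t ^ 2 / l ^ 2) * ψ t with hΨ
  have hψd : ∀ t, 0 < t → DifferentiableAt ℝ ψ t := fun t ht =>
    (hψc.contDiffAt (Ioi_mem_nhds ht)).differentiableAt (by simp)
  have hΨd : ∀ t, 0 < t → HasDerivAt Ψ (deriv Ψ t) t := fun t ht =>
    (DifferentiableAt.fun_mul (by fun_prop) (hψd t ht)).hasDerivAt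
  have h11 : symDelta (1 : Fin n) 1 1 1 = 2 := by simp [symDelta]; norm_num
  have htr : ∀ z ∈ reg n 0, trace l h ![] z = z 0 * Ψ (z 1) := by
    intro z hz
    rw [trace_apply hl hz, Finset.sum_eq_single 1, hval z hz, h11, gdiag_one, inv_inv]
    · ring
    · intro μ _ hμ
      rw [hval z hz, hs0 _ _ (by simp [hμ])]; ring
    · simp
  have hT11 : ∀ z ∈ reg n 0, raise l h ![1, 1] z
      = z 0 * ((fun t => (1 + t ^ 2 / l ^ 2) * Ψ t) (z 1)) := by
    intro z hz
    rw [raise_apply hl hz, hval z hz, h11, gdiag_one, inv_inv]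
    ring
  have hpd0 : ∀ (u : Pt n → ℝ) (f : ℝ → ℝ), (∀ z ∈ reg n 0, u z = z 0 * f (z 1)) →
      (∀ t, 0 < t → DifferentiableAt ℝ f t) → ∀ κ, ∀ z ∈ reg n 0, pd κ u z
        = (if κ = 0 then f (z 1) else 0) + if κ = 1 then z 0 * deriv f (z 1) else 0 := by
    intro u f huf hf κ z hz
    rw [pd_congr ((eventually_mem_reg hz).mono huf),
      pd_pair (a := fun t => t) (a' := fun _ => 1) (ψ' := deriv f) (hasDerivAt_id _)
        (hf _ hz.2).hasDerivAt]
    simp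
  have hY : ∀ z ∈ reg n 0, (gdiag l 0 z)⁻¹ * pd 0 (raise l h ![1, 1]) z
      = (fun t => -Ψ t) (z 1) := by
    intro z hz
    have hN : 1 + z 1 ^ 2 / l ^ 2 ≠ 0 := by positivity
    rw [hpd0 _ (fun t => (1 + t ^ 2 / l ^ 2) * Ψ t) hT11 (fun t ht => DifferentiableAt.fun_mul (by fun_prop)
      (hΨd t ht).differentiableAt) 0 z hz, if_pos rfl, if_neg zero_ne_one', gdiag_zero]
    field_simp
    ring
  have hY1 : pd 1 (fun z => (gdiag l 0 z)⁻¹ * pd 0 (raise l h ![1, 1]) z) x = -deriv Ψ r := by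
    rw [pd_congr (hnear.mono hY), pd_comp_coord (φ := fun t => -Ψ t) (hΨd _ hx.2).fun_neg.differentiableAt,
      (hΨd _ hx.2).fun_neg.deriv, if_pos rfl, hx1]
  have htd := hpd0 _ _ htr fun t ht => (hΨd t ht).differentiableAt
  -- The trace is `τ Ψ(r)`; at `τ = 0` its mixed Hessian contains only `Ψ'` and one connection term.
  have hDD : gradUp l (gradUp l (trace l h)) ![0, 1] x = -(deriv Ψ r - dlog l 0 x * Ψ r) := by
    have h2 : pd 0 (pd 1 (trace l h ![])) x = deriv Ψ r := by
      rw [pd_comm (contDiffAt_trace hl hx hsm), pd_congr (v := fun z => Ψ (z 1)),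
        pd_comp_coord (hΨd _ hx.2).differentiableAt, if_pos rfl, hx1]
      filter_upwards [hnear] with z hz
      rw [htd 0 z hz, if_pos rfl, if_neg zero_ne_one', add_zero]
    have hN : 1 + r ^ 2 / l ^ 2 ≠ 0 := by positivity
    rw [gradUp_gradUp_zero hl hx (contDiffAt_trace hl hx hsm), h2]
    simp only [christoffel_symm hl hx _ 0 1, christoffel_one hl hx, ite_mul, zero_mul,
      Finset.sum_ite_eq', Finset.mem_univ, if_true]
    rw [htd 0 x hx, if_pos rfl, if_neg zero_ne_one', gdiag_zero, gdiag_one, hx1]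
    field_simp
    ring
  have hne : ∀ {b : Fin n}, b ∈ Finset.univ.erase 1 → b ≠ 1 := fun hb => Finset.ne_of_mem_erase hb
  have hsym : ∀ᶠ z in 𝓝 x, ∀ μ ν, h μ ν z = h ν μ z := hnear.mono fun z hz μ ν => by
    rw [hval z hz, hval z hz, symDelta, symDelta]; ring
  have e1 : ∑ b ∈ Finset.univ.erase 1, (1 + x 1 ^ 2 / l ^ 2) * dlog l b x * gdiag l b x *
      ((gdiag l 0 x)⁻¹ * (pd 0 (raise l h ![b, b]) x
        + 2 * ∑ c ∈ Finset.univ.erase 1, christoffel l x b 0 c * raise l h ![c, b] x)) = 0 := by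
    refine Finset.sum_eq_zero fun b hb => ?_
    have hb := hne hb
    rw [hp0 0 b b (by simp [hb]), Finset.sum_eq_zero fun c _ => by
      rw [hT0 c b (by simp [hb]) x hx, mul_zero]]
    ring
  have e2 : ∑ b ∈ Finset.univ.erase 1, (pd b (flux l (raise l h) ![b, 0, 1]) x
      + ∑ c ∈ Finset.univ.erase 1, christoffel l x b b c * flux l (raise l h) ![c, 0, 1] x
      + ∑ c ∈ Finset.univ.erase 1, christoffel l x 0 b c * flux l (raise l h) ![b, c, 1] x) = 0 := by
    refine Finset.sum_eq_zero fun b hb => ?_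
    have hb := hne hb
    rw [pd_eventually_zero (hnear.mono fun z hz => flux_eq_zero hl hT0 hb zero_ne_one' hz),
      Finset.sum_eq_zero fun c hc => by rw [flux_eq_zero hl hT0 (hne hc) zero_ne_one' hx, mul_zero],
      Finset.sum_eq_zero fun c hc => by rw [flux_eq_zero hl hT0 hb (hne hc) hx, mul_zero], add_zero,
      add_zero]
  rw [linCore_mixed hl Λ hx hsm hsym zero_ne_one',
    hT0 0 1 (by simp only [zero_ne_one', false_and, not_false_iff]) x hx, mul_zero, zero_add,
    mixedRemainder, hDD, hY1, hY x hx, e1, e2]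
  have hsd := sum_dlog hl hx
  -- The terms `Ψ'` cancel, and the logarithmic derivatives combine to the sum `(n - 2) / r`. The
  -- result holds for every `Λ` because `h^{τr}` vanishes.
  have h01 : dlog l 0 x = -dlog l 1 x := by rw [dlog_zero hl, dlog_one hl, neg_neg]
  simp only [hx1] at hsd ⊢
  rw [h01]
  simp only [hΨ] at hsd ⊢
  linear_combination 2 * (1 + r ^ 2 / l ^ 2) * ψ r * hsd

/-- For each exponent one component of the operator detects it independently of `Λ`: the `τr`
component for `p`, and an angular diagonal component for `q` and `s`. -/
theorem exponents_of_forall_conserved {l Λ : ℝ} (hl : 0 < l) {p q s : ℝ}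
    (H : ∀ h : Fin n → Fin n → Pt n → ℝ, FallOffClass p q s h → AsymptoticallyConserved l Λ h) :
    p ≤ -n - 1 ∧ q ≤ -n + 2 ∧ s ≤ -n + 3 := by
  have hn : (3 : ℝ) ≤ n := by exact_mod_cast h3.out
  have h0 : (0 : Fin n) = 0 ∨ (0 : Fin n) = 1 := Or.inl rfl
  have h1 : (1 : Fin n) = 0 ∨ (1 : Fin n) = 1 := Or.inr rfl
  have hA1 : angleOne n ≠ 1 := ne_one_of_two_le (by rw [val_angleOne])
  have hid : ContDiff ℝ ∞ fun t : ℝ => t := contDiff_id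
  have hB : ∀ (a : ℝ → ℝ) (m A B C : ℝ) (i j : Fin n), ContDiff ℝ ∞ a →
      ((bigO n).Q 2 0 fun x => a (x 0)) → (i = 0 ∨ i = 1) → (j = 0 ∨ j = 1) →
      (i = 1 → j = 1 → m ≤ p) → (i ≠ j → m ≤ q) → (i = 0 → j = 0 → m ≤ s) →
      LinOpBounds l Λ (testPert (n := n) a (wave m A B C) i j) := by
    intro a m A B C i j ha hQ hi hj hp hq hs
    refine (asymptoticallyConserved_iff hl (isSmoothPerturbation_testPert ha
      (contDiffOn_wave m A B C) i j)).1 (H _ (fallOffClass_testPert ha (contDiffOn_wave m A B C)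
        hi hj ((hQ.mul (Q_wave 2 m A B C)).mono (by simp)) hp hq hs))
  refine ⟨?_, ?_, ?_⟩
  -- Here `h_rr = 2 τ r^p`: the factor `τ` makes the time derivative visible at `τ = 0`, and
  -- `𝓗^{τr}` without the density grows as `r^(p+1)`.
  · have hb := (hB (fun t => t) p 1 0 0 1 1 hid (Gauge.Q.time 2) h1 h1 (fun _ _ => le_rfl)
      (fun h => absurd rfl h) (fun h => absurd h one_ne_zero')).2.1 0 zero_ne_one' 1
        isSpatialRotation_one
    have := linOp_exponent_le (e := p + 1) (c := 2 * (n - 2) / l ^ 2) hb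
      (div_pos (by linarith) (by positivity)) fun k => by
        have hr := testRadius_pos k
        rw [linCore_mixed_testPert hl Λ (contDiffOn_wave _ _ _ _) hr, wave_testRadius,
          Real.rpow_add_one hr.ne']
        have h2 : 0 < (n : ℝ) - 2 := by linarith
        rw [abs_of_pos (by simp; positivity)]
        -- Only the part `r² / l²` of the lapse function is used; the part `1` contributes this
        -- positive excess.
        have h4 : 2 * ((n : ℝ) - 2) * (testRadius k)⁻¹ * (1 + testRadius k ^ 2 / l ^ 2) *
            (testRadius k ^ p * (1 + 0)) - 2 * ((n : ℝ) - 2) / l ^ 2 *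
            (testRadius k ^ p * testRadius k)
            = 2 * ((n : ℝ) - 2) * (testRadius k)⁻¹ * testRadius k ^ p := by
          field_simp
          ring
        have h5 : 0 < 2 * ((n : ℝ) - 2) * (testRadius k)⁻¹ * testRadius k ^ p := by positivity
        linarith
    linarith
  -- Here `h_τr = τ r^q sin(log r)`: at `τ = 0` on the test radii its one-jet vanishes and the mixed
  -- second derivative is `r^(q-1)`.
  · have hb := (hB (fun t => t) q 0 0 1 0 1 hid (Gauge.Q.time 2) h0 h1
      (fun h => absurd h zero_ne_one') (fun _ => le_rfl)
      (fun _ h => absurd h one_ne_zero')).2.2 _ _ hA1 hA1 1 isSpatialRotation_one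
    have := linOp_exponent_le (e := q - 3) (c := 2) hb two_pos fun k => by
      have hr := testRadius_pos k
      rw [linCore_testPert hl Λ h0 h1 hid (contDiffOn_wave _ _ _ _) (c := 1) hasDerivAt_id
        (fun t ht => hasDerivAt_wave _ _ _ _ ht) (fun t ht => hasDerivAt_wave _ _ _ _ ht) hr
        (by rw [wave_testRadius]; ring) (zero_mul _), symDelta, symDelta]
      simp only [wave_testRadius, if_true, if_neg (zero_ne_one' (n := n)), if_neg (one_ne_zero' (n := n))]
      refine le_of_eq ?_
      have h5 := Real.rpow_pos_of_pos hr (q - 1)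
      have h6 : testRadius k ^ (q - 3) = (testRadius k)⁻¹ ^ 2 * testRadius k ^ (q - 1) := by
        rw [inv_pow, ← Real.rpow_two, ← Real.rpow_neg hr.le, ← Real.rpow_add hr]
        congr 1; ring
      rw [h6, abs_mul, abs_of_pos (by positivity : 0 < (testRadius k)⁻¹ ^ 2), mul_left_comm]
      congr 1
      rw [← abs_of_pos (by positivity : 0 < 2 * testRadius k ^ (q - 1)), ← abs_neg]
      congr 1
      ring
    linarith
  -- Here `h_ττ = 2 r^s (1 - cos(log r))`: on the test radii the profile has a double zero with
  -- second derivative `r^(s-2)`.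
  · have hb := (hB (fun _ => 1) s 1 (-1) 0 0 0 contDiff_const (Gauge.Q.const _ 2 1) h0 h0
      (fun h => absurd h zero_ne_one') (fun h => absurd rfl h)
      (fun _ _ => le_rfl)).2.2 _ _ hA1 hA1 1 isSpatialRotation_one
    have := linOp_exponent_le (e := s - 4) (c := 2) hb two_pos fun k => by
      have hr := testRadius_pos k
      rw [linCore_testPert hl Λ h0 h0 contDiff_const (contDiffOn_wave _ _ _ _) (c := 0)
        (fun t => hasDerivAt_const t _)
        (fun t ht => hasDerivAt_wave _ _ _ _ ht) (fun t ht => hasDerivAt_wave _ _ _ _ ht) hr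
        (by rw [wave_testRadius]; ring) (by rw [wave_testRadius]; ring), wave_testRadius,
        wave_testRadius, symDelta, symDelta]
      simp only [if_true, if_neg (one_ne_zero' (n := n))]
      refine le_of_eq ?_
      have h6 : testRadius k ^ (s - 4) = (testRadius k)⁻¹ ^ 2 * testRadius k ^ (s - 1 - 1) := by
        rw [inv_pow, ← Real.rpow_two, ← Real.rpow_neg hr.le, ← Real.rpow_add hr]
        congr 1; ring
      have h5 := Real.rpow_pos_of_pos hr (s - 1 - 1)
      rw [h6, abs_mul, abs_of_pos (by positivity : 0 < (testRadius k)⁻¹ ^ 2), mul_left_comm]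
      congr 1
      rw [show ((1 : ℝ) * 1 + 1 * 1) * (1 * (testRadius k ^ (s - 1 - 1) *
        ((s - 1) * (s * 1) + ((s - 1) * (s * -1 + 0) + (s * 0 - -1)))))
        - 2 * ((1 * 0 + 1 * 0) * (0 * (testRadius k ^ (s - 1) * (s * 1 + (s * -1 + 0)))))
        = 2 * testRadius k ^ (s - 1 - 1) by ring, abs_of_pos (by positivity)]
    linarith

theorem forall_conserved_vacuum_iff {l : ℝ} (hl : 0 < l) (p q s : ℝ) :
    (∀ h : Fin n → Fin n → Pt n → ℝ, FallOffClass p q s h →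
      AsymptoticallyConserved l (-((n - 1) * (n - 2)) / (2 * l ^ 2)) h) ↔
    p ≤ -n - 1 ∧ q ≤ -n + 2 ∧ s ≤ -n + 3 :=
  ⟨exponents_of_forall_conserved hl, fun ⟨hp, hq, hs⟩ _ hh =>
    (hh.linOpBounds_vacuum hl hp hq hs).asymptoticallyConserved hl hh.1⟩

/-- The bound on `q` beyond the vacuum case follows by comparing two values of `Λ`. The stationary
perturbation `h_τr = r^q` satisfies the vacuum bounds, so only the difference of the `Λ` terms, an
algebraic multiple of `h^{τr}`, has to be estimated. -/
theorem forall_conserved_iff {l : ℝ} (hl : 0 < l) (p q s : ℝ) :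
    (∀ h : Fin n → Fin n → Pt n → ℝ, FallOffClass p q s h →
      AsymptoticallyConserved l (-((n - 1) * (n - 2)) / l ^ 2) h) ↔
    p ≤ -n - 1 ∧ q ≤ -n ∧ s ≤ -n + 3 := by
  refine ⟨fun H => ?_, fun ⟨hp, hq, hs⟩ _ hh =>
    (hh.linOpBounds hl _ hp hq hs).asymptoticallyConserved hl hh.1⟩
  obtain ⟨hp, hq, hs⟩ := exponents_of_forall_conserved hl H
  refine ⟨hp, ?_, hs⟩
  have hn : (3 : ℝ) ≤ n := by exact_mod_cast h3.out
  have hQ : (bigO n).Q 2 q fun x => (fun _ => (1 : ℝ)) (x 0) * wave q 1 0 0 (x 1) := by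
    simpa using Q_wave 2 q 1 0 0
  have h0 : (0 : Fin n) = 0 ∨ (0 : Fin n) = 1 := Or.inl rfl
  have h1 : (1 : Fin n) = 0 ∨ (1 : Fin n) = 1 := Or.inr rfl
  have hcl : ∀ p' q' s', q ≤ q' → FallOffClass p' q' s' (testPert (n := n) (fun _ => 1)
      (wave q 1 0 0) 0 1) := fun p' q' s' hq' =>
    fallOffClass_testPert contDiff_const (contDiffOn_wave _ _ _ _) h0 h1 hQ
      (fun h => absurd h zero_ne_one') (fun _ => hq') (fun _ h => absurd h one_ne_zero')
  -- The weaker bound on `q` already proved places the test perturbation in the vacuum class.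
  have hv := ((hcl (-n - 1) (-n + 2) (-n + 3) hq).linOpBounds_vacuum hl le_rfl le_rfl le_rfl).2.1 0
    zero_ne_one' 1 isSpatialRotation_one
  have hb := ((asymptoticallyConserved_iff hl (hcl p q s le_rfl).1).1 (H _ (hcl p q s le_rfl))).2.1 0
    zero_ne_one' 1 isSpatialRotation_one
  have hd : (bigO n).P (-2) fun x => linOp l (-((n - 1) * (n - 2)) / l ^ 2)
      (comp2 (testPert (fun _ => 1) (wave q 1 0 0) 0 1) 1) 0 1 x
      + (-1) * linOp l (-((n - 1) * (n - 2)) / (2 * l ^ 2))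
        (comp2 (testPert (fun _ => 1) (wave q 1 0 0) 0 1) 1) 0 1 x :=
    (bigO n).add hb ((bigO n).mono (by norm_num) ((bigO n).mul ((bigO n).const (-1)) hv))
  -- The constant is `4 (Λ_vac - Λ) / (n - 2) = 2 (n - 1) / l²` over `32π`. The lapse cancels in
  -- `ḡ^{ττ} ḡ^{rr} = -1`.
  have hle := exponent_le (m' := n - 2 + q) (c := 2 * (n - 1) / (32 * Real.pi * l ^ 2)) hd
    (div_pos (by linarith) (by positivity)) fun k => by
      have hr := testRadius_pos k
      have hx := equatorPt_mem_reg (n := n) hr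
      have h10 : (1 : Fin n) ≠ 0 := one_ne_zero'
      have h01 : (0 : Fin n) ≠ 1 := zero_ne_one'
      simp only [linOp_eq, linCore]
      rw [sqrtNegDet_eq hx, sphereDensity_equatorPt, equatorPt_one, gbar_inv hl hx, if_neg h01,
        raise_apply hl hx, comp2_testPert isSpatialRotation_one hx h0 h1, equatorPt_one,
        wave_testRadius, symDelta, gdiag_zero, gdiag_one, equatorPt_one]
      simp only [if_true, if_neg h01, if_neg h10]
      have hN : 1 + testRadius k ^ 2 / l ^ 2 ≠ 0 := by positivity
      have hn2 : (n : ℝ) - 2 ≠ 0 := by linarith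
      have hn1 : 0 < (n : ℝ) - 1 := by linarith
      have hpow : testRadius k ^ ((n : ℝ) - 2 + q) = testRadius k ^ (n - 2) * testRadius k ^ q := by
        rw [Real.rpow_add hr, ← Real.rpow_natCast, Nat.cast_sub (by have := h3.out; omega),
          Nat.cast_two]
      rw [hpow]
      refine le_of_eq ((abs_of_pos (?_ : 0 < 2 * ((n : ℝ) - 1) / (32 * Real.pi * l ^ 2) *
        (testRadius k ^ (n - 2) * testRadius k ^ q))).symm.trans (congrArg _ ?_))
      · have := Real.rpow_pos_of_pos hr q
        positivity
      · field_simp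
        ring
  linarith

end Necessity


/-! ### The metric in Cartesian coordinates and the transformation of the connection. -/

section Covariance

variable {n : ℕ} [NeZero n] [h3 : Fact (3 ≤ n)] {R : Matrix (Fin n) (Fin n) ℝ}

/-- The entrywise derivative of a matrix. -/
noncomputable def mpd (σ : Fin n) (M : Pt n → Matrix (Fin n) (Fin n) ℝ) (x : Pt n) :
    Matrix (Fin n) (Fin n) ℝ :=
  Matrix.of fun i j => pd σ (fun z => M z i j) x

theorem mpd_apply (σ : Fin n) (M : Pt n → Matrix (Fin n) (Fin n) ℝ) (x : Pt n) (i j : Fin n) :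
    mpd σ M x i j = pd σ (fun z => M z i j) x := rfl

theorem mpd_congr {σ : Fin n} {M N : Pt n → Matrix (Fin n) (Fin n) ℝ} {x : Pt n}
    (h : ∀ᶠ z in 𝓝 x, M z = N z) : mpd σ M x = mpd σ N x := by
  ext i j
  exact pd_congr (h.mono fun z hz => congrFun (congrFun hz i) j)

theorem mpd_transpose (σ : Fin n) (M : Pt n → Matrix (Fin n) (Fin n) ℝ) (x : Pt n) :
    mpd σ (fun z => (M z).transpose) x = (mpd σ M x).transpose := rfl

theorem differentiableAt_matrix_mul {M N : Pt n → Matrix (Fin n) (Fin n) ℝ} {x : Pt n}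
    (hM : ∀ i j, DifferentiableAt ℝ (fun z => M z i j) x)
    (hN : ∀ i j, DifferentiableAt ℝ (fun z => N z i j) x) (i j : Fin n) :
    DifferentiableAt ℝ (fun z => (M z * N z) i j) x := by
  simp only [Matrix.mul_apply]
  exact DifferentiableAt.fun_sum fun k _ => (hM i k).fun_mul (hN k j)

theorem mpd_mul {σ : Fin n} {M N : Pt n → Matrix (Fin n) (Fin n) ℝ} {x : Pt n}
    (hM : ∀ i j, DifferentiableAt ℝ (fun z => M z i j) x)
    (hN : ∀ i j, DifferentiableAt ℝ (fun z => N z i j) x) :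
    mpd σ (fun z => M z * N z) x = mpd σ M x * N x + M x * mpd σ N x := by
  ext i j
  simp only [mpd_apply, Matrix.mul_apply, Matrix.add_apply, ← Finset.sum_add_distrib]
  rw [pd_sum _ fun k _ => (hM i k).fun_mul (hN k j)]
  exact Finset.sum_congr rfl fun k _ => pd_mul (hM i k) (hN k j)

theorem pd_comp_chart {f : Pt n → ℝ} {x : Pt n} (hf : DifferentiableAt ℝ f (chart R x))
    (σ : Fin n) :
    pd σ (fun z => f (chart R z)) x = ∑ γ, jac R x γ σ * pd γ f (chart R x) := by
  have hc : HasFDerivAt (chart R) (fderiv ℝ (chart R) x) x :=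
    ((contDiff_chart R).differentiable (by simp) x).hasFDerivAt
  have hcomp : fderiv ℝ (fun z => f (chart R z)) x = _ := (hf.hasFDerivAt.comp x hc).fderiv
  have hv : fderiv ℝ (chart R) x (Pi.single σ 1) = ∑ γ, jac R x γ σ • Pi.single γ (1 : ℝ) := by
    have hp : HasFDerivAt (chart R) (ContinuousLinearMap.pi fun γ =>
        fderiv ℝ (fun z => chart R z γ) x) x :=
      hasFDerivAt_pi.2 fun γ =>
        ((contDiff_chart_apply R γ).differentiable (by simp) x).hasFDerivAt
    rw [hp.fderiv]
    ext γ
    simp [Finset.sum_apply, Pi.single_apply, jac_eq_pd, pd]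
  rw [pd, hcomp, ContinuousLinearMap.comp_apply, hv, map_sum]
  simp only [map_smul, smul_eq_mul, pd]

theorem mpd_comp_chart {F : Pt n → Matrix (Fin n) (Fin n) ℝ} {x : Pt n}
    (hF : ∀ i j, DifferentiableAt ℝ (fun z => F z i j) (chart R x)) (σ : Fin n) :
    mpd σ (fun z => F (chart R z)) x = ∑ γ, jac R x γ σ • mpd γ F (chart R x) := by
  ext i j
  rw [mpd_apply, pd_comp_chart (hF i j) σ, Matrix.sum_apply]
  rfl

theorem differentiableAt_jac (x : Pt n) (α μ : Fin n) :
    DifferentiableAt ℝ (fun z => jac R z α μ) x :=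
  (contDiff_jac R α μ).differentiable (by simp) x

theorem mpd_jac_symm (x : Pt n) (α κ μ : Fin n) :
    mpd κ (jac R) x α μ = mpd μ (jac R) x α κ :=
  pd_comm (contDiff_chart_apply R α).contDiffAt

theorem jac_mul_inv (hR : IsSpatialRotation R) {x : Pt n} (hx : x ∈ reg n 0) :
    jac R x * (jac R x)⁻¹ = 1 := Matrix.mul_nonsing_inv _ (isUnit_det_jac hR hx)

theorem inv_mul_jac (hR : IsSpatialRotation R) {x : Pt n} (hx : x ∈ reg n 0) :
    (jac R x)⁻¹ * jac R x = 1 := Matrix.nonsing_inv_mul _ (isUnit_det_jac hR hx)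

/-- `r²` in Cartesian coordinates. -/
noncomputable def radSq (z : Pt n) : ℝ :=
  ∑ k ∈ Finset.univ.filter (fun k : Fin n => k ≠ 0), z k ^ 2

theorem radSq_nonneg (z : Pt n) : 0 ≤ radSq z := Finset.sum_nonneg fun _ _ => sq_nonneg _

theorem contDiff_radSq : ContDiff ℝ ∞ (radSq (n := n)) :=
  ContDiff.sum fun k _ => (contDiff_apply ℝ ℝ k).pow 2

/-- The metric in Cartesian static coordinates. -/
noncomputable def cartMetric (l : ℝ) (z : Pt n) : Matrix (Fin n) (Fin n) ℝ :=
  Matrix.of fun α β => (if α = β then 1 else 0)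
    + (if α = 0 ∨ β = 0 then 0 else -(l ^ 2 + radSq z)⁻¹ * (z α * z β))
    + (if α = 0 ∧ β = 0 then -(1 + radSq z / l ^ 2) - 1 else 0)

/-- The inverse metric in Cartesian static coordinates. -/
noncomputable def cartInv (l : ℝ) (z : Pt n) : Matrix (Fin n) (Fin n) ℝ :=
  Matrix.of fun α β => (if α = β then 1 else 0)
    + (if α = 0 ∨ β = 0 then 0 else (l ^ 2)⁻¹ * (z α * z β))
    + (if α = 0 ∧ β = 0 then -(1 + radSq z / l ^ 2)⁻¹ - 1 else 0)

theorem contDiff_cartMetric {l : ℝ} (hl : 0 < l) (α β : Fin n) :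
    ContDiff ℝ ∞ fun z : Pt n => cartMetric l z α β := by
  have hr := contDiff_radSq (n := n)
  have h0 : ∀ z : Pt n, l ^ 2 + radSq z ≠ 0 := fun z => by
    have := radSq_nonneg z; positivity
  refine (contDiff_const.add ?_).add ?_ <;> split_ifs
  · exact contDiff_const
  · exact ((contDiff_const.add hr).inv h0).neg.mul
      ((contDiff_apply ℝ ℝ α).mul (contDiff_apply ℝ ℝ β))
  · exact ((contDiff_const.add (hr.div_const _)).neg).sub contDiff_const
  · exact contDiff_const

theorem contDiff_cartInv {l : ℝ} (hl : 0 < l) (α β : Fin n) :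
    ContDiff ℝ ∞ fun z : Pt n => cartInv l z α β := by
  have hr := contDiff_radSq (n := n)
  have h0 : ∀ z : Pt n, 1 + radSq z / l ^ 2 ≠ 0 := fun z => by
    have := radSq_nonneg z; positivity
  refine (contDiff_const.add ?_).add ?_ <;> split_ifs
  · exact contDiff_const
  · exact contDiff_const.mul ((contDiff_apply ℝ ℝ α).mul (contDiff_apply ℝ ℝ β))
  · exact (((contDiff_const.add (hr.div_const _)).inv h0).neg).sub contDiff_const
  · exact contDiff_const

theorem cartMetric_symm (l : ℝ) (z : Pt n) : (cartMetric l z).transpose = cartMetric l z := by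
  ext α β
  simp only [Matrix.transpose_apply, cartMetric, Matrix.of_apply, eq_comm (a := β) (b := α),
    mul_comm (z β), or_comm (a := β = 0), and_comm (a := β = 0)]

theorem gdiag_eq_flatDiag (l : ℝ) (x : Pt n) {A : Fin n} (hA : 2 ≤ A.val) :
    gdiag l A x = flatDiag A x := by rw [gdiag_angle l x hA, flatDiag_angle x hA]

/-- A diagonal form that agrees with the inverse Euclidean metric on the angles differs from it only
in the time and radial directions. Its Cartesian matrix is thus the identity plus two rank-one
corrections, which are regular at the poles. -/
theorem jac_mul_diagonal (hR : IsSpatialRotation R) {x : Pt n} (hx : x ∈ reg n 0) {d : Fin n → ℝ}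
    (hd : ∀ A : Fin n, 2 ≤ A.val → d A = (flatDiag A x)⁻¹) (α β : Fin n) :
    (jac R x * Matrix.diagonal d * (jac R x).transpose) α β = (if α = β then 1 else 0)
      + (if α = 0 ∨ β = 0 then 0 else (d 1 - 1) * (x 1 ^ 2)⁻¹ * (chart R x α * chart R x β))
      + (if α = 0 ∧ β = 0 then d 0 - 1 else 0) := by
  have key : (jac R x * (jac R x)⁻¹) α β = if α = β then 1 else 0 := by
    rw [jac_mul_inv hR hx, Matrix.one_apply]
  have hx1 : x 1 ≠ 0 := hx.2.ne'
  rw [← key, Matrix.mul_apply, Matrix.mul_apply, sum_univ_split, sum_univ_split (n := n)]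
  simp only [Matrix.mul_diagonal, Matrix.transpose_apply, jac_inv_apply hR hx, jac_zero_col hR,
    flatDiag_zero, flatDiag_one, inv_one, one_mul]
  have hs : ∑ A ∈ Finset.univ.filter (fun A : Fin n => 2 ≤ A.val), jac R x α A * d A * jac R x β A
      = ∑ A ∈ Finset.univ.filter (fun A : Fin n => 2 ≤ A.val),
        jac R x α A * ((flatDiag A x)⁻¹ * jac R x β A) :=
    Finset.sum_congr rfl fun A hA => by rw [hd A (Finset.mem_filter.1 hA).2, mul_assoc]
  rw [hs]
  generalize ∑ A ∈ Finset.univ.filter (fun A : Fin n => 2 ≤ A.val),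
        jac R x α A * ((flatDiag A x)⁻¹ * jac R x β A) = S
  have h1 : jac R x 0 1 = 0 := by rw [jac_zero_row hR, if_neg one_ne_zero']
  by_cases hα : α = 0
  · subst hα
    by_cases hβ : β = 0
    · subst hβ; simp [h1]; ring
    · simp [h1, hβ]
  · by_cases hβ : β = 0
    · subst hβ; simp [h1, hα]
    · simp only [hα, hβ, if_false, or_self, and_self, chart_of_ne hR x hα, chart_of_ne hR x hβ]
      field_simp
      ring

theorem radSq_chart (hR : IsSpatialRotation R) (x : Pt n) : radSq (chart R x) = x 1 ^ 2 :=
  sum_chart_sq hR x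

theorem jac_mul_gbar_inv {l : ℝ} (hl : 0 < l) (hR : IsSpatialRotation R) {x : Pt n}
    (hx : x ∈ reg n 0) :
    jac R x * (gbar l x)⁻¹ * (jac R x).transpose = cartInv l (chart R x) := by
  have hg : (gbar l x)⁻¹ = Matrix.diagonal fun μ => (gdiag l μ x)⁻¹ := by
    ext μ ν; rw [gbar_inv hl hx, Matrix.diagonal_apply]
  have hx1 : x 1 ≠ 0 := hx.2.ne'
  ext α β
  rw [hg, jac_mul_diagonal hR hx (fun A hA => by rw [gdiag_eq_flatDiag l x hA])]
  simp only [cartInv, Matrix.of_apply, radSq_chart hR, gdiag_zero, gdiag_one, inv_inv, inv_neg]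
  congr 3
  field_simp
  ring

theorem jac_cartMetric {l : ℝ} (hl : 0 < l) (hR : IsSpatialRotation R) {x : Pt n}
    (hx : x ∈ reg n 0) :
    (jac R x).transpose * cartMetric l (chart R x) * jac R x = gbar l x := by
  have hx1 : x 1 ≠ 0 := hx.2.ne'
  have hG : cartMetric l (chart R x) = jac R x *
      Matrix.diagonal (fun μ => (flatDiag μ x)⁻¹ * gdiag l μ x * (flatDiag μ x)⁻¹) *
      (jac R x).transpose := by
    ext α β
    rw [jac_mul_diagonal hR hx (fun A hA => by
      rw [gdiag_eq_flatDiag l x hA, inv_mul_cancel₀ (flatDiag_pos hx A).ne', one_mul])]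
    simp only [cartMetric, Matrix.of_apply, radSq_chart hR, gdiag_zero, gdiag_one, flatDiag_zero,
      flatDiag_one, inv_one, one_mul, mul_one]
    congr 3
    have : l ^ 2 + x 1 ^ 2 ≠ 0 := by positivity
    field_simp
    ring
  have hF : (jac R x).transpose * jac R x = Matrix.diagonal fun μ => flatDiag μ x := by
    ext μ ν
    rw [Matrix.mul_apply, Matrix.diagonal_apply]
    exact jac_gram hR x μ ν
  calc (jac R x).transpose * cartMetric l (chart R x) * jac R x
      = ((jac R x).transpose * jac R x) *
        Matrix.diagonal (fun μ => (flatDiag μ x)⁻¹ * gdiag l μ x * (flatDiag μ x)⁻¹) *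
        ((jac R x).transpose * jac R x) := by rw [hG]; simp only [Matrix.mul_assoc]
    _ = gbar l x := by
      rw [hF, Matrix.diagonal_mul_diagonal, Matrix.diagonal_mul_diagonal]
      ext μ ν
      rw [gbar_apply, Matrix.diagonal_apply]
      split_ifs with h
      · have := (flatDiag_pos hx μ).ne'
        field_simp
      · rfl

theorem isUnit_det_gbar {l : ℝ} (hl : 0 < l) {x : Pt n} (hx : x ∈ reg n 0) :
    IsUnit (gbar l x).det := by
  have : gbar l x = Matrix.diagonal fun μ => gdiag l μ x := rfl
  rw [this, Matrix.det_diagonal, isUnit_iff_ne_zero]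
  exact Finset.prod_ne_zero_iff.2 fun μ _ => gdiag_ne_zero hl hx μ

theorem cartInv_mul_cartMetric {l : ℝ} (hl : 0 < l) (hR : IsSpatialRotation R) {x : Pt n}
    (hx : x ∈ reg n 0) : cartInv l (chart R x) * cartMetric l (chart R x) = 1 := by
  calc cartInv l (chart R x) * cartMetric l (chart R x)
      = jac R x * ((gbar l x)⁻¹ * ((jac R x).transpose * cartMetric l (chart R x) * jac R x))
        * (jac R x)⁻¹ := by
        rw [← jac_mul_gbar_inv hl hR hx]
        simp only [Matrix.mul_assoc, jac_mul_inv hR hx, Matrix.mul_one]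
    _ = 1 := by
        rw [jac_cartMetric hl hR hx, Matrix.nonsing_inv_mul _ (isUnit_det_gbar hl hx),
          Matrix.mul_one, jac_mul_inv hR hx]

/-- The Christoffel symbols of the first kind in Cartesian static coordinates. -/
noncomputable def cartFirst (l : ℝ) (β γ δ : Fin n) (z : Pt n) : ℝ :=
  1 / 2 * (mpd γ (cartMetric l) z β δ + mpd δ (cartMetric l) z β γ - mpd β (cartMetric l) z γ δ)

/-- The Christoffel symbols in Cartesian static coordinates. -/
noncomputable def cartGamma (l : ℝ) (γ : Fin n) (z : Pt n) : Matrix (Fin n) (Fin n) ℝ :=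
  cartInv l z * Matrix.of fun β δ => cartFirst l β γ δ z

theorem contDiff_cartGamma {l : ℝ} (hl : 0 < l) (γ α β : Fin n) :
    ContDiff ℝ ∞ fun z : Pt n => cartGamma l γ z α β := by
  have h : ∀ κ μ ν : Fin n, ContDiff ℝ ∞ fun z => mpd κ (cartMetric l) z μ ν := fun κ μ ν =>
    contDiff_iff_contDiffAt.2 fun _ => contDiffAt_pd (contDiff_cartMetric hl μ ν).contDiffAt
  simp only [cartGamma, Matrix.mul_apply, Matrix.of_apply, cartFirst]
  exact ContDiff.sum fun κ _ => (contDiff_cartInv hl α κ).mul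
    (contDiff_const.mul (((h _ _ _).add (h _ _ _)).sub (h _ _ _)))

/-- The matrix `Γ^κ_{σ ρ}` for fixed `σ`. -/
noncomputable def gammaMat (l : ℝ) (σ : Fin n) (x : Pt n) : Matrix (Fin n) (Fin n) ℝ :=
  Matrix.of fun κ ρ => christoffel l x κ σ ρ

theorem mpd_gbar {l : ℝ} (hl : 0 < l) (hR : IsSpatialRotation R) {x : Pt n} (hx : x ∈ reg n 0)
    (κ : Fin n) :
    mpd κ (gbar l) x = ((jac R x).transpose * cartMetric l (chart R x) * mpd κ (jac R) x).transpose
      + (jac R x).transpose * cartMetric l (chart R x) * mpd κ (jac R) x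
      + (jac R x).transpose * (∑ γ, jac R x γ κ • mpd γ (cartMetric l) (chart R x)) * jac R x := by
  have hJ := differentiableAt_jac (R := R) x
  have hG : ∀ i j, DifferentiableAt ℝ (fun z => cartMetric l z i j) (chart R x) := fun i j =>
    (contDiff_cartMetric hl i j).differentiable (by simp) _
  have hGc : ∀ i j, DifferentiableAt ℝ (fun z => cartMetric l (chart R z) i j) x := fun i j =>
    (hG i j).comp x ((contDiff_chart R).differentiable (by simp) x)
  have he : mpd κ (gbar l) x =
      mpd κ (fun z => (jac R z).transpose * cartMetric l (chart R z) * jac R z) x :=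
    mpd_congr (((isOpen_reg 0).eventually_mem hx).mono fun z hz => (jac_cartMetric hl hR hz).symm)
  rw [he, mpd_mul (M := fun z => (jac R z).transpose * cartMetric l (chart R z))
    (differentiableAt_matrix_mul (fun i j => hJ j i) hGc) hJ,
    mpd_mul (M := fun z => (jac R z).transpose) (fun i j => hJ j i) hGc, mpd_transpose, mpd_comp_chart hG]
  simp only [Matrix.transpose_mul, Matrix.transpose_transpose, cartMetric_symm, Matrix.add_mul,
    Matrix.mul_assoc]
  abel

/-- The transformation law of the Christoffel symbols. -/
theorem jac_mul_gammaMat {l : ℝ} (hl : 0 < l) (hR : IsSpatialRotation R) {x : Pt n}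
    (hx : x ∈ reg n 0) (μ : Fin n) :
    jac R x * gammaMat l μ x = mpd μ (jac R) x
      + (∑ γ, jac R x γ μ • cartGamma l γ (chart R x)) * jac R x := by
  set G := cartMetric l (chart R x)
  set J := jac R x
  set P : Fin n → Matrix (Fin n) (Fin n) ℝ := fun κ => J.transpose * G * mpd κ (jac R) x with hP
  set B : Fin n → Matrix (Fin n) (Fin n) ℝ := fun κ =>
    J.transpose * (∑ γ, J γ κ • mpd γ (cartMetric l) (chart R x)) * J with hB
  -- The terms with second derivatives of the chart are symmetric in the two differentiation
  -- indices; in the Christoffel combination this leaves a single one.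
  have hPs : ∀ κ σ ν, P κ σ ν = P ν σ κ := fun κ σ ν => by
    simp only [hP]
    rw [Matrix.mul_apply, Matrix.mul_apply]
    exact Finset.sum_congr rfl fun α _ => by rw [mpd_jac_symm]
  have hd : ∀ κ σ ν, pd κ (fun z => gbar l z σ ν) x = P κ ν σ + P κ σ ν + B κ σ ν := fun κ σ ν => by
    have := congrFun (congrFun (mpd_gbar hl hR hx κ) σ) ν
    simpa only [mpd_apply, Matrix.add_apply, Matrix.transpose_apply] using this
  have hBe : ∀ κ σ ν, B κ σ ν
      = ∑ β, ∑ γ, ∑ δ, J β σ * J γ κ * J δ ν * mpd γ (cartMetric l) (chart R x) β δ := by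
    intro κ σ ν
    simp only [hB, Matrix.mul_apply, Matrix.transpose_apply, Matrix.sum_apply, Matrix.smul_apply,
      smul_eq_mul, Finset.mul_sum, Finset.sum_mul]
    refine (Finset.sum_congr rfl fun γ _ => Finset.sum_comm).trans (Finset.sum_comm.trans ?_)
    exact Finset.sum_congr rfl fun β _ => Finset.sum_congr rfl fun γ _ =>
      Finset.sum_congr rfl fun δ _ => by ring
  -- The remaining terms assemble into the Cartesian Christoffel symbols of the first kind after
  -- renaming summation indices.
  have hBB : ∀ σ ν, 1 / 2 * (B μ σ ν + B ν σ μ - B σ μ ν)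
      = (J.transpose * ((∑ γ, J γ μ • Matrix.of fun β δ => cartFirst l β γ δ (chart R x)) * J)) σ ν
      := by
    intro σ ν
    have e1 : B ν σ μ
        = ∑ β, ∑ γ, ∑ δ, J β σ * J γ μ * J δ ν * mpd δ (cartMetric l) (chart R x) β γ := by
      rw [hBe]
      refine Finset.sum_congr rfl fun β _ => ?_
      rw [Finset.sum_comm]
      exact Finset.sum_congr rfl fun γ _ => Finset.sum_congr rfl fun δ _ => by ring
    have e2 : B σ μ ν
        = ∑ β, ∑ γ, ∑ δ, J β σ * J γ μ * J δ ν * mpd β (cartMetric l) (chart R x) γ δ := by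
      rw [hBe, Finset.sum_comm]
      exact Finset.sum_congr rfl fun β _ => Finset.sum_congr rfl fun γ _ =>
        Finset.sum_congr rfl fun δ _ => by ring
    rw [hBe, e1, e2]
    simp only [Matrix.mul_apply, Matrix.transpose_apply, Matrix.sum_apply, Matrix.smul_apply,
      smul_eq_mul, Finset.mul_sum, Finset.sum_mul, Matrix.of_apply, ← Finset.sum_add_distrib,
      ← Finset.sum_sub_distrib, cartFirst]
    exact Finset.sum_congr rfl fun β _ => Finset.sum_congr rfl fun γ _ =>
      Finset.sum_congr rfl fun δ _ => by ring
  have hΓ : gammaMat l μ x = (gbar l x)⁻¹ * (J.transpose * (G * mpd μ (jac R) x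
      + (∑ γ, J γ μ • Matrix.of fun β δ => cartFirst l β γ δ (chart R x)) * J)) := by
    ext κ ν
    rw [gammaMat, Matrix.of_apply, christoffel, Matrix.mul_apply, Finset.mul_sum]
    refine Finset.sum_congr rfl fun σ _ => ?_
    rw [Matrix.mul_add, Matrix.add_apply, ← hBB, ← Matrix.mul_assoc, hd, hd, hd]
    have h1 := hPs ν σ μ
    have h2 := hPs μ ν σ
    have h4 := hPs ν μ σ
    change _ = _ * (P μ σ ν + _)
    rw [h1, h2, h4]
    ring
  rw [hΓ]
  calc J * ((gbar l x)⁻¹ * (J.transpose * (G * mpd μ (jac R) x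
      + (∑ γ, J γ μ • Matrix.of fun β δ => cartFirst l β γ δ (chart R x)) * J)))
      = (J * (gbar l x)⁻¹ * J.transpose * G) * mpd μ (jac R) x
        + ((J * (gbar l x)⁻¹ * J.transpose) *
          ∑ γ, J γ μ • Matrix.of fun β δ => cartFirst l β γ δ (chart R x)) * J := by
        simp only [Matrix.mul_add, Matrix.mul_assoc]
    _ = _ := by
        rw [jac_mul_gbar_inv hl hR hx, cartInv_mul_cartMetric hl hR hx, Matrix.one_mul,
          Finset.mul_sum]
        simp only [Matrix.mul_smul, cartGamma]

end Covariance


/-! ### Tensor fields given by compatible components in all static charts. -/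

section TensorFields

variable {n : ℕ} [NeZero n] [h3 : Fact (3 ≤ n)] {R : Matrix (Fin n) (Fin n) ℝ} {ρ : ℝ}

/-- The functions `u` on the static charts represent one smooth function on `r > ρ`. -/
def IsScalar (ρ : ℝ) (u : ChartFun n) : Prop :=
  ∃ f : Pt n → ℝ, ContDiffOn ℝ ∞ f (exterior n ρ) ∧
    ∀ R, IsSpatialRotation R → ∀ x ∈ reg n ρ, u R x = f (chart R x)

/-- `v` represents a smooth vector field `v^μ` on `r > ρ`. -/
def IsVector (ρ : ℝ) (v : Matrix (Fin n) (Fin n) ℝ → Pt n → Fin n → ℝ) : Prop :=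
  ∃ f : Pt n → Fin n → ℝ, (∀ α, ContDiffOn ℝ ∞ (fun z => f z α) (exterior n ρ)) ∧
    ∀ R, IsSpatialRotation R → ∀ x ∈ reg n ρ, (jac R x).mulVec (v R x) = f (chart R x)

/-- `t` represents a smooth tensor field `t^{μν}` on `r > ρ`. -/
def IsBitensor (ρ : ℝ) (t : Matrix (Fin n) (Fin n) ℝ → Pt n → Matrix (Fin n) (Fin n) ℝ) : Prop :=
  ∃ f : Pt n → Matrix (Fin n) (Fin n) ℝ,
    (∀ α β, ContDiffOn ℝ ∞ (fun z => f z α β) (exterior n ρ)) ∧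
    ∀ R, IsSpatialRotation R → ∀ x ∈ reg n ρ,
      jac R x * t R x * (jac R x).transpose = f (chart R x)

/-- `t` represents a smooth tensor field `t_μ^ν` on `r > ρ`. -/
def IsMixed (ρ : ℝ) (t : Matrix (Fin n) (Fin n) ℝ → Pt n → Matrix (Fin n) (Fin n) ℝ) : Prop :=
  ∃ f : Pt n → Matrix (Fin n) (Fin n) ℝ,
    (∀ α β, ContDiffOn ℝ ∞ (fun z => f z α β) (exterior n ρ)) ∧
    ∀ R, IsSpatialRotation R → ∀ x ∈ reg n ρ,
      t R x * (jac R x).transpose = (jac R x).transpose * f (chart R x)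

theorem contDiffOn_matrix_mul {F G : Pt n → Matrix (Fin n) (Fin n) ℝ} {s : Set (Pt n)}
    (hF : ∀ α β, ContDiffOn ℝ ∞ (fun z => F z α β) s)
    (hG : ∀ α β, ContDiffOn ℝ ∞ (fun z => G z α β) s) (α β : Fin n) :
    ContDiffOn ℝ ∞ (fun z => (F z * G z) α β) s := by
  simp only [Matrix.mul_apply]
  exact ContDiffOn.sum fun κ _ => (hF α κ).mul (hG κ β)

theorem contDiffOn_mulVec {F : Pt n → Matrix (Fin n) (Fin n) ℝ} {v : Pt n → Fin n → ℝ}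
    {s : Set (Pt n)} (hF : ∀ α β, ContDiffOn ℝ ∞ (fun z => F z α β) s)
    (hv : ∀ α, ContDiffOn ℝ ∞ (fun z => v z α) s) (α : Fin n) :
    ContDiffOn ℝ ∞ (fun z => (F z).mulVec (v z) α) s := by
  simp only [Matrix.mulVec, dotProduct]
  exact ContDiffOn.sum fun κ _ => (hF α κ).mul (hv κ)

theorem contDiffOn_pd {f : Pt n → ℝ} (hf : ContDiffOn ℝ ∞ f (exterior n ρ)) (γ : Fin n) :
    ContDiffOn ℝ ∞ (pd γ f) (exterior n ρ) := fun _ hz =>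
  (contDiffAt_pd (hf.contDiffAt ((isOpen_exterior ρ).mem_nhds hz))).contDiffWithinAt

theorem contDiff_flatDiag (μ : Fin n) : ContDiff ℝ ∞ fun x : Pt n => flatDiag μ x := by
  unfold flatDiag
  split_ifs
  · exact contDiff_const
  · exact contDiff_const
  · exact ((contDiff_apply ℝ ℝ (1 : Fin n)).pow 2).mul (contDiff_angFactor μ)

theorem contDiffAt_jac_inv (hR : IsSpatialRotation R) {x : Pt n} (hx : x ∈ reg n 0)
    (μ α : Fin n) : ContDiffAt ℝ ∞ (fun z => (jac R z)⁻¹ μ α) x :=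
  (((contDiff_flatDiag μ).contDiffAt.inv (flatDiag_pos hx μ).ne').mul
    (contDiff_jac R α μ).contDiffAt).congr_of_eventuallyEq
    (((isOpen_reg 0).eventually_mem hx).mono fun _ hz => jac_inv_apply hR hz μ α)

theorem contDiffAt_comp_chart (hR : IsSpatialRotation R) (hρ : 0 ≤ ρ) {f : Pt n → ℝ}
    (hf : ContDiffOn ℝ ∞ f (exterior n ρ)) {x : Pt n} (hx : x ∈ reg n ρ) :
    ContDiffAt ℝ ∞ (fun z => f (chart R z)) x :=
  ContDiffAt.comp x (hf.contDiffAt ((isOpen_exterior ρ).mem_nhds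
    (chart_mem_exterior hR hρ hx.2))) (contDiff_chart R).contDiffAt

theorem differentiableAt_of_contDiffOn (hR : IsSpatialRotation R) (hρ : 0 ≤ ρ) {f : Pt n → ℝ}
    (hf : ContDiffOn ℝ ∞ f (exterior n ρ)) {x : Pt n} (hx : x ∈ reg n ρ) :
    DifferentiableAt ℝ f (chart R x) :=
  (hf.contDiffAt ((isOpen_exterior ρ).mem_nhds
    (chart_mem_exterior hR hρ hx.2))).differentiableAt (by simp)

theorem IsVector.contDiffAt {v : Matrix (Fin n) (Fin n) ℝ → Pt n → Fin n → ℝ}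
    (hv : IsVector ρ v) (hρ : 0 ≤ ρ) (hR : IsSpatialRotation R) {x : Pt n} (hx : x ∈ reg n ρ)
    (μ : Fin n) : ContDiffAt ℝ ∞ (fun z => v R z μ) x := by
  obtain ⟨f, hf, he⟩ := hv
  have h0 := reg_anti (n := n) hρ
  refine (ContDiffAt.sum (s := Finset.univ) fun α _ => (contDiffAt_jac_inv hR (h0 hx) μ α).mul
    (contDiffAt_comp_chart hR hρ (hf α) hx)).congr_of_eventuallyEq ?_
  filter_upwards [(isOpen_reg ρ).eventually_mem hx] with z hz
  have h : (jac R z)⁻¹.mulVec ((jac R z).mulVec (v R z)) = v R z := by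
    rw [Matrix.mulVec_mulVec, inv_mul_jac hR (h0 hz), Matrix.one_mulVec]
  rw [he R hR z hz] at h
  exact (congrFun h μ).symm

theorem IsBitensor.eq_inv {t f : Matrix (Fin n) (Fin n) ℝ} {x : Pt n} (hx : x ∈ reg n 0)
    (hR : IsSpatialRotation R) (h : jac R x * t * (jac R x).transpose = f) :
    t = (jac R x)⁻¹ * f * (jac R x)⁻¹.transpose := by
  rw [← h]
  calc t = ((jac R x)⁻¹ * jac R x) * t * ((jac R x)⁻¹ * jac R x).transpose := by
        rw [inv_mul_jac hR hx]; simp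
    _ = _ := by simp only [Matrix.transpose_mul, Matrix.mul_assoc]

theorem IsBitensor.contDiffAt {t : Matrix (Fin n) (Fin n) ℝ → Pt n → Matrix (Fin n) (Fin n) ℝ}
    (ht : IsBitensor ρ t) (hρ : 0 ≤ ρ) (hR : IsSpatialRotation R) {x : Pt n} (hx : x ∈ reg n ρ)
    (μ ν : Fin n) : ContDiffAt ℝ ∞ (fun z => t R z μ ν) x := by
  obtain ⟨f, hf, he⟩ := ht
  have h0 := reg_anti (n := n) hρ
  have hJ := contDiffAt_jac_inv hR (h0 hx)
  refine (ContDiffAt.sum (s := Finset.univ) fun β _ => (ContDiffAt.sum (s := Finset.univ) fun α _ =>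
    (hJ μ α).mul (contDiffAt_comp_chart hR hρ (hf α β) hx)).mul
      (hJ ν β)).congr_of_eventuallyEq ?_
  filter_upwards [(isOpen_reg ρ).eventually_mem hx] with z hz
  rw [IsBitensor.eq_inv (h0 hz) hR (he R hR z hz)]
  simp only [Matrix.mul_apply, Matrix.transpose_apply]

section Closure

variable {u : ChartFun n} {v w : Matrix (Fin n) (Fin n) ℝ → Pt n → Fin n → ℝ}
  {s t : Matrix (Fin n) (Fin n) ℝ → Pt n → Matrix (Fin n) (Fin n) ℝ}

theorem IsVector.smul (hu : IsScalar ρ u) (hv : IsVector ρ v) :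
    IsVector ρ fun R x => u R x • v R x := by
  obtain ⟨f, hf, he⟩ := hu
  obtain ⟨g, hg, he'⟩ := hv
  refine ⟨fun z => f z • g z, fun α => hf.mul (hg α), fun R hR x hx => ?_⟩
  rw [Matrix.mulVec_smul, he R hR x hx, he' R hR x hx]

theorem IsBitensor.add (hs : IsBitensor ρ s) (ht : IsBitensor ρ t) :
    IsBitensor ρ fun R x => s R x + t R x := by
  obtain ⟨f, hf, he⟩ := hs
  obtain ⟨g, hg, he'⟩ := ht
  refine ⟨fun z => f z + g z, fun α β => (hf α β).add (hg α β), fun R hR x hx => ?_⟩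
  rw [Matrix.mul_add, Matrix.add_mul, he R hR x hx, he' R hR x hx]

theorem IsScalar.const (c : ℝ) : IsScalar (n := n) ρ fun _ _ => c :=
  ⟨fun _ => c, contDiffOn_const, fun _ _ _ _ => rfl⟩

theorem IsBitensor.smul (hu : IsScalar ρ u) (ht : IsBitensor ρ t) :
    IsBitensor ρ fun R x => u R x • t R x := by
  obtain ⟨f, hf, he⟩ := hu
  obtain ⟨g, hg, he'⟩ := ht
  refine ⟨fun z => f z • g z, fun α β => hf.mul (hg α β), fun R hR x hx => ?_⟩
  rw [Matrix.mul_smul, Matrix.smul_mul, he R hR x hx, he' R hR x hx]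

theorem IsBitensor.transpose (ht : IsBitensor ρ t) : IsBitensor ρ fun R x => (t R x).transpose := by
  obtain ⟨f, hf, he⟩ := ht
  refine ⟨fun z => (f z).transpose, fun α β => hf β α, fun R hR x hx => ?_⟩
  beta_reduce
  rw [← he R hR x hx]
  simp only [Matrix.transpose_mul, Matrix.transpose_transpose, Matrix.mul_assoc]

theorem IsVector.vecMulVec (hv : IsVector ρ v) (hw : IsVector ρ w) :
    IsBitensor ρ fun R x => Matrix.vecMulVec (v R x) (w R x) := by
  obtain ⟨f, hf, he⟩ := hv
  obtain ⟨g, hg, he'⟩ := hw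
  refine ⟨fun z => Matrix.vecMulVec (f z) (g z), fun α β => (hf α).mul (hg β),
    fun R hR x hx => ?_⟩
  rw [Matrix.mul_vecMulVec, Matrix.vecMulVec_mul, Matrix.vecMul_transpose, he R hR x hx,
    he' R hR x hx]

theorem IsBitensor.mul_mixed (ht : IsBitensor ρ t) (hs : IsMixed ρ s) :
    IsBitensor ρ fun R x => t R x * s R x := by
  obtain ⟨f, hf, he⟩ := ht
  obtain ⟨g, hg, he'⟩ := hs
  refine ⟨fun z => f z * g z, contDiffOn_matrix_mul hf hg, fun R hR x hx => ?_⟩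
  beta_reduce
  rw [← he R hR x hx, Matrix.mul_assoc, Matrix.mul_assoc, he' R hR x hx]
  simp only [Matrix.mul_assoc]

variable {l : ℝ}

theorem IsBitensor.gbar_inv (hl : 0 < l) (hρ : 0 ≤ ρ) : IsBitensor (n := n) ρ fun _ x => (gbar l x)⁻¹ :=
  ⟨cartInv l, fun α β => (contDiff_cartInv hl α β).contDiffOn,
    fun _ hR _ hx => jac_mul_gbar_inv hl hR (reg_anti hρ hx)⟩

theorem IsBitensor.mul_gbar_mul (hl : 0 < l) (hρ : 0 ≤ ρ) (hs : IsBitensor ρ s) (ht : IsBitensor ρ t) :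
    IsBitensor ρ fun R x => s R x * gbar l x * t R x := by
  obtain ⟨f, hf, he⟩ := hs
  obtain ⟨g, hg, he'⟩ := ht
  refine ⟨fun z => f z * cartMetric l z * g z, contDiffOn_matrix_mul (contDiffOn_matrix_mul hf
    fun α β => (contDiff_cartMetric hl α β).contDiffOn) hg, fun R hR x hx => ?_⟩
  beta_reduce
  rw [← he R hR x hx, ← he' R hR x hx, ← jac_cartMetric hl hR (reg_anti hρ hx)]
  simp only [Matrix.mul_assoc]

theorem IsBitensor.mul_gbar_mulVec (hl : 0 < l) (hρ : 0 ≤ ρ) (ht : IsBitensor ρ t) (hv : IsVector ρ v) :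
    IsVector ρ fun R x => (t R x * gbar l x).mulVec (v R x) := by
  obtain ⟨f, hf, he⟩ := ht
  obtain ⟨g, hg, he'⟩ := hv
  refine ⟨fun z => (f z * cartMetric l z).mulVec (g z), contDiffOn_mulVec (contDiffOn_matrix_mul hf
    fun α β => (contDiff_cartMetric hl α β).contDiffOn) hg, fun R hR x hx => ?_⟩
  beta_reduce
  rw [← he R hR x hx, ← he' R hR x hx, ← jac_cartMetric hl hR (reg_anti hρ hx)]
  simp only [Matrix.mulVec_mulVec, Matrix.mul_assoc]

/-- The covariant derivative of a vector field is a tensor field. -/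
theorem IsVector.covD (hl : 0 < l) (hρ : 0 ≤ ρ) (hv : IsVector ρ v) :
    IsMixed ρ fun R x => Matrix.of fun σ μ => covD l (fun a z => v R z (a 0)) σ ![μ] x := by
  have hv' := hv
  obtain ⟨f, hf, he⟩ := hv
  refine ⟨fun z => Matrix.of fun γ α => pd γ (fun z => f z α) z + (cartGamma l γ z).mulVec (f z) α,
    fun γ α => (contDiffOn_pd (hf α) γ).add (contDiffOn_mulVec
      (fun α β => (contDiff_cartGamma hl γ α β).contDiffOn) hf α), fun R hR x hx => ?_⟩
  have hx0 := reg_anti hρ hx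
  ext σ α
  -- The transformation law of the components is differentiated along `σ`; the inhomogeneous term is
  -- cancelled by that of the connection.
  have h1 : ∑ μ, mpd σ (jac R) x α μ * v R x μ + ∑ μ, jac R x α μ * pd σ (fun z => v R z μ) x
      = ∑ γ, jac R x γ σ * pd γ (fun z => f z α) (chart R x) := by
    rw [← pd_comp_chart (differentiableAt_of_contDiffOn hR hρ (hf α) hx), ← Finset.sum_add_distrib,
      ← pd_congr (u := fun z => ∑ μ, jac R z α μ * v R z μ)
        (((isOpen_reg ρ).eventually_mem hx).mono fun z hz => congrFun (he R hR z hz) α)]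
    have hd := fun μ => (hv'.contDiffAt hρ hR hx μ).differentiableAt (by simp)
    rw [pd_sum _ fun μ _ => (differentiableAt_jac x α μ).fun_mul (hd μ)]
    exact Finset.sum_congr rfl fun μ _ => (pd_mul (differentiableAt_jac x α μ) (hd μ)).symm
  have h2 : (jac R x * gammaMat l σ x).mulVec (v R x) α = ∑ μ, mpd σ (jac R) x α μ * v R x μ
      + ∑ γ, jac R x γ σ * (cartGamma l γ (chart R x)).mulVec (f (chart R x)) α := by
    rw [jac_mul_gammaMat hl hR hx0, Matrix.add_mulVec, ← Matrix.mulVec_mulVec, he R hR x hx,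
      Matrix.sum_mulVec, Pi.add_apply, Finset.sum_apply]
    simp only [Matrix.smul_mulVec, Pi.smul_apply, smul_eq_mul]
    rfl
  simp only [Matrix.mul_apply, Matrix.transpose_apply, Matrix.of_apply, covD_one, mul_add,
    Finset.sum_add_distrib, ← h1]
  rw [← Matrix.mulVec_mulVec] at h2
  simp only [Matrix.cons_val]
  have h4 : ∑ μ, (∑ ρ, christoffel l x μ σ ρ * v R x ρ) * jac R x α μ
      = (jac R x).mulVec ((gammaMat l σ x).mulVec (v R x)) α := by
    simp only [Matrix.mulVec, dotProduct, gammaMat, Matrix.of_apply, mul_comm (jac R x _ _)]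
  simp only [add_mul, Finset.sum_add_distrib, h4, h2, mul_comm (jac R x α _)]
  ring

/-- The divergence of a tensor field is a vector field. -/
theorem IsBitensor.div (hl : 0 < l) (hρ : 0 ≤ ρ) (ht : IsBitensor ρ t) :
    IsVector ρ fun R x μ => ∑ σ, AdS.covD l (fun a z => t R z (a 0) (a 1)) σ ![μ, σ] x := by
  have ht' := ht
  obtain ⟨f, hf, he⟩ := ht
  set D : Fin n → Pt n → Matrix (Fin n) (Fin n) ℝ := fun γ z =>
    mpd γ f z + cartGamma l γ z * f z + f z * (cartGamma l γ z).transpose with hD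
  refine ⟨fun z α => ∑ γ, D γ z α γ, fun α => ContDiffOn.sum fun γ _ => ?_, fun R hR x hx => ?_⟩
  · have hΓ := fun α β => (contDiff_cartGamma (n := n) hl γ α β).contDiffOn (s := exterior n ρ)
    exact ((contDiffOn_pd (hf α γ) γ).add (contDiffOn_matrix_mul hΓ hf α γ)).add
      (contDiffOn_matrix_mul hf (fun α β => hΓ β α) α γ)
  have hx0 := reg_anti hρ hx
  set J := jac R x
  set T := t R x
  have hJ := differentiableAt_jac (R := R) x
  have hT := fun μ ν => (ht'.contDiffAt hρ hR hx μ ν).differentiableAt (by simp)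
  set E : Fin n → Matrix (Fin n) (Fin n) ℝ := fun σ =>
    mpd σ (t R) x + gammaMat l σ x * T + T * (gammaMat l σ x).transpose with hE
  have h1 : ∀ σ, mpd σ (jac R) x * T * J.transpose + J * mpd σ (t R) x * J.transpose
      + J * T * (mpd σ (jac R) x).transpose = ∑ γ, J γ σ • mpd γ f (chart R x) := by
    intro σ
    rw [← mpd_comp_chart (fun i j => differentiableAt_of_contDiffOn hR hρ (hf i j) hx),
      ← mpd_congr (M := fun z => jac R z * t R z * (jac R z).transpose)
        (((isOpen_reg ρ).eventually_mem hx).mono fun z hz => he R hR z hz),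
      mpd_mul (M := fun z => jac R z * t R z) (N := fun z => (jac R z).transpose)
        (differentiableAt_matrix_mul hJ hT) (fun i j => hJ j i), mpd_mul hJ hT, mpd_transpose,
      Matrix.add_mul]
  -- Both inhomogeneous terms, one for each index of the tensor, cancel against the derivatives of
  -- the two Jacobians.
  have h2 : ∀ σ, J * E σ * J.transpose = ∑ γ, J γ σ • D γ (chart R x) := by
    intro σ
    have h := jac_mul_gammaMat hl hR hx0 σ
    calc J * E σ * J.transpose = J * mpd σ (t R) x * J.transpose
          + (J * gammaMat l σ x) * T * J.transpose
          + J * T * (J * gammaMat l σ x).transpose := by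
          simp only [hE, Matrix.mul_add, Matrix.add_mul, Matrix.transpose_mul, Matrix.mul_assoc]
      _ = (∑ γ, J γ σ • mpd γ f (chart R x))
          + (∑ γ, J γ σ • cartGamma l γ (chart R x)) * (J * T * J.transpose)
          + (J * T * J.transpose) * (∑ γ, J γ σ • cartGamma l γ (chart R x)).transpose := by
          rw [h, ← h1]
          simp only [Matrix.add_mul, Matrix.mul_add, Matrix.transpose_mul, Matrix.transpose_add,
            Matrix.mul_assoc]
          abel
      _ = _ := by
          rw [he R hR x hx, Finset.sum_mul, Matrix.transpose_sum, Finset.mul_sum]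
          simp only [hD, smul_add, Finset.sum_add_distrib, Matrix.transpose_smul, Matrix.smul_mul,
            Matrix.mul_smul]
  have h4 : ∀ σ, J * E σ = (∑ γ, J γ σ • D γ (chart R x)) * J⁻¹.transpose := by
    intro σ
    rw [← h2, Matrix.mul_assoc, Matrix.mul_assoc, ← Matrix.transpose_mul, inv_mul_jac hR hx0,
      Matrix.transpose_one, Matrix.mul_one]
  have h5 : (fun μ => ∑ σ, AdS.covD l (fun a z => t R z (a 0) (a 1)) σ ![μ, σ] x)
      = fun μ => ∑ σ, E σ μ σ := by
    funext μ
    refine Finset.sum_congr rfl fun σ _ => ?_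
    rw [covD_two]
    simp only [hE, Matrix.add_apply, Matrix.mul_apply, gammaMat, Matrix.of_apply,
      Matrix.transpose_apply, mpd_apply, Matrix.cons_val, mul_comm (christoffel l x σ σ _)]
    rfl
  beta_reduce
  rw [h5]
  funext α
  calc J.mulVec (fun μ => ∑ σ, E σ μ σ) α = ∑ σ, (J * E σ) α σ := by
        simp only [Matrix.mulVec, dotProduct, Finset.mul_sum, Matrix.mul_apply]
        exact Finset.sum_comm
    -- The contraction of the derivative index with a tensor index brings the Jacobian and its
    -- inverse together.
    _ = ∑ β, ∑ γ, (J * J⁻¹) γ β * D γ (chart R x) α β := by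
        rw [Finset.sum_congr rfl fun σ _ => congrFun (congrFun (h4 σ) α) σ]
        simp only [Matrix.mul_apply, Matrix.transpose_apply, Matrix.sum_apply,
          Matrix.smul_apply, smul_eq_mul, Finset.sum_mul]
        rw [Finset.sum_comm]
        refine Finset.sum_congr rfl fun β _ => ?_
        rw [Finset.sum_comm]
        exact Finset.sum_congr rfl fun γ _ => Finset.sum_congr rfl fun σ _ => by ring
    _ = _ := by
        rw [jac_mul_inv hR hx0]
        simp [Matrix.one_apply]

end Closure

/-- All static charts share the functions `τ` and `r`. Their differentials, the first two rows of
the inverse Jacobian, are therefore globally smooth covectors, and contracting with them gives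
scalars. -/
theorem IsBitensor.isScalar_apply {t : Matrix (Fin n) (Fin n) ℝ → Pt n → Matrix (Fin n) (Fin n) ℝ}
    (ht : IsBitensor ρ t) (hρ : 0 ≤ ρ) {μ ν : Fin n} (hμ : μ.val < 2) (hν : ν.val < 2) :
    IsScalar ρ fun R x => t R x μ ν := by
  obtain ⟨f, hf, he⟩ := ht
  have hc : ∀ (κ : Fin n), κ.val < 2 → ∀ α, ∃ c : Pt n → ℝ, ContDiffOn ℝ ∞ c (exterior n ρ) ∧
      ∀ R, IsSpatialRotation R → ∀ x ∈ reg n ρ, (jac R x)⁻¹ κ α = c (chart R x) := by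
    intro κ hκ α
    have hκ' : κ = 0 ∨ κ = 1 := by
      by_contra! h
      exact absurd (two_le_of_ne h.1 h.2) (by omega)
    rcases hκ' with rfl | rfl
    · refine ⟨fun _ => if α = 0 then 1 else 0, contDiffOn_const, fun R hR x hx => ?_⟩
      rw [jac_inv_apply hR (reg_anti hρ hx), jac_zero_col hR, flatDiag_zero, inv_one, one_mul]
    · refine ⟨fun z => if α = 0 then 0 else z α * (radius z)⁻¹, ?_, fun R hR x hx => ?_⟩
      · split_ifs
        · exact contDiffOn_const
        · exact (contDiff_apply ℝ ℝ α).contDiffOn.mul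
            ((contDiffOn_radius ρ).inv fun z hz => (radius_pos hz).ne')
      · have hx0 := reg_anti hρ hx
        beta_reduce
        rw [jac_inv_apply hR hx0, flatDiag_one, inv_one, one_mul, radius_chart hR hx0.2.le]
        split_ifs with h
        · rw [h, jac_zero_row hR, if_neg one_ne_zero']
        · rw [chart_of_ne hR x h, mul_right_comm, mul_inv_cancel₀ hx0.2.ne', one_mul]
  choose c hcs hce using hc μ hμ
  choose d hds hde using hc ν hν
  refine ⟨fun z => ∑ β, (∑ α, c α z * f z α β) * d β z, ContDiffOn.sum fun β _ =>
    (ContDiffOn.sum fun α _ => (hcs α).mul (hf α β)).mul (hds β), fun R hR x hx => ?_⟩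
  simp only [← hce _ R hR x hx, ← hde _ R hR x hx]
  rw [IsBitensor.eq_inv (reg_anti hρ hx) hR (he R hR x hx)]
  simp only [Matrix.mul_apply, Matrix.transpose_apply]

end TensorFields


/-! ### Covariance of the superpotential. -/

section Superpotential

variable {n : ℕ} [NeZero n] [h3 : Fact (3 ≤ n)] {R : Matrix (Fin n) (Fin n) ℝ} {ρ l : ℝ}
  {h : Fin n → Fin n → Pt n → ℝ} {ξ : Fin n → Pt n → ℝ}

theorem isVector_compV (hξ : ∀ α, ContDiffOn ℝ ∞ (ξ α) (exterior n ρ)) (hρ : 0 ≤ ρ) :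
    IsVector ρ fun R x μ => compV ξ R μ x :=
  ⟨fun z α => ξ α z, hξ, fun R hR x hx => by
    simp only [compV]
    rw [Matrix.mulVec_mulVec, jac_mul_inv hR (reg_anti hρ hx), Matrix.one_mulVec]⟩

theorem comp2_eq_mul (h : Fin n → Fin n → Pt n → ℝ) (R : Matrix (Fin n) (Fin n) ℝ) (x : Pt n) :
    (Matrix.of fun μ ν => comp2 h R μ ν x) =
      (jac R x).transpose * (Matrix.of fun α β => h α β (chart R x)) * jac R x := by
  ext μ ν
  simp only [comp2, Matrix.mul_apply, Matrix.of_apply, Matrix.transpose_apply, Finset.sum_mul]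
  rw [Finset.sum_comm]
  exact Finset.sum_congr rfl fun _ _ => Finset.sum_congr rfl fun _ _ => by ring

theorem raise_eq_mul (l : ℝ) (k : Fin n → Fin n → Pt n → ℝ) (x : Pt n) :
    (Matrix.of fun μ ν => raise l k ![μ, ν] x) =
      (gbar l x)⁻¹ * (Matrix.of fun μ ν => k μ ν x) * (gbar l x)⁻¹.transpose := by
  ext μ ν
  simp only [raise, Matrix.mul_apply, Matrix.of_apply, Matrix.transpose_apply, Finset.sum_mul,
    Matrix.cons_val]
  rw [Finset.sum_comm]
  exact Finset.sum_congr rfl fun _ _ => Finset.sum_congr rfl fun _ _ => by ring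

theorem isBitensor_raise (hl : 0 < l) (hρ : 0 ≤ ρ)
    (hh : ∀ α β, ContDiffOn ℝ ∞ (h α β) (exterior n ρ)) :
    IsBitensor ρ fun R x => Matrix.of fun μ ν => raise l (comp2 h R) ![μ, ν] x := by
  have hI := fun α β => (contDiff_cartInv (n := n) hl α β).contDiffOn (s := exterior n ρ)
  refine ⟨fun z => cartInv l z * (Matrix.of fun α β => h α β z) * (cartInv l z).transpose,
    contDiffOn_matrix_mul (contDiffOn_matrix_mul hI hh) fun α β => hI β α, fun R hR x hx => ?_⟩
  beta_reduce
  rw [raise_eq_mul, comp2_eq_mul, ← jac_mul_gbar_inv hl hR (reg_anti hρ hx)]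
  simp only [Matrix.transpose_mul, Matrix.transpose_transpose, Matrix.mul_assoc]

theorem isScalar_trace (hl : 0 < l) (hρ : 0 ≤ ρ)
    (hh : ∀ α β, ContDiffOn ℝ ∞ (h α β) (exterior n ρ)) :
    IsScalar ρ fun R => trace l (comp2 h R) ![] := by
  refine ⟨fun z => ∑ α, ∑ β, cartInv l z α β * h α β z, ContDiffOn.sum fun α _ =>
    ContDiffOn.sum fun β _ => (contDiff_cartInv hl α β).contDiffOn.mul (hh α β),
    fun R hR x hx => ?_⟩
  have ht : ∀ M N : Matrix (Fin n) (Fin n) ℝ, ∑ α, ∑ β, M α β * N α β = (M.transpose * N).trace :=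
    fun M N => by
      simp only [Matrix.trace, Matrix.diag_apply, Matrix.mul_apply, Matrix.transpose_apply]
      exact Finset.sum_comm
  have h1 := ht (gbar l x)⁻¹ (Matrix.of fun μ ν => comp2 h R μ ν x)
  have h2 := ht (cartInv l (chart R x)) (Matrix.of fun α β => h α β (chart R x))
  simp only [Matrix.of_apply] at h1 h2
  change ∑ α, ∑ β, (gbar l x)⁻¹ α β * comp2 h R α β x
    = ∑ α, ∑ β, cartInv l (chart R x) α β * h α β (chart R x)
  rw [h1, h2, comp2_eq_mul, ← jac_mul_gbar_inv hl hR (reg_anti hρ hx)]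
  simp only [Matrix.transpose_mul, Matrix.transpose_transpose, ← Matrix.mul_assoc]
  rw [Matrix.trace_mul_comm]
  simp only [Matrix.mul_assoc]

/-- The Leibniz rule reduces the one tensor of rank three in the superpotential to divergences and
products of tensors of rank at most two. -/
theorem covD_mul {x : Pt n} {T : Tensor n 2} {v : Fin n → Pt n → ℝ}
    (hT : ∀ a, DifferentiableAt ℝ (T a) x) (hv : ∀ ν, DifferentiableAt ℝ (v ν) x)
    (σ κ μ ν : Fin n) :
    covD l (fun a z => T ![a 0, a 1] z * v (a 2) z : Tensor n 3) σ ![κ, μ, ν] x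
      = covD l T σ ![κ, μ] x * v ν x
        + T ![κ, μ] x * covD l (fun a => v (a 0)) σ ![ν] x := by
  rw [covD_three, covD_two, covD_one]
  simp only [Matrix.cons_val]
  rw [pd_mul (hT _) (hv _)]
  simp only [add_mul, mul_add, Finset.sum_mul, Finset.mul_sum, mul_assoc,
    mul_left_comm (T ![κ, μ] x)]
  ring

/-- Each term is built from the inverse metric, the raised perturbation, the vector field,
divergences and covariant derivatives by products, transposes and contractions, all of which
preserve tensor fields. -/
theorem isBitensor_superpotTerms (hl : 0 < l) (hρ : 0 ≤ ρ)
    (hh : ∀ α β, ContDiffOn ℝ ∞ (h α β) (exterior n ρ))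
    (hξ : ∀ α, ContDiffOn ℝ ∞ (ξ α) (exterior n ρ)) :
    IsBitensor ρ fun R x => Matrix.of fun ν μ => superpotTerms l (comp2 h R) (compV ξ R) ν μ x := by
  have hv := isVector_compV hξ hρ
  have ht := isBitensor_raise hl hρ hh
  have hs := isScalar_trace hl hρ hh
  have hg := IsBitensor.gbar_inv (n := n) hl hρ
  have hD := hv.covD hl hρ
  have hM := hg.mul_mixed hD
  have hX := hg.mul_mixed ((hv.smul hs).covD hl hρ)
  have hW := hg.mul_mixed ((ht.mul_gbar_mulVec hl hρ hv).covD hl hρ)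
  have hc := IsScalar.const (n := n) (ρ := ρ) (3 / 2)
  -- The six terms in matrix form; the second is already expanded by the Leibniz rule, and a
  -- transpose marks terms whose index order is reversed.
  obtain ⟨f, hf, he⟩ := ((((hX.add ((hv.vecMulVec (ht.div hl hρ)).add
    (ht.mul_mixed hD).transpose)).add hW.transpose).add
    ((hM.transpose.smul hs).smul hc)).add ((hM.mul_gbar_mul hl hρ ht).smul hc)).add
    ((ht.mul_mixed hD).smul hc)
  refine ⟨f, hf, fun R hR x hx => ?_⟩
  rw [← he R hR x hx]
  congr 2
  ext ν μ
  have hdt : ∀ a, DifferentiableAt ℝ (raise l (comp2 h R) a) x := fun a => by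
    have ha : a = ![a 0, a 1] := by ext i; fin_cases i <;> rfl
    rw [ha]
    exact (ht.contDiffAt hρ hR hx _ _).differentiableAt (by simp)
  have hdv := fun ν => (hv.contDiffAt hρ hR hx ν).differentiableAt (by simp)
  have hgs : ∀ σ κ, gbar l x σ κ = gbar l x κ σ := fun σ κ => by
    rw [gbar_apply, gbar_apply]
    by_cases h : σ = κ
    · rw [h]
    · rw [if_neg h, if_neg (Ne.symm h)]
  have hraise : ∀ a, raise l (comp2 h R) ![a 0, a 1] = raise l (comp2 h R) a := fun a => by
    congr 1
    ext i; fin_cases i <;> rfl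
  have hWe : (fun a z => ∑ σ, ∑ κ, raise l (comp2 h R) ![a 0, σ] z * gbar l z σ κ * compV ξ R κ z
      : Tensor n 1) = fun a z => ((Matrix.of fun μ ν => raise l (comp2 h R) ![μ, ν] z) *
        gbar l z).mulVec (fun μ => compV ξ R μ z) (a 0) := by
    funext a z
    simp only [Matrix.mulVec, dotProduct, Matrix.mul_apply, Matrix.of_apply, Finset.sum_mul]
    exact Finset.sum_comm
  simp only [superpotTerms, hWe, covD_mul hdt hdv, Finset.sum_add_distrib, ← Finset.sum_mul]
  simp only [Matrix.add_apply, Matrix.smul_apply, Matrix.transpose_apply, Matrix.of_apply,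
    Matrix.vecMulVec_apply, smul_eq_mul]
  have hdiv : (fun a z => raise l (comp2 h R) ![a 0, a 1] z : Tensor n 2)
      = raise l (comp2 h R) := funext hraise
  have h5 : ∑ σ, ∑ κ, raise l (comp2 h R) ![σ, μ] x * gbar l x σ κ *
        gradUp l (fun a => compV ξ R (a 0)) ![ν, κ] x
      = ((gbar l x)⁻¹ * (Matrix.of fun σ μ => covD l (fun a z => compV ξ R (a 0) z) σ ![μ] x) *
        gbar l x * Matrix.of fun μ ν => raise l (comp2 h R) ![μ, ν] x) ν μ := by
    rw [Matrix.mul_apply]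
    refine Finset.sum_congr rfl fun σ _ => ?_
    rw [Matrix.mul_apply, Finset.sum_mul]
    refine Finset.sum_congr rfl fun κ _ => ?_
    rw [hgs, mul_comm, Matrix.of_apply, mul_comm (raise l (comp2 h R) ![σ, μ] x), ← mul_assoc]
    rfl
  rw [h5, hdiv, mul_comm (compV ξ R ν x)]
  rfl

theorem IsSmoothPerturbation.isScalar_superpotTerms (hl : 0 < l) (hh : IsSmoothPerturbation h)
    (hξ : IsSmoothVectorField ξ) : ∃ ρ, 0 ≤ ρ ∧ ∀ μ ν : Fin n, μ.val < 2 → ν.val < 2 →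
      IsScalar ρ fun R => superpotTerms l (comp2 h R) (compV ξ R) μ ν := by
  obtain ⟨ρ₁, h1, hs, -⟩ := hh
  obtain ⟨ρ₂, h2, hs'⟩ := hξ
  refine ⟨max ρ₁ ρ₂, h1.le.trans (le_max_left _ _), fun μ ν hμ hν => ?_⟩
  exact (isBitensor_superpotTerms hl (h1.le.trans (le_max_left _ _))
    (fun α β => (hs α β).mono (exterior_anti h1.le (le_max_left _ _)))
    fun α => (hs' α).mono (exterior_anti h2.le (le_max_right _ _))).isScalar_apply
      (h1.le.trans (le_max_left _ _)) hμ hν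

end Superpotential


/-! ### Covering the spheres by finitely many static charts. -/

section Cover

variable {n : ℕ} [NeZero n] [h3 : Fact (3 ≤ n)]

/-- The bound by `π` for nonnegative sine serves all angles except the last, whose range is the full
circle. -/
theorem exists_angle {c s : ℝ} (h : c ^ 2 + s ^ 2 = 1) :
    ∃ θ, 0 ≤ θ ∧ θ ≤ 2 * Real.pi ∧ (0 ≤ s → θ ≤ Real.pi) ∧ Real.cos θ = c ∧ Real.sin θ = s := by
  have hc : -1 ≤ c ∧ c ≤ 1 := abs_le.1 ((sq_le_one_iff_abs_le_one c).1 (by nlinarith [sq_nonneg s]))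
  have h0 := Real.arccos_nonneg c
  have hπ := Real.arccos_le_pi c
  have hs : Real.sin (Real.arccos c) = |s| := by
    rw [Real.sin_arccos, ← Real.sqrt_sq_eq_abs, ← h]
    congr 1; ring
  rcases le_or_gt 0 s with h1 | h1
  · exact ⟨Real.arccos c, h0, by linarith [Real.pi_pos], fun _ => hπ,
      Real.cos_arccos hc.1 hc.2, by rw [hs, abs_of_nonneg h1]⟩
  · refine ⟨2 * Real.pi - Real.arccos c, by linarith, by linarith, fun h2 => absurd h2 h1.not_ge,
      ?_, ?_⟩
    · rw [Real.cos_two_pi_sub, Real.cos_arccos hc.1 hc.2]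
    · rw [Real.sin_two_pi_sub, hs, abs_of_neg h1, neg_neg]

/-- The points of the unit sphere at time `τ` whose angles stay away from the poles. -/
noncomputable def polarCompact (n : ℕ) [NeZero n] (τ : ℝ) : Set (Pt n) :=
  Set.univ.pi fun A => if 2 ≤ A.val then
      {t | t ∈ Set.Icc 0 (if A.val + 1 = n then 2 * Real.pi else Real.pi) ∧
        (n : ℝ)⁻¹ ≤ Real.sin t ^ 2}
    else if A = 0 then {τ} else {1}

theorem isCompact_polarCompact (τ : ℝ) : IsCompact (polarCompact n τ) := by
  refine isCompact_univ_pi fun A => ?_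
  split_ifs
  all_goals first
    | exact isCompact_singleton
    | exact isCompact_Icc.inter_right (isClosed_le continuous_const (Real.continuous_sin.pow 2))

theorem polarCompact_subset (τ : ℝ) : polarCompact n τ ⊆ chartBox n := by
  intro x hx A hA
  have h := hx A (Set.mem_univ A)
  simp only [hA, if_true] at h
  obtain ⟨⟨h0, h1⟩, h2⟩ := h
  have hn : (0 : ℝ) < (n : ℝ)⁻¹ := inv_pos.2 (Nat.cast_pos.2 (NeZero.pos n))
  have hs : Real.sin (x A) ≠ 0 := fun h => by
    rw [h, zero_pow two_ne_zero] at h2; linarith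
  refine ⟨lt_of_le_of_ne h0 fun h => hs (by rw [← h, Real.sin_zero]),
    lt_of_le_of_ne h1 fun h => hs ?_⟩
  rw [h]
  split_ifs <;> simp

/-- The points of the unit sphere whose last Cartesian coordinate is bounded away from zero are
covered by `polarCompact`. -/
theorem exists_polarCompact (τ : ℝ) {a : Pt n} (h0 : a 0 = 0) (ha : ∑ k, a k ^ 2 = 1)
    (hlast : ∀ k : Fin n, k.val + 1 = n → (n : ℝ)⁻¹ ≤ a k ^ 2) :
    ∃ x ∈ polarCompact n τ, ∀ r : ℝ, ∀ k : Fin n, k ≠ 0 →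
      toCartesian (Function.update x 1 r) k = r * a k := by
  have hn := h3.out
  have hn0 : (0 : ℝ) < (n : ℝ)⁻¹ := inv_pos.2 (Nat.cast_pos.2 (NeZero.pos n))
  set b := seqExt a with hb
  set q : ℕ → ℝ := fun k => ∑ i ∈ Finset.Ico k n, b i ^ 2 with hq
  -- The length of the tail of the vector, except that the last entry keeps its sign. Hence only the
  -- last angle can have negative sine.
  set σ : ℕ → ℝ := fun k => if k + 1 = n then b k else Real.sqrt (q k) with hσ
  have hbl : (n : ℝ)⁻¹ ≤ b (n - 1) ^ 2 := by
    have := hlast ⟨n - 1, by omega⟩ (by simp only; omega)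
    rwa [hb, seqExt, dif_pos (by omega : n - 1 < n)]
  have hqn : ∀ k, k < n → q k = b k ^ 2 + q (k + 1) := fun k hk => Finset.sum_eq_sum_Ico_succ_bot hk _
  have hqpos : ∀ k, k < n → (n : ℝ)⁻¹ ≤ q k := fun k hk => hbl.trans
    (Finset.single_le_sum (f := fun i => b i ^ 2) (fun _ _ => sq_nonneg _)
      (Finset.mem_Ico.2 ⟨by omega, by omega⟩))
  have hσq : ∀ k, k < n → σ k ^ 2 = q k := by
    intro k hk
    simp only [hσ]
    split_ifs with h
    · rw [hqn k hk, h]; simp [hq]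
    · exact Real.sq_sqrt (hn0.le.trans (hqpos k hk))
  have hσpos : ∀ k, k + 1 < n → 0 < σ k := by
    intro k hk
    simp only [hσ, if_neg hk.ne]
    exact Real.sqrt_pos.2 (hn0.trans_le (hqpos k (by omega)))
  have hq1 : q 1 = 1 := by
    rw [← ha]
    exact (sum_fin_ne_zero (fun i => b i ^ 2) (fun k => a k ^ 2) (by simp [h0]) fun k _ => by
      rw [hb, seqExt_val]).symm
  have hσ1 : σ 1 = 1 := by
    simp only [hσ, if_neg (show 1 + 1 ≠ n by omega), hq1, Real.sqrt_one]
  have hang : ∀ B : ℕ, ∃ θ : ℝ, 2 ≤ B → B < n → 0 ≤ θ ∧ θ ≤ 2 * Real.pi ∧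
      (0 ≤ σ B / σ (B - 1) → θ ≤ Real.pi) ∧
      Real.cos θ = b (B - 1) / σ (B - 1) ∧ Real.sin θ = σ B / σ (B - 1) := by
    intro B
    by_cases hB : 2 ≤ B ∧ B < n
    · have hp := hσpos (B - 1) (by omega)
      have hsq : b (B - 1) ^ 2 + σ B ^ 2 = σ (B - 1) ^ 2 := by
        rw [hσq B hB.2, hσq (B - 1) (by omega), hqn (B - 1) (by omega),
          show B - 1 + 1 = B by omega]
      obtain ⟨θ, hθ⟩ := exists_angle (c := b (B - 1) / σ (B - 1)) (s := σ B / σ (B - 1))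
        (by rw [div_pow, div_pow, ← add_div, hsq, div_self (by positivity)])
      exact ⟨θ, fun _ _ => hθ⟩
    · exact ⟨0, fun h h' => absurd ⟨h, h'⟩ hB⟩
  choose y hy using hang
  -- The sines are quotients of consecutive tail lengths, so their product telescopes.
  have hprod : ∀ k, 1 ≤ k → k < n → ∏ B ∈ Finset.Ioc 1 k, Real.sin (y B) = σ k := by
    intro k hk
    induction k, hk using Nat.le_induction with
    | base => simp [hσ1]
    | succ k hk ih =>
      intro hkn
      rw [Finset.prod_Ioc_succ_top hk, ih (by omega), (hy (k + 1) (by omega) hkn).2.2.2.2,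
        Nat.add_sub_cancel, mul_div_cancel₀ _ (hσpos k hkn).ne']
  set x : Pt n := fun A => if 2 ≤ A.val then y A.val else if A = 0 then τ else 1 with hx
  have hext : ∀ r, ∀ B, 2 ≤ B → B < n → seqExt (Function.update x 1 r) B = y B := by
    intro r B hB hBn
    rw [seqExt_update _ _ _ (by rw [val_one]; omega), seqExt, dif_pos hBn]
    simp only [hx, if_pos hB]
  refine ⟨x, fun A _ => ?_, fun r k hk => ?_⟩
  · by_cases hA : 2 ≤ A.val
    · simp only [hx, if_pos hA]
      obtain ⟨h1, h2, h4, -, h6⟩ := hy A.val hA A.isLt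
      have hp := hσpos (A.val - 1) (by omega)
      refine ⟨⟨h1, ?_⟩, ?_⟩
      · split_ifs with hl
        · exact h2
        · exact h4 (div_pos (hσpos _ (by omega)) hp).le
      -- The squared sine is a quotient of tail sums with numerator at least `1 / n` and denominator
      -- at most one.
      · rw [h6, div_pow, hσq _ A.isLt, hσq _ (by omega), le_div_iff₀ (hn0.trans_le
          (hqpos _ (by omega)))]
        have hle : q (A.val - 1) ≤ 1 := by
          rw [← hq1]
          exact Finset.sum_le_sum_of_subset_of_nonneg (Finset.Ico_subset_Ico_left (by omega))
            fun _ _ _ => sq_nonneg _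
        nlinarith [hqpos A.val A.isLt]
    · simp only [hx, if_neg hA]
      by_cases hA0 : A = 0
      · simp [hA0]
      · simp [hA0]
  · have hk1 : 1 ≤ k.val := Nat.one_le_iff_ne_zero.2 fun h => hk (Fin.ext h)
    rw [toCartesian_of_ne _ hk, Function.update_self, tailCoord]
    congr 1
    rw [Finset.prod_congr rfl fun B hB => by
      rw [hext r B (Finset.mem_Ioc.1 hB).1 ((Finset.mem_Ioc.1 hB).2.trans_lt k.isLt)],
      hprod k.val hk1 k.isLt, ← seqExt_val a k]
    by_cases hkn : k.val + 1 < n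
    · rw [hext r _ (by omega) hkn, (hy (k.val + 1) (by omega) hkn).2.2.2.1, Nat.add_sub_cancel,
        mul_div_cancel₀ _ (hσpos _ hkn).ne']
    · have hkn' : k.val + 1 = n := by omega
      rw [hkn', seqExt_self, Real.cos_zero, mul_one]
      simp only [hσ, if_pos hkn', hb]

theorem isSpatialRotation_permMatrix {σ : Equiv.Perm (Fin n)} (h : σ 0 = 0) :
    IsSpatialRotation (σ.permMatrix ℝ) := by
  refine ⟨?_, ?_⟩
  · rw [Matrix.mem_orthogonalGroup_iff]
    ext i j
    rw [Matrix.mul_apply, Matrix.one_apply]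
    change ∑ κ, σ.permMatrix ℝ i κ * σ.permMatrix ℝ j κ = _
    simp [eq_comm]
  · simp [Equiv.Perm.permMatrix, PEquiv.toMatrix_apply, h]

/-- Some spatial coordinate carries at least the fraction `1 / n` of `r²`. Exchanging it with the
last one keeps all sines away from zero, because the last Cartesian coordinate is `r` times the
product of all of them. -/
theorem exists_chart_eq (τ : ℝ) {x : Pt n} (hx : 0 < x 1) (hτ : x 0 = τ) :
    ∃ σ : Equiv.Perm (Fin n), σ 0 = 0 ∧ ∃ x' ∈ polarCompact n τ,
      chart 1 x = chart (σ.permMatrix ℝ) (Function.update x' 1 (x 1)) := by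
  have hn := h3.out
  set X := chart 1 x with hX
  have hsum : ∑ k ∈ Finset.univ.filter (fun k : Fin n => k ≠ 0), X k ^ 2 = x 1 ^ 2 :=
    sum_chart_sq isSpatialRotation_one x
  obtain ⟨j, hj, hjle⟩ : ∃ j ∈ Finset.univ.filter (fun k : Fin n => k ≠ 0),
      (n : ℝ)⁻¹ * x 1 ^ 2 ≤ X j ^ 2 := by
    refine Finset.exists_le_of_sum_le
      ⟨1, Finset.mem_filter.2 ⟨Finset.mem_univ _, one_ne_zero'⟩⟩ ?_
    rw [hsum, Finset.sum_const, nsmul_eq_mul, ← mul_assoc]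
    have hc : ((Finset.univ.filter (fun k : Fin n => k ≠ 0)).card : ℝ) ≤ n := by
      have := (Finset.univ.filter (fun k : Fin n => k ≠ 0)).card_le_univ
      rw [Fintype.card_fin] at this
      exact_mod_cast this
    have hn0 : (0 : ℝ) < n := Nat.cast_pos.2 (NeZero.pos n)
    have : ((Finset.univ.filter (fun k : Fin n => k ≠ 0)).card : ℝ) * (n : ℝ)⁻¹ ≤ 1 := by
      rw [← div_eq_mul_inv, div_le_one hn0]; exact hc
    nlinarith [sq_nonneg (x 1)]
  have hj0 : j ≠ 0 := (Finset.mem_filter.1 hj).2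
  set m : Fin n := ⟨n - 1, by omega⟩ with hm
  have hm0 : m ≠ 0 := fun h => by
    have := congrArg Fin.val h
    simp only [hm, Fin.val_zero] at this
    omega
  set σ := Equiv.swap j m with hσ
  have hσ0 : σ 0 = 0 := Equiv.swap_apply_of_ne_of_ne (Ne.symm hj0) (Ne.symm hm0)
  have hσσ : ∀ k, σ (σ k) = k := fun k => by
    rw [← Equiv.Perm.mul_apply, Equiv.swap_mul_self, Equiv.Perm.one_apply]
  have hσne : ∀ k, k ≠ 0 → σ k ≠ 0 := fun k hk h => hk (by rw [← hσσ k, h, hσ0])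
  obtain ⟨x', hx', he⟩ := exists_polarCompact τ (a := fun k => if k = 0 then 0 else X (σ k) / x 1)
    (if_pos rfl) (by
      have h1 : ∀ k, (if k = 0 then 0 else X (σ k) / x 1) ^ 2
          = (x 1 ^ 2)⁻¹ * (fun i => if i ≠ 0 then X i ^ 2 else 0) (σ k) := by
        intro k
        by_cases hk : k = 0
        · simp [hk, hσ0]
        · simp only [hk, hσne k hk, if_false, ne_eq, not_false_iff, if_true]
          field_simp
      rw [Finset.sum_congr rfl fun k _ => h1 k, ← Finset.mul_sum, 
        Equiv.sum_comp σ fun i => if i ≠ 0 then X i ^ 2 else 0,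
        ← Finset.sum_filter, hsum]
      exact inv_mul_cancel₀ (by positivity))
    (by
      intro k hk
      have hkm : k = m := Fin.ext (by simp only [hm]; omega)
      simp only [hkm, if_neg hm0, hσ, Equiv.swap_apply_right]
      rw [div_pow, le_div_iff₀ (by positivity)]
      exact hjle)
  refine ⟨σ, hσ0, x', hx', ?_⟩
  funext α
  rw [chart, Matrix.permMatrix_mulVec]
  by_cases hα : α = 0
  · subst hα
    have h0 := hx' 0 (Set.mem_univ 0)
    simp only [Fin.val_zero, if_true] at h0
    rw [hX, chart_zero isSpatialRotation_one, Function.comp_apply, hσ0, toCartesian_zero,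
      Function.update_of_ne zero_ne_one', hτ]
    simpa using h0.symm
  · rw [Function.comp_apply, he _ _ (hσne α hα)]
    simp only [if_neg (hσne α hα), hσσ]
    field_simp

end Cover


/-! ### Boundedness and convergence of the charges. -/

section Charges

variable {n : ℕ} [NeZero n] [h3 : Fact (3 ≤ n)] {l : ℝ} {h : Fin n → Fin n → Pt n → ℝ}
  {ξ : Fin n → Pt n → ℝ}

theorem staticPt_zero (τ r : ℝ) (y : {A : Fin n // 2 ≤ A.val} → ℝ) : staticPt τ r y 0 = τ := by
  simp [staticPt]

theorem staticPt_one (τ r : ℝ) (y : {A : Fin n // 2 ≤ A.val} → ℝ) : staticPt τ r y 1 = r := by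
  rw [staticPt, dif_neg (by rw [val_one]; omega), if_neg one_ne_zero']

theorem staticPt_angle (τ r : ℝ) (y : {A : Fin n // 2 ≤ A.val} → ℝ) {A : Fin n} (hA : 2 ≤ A.val) :
    staticPt τ r y A = y ⟨A, hA⟩ := dif_pos hA

theorem staticPt_eq_update (τ r : ℝ) (y : {A : Fin n // 2 ≤ A.val} → ℝ) :
    staticPt τ r y = Function.update (staticPt τ 1 y) 1 r := by
  funext μ
  by_cases h1 : μ = 1
  · subst h1; rw [staticPt_one, Function.update_self]
  · rw [Function.update_of_ne h1]
    by_cases h0 : μ = 0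
    · subst h0; rw [staticPt_zero, staticPt_zero]
    · have := two_le_of_ne h0 h1
      rw [staticPt_angle _ _ _ this, staticPt_angle _ _ _ this]

theorem staticPt_mem_chartBox {τ r : ℝ} {y : {A : Fin n // 2 ≤ A.val} → ℝ} (hy : y ∈ angleBox n) :
    staticPt τ r y ∈ chartBox n := fun A hA => by
  rw [staticPt_angle _ _ _ hA]; exact hy ⟨A, hA⟩

theorem continuous_staticPt (τ r : ℝ) : Continuous (staticPt (n := n) τ r) := by
  refine continuous_pi fun μ => ?_
  unfold staticPt
  split_ifs
  · exact continuous_apply _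
  · exact continuous_const
  · exact continuous_const

theorem isOpen_angleBox : IsOpen (angleBox n) := by
  have : angleBox n = Set.univ.pi fun A => {t | InAngleRange A.1 t} := by
    ext y; simp [angleBox]
  rw [this]
  exact isOpen_set_pi Set.finite_univ fun A _ => isOpen_setOf_inAngleRange A.1

theorem volume_angleBox_lt_top : volume (angleBox n) < ⊤ := by
  refine (measure_mono (t := Set.univ.pi fun A : {A : Fin n // 2 ≤ A.val} =>
    Set.Icc 0 (if A.1.val + 1 = n then 2 * Real.pi else Real.pi)) fun y hy A _ =>
      ⟨(hy A).1.le, (hy A).2.le⟩).trans_lt ?_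
  exact (isCompact_univ_pi fun _ => isCompact_Icc).measure_lt_top

/-- Estimates of a scalar in all static charts are uniform on the spheres. -/
theorem IsScalar.uniform_bound {ρ m : ℝ} {u : ChartFun n} (hu : IsScalar ρ u)
    (hb : ∀ R, IsSpatialRotation R → (bigO n).P m (u R)) (τ : ℝ) :
    ∃ C : ℝ, ∀ᶠ r : ℝ in atTop, ∀ x ∈ chartBox n, x 0 = τ →
      |u 1 (Function.update x 1 r)| ≤ C * r ^ m := by
  obtain ⟨f, -, he⟩ := hu
  have hC : ∀ σ : Equiv.Perm (Fin n), ∃ C : ℝ, 0 ≤ C ∧ (σ 0 = 0 → ∀ᶠ r : ℝ in atTop,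
      ∀ x ∈ polarCompact n τ, |u (σ.permMatrix ℝ) (Function.update x 1 r)| ≤ C * r ^ m) := by
    intro σ
    by_cases hσ : σ 0 = 0
    · obtain ⟨C, h0, hC⟩ := ChartBigO.nonneg (hb _ (isSpatialRotation_permMatrix hσ))
        (isCompact_polarCompact τ) (polarCompact_subset τ)
      exact ⟨C, h0, fun _ => hC⟩
    · exact ⟨0, le_rfl, fun h => absurd h hσ⟩
  choose C hC0 hC using hC
  -- There are finitely many permutations, so the sum of their nonnegative constants serves every
  -- chart.
  refine ⟨∑ σ, C σ, ?_⟩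
  have hall : ∀ᶠ r : ℝ in atTop, ∀ σ : Equiv.Perm (Fin n), σ 0 = 0 →
      ∀ x ∈ polarCompact n τ, |u (σ.permMatrix ℝ) (Function.update x 1 r)| ≤ C σ * r ^ m := by
    refine eventually_all.2 fun σ => ?_
    by_cases hσ : σ 0 = 0
    · exact (hC σ hσ).mono fun r hr _ => hr
    · exact .of_forall fun r h => absurd h hσ
  filter_upwards [hall, eventually_gt_atTop ρ, eventually_gt_atTop 0] with r hr hρ h0 x hx hτ
  obtain ⟨σ, hσ, x', hx', hc⟩ := exists_chart_eq τ (x := Function.update x 1 r)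
    (by rwa [Function.update_self]) (by rwa [Function.update_of_ne zero_ne_one'])
  rw [Function.update_self] at hc
  rw [he 1 isSpatialRotation_one _ (update_mem_reg hx hρ), hc,
    ← he _ (isSpatialRotation_permMatrix hσ) _ (update_mem_reg (polarCompact_subset τ hx') hρ)]
  refine (hr σ hσ x' hx').trans ?_
  gcongr
  exact Finset.single_le_sum (f := C) (fun σ _ => hC0 σ) (Finset.mem_univ σ)

theorem vq_of_components {G : Gauge n} {k : ℕ} {v : Fin n → Pt n → ℝ} (h1 : G.Q k 1 (v 1))
    (ha : ∀ a, a ≠ 1 → G.Q k 0 (v a)) : G.VQ k killingOrder v := by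
  intro μ
  by_cases hμ : μ = 1
  · subst hμ
    simpa [om_one, par_one, killingOrder] using h1
  · simpa [om_ne hμ, par_ne hμ, killingOrder] using ha μ hμ

/-- The orders of `h` and `ξ` combine to even order `-n + 1` and odd order `-n + 2`. The `τr`
component has total weight zero and odd parity. -/
theorem superpotTerms_order {G : Gauge n} (hl : 0 < l) {k : Fin n → Fin n → Pt n → ℝ}
    {v : Fin n → Pt n → ℝ} (hk : G.HQ 1 (two (-n + 1) (-n)) k) (hv : G.VQ 1 killingOrder v)
    {μ ν : Fin n} (hμν : om ν + om μ = 0) (hp : par ν + par μ = 1) :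
    G.P (-n + 2) (superpotTerms l k v ν μ) := by
  have h := (Gauge.HQ.superpotTerms (k := 0) (c := two (-n + 1) (-n + 2))
    (compat_two (by linarith) (by linarith)) compat_killingOrder
    (compat_two (by linarith) (by linarith))
    (two_add_le (by simp [killingOrder]) (by simp [killingOrder]) (by simp [killingOrder]; linarith)
      (by simp [killingOrder])) hl hk hv ν μ).base
  rwa [hμν, hp, two_one, zero_add] at h

/-- The radial power `r^(n-2)` of the density is exactly the inverse of the order of the
superpotential terms. Antisymmetry of the superpotential removes the factor one half. -/
theorem chargeIntegrand_eq {τ r : ℝ} (hr : 0 < r) {y : {A : Fin n // 2 ≤ A.val} → ℝ}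
    (hy : y ∈ angleBox n) :
    chargeIntegrand l h ξ τ r y = -(sphereDensity (staticPt τ 1 y) / (16 * Real.pi)) *
      (r ^ (-(-n + 2 : ℝ)) * superpotTerms l (comp2 h 1) (compV ξ 1) 0 1 (staticPt τ r y)
        - r ^ (-(-n + 2 : ℝ)) * superpotTerms l (comp2 h 1) (compV ξ 1) 1 0 (staticPt τ r y)) := by
  have hx : staticPt τ r y ∈ reg n 0 := ⟨staticPt_mem_chartBox hy, by rwa [staticPt_one]⟩
  have hs : sphereDensity (staticPt τ r y) = sphereDensity (staticPt τ 1 y) := by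
    refine Finset.prod_congr rfl fun A _ => Finset.prod_congr rfl fun B hB => ?_
    have hB2 : 2 ≤ B.val := by simp only [Finset.mem_filter] at hB; omega
    rw [staticPt_angle _ _ _ hB2, staticPt_angle _ _ _ hB2]
  have hpow : r ^ (-(-n + 2 : ℝ)) = r ^ (n - 2) := by
    rw [← Real.rpow_natCast, Nat.cast_sub (by have := h3.out; omega)]
    congr 1; push_cast; ring
  rw [chargeIntegrand, superpot, superpot, sqrtNegDet_eq hx, staticPt_one, hs, hpow]
  ring

theorem continuous_sphereDensity : Continuous (sphereDensity (n := n)) := by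
  unfold sphereDensity
  exact continuous_finsetProd _ fun A _ => continuous_finsetProd _ fun B _ =>
    Real.continuous_sin.comp (continuous_apply B)

theorem IsScalar.continuousOn {ρ : ℝ} {u : ChartFun n} (hu : IsScalar ρ u) (hρ : 0 ≤ ρ)
    {τ r : ℝ} (hr : ρ < r) : ContinuousOn (fun y => u 1 (staticPt τ r y)) (angleBox n) := by
  obtain ⟨f, hf, he⟩ := hu
  have hm : ∀ y ∈ angleBox n, staticPt τ r y ∈ reg n ρ := fun y hy =>
    ⟨staticPt_mem_chartBox hy, by rwa [staticPt_one]⟩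
  refine ContinuousOn.congr (f := fun y => f (chart 1 (staticPt τ r y))) ?_
    fun y hy => he 1 isSpatialRotation_one _ (hm y hy)
  exact hf.continuousOn.comp
    ((contDiff_chart 1).continuous.comp (continuous_staticPt τ r)).continuousOn
    fun y hy => chart_mem_exterior isSpatialRotation_one hρ (hm y hy).2

/-- The integrand contains a density, not a scalar, so the uniform estimate is applied to the
superpotential terms. The remaining angular density lies between zero and one on the whole chart. -/
theorem exists_chargeIntegrand_bound (hl : 0 < l) (hh : FallOffClass (-n - 1) (-n) (-n + 3) h)
    (hξ : IsAsymptoticKilling l ξ) (τ : ℝ) : ∃ C : ℝ, ∀ᶠ r : ℝ in atTop,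
      AEStronglyMeasurable (chargeIntegrand l h ξ τ r) (volume.restrict (angleBox n)) ∧
      ∀ y ∈ angleBox n, ‖chargeIntegrand l h ξ τ r y‖ ≤ C := by
  obtain ⟨ρ, hρ, hS⟩ := hh.1.isScalar_superpotTerms hl hξ.1
  have h01 := hS 0 1 (by simp) (by rw [val_one]; omega)
  have h10 := hS 1 0 (by rw [val_one]; omega) (by simp)
  have hHQ : ∀ R, IsSpatialRotation R → (bigO n).HQ 1 (two (-n + 1) (-n)) (comp2 h R) :=
    fun R hR μ ν => (hh.hq (by linarith) le_rfl (by linarith) hR μ ν).pred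
  have hVQ : ∀ R, IsSpatialRotation R → (bigO n).VQ 1 killingOrder (compV ξ R) := fun R hR =>
    vq_of_components ⟨hξ.1.sm_compV hR 1, fallOff_iff.1 hξ.2.1 R hR⟩
      fun a ha => ⟨hξ.1.sm_compV hR a, fallOff_iff.1 (hξ.2.2.1 a ha) R hR⟩
  obtain ⟨C, hC⟩ := h01.uniform_bound (fun R hR => superpotTerms_order hl (hHQ R hR) (hVQ R hR)
    (by rw [om_one, om_ne zero_ne_one']; norm_num) (by rw [par_one, par_ne zero_ne_one', add_zero])) τ
  obtain ⟨C', hC'⟩ := h10.uniform_bound (fun R hR => superpotTerms_order hl (hHQ R hR) (hVQ R hR)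
    (by rw [om_one, om_ne zero_ne_one']; norm_num) (by rw [par_one, par_ne zero_ne_one', zero_add])) τ
  refine ⟨(16 * Real.pi)⁻¹ * (C + C'), ?_⟩
  filter_upwards [hC, hC', eventually_gt_atTop ρ, eventually_gt_atTop 0] with r hr hr' hrρ hr0
  refine ⟨?_, fun y hy => ?_⟩
  · refine (ContinuousOn.congr ?_ fun y hy => chargeIntegrand_eq hr0 hy).aestronglyMeasurable
      isOpen_angleBox.measurableSet
    exact ((continuous_sphereDensity.comp (continuous_staticPt τ 1)).div_const _).neg.continuousOn.mul
      ((continuousOn_const.mul (h01.continuousOn hρ hrρ)).sub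
        (continuousOn_const.mul (h10.continuousOn hρ hrρ)))
  · have hb := staticPt_mem_chartBox (τ := τ) (r := 1) hy
    have e1 := hr _ hb (staticPt_zero τ 1 y)
    have e2 := hr' _ hb (staticPt_zero τ 1 y)
    rw [← staticPt_eq_update] at e1 e2
    have hp : 0 < r ^ (-(-n + 2 : ℝ)) := Real.rpow_pos_of_pos hr0 _
    have hpm : r ^ (-(-n + 2 : ℝ)) * r ^ (-n + 2 : ℝ) = 1 := by
      rw [← Real.rpow_add hr0, neg_add_cancel, Real.rpow_zero]
    have hd0 := (sphereDensity_pos hb).le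
    have hd1 := sphereDensity_le_one hb
    have key : ∀ t c : ℝ, |t| ≤ c * r ^ (-n + 2 : ℝ) → |r ^ (-(-n + 2 : ℝ)) * t| ≤ c := by
      intro t c ht
      rw [abs_mul, abs_of_pos hp]
      calc _ ≤ r ^ (-(-n + 2 : ℝ)) * (c * r ^ (-n + 2 : ℝ)) := by gcongr
        _ = c * (r ^ (-(-n + 2 : ℝ)) * r ^ (-n + 2 : ℝ)) := by ring
        _ = c := by rw [hpm, mul_one]
    rw [chargeIntegrand_eq hr0 hy, Real.norm_eq_abs, abs_mul]
    refine mul_le_mul ?_ ((abs_sub _ _).trans (add_le_add (key _ _ e1) (key _ _ e2)))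
      (abs_nonneg _) (by positivity)
    rw [abs_neg, abs_of_nonneg (by positivity), inv_eq_one_div]
    gcongr

theorem eventually_integrableOn_chargeIntegrand (hl : 0 < l)
    (hh : FallOffClass (-n - 1) (-n) (-n + 3) h) (hξ : IsAsymptoticKilling l ξ) (τ : ℝ) :
    ∃ C : ℝ, ∀ᶠ r : ℝ in atTop, IntegrableOn (chargeIntegrand l h ξ τ r) (angleBox n) ∧
      |chargeAt l h ξ τ r| ≤ C := by
  obtain ⟨C, hC⟩ := exists_chargeIntegrand_bound hl hh hξ τ
  refine ⟨C * volume.real (angleBox n), hC.mono fun r hr => ⟨?_, ?_⟩⟩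
  · exact Integrable.mono' (g := fun _ => C) (integrableOn_const volume_angleBox_lt_top.ne) hr.1
      ((ae_restrict_iff' isOpen_angleBox.measurableSet).2 (.of_forall hr.2))
  · rw [chargeAt, abs_neg]
    exact norm_setIntegral_le_of_norm_le_const volume_angleBox_lt_top hr.2

theorem exists_tendsto_chargeAt (hl : 0 < l) (hh : FallOffClass (-n - 1) (-n) (-n + 3) h)
    (hξ : IsAsymptoticKilling l ξ) (τ : ℝ)
    (h11 : HasLeadingCoefficient (-n - 1) (comp2 h 1 1 1))
    (ha1 : ∀ a : Fin n, a ≠ 1 → HasLeadingCoefficient (-n) (comp2 h 1 a 1))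
    (hab : ∀ a b : Fin n, a ≠ 1 → b ≠ 1 → HasLeadingCoefficient (-n + 3) (comp2 h 1 a b))
    (h1 : HasLeadingCoefficient 1 (compV ξ 1 1))
    (ha : ∀ a : Fin n, a ≠ 1 → HasLeadingCoefficient 0 (compV ξ 1 a)) :
    ∃ Q : ℝ, Tendsto (chargeAt l h ξ τ) atTop (𝓝 Q) := by
  have hI := isSpatialRotation_one (n := n)
  have hH : (leading n).HQ 1 (two (-n + 1) (-n)) (comp2 h 1) :=
    Gauge.hq_of_components ⟨hh.1.sm_comp2 hI 1 1, hasLeadingCoefficient_iff.1 h11⟩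
      (fun a h => ⟨hh.1.sm_comp2 hI a 1, hasLeadingCoefficient_iff.1 (ha1 a h)⟩)
      (fun a b h h' => ⟨hh.1.sm_comp2 hI a b, hasLeadingCoefficient_iff.1 (hab a b h h')⟩)
      (fun ν => (hh.1.comp2_symm hI).mono fun _ hx => hx ν 1)
      (by linarith) le_rfl (by linarith)
  have hV : (leading n).VQ 1 killingOrder (compV ξ 1) :=
    vq_of_components ⟨hξ.1.sm_compV hI 1, hasLeadingCoefficient_iff.1 h1⟩
      fun a h => ⟨hξ.1.sm_compV hI a, hasLeadingCoefficient_iff.1 (ha a h)⟩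
  have t01 : (leading n).P (-n + 2) (superpotTerms l (comp2 h 1) (compV ξ 1) 0 1) :=
    superpotTerms_order hl hH hV (by rw [om_one, om_ne zero_ne_one']; norm_num)
      (by rw [par_one, par_ne zero_ne_one', add_zero])
  have t10 : (leading n).P (-n + 2) (superpotTerms l (comp2 h 1) (compV ξ 1) 1 0) :=
    superpotTerms_order hl hH hV (by rw [om_one, om_ne zero_ne_one']; norm_num)
      (by rw [par_one, par_ne zero_ne_one', zero_add])
  have hlim : ∀ y, ∃ c : ℝ, y ∈ angleBox n →
      Tendsto (fun r => chargeIntegrand l h ξ τ r y) atTop (𝓝 c) := by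
    intro y
    by_cases hy : y ∈ angleBox n
    · have hb := staticPt_mem_chartBox (τ := τ) (r := 1) hy
      obtain ⟨c, hc⟩ := t01 _ hb
      obtain ⟨c', hc'⟩ := t10 _ hb
      refine ⟨_, fun _ => ((hc.sub hc').const_mul
        (-(sphereDensity (staticPt τ 1 y) / (16 * Real.pi)))).congr' ?_⟩
      filter_upwards [eventually_gt_atTop 0] with r hr
      rw [chargeIntegrand_eq hr hy, staticPt_eq_update τ r]
    · exact ⟨0, fun h => absurd h hy⟩
  choose c hc using hlim
  obtain ⟨C, hC⟩ := exists_chargeIntegrand_bound hl hh hξ τ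
  have hae : ∀ {p : ({A : Fin n // 2 ≤ A.val} → ℝ) → Prop}, (∀ y ∈ angleBox n, p y) →
      ∀ᵐ y ∂volume.restrict (angleBox n), p y := fun hp =>
    (ae_restrict_iff' isOpen_angleBox.measurableSet).2 (.of_forall hp)
  -- Pointwise limits come from the `leading` gauge in one chart; the uniform bound on the finite
  -- angular domain dominates.
  refine ⟨-∫ y in angleBox n, c y, (tendsto_integral_filter_of_dominated_convergence (fun _ => C)
    (hC.mono fun r hr => hr.1) (hC.mono fun r hr => hae hr.2) ?_ (hae hc)).neg⟩
  exact integrableOn_const volume_angleBox_lt_top.ne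

end Charges

end AdS

theorem mainTheorem2 (n : ℕ) [NeZero n] (hn : 3 ≤ n) (l : ℝ) (hl : 0 < l) :
    -- asymptotic conservation imposes, and is implied by, the bounds on the linearized operator
    (∀ (Λ : ℝ) (h : Fin n → Fin n → AdS.Pt n → ℝ), AdS.IsSmoothPerturbation h →
      (AdS.AsymptoticallyConserved l Λ h ↔ AdS.LinOpBounds l Λ h)) ∧
    -- the fall-off that generic perturbations must have
    (∀ p q s : ℝ,
      (∀ h : Fin n → Fin n → AdS.Pt n → ℝ, AdS.FallOffClass p q s h →
        AdS.AsymptoticallyConserved l (-((n - 1) * (n - 2)) / l ^ 2) h) ↔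
      p ≤ -n - 1 ∧ q ≤ -n ∧ s ≤ -n + 3) ∧
    -- the same with the value of the constant for which the background solves the field equations
    (∀ p q s : ℝ,
      (∀ h : Fin n → Fin n → AdS.Pt n → ℝ, AdS.FallOffClass p q s h →
        AdS.AsymptoticallyConserved l (-((n - 1) * (n - 2)) / (2 * l ^ 2)) h) ↔
      p ≤ -n - 1 ∧ q ≤ -n + 2 ∧ s ≤ -n + 3) ∧
    -- finiteness of the charges
    (∀ h : Fin n → Fin n → AdS.Pt n → ℝ, AdS.FallOffClass (-n - 1) (-n) (-n + 3) h →
      ∀ ξ : Fin n → AdS.Pt n → ℝ, AdS.IsAsymptoticKilling l ξ → ∀ τ : ℝ,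
        (∃ C : ℝ, ∀ᶠ r : ℝ in Filter.atTop,
          MeasureTheory.IntegrableOn (AdS.chargeIntegrand l h ξ τ r) (AdS.angleBox n) ∧
          |AdS.chargeAt l h ξ τ r| ≤ C) ∧
        (AdS.HasLeadingCoefficient (-n - 1) (AdS.comp2 h 1 1 1) →
          (∀ a : Fin n, a ≠ 1 → AdS.HasLeadingCoefficient (-n) (AdS.comp2 h 1 a 1)) →
          (∀ a b : Fin n, a ≠ 1 → b ≠ 1 →
            AdS.HasLeadingCoefficient (-n + 3) (AdS.comp2 h 1 a b)) →
          AdS.HasLeadingCoefficient 1 (AdS.compV ξ 1 1) →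
          (∀ a : Fin n, a ≠ 1 → AdS.HasLeadingCoefficient 0 (AdS.compV ξ 1 a)) →
          ∃ Q : ℝ, Filter.Tendsto (AdS.chargeAt l h ξ τ) Filter.atTop (nhds Q))) := by
  have : Fact (3 ≤ n) := ⟨hn⟩
  refine ⟨fun Λ h hh => AdS.asymptoticallyConserved_iff hl hh, AdS.forall_conserved_iff hl,
    AdS.forall_conserved_vacuum_iff hl, fun h hh ξ hξ τ => ?_⟩
  exact ⟨AdS.eventually_integrableOn_chargeIntegrand hl hh hξ τ,
    AdS.exists_tendsto_chargeAt hl hh hξ τ⟩
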